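/- **Definitions.** Let $\|\cdot\|$ be the Euclidean norm and $\langle\cdot,\cdot\rangle$ the Euclidean inner product on $\mathbb{R}^4$. For real $A$ let $\mathbb{L}(A)$ be the set of $\mathbf{a}=(a_1,a_2,a_3,a_4)\in\mathbb{Z}^4$ with all $a_i\neq 0$, $\gcd(a_1,a_2,a_3,a_4)=1$ and $\|\mathbf{a}\|\le A$. For real $B\ge 3$ let $\mathcal{P}(B)$ be the set of $4$-tuples of primes, each at most $B$. For $\mathbf{x}\in\mathbb{Z}^4$, an integer $Q\ge 1$ and real $\gamma>0$ put $$\Lambda_{\mathbf{x}}=\{\mathbf{y}\in\mathbb{Z}^4:\langle\mathbf{x},\mathbf{y}\rangle=0\},\qquad \Lambda_{\mathbf{x}}^{(Q)}=\{\mathbf{y}\in\mathbb{Z}^4:\langle\mathbf{x},\mathbf{y}\rangle\equiv 0 \bmod Q\},$$ $$\mathcal{C}_{\mathbf{x}}^{(\gamma)}=\Big\{\mathbf{t}\in\mathbb{R}^4:|\langle\mathbf{x},\mathbf{t}\rangle|\le\frac{\|\mathbf{x}\|\,\|\mathbf{t}\|}{2\gamma}\Big\}.$$ Put $\alpha=\log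 B$, $w=\dfrac{\log\log B}{\log\log\log B}$ and $W=\prod_{p\le w}p^{\lceil \log w/\log p\rceil+1}$, the product being over the primes $p\le w$ (so $W=1$ if $w<2$). (The value $B=e^e$, where $w$ is undefined, does not satisfy the hypotheses below for any $A$.) For $\mathbf{a}\in\mathbb{Z}^4\setminus\{0\}$ define $$N_{\mathbf{a}}(B)=(\log B)^4\sum_{\substack{\mathbf{x}\in\mathcal{P}(B)\\ \mathbf{a}\in\Lambda_{\mathbf{x}}}}1,\qquad N_{\mathbf{a}}^{\mathrm{loc}}(B)=(\log B)^4\,\frac{\alpha W}{\|\mathbf{a}\|}\sum_{\substack{\mathbf{x}\in\mathcal{P}(B)\\ \mathbf{a}\in\Lambda_{\mathbf{x}}^{(W)}\cap\,\mathcal{C}_{\mathbf{x}}^{(\alpha)}}}\frac{1}{\|\mathbf{x}\|}.$$ **Proposition.** There exist absolute constants $C>0$ and $K>0$ such that for all real numbers $A$ and $B\ge 3$ with $$B^2\log B<A\le B^3(\log B)^{-4}(\log\log B)^{-1}$$ one has $$\sum_{\mathbf{a}\in\mathbb{L}(A)}\big|N_{\mathbf{a}}(B)-N_{\mathbf{a}}^{\mathrm{loc}}(B)\big|^2\le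 K\,\frac{A^2B^6}{(\log\log B)^C}.$$ -/

import Mathlib

namespace PrimeLinearForms

noncomputable section

/-- The primitive integer tuples: four non-zero entries with greatest common divisor `1`. -/
def primitiveTuples : Set (Fin 4 → ℤ) :=
  {a | (∀ i, a i ≠ 0) ∧ Finset.univ.gcd a = 1}

/-- An integer vector seen as a vector of Euclidean space, so that `‖euc x‖` is the Euclidean
norm of `x`. -/
def euc {N : ℕ} (x : Fin N → ℤ) : EuclideanSpace ℝ (Fin N) :=
  WithLp.toLp 2 (fun i => (x i : ℝ))

/-- The primitive integer tuples of Euclidean norm at most `A`. -/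
def primitiveTuplesUpTo (A : ℝ) : Set (Fin 4 → ℤ) :=
  {a | a ∈ primitiveTuples ∧ ‖euc a‖ ≤ A}

/-- The 4-tuples of (positive) prime numbers of maximum norm at most `B`. -/
def primeTuples (B : ℝ) : Set (Fin 4 → ℤ) :=
  {x | ∀ i, Nat.Prime (x i).toNat ∧ |(x i : ℝ)| ≤ B}

theorem finite_box {N : ℕ} (T : ℝ) : {x : Fin N → ℤ | ∀ i, |(x i : ℝ)| ≤ T}.Finite := by
  refine (Set.Finite.pi' (t := fun _ : Fin N => Set.Icc (-⌊T⌋) ⌊T⌋)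
    (fun _ => Set.finite_Icc _ _)).subset ?_
  intro x hx i
  have h := abs_le.mp (hx i)
  refine ⟨?_, Int.le_floor.mpr h.2⟩
  have h2 : -x i ≤ ⌊T⌋ := Int.le_floor.mpr (by push_cast; linarith)
  linarith

theorem finite_primitiveTuplesUpTo (A : ℝ) : (primitiveTuplesUpTo A).Finite := by
  refine (finite_box A).subset ?_
  intro a ha i
  have h := PiLp.norm_apply_le (euc a) i
  exact le_trans h ha.2

theorem finite_primeTuples (B : ℝ) : (primeTuples B).Finite :=
  (finite_box B).subset fun _ hx i => (hx i).2

/-- The lattice `Λ_c` of integer vectors orthogonal to `c`. -/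
def orthLattice {N : ℕ} (c : Fin N → ℤ) : Set (Fin N → ℤ) :=
  {y | ∑ i, c i * y i = 0}

/-- The lattice `Λ_c^(Q)` of integer vectors orthogonal to `c` modulo `Q`. -/
def orthLatticeMod {N : ℕ} (Q : ℕ) (c : Fin N → ℤ) : Set (Fin N → ℤ) :=
  {y | ∑ i, c i * y i ≡ 0 [ZMOD (Q : ℤ)]}

/-- The region `C_v^(γ)`. -/
def coneRegion {N : ℕ} (γ : ℝ) (v : EuclideanSpace ℝ (Fin N)) : Set (EuclideanSpace ℝ (Fin N)) :=
  {t | |inner ℝ v t| ≤ ‖v‖ * ‖t‖ / (2 * γ)}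

/-- `α = log B`. -/
def alphaParam (B : ℝ) : ℝ := Real.log B

/-- `w = log log B / log log log B`. -/
def wParam (B : ℝ) : ℝ :=
  Real.log (Real.log B) / Real.log (Real.log (Real.log B))

/-- `W = ∏_{p ≤ w} p ^ (⌈log w / log p⌉ + 1)`, the product over the primes `p ≤ w` (an empty
product if `w < 2`). -/
def WParam (B : ℝ) : ℕ :=
  ∏ p ∈ (Finset.range (⌊wParam B⌋₊ + 1)).filter Nat.Prime,
    p ^ (⌈Real.log (wParam B) / Real.log (p : ℝ)⌉₊ + 1)

open scoped Classical in
/-- The weighted count `N_a(B) = (log B)^4 ∑_{x ∈ P(B), a ∈ Λ_x} 1` of prime solutions. -/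
def weightedCount (a : Fin 4 → ℤ) (B : ℝ) : ℝ :=
  (Real.log B) ^ 4 *
    ∑ _x ∈ (finite_primeTuples B).toFinset.filter (fun x => a ∈ orthLattice x), (1 : ℝ)

open scoped Classical in
/-- The local count
`N_a^loc(B) = (log B)^4 (α W / ‖a‖) ∑_{x ∈ P(B), a ∈ Λ_x^(W) ∩ C_x^(α)} 1 / ‖x‖`. -/
def localCount (a : Fin 4 → ℤ) (B : ℝ) : ℝ :=
  (Real.log B) ^ 4 * (alphaParam B * (WParam B : ℝ) / ‖euc a‖) *
    ∑ x ∈ (finite_primeTuples B).toFinset.filter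
        (fun x => a ∈ orthLatticeMod (WParam B) x ∧ euc a ∈ coneRegion (alphaParam B) (euc x)),
      1 / ‖euc x‖

end

end PrimeLinearForms

namespace PrimeLinearForms


/-! Expanding the square and exchanging sums (`sum_abs_sub_sq_eq`) turns the left side into `(log
B)^8` times the sum, over pairs of prime tuples `x`, `y`, of `pairCount - 2 * pairMixed +
pairLocal`. Let `Δ` be the Gram determinant of `x` and `y`, and `G` the gcd of their `2 × 2` minors.
The integer vectors orthogonal to both form a lattice of rank two and covolume `√Δ / G`.

For a pair in general position the three terms have the same main term `ν π A² / √Δ`. Here `ν W²` is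
the number of classes modulo `W` in the lattice orthogonal to `x`, primitive at the primes dividing
`W`, on which `⟨y, ·⟩` vanishes modulo `W`. The mixed term has a negative coefficient, so upper
bounds for `pairCount` and `pairLocal` and a lower bound for `pairMixed` are enough. Upper bounds
may relax coprimality of the entries to primitivity at `W`. Only the lower bound has to sieve
further: the primes in `(w, z]` enter through congruences modulo their product `P`, and larger
common factors, as well as zero entries, are removed by a crude count. All counts come from
comparing sums over residue classes with integrals over disjoint or covering cubes; the integrals
are areas of ellipses and parallelograms.

Up to error terms, the variance of a pair is therefore `O(η A² G / √Δ)` with `η = 1 / w`, if `G ≤ w`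
and the angle between `x` and `y` is not tiny (`PairFrame.variance_le`). The exponents in `W` are
exactly what makes `G p` divide `W` for all primes `p ∣ W`, whence the densities of the exact count
and of the local model agree. Without these conditions the bound is `O(A² G / √Δ)`
(`PairFrame.variance_le'`).

It remains to sum `G / √Δ`. The weight `G^(3/2) Δ^(-9/16)`, slightly heavier on large `G` and small
`Δ`, has sum `O(B^(23/4) / (log B)^8)` over the relevant pairs (`sum_generic_le`). All eight
logarithms are saved by Chebyshev's bound and a bound of Brun–Titchmarsh type for one residue class,
proved by an elementary factorial argument. The spare factor `G^(-1/2) Δ^(1/16)` is at most `2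
B^(1/4)`, and gains `δ = (log log B)^(-1/4)` on the pairs in bad position.

The other pairs need no prime number theory. Those with `√Δ / G` at most `4 B² / (log B)^20` are
parametrised by their reduced minors (`sum_pairs_small_covolume_le`), and pairs with coinciding
coordinates number `O(B^7)`. Dependent pairs are equal, or both constant; the diagonal contributes
about `A³ B³ / (log B)^4`, which is where the upper bound for `A` is needed. The lower bound for `A`
absorbs the boundary errors. Bounded `B` is trivial once `W` is bounded; this fails only near `B =
e^e`, where the range of `A` is empty. -/

/-! ### Chebyshev and Brun–Titchmarsh type bounds for primes -/

theorem log_le_two_sqrt {z : ℝ} (hz : 0 < z) : Real.log z ≤ 2 * Real.sqrt z := by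
  have h : Real.log z = 2 * Real.log (Real.sqrt z) := by
    rw [Real.log_sqrt hz.le]; ring
  have := Real.log_le_sub_one_of_pos (Real.sqrt_pos.mpr hz)
  rw [h]; linarith

/-- A form of Chebyshev's upper bound that compares `π(t)` with `B` for every `t ≤ B`. -/
theorem primeCounting_le_sqrt : ∃ C : ℝ, 0 < C ∧ ∀ t B : ℝ, 2 ≤ t → t ≤ B →
    (Nat.primeCounting ⌊t⌋₊ : ℝ) ≤ C * Real.sqrt (t * B) / Real.log B := by
  refine ⟨16, by norm_num, fun t B ht hB => ?_⟩
  have h := Chebyshev.pi_le_log4_mul_div (x := t) (by linarith)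
  have hlt : 0.69 ≤ Real.log t := by
    have := Real.log_le_log (by norm_num) ht
    linarith [Real.log_two_gt_d9]
  have hlB : 0 < Real.log B := Real.log_pos (by linarith)
  have hs : 0 < Real.sqrt t := Real.sqrt_pos.mpr (by linarith)
  have hsB : 0 < Real.sqrt B := Real.sqrt_pos.mpr (by linarith)
  have hmul : Real.sqrt (t * B) = Real.sqrt t * Real.sqrt B := Real.sqrt_mul (by linarith) _
  have htt : Real.sqrt t * Real.sqrt t = t := Real.mul_self_sqrt (by linarith)
  have h1 : Real.log B ≤ 2 * Real.sqrt B := log_le_two_sqrt (by linarith)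
  -- This compares `t / log t` with `√(t B) / log B`. In `log B = log t + log (B / t)` the second
  -- part is at most `2 √(B / t)`, and `log t ≥ 0.69` turns the resulting `2 √B` into a multiple of
  -- `√B log t`.
  have h2 : Real.log B * Real.sqrt t ≤ 4 * (Real.sqrt B * Real.log t) := by
    have e1 : Real.log B = Real.log t + Real.log (B / t) := by
      rw [Real.log_div (by linarith) (by linarith)]; ring
    have e2 : Real.log (B / t) ≤ 2 * Real.sqrt (B / t) :=
      log_le_two_sqrt (div_pos (by linarith) (by linarith))
    rw [Real.sqrt_div (by linarith)] at e2
    have e3 : Real.sqrt B / Real.sqrt t * Real.sqrt t = Real.sqrt B := by field_simp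
    have e4 : Real.sqrt t ≤ Real.sqrt B := Real.sqrt_le_sqrt hB
    have e5 := mul_le_mul_of_nonneg_right e2 hs.le
    rw [e1]
    nlinarith
  have hlog4 : Real.log 4 ≤ 1.4 := by
    have : Real.log 4 = 2 * Real.log 2 := by
      rw [show (4 : ℝ) = 2 ^ 2 by norm_num, Real.log_pow]; norm_num
    linarith [Real.log_two_lt_d9]
  rw [Real.log_sqrt (by linarith)] at h
  refine h.trans ?_
  rw [le_div_iff₀ hlB, hmul, add_mul]
  have a1 : Real.log 4 * t / (Real.log t / 2) * Real.log B ≤ 11.2 * (Real.sqrt t * Real.sqrt B) := by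
    rw [show Real.log 4 * t / (Real.log t / 2) * Real.log B
      = (2 * Real.log 4 * t * Real.log B) / Real.log t by field_simp]
    rw [div_le_iff₀ (by linarith)]
    have : 2 * Real.log 4 * t * Real.log B = 2 * Real.log 4 * (Real.sqrt t *
      (Real.log B * Real.sqrt t)) := by
      nth_rewrite 1 [← htt]; ring
    rw [this]
    have b1 : Real.sqrt t * (Real.log B * Real.sqrt t)
        ≤ Real.sqrt t * (4 * (Real.sqrt B * Real.log t)) := mul_le_mul_of_nonneg_left h2 hs.le
    have b0 : 0 ≤ Real.sqrt t * (Real.log B * Real.sqrt t) := by positivity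
    nlinarith
  have a2 : Real.sqrt t * Real.log B ≤ 2 * (Real.sqrt t * Real.sqrt B) := by nlinarith
  nlinarith [mul_pos hs hsB]

/-- Checked one prime power `p ^ k` at a time. If `p ∣ q`, the power `q ^ N` suffices, since the
`p`-adic valuation of `N!` is at most `N`. Otherwise `a ≡ q b` modulo `p ^ k`, and the product
becomes `q ^ N` times `N` consecutive integers. -/
theorem factorial_dvd_pow_mul_prod (a q N : ℕ) :
    N.factorial ∣ q ^ N * ∏ n ∈ Finset.range N, (a + q * n) := by
  rw [Nat.dvd_iff_prime_pow_dvd_dvd]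
  intro p k hp hk
  by_cases hpq : p ∣ q
  · refine Dvd.dvd.mul_right ?_ _
    have hkN : k ≤ N := by
      have h1 : k ≤ padicValNat p N.factorial := by
        have := Fact.mk hp
        exact (padicValNat_dvd_iff_le (Nat.factorial_ne_zero N)).mp hk
      have := Fact.mk hp
      have h2 := sub_one_mul_padicValNat_factorial (p := p) N
      have h3 : 1 ≤ p - 1 := by have := hp.two_le; omega
      calc k ≤ padicValNat p N.factorial := h1
        _ ≤ (p - 1) * padicValNat p N.factorial := Nat.le_mul_of_pos_left _ h3
        _ ≤ N := by rw [h2]; omega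
    exact (pow_dvd_pow p hkN).trans (pow_dvd_pow_of_dvd hpq N)
  · refine Dvd.dvd.mul_left ?_ _
    have hco : Nat.Coprime q (p ^ k) :=
      (Nat.Coprime.pow_left k ((Nat.Prime.coprime_iff_not_dvd hp).mpr hpq)).symm
    obtain ⟨b, hb⟩ : ∃ b : ℕ, q * b ≡ a [MOD p ^ k] := by
      have hpk : p ^ k ≠ 0 := pow_ne_zero _ hp.ne_zero
      have : NeZero (p ^ k) := ⟨hpk⟩
      refine ⟨(((q : ZMod (p ^ k))⁻¹ * a : ZMod (p ^ k))).val, ?_⟩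
      rw [← ZMod.natCast_eq_natCast_iff]
      push_cast
      rw [ZMod.natCast_zmod_val, ← mul_assoc, ZMod.coe_mul_inv_eq_one q hco, one_mul]
    have h1 : ∏ n ∈ Finset.range N, (a + q * n) ≡ ∏ n ∈ Finset.range N, (q * (b + n)) [MOD p ^ k] := by
      rw [← ZMod.natCast_eq_natCast_iff] at hb ⊢
      push_cast at hb ⊢
      refine Finset.prod_congr rfl fun n _ => ?_
      rw [← hb]; ring
    refine (h1.dvd_iff dvd_rfl).mpr ?_
    rw [Finset.prod_mul_distrib]
    refine Dvd.dvd.mul_left (hk.trans ?_) _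
    rw [← Nat.ascFactorial_eq_prod_range]
    exact Nat.factorial_dvd_ascFactorial b N

/-- Primes exceeding `N` among `N` consecutive terms of a progression of modulus `q`. -/
theorem pow_card_mul_le (a q N : ℕ) (T : ℝ) (ha : 0 < a) (hq : 0 < q) (hN : 0 < N)
    (hT : ∀ n < N, ((a + q * n : ℕ) : ℝ) ≤ T)
    (S : Finset ℕ) (hS : ∀ p ∈ S, p.Prime ∧ N < p ∧ ∃ n < N, p = a + q * n) :
    (N : ℝ) ^ S.card ≤ (Real.exp 1 * q * T / N) ^ N := by
  set D := ∏ n ∈ Finset.range N, (a + q * n) with hD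
  have hT0 : 0 ≤ T := (Nat.cast_nonneg _).trans (hT 0 hN)
  obtain ⟨E, hE⟩ := factorial_dvd_pow_mul_prod a q N
  rw [← hD] at hE
  have hDpos : 0 < D := Finset.prod_pos fun n _ => by omega
  have hEpos : 0 < E := by
    rcases Nat.eq_zero_or_pos E with h | h
    · rw [h, mul_zero] at hE
      have : 0 < q ^ N * D := by positivity
      exact absurd hE this.ne'
    · exact h
  -- The primes of `S` are factors of `D`, hence divide `N! * E`; they exceed `N`, so they are
  -- coprime to `N!` and their product divides the cofactor `E`. The size of `E` then follows from
  -- `N ^ N / N! ≤ e ^ N`.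
  have h1 : ∏ p ∈ S, p ∣ E := by
    have d1 : ∏ p ∈ S, p ∣ N.factorial * E := by
      rw [← hE]
      refine Dvd.dvd.mul_left ?_ _
      refine Finset.prod_primes_dvd _ (fun p hp => (hS p hp).1.prime) fun p hp => ?_
      obtain ⟨_, _, n, hn, rfl⟩ := hS p hp
      exact Finset.dvd_prod_of_mem (fun n => a + q * n) (Finset.mem_range.mpr hn)
    refine Nat.Coprime.dvd_of_dvd_mul_left ?_ d1
    refine Nat.Coprime.prod_left fun p hp => ?_
    exact ((hS p hp).1.coprime_factorial_of_lt (hS p hp).2.1)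
  have h2 : N ^ S.card ≤ ∏ p ∈ S, p := by
    rw [← Finset.prod_const]
    exact Finset.prod_le_prod' fun p hp => (hS p hp).2.1.le
  have h3 : (N : ℝ) ^ S.card ≤ E := by
    exact_mod_cast h2.trans (Nat.le_of_dvd hEpos h1)
  refine h3.trans ?_
  have hE' : (q : ℝ) ^ N * D = N.factorial * E := by exact_mod_cast hE
  have hDT : (D : ℝ) ≤ T ^ N := by
    rw [hD, Nat.cast_prod]
    calc _ ≤ ∏ n ∈ Finset.range N, T := Finset.prod_le_prod (fun _ _ => by positivity)
            fun n hn => hT n (Finset.mem_range.mp hn)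
      _ = T ^ N := by simp
  have hfac := Real.pow_div_factorial_le_exp (N : ℝ) (by positivity) N
  have hf : (0 : ℝ) < N.factorial := by exact_mod_cast Nat.factorial_pos N
  have hNr : (0 : ℝ) < N := by exact_mod_cast hN
  have hEe : (E : ℝ) = (q : ℝ) ^ N * D / N.factorial := by
    rw [hE']; field_simp
  rw [hEe, div_pow, mul_pow, mul_pow, ← Real.exp_nat_mul, mul_one, div_le_div_iff₀ hf (by positivity)]
  rw [div_le_iff₀ hf] at hfac
  calc (q : ℝ) ^ N * D * N ^ N ≤ q ^ N * T ^ N * (Real.exp N * N.factorial) := by gcongr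
    _ = _ := by ring

theorem log_le_mul_rpow {z : ℝ} (hz : 1 ≤ z) : Real.log z ≤ 8 * z ^ (1 / 8 : ℝ) := by
  have h := Real.log_le_sub_one_of_pos (Real.rpow_pos_of_pos (by linarith : 0 < z) (1 / 8 : ℝ))
  rw [Real.log_rpow (by linarith)] at h
  linarith

/-- An upper bound of Brun–Titchmarsh type, with a loss of `(qB/H)^(1/8)`, for the primes up to `B`
of one residue class modulo `q` in an interval of length `2H`. -/
theorem card_primes_residue_interval_le : ∃ C : ℝ, 0 < C ∧ ∀ (B : ℝ) (q : ℕ) (ξ H : ℝ), 2 ≤ B →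
    0 < q → H ≤ B → (q : ℝ) * B ^ (1 / 8 : ℝ) ≤ H → ∀ S : Finset ℕ,
    (∀ p ∈ S, p.Prime ∧ (p : ℝ) ≤ B ∧ |(p : ℝ) - ξ| ≤ H) →
    (∀ p ∈ S, ∀ p' ∈ S, p ≡ p' [MOD q]) →
    (S.card : ℝ) ≤ C * (H / q) * (q * B / H) ^ (1 / 8 : ℝ) / Real.log B := by
  obtain ⟨C₁, hC₁, hpi⟩ := primeCounting_le_sqrt
  refine ⟨24 * C₁ + 24 * 20, by positivity, fun B q ξ H hB hq hHB hqH S hS hmod => ?_⟩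
  have hqr : (1 : ℝ) ≤ q := by exact_mod_cast hq
  have hB8 : 1 ≤ B ^ (1 / 8 : ℝ) := Real.one_le_rpow (by linarith) (by norm_num)
  have hH1 : 1 ≤ H := by nlinarith
  have hlB : 0 < Real.log B := Real.log_pos (by linarith)
  set z := q * B / H with hz
  have hz1 : (q : ℝ) ≤ z := by
    rw [hz, le_div_iff₀ (by linarith)]; gcongr
  have hz8 : 1 ≤ z ^ (1 / 8 : ℝ) := Real.one_le_rpow (by linarith) (by norm_num)
  set r := H / q with hr
  have hr8 : B ^ (1 / 8 : ℝ) ≤ r := by rw [hr, le_div_iff₀ (by linarith)]; linarith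
  rcases S.eq_empty_or_nonempty with rfl | hne
  · simp only [Finset.card_empty, Nat.cast_zero]; positivity
  set a := S.min' hne with ha
  have haS : a ∈ S := S.min'_mem hne
  -- Starting from the least element `a`, all of `S` lies among the first `N` terms of the
  -- progression. The hypothesis on `H` gives `N ≥ B ^ (1/8)`, so that `log N` is of the order of
  -- `log B`.
  set N := ⌊2 * r⌋₊ + 1 with hN
  have hNlt : 2 * r < N := by rw [hN]; push_cast; exact Nat.lt_floor_add_one _
  have hNle : (N : ℝ) ≤ 3 * r := by
    rw [hN]; push_cast
    have := Nat.floor_le (show 0 ≤ 2 * r by linarith)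
    linarith
  have hN2 : (2 : ℝ) ≤ N := by linarith
  have hform : ∀ p ∈ S, ∃ n < N, p = a + q * n := by
    intro p hp
    have hap : a ≤ p := S.min'_le p hp
    obtain ⟨n, hn⟩ := (Nat.modEq_iff_dvd' hap).mp (hmod a haS p hp)
    have hpe : p = a + q * n := by omega
    refine ⟨n, ?_, hpe⟩
    have h1 := abs_le.mp (hS p hp).2.2
    have h2 := abs_le.mp (hS a haS).2.2
    have h3 : (q : ℝ) * n ≤ 2 * H := by
      have : (p : ℝ) = a + q * n := by exact_mod_cast hpe
      linarith
    have h4 : (n : ℝ) ≤ 2 * r := by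
      rw [hr, ← mul_div_assoc, le_div_iff₀ (by linarith)]; linarith
    exact_mod_cast h4.trans_lt hNlt
  have hlogN : Real.log B / 8 ≤ Real.log N := by
    have h1 : Real.log (B ^ (1 / 8 : ℝ)) ≤ Real.log N :=
      Real.log_le_log (by linarith) (by linarith)
    rw [Real.log_rpow (by linarith)] at h1
    linarith
  -- The factorial argument sees only the primes exceeding `N`; those up to `N` are counted by
  -- Chebyshev's bound.
  set S₁ := S.filter (fun p => N < p) with hS₁
  set S₂ := S.filter (fun p => ¬ N < p) with hS₂
  have hcard : S.card = S₁.card + S₂.card := (Finset.card_filter_add_card_filter_not _).symm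
  have hb2 : (S₂.card : ℝ) ≤ 24 * C₁ * r / Real.log B := by
    have h1 : S₂.card ≤ Nat.primeCounting N := by
      rw [Nat.primeCounting, Nat.primeCounting', Nat.count_eq_card_filter_range]
      refine Finset.card_le_card fun p hp => ?_
      rw [hS₂, Finset.mem_filter] at hp
      rw [Finset.mem_filter, Finset.mem_range]
      exact ⟨by omega, (hS p hp.1).1⟩
    have h2 := hpi N N hN2 le_rfl
    rw [Nat.floor_natCast, Real.sqrt_mul_self (by linarith)] at h2
    calc (S₂.card : ℝ) ≤ Nat.primeCounting N := by exact_mod_cast h1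
      _ ≤ C₁ * N / Real.log N := h2
      _ ≤ C₁ * (3 * r) / (Real.log B / 8) := by gcongr
      _ = _ := by ring
  have hb1 : (S₁.card : ℝ) ≤ 24 * 20 * r * z ^ (1 / 8 : ℝ) / Real.log B := by
    have h1 := pow_card_mul_le a q N (3 * B) (hS a haS).1.pos hq (by omega) ?_ S₁ ?_
    · have hNpos : (0 : ℝ) < N := by linarith
      have h2 := Real.log_le_log (by positivity) h1
      rw [Real.log_pow, Real.log_pow] at h2
      -- From `z r = B`, `q ≤ z` and `r ≤ N`. The logarithm of `9 z²` is the whole loss of the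
      -- method, and is then replaced by a multiple of `z ^ (1/8)`.
      have h3 : Real.exp 1 * q * (3 * B) / N ≤ 9 * z ^ 2 := by
        rw [div_le_iff₀ hNpos]
        have e1 : Real.exp 1 ≤ 3 := by linarith [Real.exp_one_lt_d9]
        have e2 : z * r = B := by rw [hz, hr]; field_simp
        have e3 : z * (q * B) ≤ z * (z * B) := by gcongr
        calc Real.exp 1 * q * (3 * B) ≤ 3 * q * (3 * B) := by gcongr
          _ = 9 * (q * (z * r)) := by rw [e2]; ring
          _ ≤ 9 * (z * (z * r)) := by
            have : 0 ≤ r := by linarith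
            have : 0 ≤ z := by linarith
            gcongr
          _ ≤ 9 * (z * (z * N)) := by
            have : 0 ≤ z := by linarith
            gcongr
            linarith
          _ = 9 * z ^ 2 * N := by ring
      have h4 : Real.log (Real.exp 1 * q * (3 * B) / N) ≤ 20 * z ^ (1 / 8 : ℝ) := by
        have e0 := Real.log_le_log (by positivity) h3
        rw [Real.log_mul (by norm_num) (by positivity), Real.log_pow] at e0
        have e1 := log_le_mul_rpow (show 1 ≤ z by linarith)
        have e2 : Real.log 9 ≤ 4 := by
          have : Real.log 9 ≤ Real.log (2 ^ 4) := Real.log_le_log (by norm_num) (by norm_num)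
          rw [Real.log_pow] at this
          have := Real.log_two_lt_d9
          push_cast at *
          linarith
        push_cast at e0
        linarith
      have h5 : (S₁.card : ℝ) * (Real.log B / 8) ≤ 3 * r * (20 * z ^ (1 / 8 : ℝ)) := by
        calc (S₁.card : ℝ) * (Real.log B / 8) ≤ S₁.card * Real.log N := by gcongr
          _ ≤ N * Real.log (Real.exp 1 * q * (3 * B) / N) := h2
          _ ≤ N * (20 * z ^ (1 / 8 : ℝ)) := by gcongr
          _ ≤ _ := by gcongr
      rw [le_div_iff₀ hlB]
      linarith
    · intro n hn
      push_cast
      have h1 : (n : ℝ) ≤ 2 * r := by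
        have : n ≤ ⌊2 * r⌋₊ := by omega
        exact (Nat.le_floor_iff (by linarith)).mp this
      have h2 : (q : ℝ) * n ≤ 2 * H := by
        calc (q : ℝ) * n ≤ q * (2 * r) := by gcongr
          _ = 2 * H := by rw [hr]; field_simp
      linarith [(hS a haS).2.1]
    · intro p hp
      rw [hS₁, Finset.mem_filter] at hp
      exact ⟨(hS p hp.1).1, hp.2, hform p hp.1⟩
  have hr0 : 0 ≤ r := by linarith
  calc (S.card : ℝ) = S₁.card + S₂.card := by exact_mod_cast hcard
    _ ≤ 24 * 20 * r * z ^ (1 / 8 : ℝ) / Real.log B + 24 * C₁ * r / Real.log B := add_le_add hb1 hb2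
    _ ≤ 24 * 20 * r * z ^ (1 / 8 : ℝ) / Real.log B
        + 24 * C₁ * r * z ^ (1 / 8 : ℝ) / Real.log B := by
      have : 24 * C₁ * r ≤ 24 * C₁ * r * z ^ (1 / 8 : ℝ) :=
        le_mul_of_one_le_right (by positivity) hz8
      gcongr
    _ = _ := by ring



/-! ### Sums of negative powers over primes and prime tuples -/

theorem geom_half_sum_le (K : ℕ) : ∑ k ∈ Finset.range K, ((2 : ℝ) ^ (-(1 / 2 : ℝ))) ^ k ≤ 4 := by
  have h0 : (0 : ℝ) ≤ 2 ^ (-(1 / 2 : ℝ)) := by positivity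
  have h1 : (2 : ℝ) ^ (-(1 / 2 : ℝ)) ≤ 3 / 4 := by
    rw [Real.rpow_neg (by norm_num), ← Real.sqrt_eq_rpow, inv_le_comm₀ (by positivity) (by norm_num)]
    rw [show ((3 : ℝ) / 4)⁻¹ = 4 / 3 by norm_num]
    exact Real.le_sqrt_of_sq_le (by norm_num)
  calc _ ≤ ∑ k ∈ Finset.range K, ((3 : ℝ) / 4) ^ k := by gcongr
    _ ≤ ∑' k : ℕ, ((3 : ℝ) / 4) ^ k :=
      (summable_geometric_of_lt_one (by norm_num) (by norm_num)).sum_le_tsum _ (fun _ _ => by positivity)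
    _ = 4 := by rw [tsum_geometric_of_lt_one (by norm_num) (by norm_num)]; norm_num

/-- The sum of `|p - ξ|^(-3/8)` over primes of a residue class. -/
theorem sum_dist_rpow_primes_le : ∃ C : ℝ, 0 < C ∧ ∀ (B : ℝ) (q : ℕ) (ξ : ℝ), 2 ≤ B →
    0 < q → (q : ℝ) ≤ B ^ (1 / 100 : ℝ) → 0 ≤ ξ → ξ ≤ B → ∀ S : Finset ℕ,
    (∀ p ∈ S, p.Prime ∧ (p : ℝ) ≤ B ∧ 1 / B ≤ |(p : ℝ) - ξ|) →
    (∀ p ∈ S, ∀ p' ∈ S, p ≡ p' [MOD q]) →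
    ∑ p ∈ S, |(p : ℝ) - ξ| ^ (-(3 / 8 : ℝ))
      ≤ C * B ^ (5 / 8 : ℝ) * (q : ℝ) ^ (-(7 / 8 : ℝ)) / Real.log B := by
  obtain ⟨C₁, hC₁, hBT⟩ := card_primes_residue_interval_le
  refine ⟨8 * C₁ + 120, by positivity, fun B q ξ hB hq hqB hξ hξB S hS hmod => ?_⟩
  have hB0 : 0 < B := by linarith
  have hB1 : 1 ≤ B := by linarith
  have hqr : (1 : ℝ) ≤ q := by exact_mod_cast hq
  have hq0 : (0 : ℝ) < q := by linarith
  have hlB : 0 < Real.log B := Real.log_pos (by linarith)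
  have hB5 : 1 ≤ B ^ (1 / 5 : ℝ) := Real.one_le_rpow hB1 (by norm_num)
  -- Beyond the distance `B ^ (1/5)`, which exceeds `q B ^ (1/8)`, dyadic intervals are long enough
  -- for the Brun–Titchmarsh type bound. Nearer to `ξ` it suffices to count all integers, each
  -- contributing at most `B ^ (3/8)`: even with the losses from `log B` and `q` the exponent `1/5 +
  -- 3/8 + 1/40 + 1/100` stays below `5/8`.
  rw [← Finset.sum_filter_add_sum_filter_not S (fun p : ℕ => B ^ (1 / 5 : ℝ) ≤ |(p : ℝ) - ξ|)]
  set S₁ := S.filter (fun p : ℕ => B ^ (1 / 5 : ℝ) ≤ |(p : ℝ) - ξ|) with hS₁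
  set S₂ := S.filter (fun p : ℕ => ¬ B ^ (1 / 5 : ℝ) ≤ |(p : ℝ) - ξ|) with hS₂
  have hdist : ∀ p ∈ S, |(p : ℝ) - ξ| ≤ B := by
    intro p hp
    have := (hS p hp).2.1
    rw [abs_le]; constructor <;> linarith [Nat.cast_nonneg (α := ℝ) p]
  have hpart1 : ∑ p ∈ S₁, |(p : ℝ) - ξ| ^ (-(3 / 8 : ℝ))
      ≤ 8 * C₁ * B ^ (5 / 8 : ℝ) * (q : ℝ) ^ (-(7 / 8 : ℝ)) / Real.log B := by
    obtain ⟨K, hK⟩ := pow_unbounded_of_one_lt B (show (1 : ℝ) < 2 by norm_num)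
    have hpt : ∀ p ∈ S₁, |(p : ℝ) - ξ| ^ (-(3 / 8 : ℝ)) ≤ ∑ k ∈ Finset.range K,
        if |(p : ℝ) - ξ| ≤ B / 2 ^ k then 2 * (B / 2 ^ k) ^ (-(3 / 8 : ℝ)) else 0 := by
      intro p hp
      rw [hS₁, Finset.mem_filter] at hp
      set t := |(p : ℝ) - ξ| with ht
      have ht1 : 1 ≤ t := hB5.trans hp.2
      have htB : t ≤ B := hdist p hp.1
      have ht0 : 0 < t := by linarith
      obtain ⟨k, hk1, hk2⟩ := exists_nat_pow_near (show 1 ≤ B / t by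
        rw [le_div_iff₀ ht0]; linarith) (show (1 : ℝ) < 2 by norm_num)
      have hkK : k < K := by
        have : (2 : ℝ) ^ k < 2 ^ K := by
          refine lt_of_le_of_lt (hk1.trans ?_) hK
          exact div_le_self hB0.le ht1
        exact (pow_lt_pow_iff_right₀ (by norm_num)).mp this
      have h2k : (0 : ℝ) < 2 ^ k := by positivity
      have hle : t ≤ B / 2 ^ k := by
        rw [le_div_iff₀ h2k]; rw [le_div_iff₀ ht0] at hk1; linarith
      have hlt : B / 2 ^ k ≤ 2 * t := by
        rw [div_lt_iff₀ ht0] at hk2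
        rw [div_le_iff₀ h2k]; rw [pow_succ] at hk2; linarith
      refine le_trans ?_ (Finset.single_le_sum (f := fun k => if t ≤ B / 2 ^ k then
        2 * (B / 2 ^ k) ^ (-(3 / 8 : ℝ)) else 0) (fun k _ => ?_) (Finset.mem_range.mpr hkK))
      · simp only [if_pos hle]
        calc t ^ (-(3 / 8 : ℝ)) ≤ ((B / 2 ^ k) / 2) ^ (-(3 / 8 : ℝ)) :=
              Real.rpow_le_rpow_of_nonpos (by positivity) (by linarith) (by norm_num)
          _ = 2 ^ (3 / 8 : ℝ) * (B / 2 ^ k) ^ (-(3 / 8 : ℝ)) := by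
              rw [Real.div_rpow (by positivity) (by norm_num), Real.rpow_neg (x := 2) (by norm_num)]
              rw [div_inv_eq_mul, mul_comm]
          _ ≤ 2 * (B / 2 ^ k) ^ (-(3 / 8 : ℝ)) := by
              gcongr
              calc (2 : ℝ) ^ (3 / 8 : ℝ) ≤ 2 ^ (1 : ℝ) :=
                    Real.rpow_le_rpow_of_exponent_le (by norm_num) (by norm_num)
                _ = 2 := Real.rpow_one 2
      · split_ifs <;> positivity
    refine (Finset.sum_le_sum hpt).trans ?_
    rw [Finset.sum_comm]
    have hk : ∀ k ∈ Finset.range K, (∑ p ∈ S₁, if |(p : ℝ) - ξ| ≤ B / 2 ^ k then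
        2 * (B / 2 ^ k) ^ (-(3 / 8 : ℝ)) else 0)
        ≤ 2 * C₁ * B ^ (5 / 8 : ℝ) * (q : ℝ) ^ (-(7 / 8 : ℝ)) / Real.log B
          * ((2 : ℝ) ^ (-(1 / 2 : ℝ))) ^ k := by
      intro k _
      rw [← Finset.sum_filter, Finset.sum_const, nsmul_eq_mul]
      set H := B / 2 ^ k with hH
      have hH0 : 0 < H := by positivity
      rcases (S₁.filter (fun p : ℕ => |(p : ℝ) - ξ| ≤ H)).eq_empty_or_nonempty with he | ⟨p, hp⟩
      · rw [he]; simp only [Finset.card_empty, Nat.cast_zero, zero_mul]; positivity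
      · rw [Finset.mem_filter, hS₁, Finset.mem_filter] at hp
        have hHB5 : B ^ (1 / 5 : ℝ) ≤ H := hp.1.2.trans hp.2
        have hbt := hBT B q ξ H hB hq (div_le_self hB0.le (one_le_pow₀ (by norm_num))) ?_
          (S₁.filter (fun p : ℕ => |(p : ℝ) - ξ| ≤ H)) ?_ ?_
        · calc _ ≤ C₁ * (H / q) * (q * B / H) ^ (1 / 8 : ℝ) / Real.log B
                * (2 * H ^ (-(3 / 8 : ℝ))) := by gcongr
            _ = 2 * C₁ * B ^ (5 / 8 : ℝ) * (q : ℝ) ^ (-(7 / 8 : ℝ)) / Real.log B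
                * ((2 : ℝ) ^ (-(1 / 2 : ℝ))) ^ k := by
              rw [Real.div_rpow (by positivity) hH0.le, Real.mul_rpow hq0.le hB0.le]
              -- The exponent `1 - 3/8 - 1/8` is positive, so the dyadic sum is dominated by its
              -- longest interval, `H = B`.
              have e1 : H * H ^ (-(3 / 8 : ℝ)) / H ^ (1 / 8 : ℝ) = H ^ (1 / 2 : ℝ) := by
                rw [← Real.rpow_one_add' hH0.le (by norm_num), ← Real.rpow_sub hH0]; norm_num
              have e2 : (q : ℝ) ^ (1 / 8 : ℝ) / q = (q : ℝ) ^ (-(7 / 8 : ℝ)) := by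
                rw [← Real.rpow_sub_one hq0.ne']; norm_num
              have e3 : B ^ (5 / 8 : ℝ) = B ^ (1 / 2 : ℝ) * B ^ (1 / 8 : ℝ) := by
                rw [← Real.rpow_add hB0]; norm_num
              have e4 : H ^ (1 / 2 : ℝ) = B ^ (1 / 2 : ℝ) * ((2 : ℝ) ^ (-(1 / 2 : ℝ))) ^ k := by
                rw [hH, Real.div_rpow hB0.le (by positivity), ← Real.rpow_natCast, ← Real.rpow_natCast,
                  ← Real.rpow_mul (by norm_num), ← Real.rpow_mul (by norm_num), div_eq_mul_inv,
                  ← Real.rpow_neg (by norm_num)]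
                congr 2; ring
              calc _ = 2 * C₁ * (H * H ^ (-(3 / 8 : ℝ)) / H ^ (1 / 8 : ℝ))
                    * ((q : ℝ) ^ (1 / 8 : ℝ) / q) * B ^ (1 / 8 : ℝ) / Real.log B := by ring
                _ = _ := by rw [e1, e2, e3, e4]; ring
        · calc (q : ℝ) * B ^ (1 / 8 : ℝ) ≤ B ^ (1 / 100 : ℝ) * B ^ (1 / 8 : ℝ) := by gcongr
            _ = B ^ (27 / 200 : ℝ) := by rw [← Real.rpow_add hB0]; norm_num
            _ ≤ B ^ (1 / 5 : ℝ) := Real.rpow_le_rpow_of_exponent_le hB1 (by norm_num)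
            _ ≤ H := hHB5
        · intro p hp
          rw [Finset.mem_filter, hS₁, Finset.mem_filter] at hp
          exact ⟨(hS p hp.1.1).1, (hS p hp.1.1).2.1, hp.2⟩
        · intro p hp p' hp'
          rw [Finset.mem_filter, hS₁, Finset.mem_filter] at hp hp'
          exact hmod p hp.1.1 p' hp'.1.1
    refine (Finset.sum_le_sum hk).trans ?_
    rw [← Finset.mul_sum]
    calc _ ≤ 2 * C₁ * B ^ (5 / 8 : ℝ) * (q : ℝ) ^ (-(7 / 8 : ℝ)) / Real.log B * 4 := by
          gcongr
          exact geom_half_sum_le K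
      _ = _ := by ring
  have hpart2 : ∑ p ∈ S₂, |(p : ℝ) - ξ| ^ (-(3 / 8 : ℝ))
      ≤ 120 * B ^ (5 / 8 : ℝ) * (q : ℝ) ^ (-(7 / 8 : ℝ)) / Real.log B := by
    have hcard : (S₂.card : ℝ) ≤ 3 * B ^ (1 / 5 : ℝ) := by
      have hsub : S₂.image (fun p : ℕ => (p : ℤ)) ⊆
          Finset.Icc ⌈ξ - B ^ (1 / 5 : ℝ)⌉ ⌊ξ + B ^ (1 / 5 : ℝ)⌋ := by
        intro z hz
        obtain ⟨p, hp, rfl⟩ := Finset.mem_image.mp hz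
        rw [hS₂, Finset.mem_filter, not_le, abs_lt] at hp
        rw [Finset.mem_Icc, Int.ceil_le, Int.le_floor]
        push_cast
        constructor <;> linarith [hp.2.1, hp.2.2]
      have h1 := Finset.card_le_card hsub
      rw [Finset.card_image_of_injective _ Nat.cast_injective, Int.card_Icc] at h1
      have h2 : ((⌊ξ + B ^ (1 / 5 : ℝ)⌋ + 1 - ⌈ξ - B ^ (1 / 5 : ℝ)⌉).toNat : ℝ)
          ≤ 2 * B ^ (1 / 5 : ℝ) + 1 := by
        rcases le_or_gt 0 (⌊ξ + B ^ (1 / 5 : ℝ)⌋ + 1 - ⌈ξ - B ^ (1 / 5 : ℝ)⌉) with h | h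
        · have : ((⌊ξ + B ^ (1 / 5 : ℝ)⌋ + 1 - ⌈ξ - B ^ (1 / 5 : ℝ)⌉).toNat : ℝ)
              = ((⌊ξ + B ^ (1 / 5 : ℝ)⌋ + 1 - ⌈ξ - B ^ (1 / 5 : ℝ)⌉ : ℤ) : ℝ) := by
            exact_mod_cast congrArg (Int.cast (R := ℝ)) (Int.toNat_of_nonneg h)
          rw [this]; push_cast
          linarith [Int.floor_le (ξ + B ^ (1 / 5 : ℝ)), Int.le_ceil (ξ - B ^ (1 / 5 : ℝ))]
        · rw [Int.toNat_of_nonpos h.le]; push_cast; linarith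
      have h3 : (S₂.card : ℝ) ≤ ((⌊ξ + B ^ (1 / 5 : ℝ)⌋ + 1 - ⌈ξ - B ^ (1 / 5 : ℝ)⌉).toNat : ℝ) := by
        exact_mod_cast h1
      linarith
    have hterm : ∀ p ∈ S₂, |(p : ℝ) - ξ| ^ (-(3 / 8 : ℝ)) ≤ B ^ (3 / 8 : ℝ) := by
      intro p hp
      rw [hS₂, Finset.mem_filter] at hp
      have := (hS p hp.1).2.2
      calc |(p : ℝ) - ξ| ^ (-(3 / 8 : ℝ)) ≤ (1 / B) ^ (-(3 / 8 : ℝ)) :=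
            Real.rpow_le_rpow_of_nonpos (by positivity) this (by norm_num)
        _ = B ^ (3 / 8 : ℝ) := by
            rw [one_div, Real.inv_rpow hB0.le, Real.rpow_neg hB0.le, inv_inv]
    have hlog : Real.log B ≤ 40 * B ^ (1 / 40 : ℝ) := by
      have := Real.log_le_rpow_div hB0.le (show (0 : ℝ) < 1 / 40 by norm_num)
      linarith
    have hq78 : 1 ≤ (q : ℝ) ^ (-(7 / 8 : ℝ)) * B ^ (1 / 100 : ℝ) := by
      rw [Real.rpow_neg hq0.le, inv_mul_eq_div, le_div_iff₀ (by positivity), one_mul]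
      calc (q : ℝ) ^ (7 / 8 : ℝ) ≤ (q : ℝ) ^ (1 : ℝ) :=
            Real.rpow_le_rpow_of_exponent_le hqr (by norm_num)
        _ = q := Real.rpow_one _
        _ ≤ _ := hqB
    calc _ ≤ S₂.card • B ^ (3 / 8 : ℝ) := Finset.sum_le_card_nsmul _ _ _ hterm
      _ ≤ 3 * B ^ (1 / 5 : ℝ) * B ^ (3 / 8 : ℝ) := by rw [nsmul_eq_mul]; gcongr
      _ ≤ 120 * B ^ (5 / 8 : ℝ) * (q : ℝ) ^ (-(7 / 8 : ℝ)) / Real.log B := by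
        rw [le_div_iff₀ hlB]
        calc 3 * B ^ (1 / 5 : ℝ) * B ^ (3 / 8 : ℝ) * Real.log B
            ≤ 3 * B ^ (1 / 5 : ℝ) * B ^ (3 / 8 : ℝ) * (40 * B ^ (1 / 40 : ℝ)) * 1 := by
              rw [mul_one]; gcongr
          _ ≤ 3 * B ^ (1 / 5 : ℝ) * B ^ (3 / 8 : ℝ) * (40 * B ^ (1 / 40 : ℝ)) *
              ((q : ℝ) ^ (-(7 / 8 : ℝ)) * B ^ (1 / 100 : ℝ)) := by gcongr
          _ = 120 * (B ^ (1 / 5 : ℝ) * B ^ (3 / 8 : ℝ) * B ^ (1 / 40 : ℝ) * B ^ (1 / 100 : ℝ))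
              * (q : ℝ) ^ (-(7 / 8 : ℝ)) := by ring
          _ ≤ 120 * B ^ (5 / 8 : ℝ) * (q : ℝ) ^ (-(7 / 8 : ℝ)) := by
              rw [← Real.rpow_add hB0, ← Real.rpow_add hB0, ← Real.rpow_add hB0]
              have : B ^ (1 / 5 + 3 / 8 + 1 / 40 + 1 / 100 : ℝ) ≤ B ^ (5 / 8 : ℝ) :=
                Real.rpow_le_rpow_of_exponent_le hB1 (by norm_num)
              gcongr
  calc _ ≤ _ := add_le_add hpart1 hpart2
    _ = (8 * C₁ + 120) * B ^ (5 / 8 : ℝ) * (q : ℝ) ^ (-(7 / 8 : ℝ)) / Real.log B := by ring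

/-- The primes up to `B`, as integers. -/
noncomputable def primesUpTo (B : ℝ) : Finset ℤ :=
  ((Finset.range (⌊B⌋₊ + 1)).filter Nat.Prime).map Nat.castEmbedding

theorem mem_primesUpTo {B : ℝ} (hB : 0 ≤ B) {p : ℤ} :
    p ∈ primesUpTo B ↔ Nat.Prime p.toNat ∧ |(p : ℝ)| ≤ B := by
  simp only [primesUpTo, Finset.mem_map, Finset.mem_filter, Finset.mem_range, Nat.castEmbedding_apply]
  constructor
  · rintro ⟨n, ⟨h1, h2⟩, rfl⟩
    refine ⟨by simpa using h2, ?_⟩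
    rw [abs_of_nonneg (by positivity)]
    push_cast
    exact (Nat.le_floor_iff hB).mp (by omega)
  · rintro ⟨h1, h2⟩
    have hp : 0 ≤ p := by
      by_contra h
      rw [Int.toNat_of_nonpos (by omega)] at h1
      exact Nat.not_prime_zero h1
    refine ⟨p.toNat, ⟨?_, h1⟩, Int.toNat_of_nonneg hp⟩
    have : (p.toNat : ℝ) ≤ B := by
      have e : ((p.toNat : ℤ) : ℝ) = p := by rw [Int.toNat_of_nonneg hp]
      have e' : (p.toNat : ℝ) = p := by exact_mod_cast e
      rw [e']; exact (le_abs_self _).trans h2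
    have := (Nat.le_floor_iff hB).mpr this
    omega

theorem card_primesUpTo (B : ℝ) : (primesUpTo B).card = Nat.primeCounting ⌊B⌋₊ := by
  rw [primesUpTo, Finset.card_map, Nat.primeCounting, Nat.primeCounting',
    Nat.count_eq_card_filter_range]

theorem primeTuples_toFinset {B : ℝ} (hB : 0 ≤ B) :
    (finite_primeTuples B).toFinset = Fintype.piFinset fun _ : Fin 4 => primesUpTo B := by
  ext x
  simp only [Set.Finite.mem_toFinset, Fintype.mem_piFinset, mem_primesUpTo hB]
  rfl

theorem prod_update_const (i : Fin 4) (a b : ℕ) :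
    ∏ j : Fin 4, (if j = i then a else b) = a * b ^ 3 := by
  fin_cases i <;> simp [Fin.prod_univ_four] <;> ring

/-- Sums over prime tuples of a power of the largest coordinate. -/
theorem sum_max_rpow_le : ∃ C : ℝ, 0 < C ∧ ∀ (B s : ℝ), 2 ≤ B → 0 ≤ s → s ≤ 3 / 2 → ∀ i : Fin 4,
    ∑ y ∈ (Fintype.piFinset fun _ : Fin 4 => primesUpTo B).filter (fun y => ∀ j, y j ≤ y i),
      (y i : ℝ) ^ (-s) ≤ C * B ^ (4 - s) / Real.log B ^ 4 := by
  obtain ⟨C₁, hC₁, hpi⟩ := primeCounting_le_sqrt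
  refine ⟨C₁ ^ 4, by positivity, fun B s hB hs0 hs i => ?_⟩
  have hB0 : 0 < B := by linarith
  have hlB : 0 < Real.log B := Real.log_pos (by linarith)
  set T := (Fintype.piFinset fun _ : Fin 4 => primesUpTo B).filter (fun y => ∀ j, y j ≤ y i) with hT
  have hmaps : ∀ y ∈ T, y i ∈ primesUpTo B := by
    intro y hy
    rw [hT, Finset.mem_filter, Fintype.mem_piFinset] at hy
    exact hy.1 i
  rw [← Finset.sum_fiberwise_of_maps_to hmaps]
  have hp : ∀ p ∈ primesUpTo B, ∑ y ∈ T.filter (fun y => y i = p), (y i : ℝ) ^ (-s)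
      ≤ C₁ ^ 3 * B ^ (3 - s) / Real.log B ^ 3 := by
    intro p hp
    have hp' := (mem_primesUpTo hB0.le).mp hp
    have hp2 : (2 : ℤ) ≤ p := by
      have := hp'.1.two_le
      omega
    have hp2r : (2 : ℝ) ≤ p := by exact_mod_cast hp2
    have hpB : (p : ℝ) ≤ B := (le_abs_self _).trans hp'.2
    -- With the largest coordinate fixed to be `p`, the three others are primes up to `p`.
    have hcard : (T.filter (fun y => y i = p)).card ≤ (Nat.primeCounting ⌊(p : ℝ)⌋₊) ^ 3 := by
      have hsub : T.filter (fun y => y i = p) ⊆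
          Fintype.piFinset fun j : Fin 4 => if j = i then {p} else primesUpTo p := by
        intro y hy
        rw [Finset.mem_filter, hT, Finset.mem_filter, Fintype.mem_piFinset] at hy
        rw [Fintype.mem_piFinset]
        intro j
        split_ifs with h
        · rw [h, Finset.mem_singleton]; exact hy.2
        · have h1 := (mem_primesUpTo hB0.le).mp (hy.1.1 j)
          rw [mem_primesUpTo (by linarith)]
          refine ⟨h1.1, ?_⟩
          have h2 : y j ≤ p := by rw [← hy.2]; exact hy.1.2 j
          have h3 : 0 < y j := by have := h1.1.pos; omega
          rw [abs_of_pos (by exact_mod_cast h3)]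
          exact_mod_cast h2
      refine (Finset.card_le_card hsub).trans ?_
      rw [Fintype.card_piFinset]
      have : ∀ j : Fin 4, (if j = i then ({p} : Finset ℤ) else primesUpTo p).card
          = if j = i then 1 else Nat.primeCounting ⌊(p : ℝ)⌋₊ := by
        intro j
        split_ifs
        · simp
        · exact card_primesUpTo _
      rw [Finset.prod_congr rfl fun j _ => this j, prod_update_const, one_mul]
    -- Chebyshev's bound in the form `√(p B) / log B` saves `log B`, rather than `log p`, for each
    -- of the three coordinates. The price is that `p` occurs only to the power `3/2`, which is why
    -- `s ≤ 3/2` is required.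
    have h1 := hpi p B hp2r hpB
    have hp0 : (0 : ℝ) < p := by linarith
    calc _ = ((T.filter (fun y => y i = p)).card : ℝ) * (p : ℝ) ^ (-s) := by
          rw [Finset.sum_congr rfl (fun y hy => by rw [(Finset.mem_filter.mp hy).2]),
            Finset.sum_const, nsmul_eq_mul]
      _ ≤ (C₁ * Real.sqrt (p * B) / Real.log B) ^ 3 * (p : ℝ) ^ (-s) := by
          gcongr
          calc ((T.filter (fun y => y i = p)).card : ℝ)
              ≤ ((Nat.primeCounting ⌊(p : ℝ)⌋₊ ^ 3 : ℕ) : ℝ) := by exact_mod_cast hcard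
            _ ≤ _ := by push_cast; gcongr
      _ = C₁ ^ 3 * (B ^ (3 / 2 : ℝ) * (p : ℝ) ^ (3 / 2 - s)) / Real.log B ^ 3 := by
          have e1 : Real.sqrt (p * B) ^ 3 = B ^ (3 / 2 : ℝ) * (p : ℝ) ^ (3 / 2 : ℝ) := by
            rw [Real.sqrt_eq_rpow, ← Real.rpow_natCast, ← Real.rpow_mul (by positivity), mul_comm,
              Real.mul_rpow hB0.le hp0.le]
            norm_num
          rw [div_pow, mul_pow, e1, sub_eq_add_neg, Real.rpow_add hp0]; ring
      _ ≤ C₁ ^ 3 * (B ^ (3 / 2 : ℝ) * B ^ (3 / 2 - s)) / Real.log B ^ 3 := by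
          gcongr
      _ = _ := by
          rw [← Real.rpow_add hB0]
          congr 3; ring
  refine (Finset.sum_le_sum hp).trans ?_
  rw [Finset.sum_const, nsmul_eq_mul, card_primesUpTo]
  have h1 := hpi B B hB le_rfl
  rw [Real.sqrt_mul_self hB0.le] at h1
  calc _ ≤ C₁ * B / Real.log B * (C₁ ^ 3 * B ^ (3 - s) / Real.log B ^ 3) := by gcongr
    _ = C₁ ^ 4 * (B * B ^ (3 - s)) / Real.log B ^ 4 := by field_simp
    _ = _ := by
      rw [← Real.rpow_one_add' hB0.le (by linarith)]
      congr 3; ring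



/-! ### Minors, Gram determinants, and pairs with all minors divisible by an integer -/

/-- The `2 × 2` minors of the matrix with rows `x` and `y`. -/
def minor (x y : Fin 4 → ℤ) (i j : Fin 4) : ℤ := x i * y j - x j * y i

/-- The greatest common divisor of the minors. -/
def minorGcd (x y : Fin 4 → ℤ) : ℕ :=
  Finset.univ.gcd fun ij : Fin 4 × Fin 4 => (minor x y ij.1 ij.2).natAbs

/-- The Gram determinant of `x` and `y`. -/
def wedgeSq (x y : Fin 4 → ℤ) : ℤ :=
  (∑ i, x i ^ 2) * (∑ i, y i ^ 2) - (∑ i, x i * y i) ^ 2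

/-- Lagrange's identity; it makes every minor a lower bound for the area `√Δ`. -/
theorem wedgeSq_eq (x y : Fin 4 → ℤ) : wedgeSq x y = minor x y 0 1 ^ 2 + minor x y 0 2 ^ 2
    + minor x y 0 3 ^ 2 + minor x y 1 2 ^ 2 + minor x y 1 3 ^ 2 + minor x y 2 3 ^ 2 := by
  simp only [wedgeSq, minor, Fin.sum_univ_four]; ring

theorem minor_sq_le_wedgeSq (x y : Fin 4 → ℤ) (i j : Fin 4) : minor x y i j ^ 2 ≤ wedgeSq x y := by
  rw [wedgeSq_eq]
  have h := fun k l : Fin 4 => sq_nonneg (x k * y l - x l * y k)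
  fin_cases i <;> fin_cases j <;>
    simp only [minor, Fin.zero_eta, Fin.mk_one, Fin.reduceFinMk] <;>
    linarith [h 0 1, h 0 2, h 0 3, h 1 2, h 1 3, h 2 3]

theorem wedgeSq_nonneg (x y : Fin 4 → ℤ) : 0 ≤ wedgeSq x y :=
  (sq_nonneg _).trans (minor_sq_le_wedgeSq x y 0 0)

theorem abs_minor_le_sqrt (x y : Fin 4 → ℤ) (i j : Fin 4) :
    |(minor x y i j : ℝ)| ≤ Real.sqrt (wedgeSq x y) := by
  refine Real.abs_le_sqrt ?_
  exact_mod_cast minor_sq_le_wedgeSq x y i j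

theorem minorGcd_dvd (x y : Fin 4 → ℤ) (i j : Fin 4) : (minorGcd x y : ℤ) ∣ minor x y i j := by
  rw [Int.natCast_dvd]
  exact Finset.gcd_dvd (f := fun ij : Fin 4 × Fin 4 => (minor x y ij.1 ij.2).natAbs)
    (Finset.mem_univ (i, j))

theorem dvd_minorGcd {x y : Fin 4 → ℤ} {e : ℕ} (h : ∀ i j, (e : ℤ) ∣ minor x y i j) :
    e ∣ minorGcd x y :=
  Finset.dvd_gcd fun ij _ => Int.natCast_dvd.mp (h ij.1 ij.2)

/-- Linear independence of two integer vectors, as non-vanishing of a minor. -/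
def Indep (x y : Fin 4 → ℤ) : Prop := ∃ i j, minor x y i j ≠ 0

theorem Indep.minorGcd_pos {x y : Fin 4 → ℤ} (h : Indep x y) : 0 < minorGcd x y := by
  obtain ⟨i, j, hij⟩ := h
  rcases Nat.eq_zero_or_pos (minorGcd x y) with h0 | h0
  · have := minorGcd_dvd x y i j
    rw [h0] at this
    exact absurd (by simpa using this) hij
  · exact h0

theorem Indep.wedgeSq_pos {x y : Fin 4 → ℤ} (h : Indep x y) : 0 < wedgeSq x y := by
  obtain ⟨i, j, hij⟩ := h
  exact lt_of_lt_of_le (by positivity) (minor_sq_le_wedgeSq x y i j)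

theorem wedgeSq_le {x y : Fin 4 → ℤ} {B : ℝ} (hx : ∀ i, |(x i : ℝ)| ≤ B)
    (hy : ∀ i, |(y i : ℝ)| ≤ B) : Real.sqrt (wedgeSq x y) ≤ 4 * B ^ 2 := by
  have hB : 0 ≤ B := (abs_nonneg _).trans (hx 0)
  have hs : ∀ z : Fin 4 → ℤ, (∀ i, |(z i : ℝ)| ≤ B) → ∑ i, (z i : ℝ) ^ 2 ≤ 4 * B ^ 2 := by
    intro z hz
    calc ∑ i, (z i : ℝ) ^ 2 ≤ ∑ _i : Fin 4, B ^ 2 :=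
          Finset.sum_le_sum fun i _ => sq_le_sq' (by linarith [abs_le.mp (hz i)]) (abs_le.mp (hz i)).2
      _ = 4 * B ^ 2 := by simp
  refine Real.sqrt_le_iff.mpr ⟨by positivity, ?_⟩
  have h1 := hs x hx
  have h2 := hs y hy
  have h3 : 0 ≤ ∑ i, (x i : ℝ) ^ 2 := Finset.sum_nonneg fun _ _ => by positivity
  have h4 : 0 ≤ ∑ i, (y i : ℝ) ^ 2 := Finset.sum_nonneg fun _ _ => by positivity
  simp only [wedgeSq]
  push_cast
  nlinarith [mul_le_mul h1 h2 h4 (by positivity), sq_nonneg (∑ i, (x i : ℝ) * y i)]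

/-- No two of the relevant coordinates of `x` and `y` coincide. -/
def Distinct (x y : Fin 4 → ℤ) : Prop :=
  (∀ i, x i ≠ y i) ∧ (∀ i j, i ≠ j → x i ≠ x j) ∧ (∀ i j, i ≠ j → y i ≠ y j)

theorem eq_of_prime_dvd {p q : ℤ} (hp : Nat.Prime p.toNat) (hq : Nat.Prime q.toNat)
    (h : p ∣ q) : p = q := by
  have hp0 : 0 < p := by have := hp.pos; omega
  have hq0 : 0 < q := by have := hq.pos; omega
  lift p to ℕ using hp0.le
  lift q to ℕ using hq0.le
  simp only [Int.toNat_natCast] at hp hq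
  rw [Int.natCast_dvd_natCast] at h
  rw [(Nat.prime_dvd_prime_iff_eq hp hq).mp h]

theorem prime_of_toNat {p : ℤ} (hp : Nat.Prime p.toNat) : Prime p := by
  have hp0 : 0 < p := by have := hp.pos; omega
  lift p to ℕ using hp0.le
  exact Nat.prime_iff_prime_int.mp (by simpa using hp)

/-- If `x i * y j = x j * y i`, the prime `y i` divides `x i` or `y j`, hence equals one of them. -/
theorem minor_ne_zero_of_primes {x y : Fin 4 → ℤ} (hx : ∀ i, Nat.Prime (x i).toNat)
    (hy : ∀ i, Nat.Prime (y i).toNat) {i j : Fin 4} (h1 : x i ≠ y i)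
    (h2 : y i ≠ y j) : minor x y i j ≠ 0 := by
  intro h
  have hd : y i ∣ x i * y j := ⟨x j, by simp only [minor] at h; linarith⟩
  rcases (prime_of_toNat (hy i)).dvd_or_dvd hd with h | h
  · exact h1 (eq_of_prime_dvd (hy i) (hx i) h).symm
  · exact h2 (eq_of_prime_dvd (hy i) (hy j) h)

theorem prod_ite_eq_pow (i : Fin 4) (b : ℝ) :
    ∏ j : Fin 4, (if j = i then 1 else b) = b ^ 3 := by
  fin_cases i <;> simp [Fin.prod_univ_four] <;> ring

/-- The sum of `|p c - q y|^(-3/8)` over the primes `q ≤ B` in a residue class. -/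
theorem sum_linear_form_rpow_le : ∃ C : ℝ, 0 < C ∧ ∀ (B : ℝ) (e : ℕ) (p c y : ℤ), 2 ≤ B → 0 < e →
    (e : ℝ) ≤ B ^ (1 / 100 : ℝ) → 0 ≤ p → (p : ℝ) ≤ B → 0 ≤ c → c ≤ y → (y : ℝ) ≤ B → 0 < y →
    IsCoprime y (e : ℤ) →
    ∑ q ∈ (primesUpTo B).filter (fun q => (e : ℤ) ∣ p * c - q * y ∧ p * c - q * y ≠ 0),
      |((p * c - q * y : ℤ) : ℝ)| ^ (-(3 / 8 : ℝ))
      ≤ (y : ℝ) ^ (-(3 / 8 : ℝ)) *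
        (C * B ^ (5 / 8 : ℝ) * (e : ℝ) ^ (-(7 / 8 : ℝ)) / Real.log B) := by
  obtain ⟨C, hC, h⟩ := sum_dist_rpow_primes_le
  refine ⟨C, hC, fun B e p c y hB he heB hp hpB hc hcy hyB hy hco => ?_⟩
  have hy' : (0 : ℝ) < y := by exact_mod_cast hy
  have hB0 : 0 < B := by linarith
  -- The linear form is `y` times the distance from `q` to `ξ`. Since `c ≤ y`, the point `ξ` lies in
  -- `[0, B]`; since the form is a nonzero integer, the distance is at least `1 / y ≥ 1 / B`.
  set ξ : ℝ := p * c / y with hξ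
  have hform : ∀ q : ℤ, |((p * c - q * y : ℤ) : ℝ)| = y * |(q : ℝ) - ξ| := by
    intro q
    have e : ((p * c - q * y : ℤ) : ℝ) = -(y * ((q : ℝ) - ξ)) := by
      rw [hξ]; push_cast; field_simp; ring
    rw [e, abs_neg, abs_mul, abs_of_pos hy']
  set S := (primesUpTo B).filter (fun q => (e : ℤ) ∣ p * c - q * y ∧ p * c - q * y ≠ 0) with hS
  have hSp : ∀ q ∈ S, Nat.Prime q.toNat ∧ (q : ℝ) ≤ B ∧ 0 ≤ q ∧ (e : ℤ) ∣ p * c - q * y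
      ∧ p * c - q * y ≠ 0 := by
    intro q hq
    rw [hS, Finset.mem_filter, mem_primesUpTo hB0.le] at hq
    have := hq.1.1.pos
    exact ⟨hq.1.1, (le_abs_self _).trans hq.1.2, by omega, hq.2⟩
  have hinj : Set.InjOn Int.toNat (S : Set ℤ) := by
    intro a ha b hb hab
    have h1 := (hSp a ha).2.2.1
    have h2 := (hSp b hb).2.2.1
    omega
  have hcast : ∀ q ∈ S, ((q.toNat : ℕ) : ℝ) = q := by
    intro q hq
    exact_mod_cast congrArg (Int.cast (R := ℝ)) (Int.toNat_of_nonneg (hSp q hq).2.2.1)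
  have hsum : ∑ q ∈ S, |((p * c - q * y : ℤ) : ℝ)| ^ (-(3 / 8 : ℝ))
      = (y : ℝ) ^ (-(3 / 8 : ℝ)) * ∑ n ∈ S.image Int.toNat, |(n : ℝ) - ξ| ^ (-(3 / 8 : ℝ)) := by
    rw [Finset.sum_image hinj, Finset.mul_sum]
    refine Finset.sum_congr rfl fun q hq => ?_
    rw [hform, Real.mul_rpow hy'.le (abs_nonneg _), hcast q hq]
  rw [hsum]
  refine mul_le_mul_of_nonneg_left ?_ (by positivity)
  refine h B e ξ hB he heB (by
    have : (0 : ℝ) ≤ p := by exact_mod_cast hp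
    have : (0 : ℝ) ≤ c := by exact_mod_cast hc
    positivity) ?_ _ ?_ ?_
  · rw [hξ, div_le_iff₀ hy']
    have h1 : (0 : ℝ) ≤ p := by exact_mod_cast hp
    have h2 : (c : ℝ) ≤ y := by exact_mod_cast hcy
    nlinarith
  · intro n hn
    obtain ⟨q, hq, rfl⟩ := Finset.mem_image.mp hn
    have hq' := hSp q hq
    refine ⟨hq'.1, by rw [hcast q hq]; exact hq'.2.1, ?_⟩
    rw [hcast q hq]
    have h1 : (1 : ℝ) ≤ |((p * c - q * y : ℤ) : ℝ)| := by
      have := Int.one_le_abs hq'.2.2.2.2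
      exact_mod_cast this
    rw [hform] at h1
    rw [div_le_iff₀ hB0]
    nlinarith [abs_nonneg ((q : ℝ) - ξ)]
  · intro n hn n' hn'
    obtain ⟨q, hq, rfl⟩ := Finset.mem_image.mp hn
    obtain ⟨q', hq', rfl⟩ := Finset.mem_image.mp hn'
    have h1 := hSp q hq
    have h2 := hSp q' hq'
    have h3 : (e : ℤ) ∣ y * (q' - q) := by
      have := dvd_sub h1.2.2.2.1 h2.2.2.2.1
      rwa [show p * c - q * y - (p * c - q' * y) = y * (q' - q) by ring] at this
    -- As `y` is a unit modulo `e`, divisibility of the form by `e` confines `q` to one residue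
    -- class.
    have h4 : (e : ℤ) ∣ q' - q := hco.symm.dvd_of_dvd_mul_left h3
    rw [Nat.modEq_iff_dvd, Int.toNat_of_nonneg h1.2.2.1, Int.toNat_of_nonneg h2.2.2.1]
    exact h4

open scoped Classical in
/-- Pairs of prime tuples whose minors are all divisible by `e`, weighted by a negative power of
the area that they span. -/
theorem sum_pairs_dvd_le : ∃ C : ℝ, 0 < C ∧ ∀ (B : ℝ) (e : ℕ), 2 ≤ B → 0 < e →
    (e : ℝ) ≤ B ^ (1 / 100 : ℝ) →
    ∑ xy ∈ ((Fintype.piFinset fun _ : Fin 4 => primesUpTo B) ×ˢ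
        (Fintype.piFinset fun _ : Fin 4 => primesUpTo B)).filter
          (fun xy => Distinct xy.1 xy.2 ∧ e ∣ minorGcd xy.1 xy.2),
      (wedgeSq xy.1 xy.2 : ℝ) ^ (-(9 / 16 : ℝ))
      ≤ C * B ^ (23 / 4 : ℝ) * (e : ℝ) ^ (-(21 / 8 : ℝ)) / Real.log B ^ 8 := by
  obtain ⟨C₁, hC₁, hin⟩ := sum_linear_form_rpow_le
  obtain ⟨C₂, hC₂, hmax⟩ := sum_max_rpow_le
  obtain ⟨C₃, hC₃, hpi⟩ := primeCounting_le_sqrt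
  refine ⟨4 * (C₁ ^ 3 * C₂ * C₃), by positivity, fun B e hB he heB => ?_⟩
  have hB0 : 0 < B := by linarith
  have hlB : 0 < Real.log B := Real.log_pos (by linarith)
  have he0 : (0 : ℝ) < e := by exact_mod_cast he
  set X := Fintype.piFinset fun _ : Fin 4 => primesUpTo B with hX
  have hXm : ∀ x ∈ X, ∀ i, Nat.Prime (x i).toNat ∧ (x i : ℝ) ≤ B ∧ 0 < x i := by
    intro x hx i
    have h := (mem_primesUpTo hB0.le).mp (Fintype.mem_piFinset.mp hx i)
    have := h.1.pos
    exact ⟨h.1, (le_abs_self _).trans h.2, by omega⟩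
  set I := C₁ * B ^ (5 / 8 : ℝ) * (e : ℝ) ^ (-(7 / 8 : ℝ)) / Real.log B with hI
  -- Here `y`, with largest coordinate `y i`, is fixed. Once `x i = p` is fixed as well, the three
  -- minors `p * y j - x j * y i` depend on one unknown each, and the sum over `x` factors.
  have hfix : ∀ i : Fin 4, ∀ y ∈ X, (∀ j, y j ≤ y i) →
      ∑ x ∈ X.filter (fun x => Distinct x y ∧ e ∣ minorGcd x y),
        (wedgeSq x y : ℝ) ^ (-(9 / 16 : ℝ))
      ≤ (C₃ * B / Real.log B * I ^ 3) * (y i : ℝ) ^ (-(9 / 8 : ℝ)) := by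
    intro i y hy hyi
    have hmaps : ∀ x ∈ X.filter (fun x => Distinct x y ∧ e ∣ minorGcd x y), x i ∈ primesUpTo B :=
      fun x hx => Fintype.mem_piFinset.mp (Finset.mem_filter.mp hx).1 i
    have hyi0 : (0 : ℝ) < y i := by exact_mod_cast (hXm y hy i).2.2
    rw [← Finset.sum_fiberwise_of_maps_to hmaps]
    have hp : ∀ p ∈ primesUpTo B, ∑ x ∈ (X.filter (fun x => Distinct x y ∧ e ∣ minorGcd x y)).filter
        (fun x => x i = p), (wedgeSq x y : ℝ) ^ (-(9 / 16 : ℝ))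
        ≤ ((y i : ℝ) ^ (-(3 / 8 : ℝ)) * I) ^ 3 := by
      intro p hp
      set R := (X.filter (fun x => Distinct x y ∧ e ∣ minorGcd x y)).filter (fun x => x i = p)
        with hR
      rcases R.eq_empty_or_nonempty with h0 | ⟨x₀, hx₀⟩
      · rw [h0, Finset.sum_empty]; positivity
      have hRm : ∀ x ∈ R, x ∈ X ∧ Distinct x y ∧ e ∣ minorGcd x y ∧ x i = p := by
        intro x hx
        rw [hR, Finset.mem_filter, Finset.mem_filter] at hx
        exact ⟨hx.1.1, hx.1.2.1, hx.1.2.2, hx.2⟩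
      have hdvd : ∀ x ∈ R, ∀ j, (e : ℤ) ∣ p * y j - x j * y i := by
        intro x hx j
        have h1 : (e : ℤ) ∣ minor x y i j :=
          (Int.natCast_dvd_natCast.mpr (hRm x hx).2.2.1).trans (minorGcd_dvd x y i j)
        rwa [minor, (hRm x hx).2.2.2] at h1
      have hne : ∀ x ∈ R, ∀ j, j ≠ i → p * y j - x j * y i ≠ 0 := by
        intro x hx j hj
        have h1 := hRm x hx
        have h2 := minor_ne_zero_of_primes (fun k => (hXm x h1.1 k).1) (fun k => (hXm y hy k).1)
          (h1.2.1.1 i) (h1.2.1.2.2 i j hj.symm)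
        rwa [minor, h1.2.2.2] at h2
      -- Otherwise the prime `y i` divides `e`, hence `p * y j` for some `j ≠ i`, and so equals `x
      -- i` or `y j`, contrary to distinctness.
      have hco : IsCoprime (y i) (e : ℤ) := by
        rw [(prime_of_toNat (hXm y hy i).1).irreducible.coprime_iff_not_dvd]
        intro hye
        obtain ⟨j, hj⟩ : ∃ j : Fin 4, j ≠ i := exists_ne i
        have h1 := hRm x₀ hx₀
        have h2 := hye.trans (hdvd x₀ hx₀ j)
        have h3 : y i ∣ p * y j := by
          have := dvd_add h2 (Dvd.intro_left (x₀ j) rfl : y i ∣ x₀ j * y i)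
          rwa [sub_add_cancel] at this
        rcases (prime_of_toNat (hXm y hy i).1).dvd_or_dvd h3 with h4 | h4
        · rw [← h1.2.2.2] at h4
          exact h1.2.1.1 i (eq_of_prime_dvd (hXm y hy i).1 (hXm x₀ h1.1 i).1 h4).symm
        · exact h1.2.1.2.2 i j hj.symm (eq_of_prime_dvd (hXm y hy i).1 (hXm y hy j).1 h4)
      have hpp := (mem_primesUpTo hB0.le).mp hp
      set F : Fin 4 → Finset ℤ := fun j => if j = i then {p} else
        (primesUpTo B).filter (fun q => (e : ℤ) ∣ p * y j - q * y i ∧ p * y j - q * y i ≠ 0) with hF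
      set f : Fin 4 → ℤ → ℝ := fun j q => if j = i then 1 else
        |((p * y j - q * y i : ℤ) : ℝ)| ^ (-(3 / 8 : ℝ)) with hf
      have hf0 : ∀ j q, 0 ≤ f j q := by
        intro j q
        simp only [hf]
        split_ifs <;> positivity
      calc ∑ x ∈ R, (wedgeSq x y : ℝ) ^ (-(9 / 16 : ℝ)) ≤ ∑ x ∈ R, ∏ j, f j (x j) := by
            refine Finset.sum_le_sum fun x hx => ?_
            have hΔ : (0 : ℝ) < wedgeSq x y := by
              obtain ⟨j, hj⟩ : ∃ j : Fin 4, j ≠ i := exists_ne i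
              have : Indep x y := ⟨i, j, by
                have := hne x hx j hj
                rwa [minor, (hRm x hx).2.2.2]⟩
              exact_mod_cast this.wedgeSq_pos
            -- The exponent is shared equally among the three minors: `9/16 = 3 * (3/16)`, and `Δ ^
            -- (-3/16)` is at most the power `-3/8` of the absolute value of each minor.
            have e1 : (wedgeSq x y : ℝ) ^ (-(9 / 16 : ℝ))
                = ∏ j : Fin 4, (if j = i then 1 else (wedgeSq x y : ℝ) ^ (-(3 / 16 : ℝ))) := by
              rw [prod_ite_eq_pow, ← Real.rpow_natCast, ← Real.rpow_mul hΔ.le]; norm_num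
            rw [e1]
            refine Finset.prod_le_prod (fun j _ => by split_ifs <;> positivity) fun j _ => ?_
            simp only [hf]
            split_ifs with hj
            · exact le_rfl
            · have h1 : (0 : ℝ) < |((p * y j - x j * y i : ℤ) : ℝ)| := by
                rw [abs_pos]; exact_mod_cast hne x hx j hj
              have h2 : |((p * y j - x j * y i : ℤ) : ℝ)| ^ 2 ≤ wedgeSq x y := by
                rw [sq_abs]
                have := minor_sq_le_wedgeSq x y i j
                rw [minor, (hRm x hx).2.2.2] at this
                exact_mod_cast this
              calc (wedgeSq x y : ℝ) ^ (-(3 / 16 : ℝ))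
                  ≤ (|((p * y j - x j * y i : ℤ) : ℝ)| ^ 2) ^ (-(3 / 16 : ℝ)) :=
                    Real.rpow_le_rpow_of_nonpos (by positivity) h2 (by norm_num)
                _ = _ := by
                    rw [← Real.rpow_natCast, ← Real.rpow_mul h1.le]; norm_num
        _ ≤ ∑ x ∈ Fintype.piFinset F, ∏ j, f j (x j) := by
            refine Finset.sum_le_sum_of_subset_of_nonneg (fun x hx => ?_)
              fun x _ _ => Finset.prod_nonneg fun j _ => hf0 j _
            rw [Fintype.mem_piFinset]
            intro j
            simp only [hF]
            split_ifs with hj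
            · rw [hj, Finset.mem_singleton]; exact (hRm x hx).2.2.2
            · rw [Finset.mem_filter]
              exact ⟨Fintype.mem_piFinset.mp (hRm x hx).1 j, hdvd x hx j, hne x hx j hj⟩
        _ = ∏ j, ∑ q ∈ F j, f j q := (Finset.prod_univ_sum F f).symm
        _ ≤ ∏ j, (if j = i then 1 else (y i : ℝ) ^ (-(3 / 8 : ℝ)) * I) := by
            refine Finset.prod_le_prod (fun j _ => Finset.sum_nonneg fun q _ => hf0 j q) fun j _ => ?_
            simp only [hF, hf]
            split_ifs with hj
            · simp
            · have hp0 : 0 ≤ p := by have := hpp.1.pos; omega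
              exact hin B e p (y j) (y i) hB he heB hp0 ((le_abs_self _).trans hpp.2)
                (hXm y hy j).2.2.le (hyi j) (hXm y hy i).2.1 (hXm y hy i).2.2 hco
        _ = _ := prod_ite_eq_pow i _
    refine (Finset.sum_le_sum hp).trans ?_
    rw [Finset.sum_const, nsmul_eq_mul, card_primesUpTo]
    have h1 := hpi B B hB le_rfl
    rw [Real.sqrt_mul_self hB0.le] at h1
    have hI0 : 0 ≤ I := by positivity
    calc _ ≤ C₃ * B / Real.log B * ((y i : ℝ) ^ (-(3 / 8 : ℝ)) * I) ^ 3 := by gcongr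
      _ = _ := by
        rw [mul_pow, ← Real.rpow_natCast ((y i : ℝ) ^ (-(3 / 8 : ℝ))), ← Real.rpow_mul hyi0.le]
        norm_num
        ring
  have hI0 : 0 ≤ I := by positivity
  have hK0 : 0 ≤ C₃ * B / Real.log B * I ^ 3 := by positivity
  rw [Finset.sum_filter, Finset.sum_product_right]
  calc _ ≤ ∑ y ∈ X, ∑ i : Fin 4, (if ∀ j, y j ≤ y i then
          (C₃ * B / Real.log B * I ^ 3) * (y i : ℝ) ^ (-(9 / 8 : ℝ)) else 0) := by
        refine Finset.sum_le_sum fun y hy => ?_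
        obtain ⟨i, -, hi⟩ := Finset.exists_max_image Finset.univ y Finset.univ_nonempty
        have hpos : ∀ k : Fin 4, (0 : ℝ) < y k := fun k => by exact_mod_cast (hXm y hy k).2.2
        refine le_trans ?_ (Finset.single_le_sum (f := fun i => if ∀ j, y j ≤ y i then
          (C₃ * B / Real.log B * I ^ 3) * (y i : ℝ) ^ (-(9 / 8 : ℝ)) else 0) (fun k _ => ?_)
          (Finset.mem_univ i))
        · simp only
          rw [if_pos (fun j => hi j (Finset.mem_univ j)), ← Finset.sum_filter]
          exact hfix i y hy fun j => hi j (Finset.mem_univ j)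
        · have := hpos k
          split_ifs <;> positivity
    _ = ∑ i : Fin 4, (C₃ * B / Real.log B * I ^ 3) *
          ∑ y ∈ X.filter (fun y => ∀ j, y j ≤ y i), (y i : ℝ) ^ (-(9 / 8 : ℝ)) := by
        rw [Finset.sum_comm]
        refine Finset.sum_congr rfl fun i _ => ?_
        rw [Finset.mul_sum, Finset.sum_filter]
    _ ≤ ∑ i : Fin 4, (C₃ * B / Real.log B * I ^ 3) * (C₂ * B ^ (4 - 9 / 8 : ℝ) / Real.log B ^ 4) := by
        gcongr with i
        exact hmax B (9 / 8) hB (by norm_num) (by norm_num) i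
    _ = _ := by
        rw [Finset.sum_const, Finset.card_univ, Fintype.card_fin, nsmul_eq_mul, hI]
        have e1 : ((e : ℝ) ^ (-(7 / 8 : ℝ))) ^ 3 = (e : ℝ) ^ (-(21 / 8 : ℝ)) := by
          rw [← Real.rpow_natCast, ← Real.rpow_mul he0.le]; norm_num
        have e2 : B ^ (23 / 4 : ℝ) = B * (B ^ (5 / 8 : ℝ)) ^ 3 * B ^ (4 - 9 / 8 : ℝ) := by
          rw [← Real.rpow_natCast, ← Real.rpow_mul hB0.le, ← Real.rpow_one_add' hB0.le (by norm_num),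
            ← Real.rpow_add hB0]
          norm_num
        rw [div_pow, mul_pow, mul_pow, e1, e2]
        push_cast
        field_simp



/-! ### Pairs whose orthogonal lattice has small covolume -/

theorem sum_le_sum_of_injOn {α β : Type*} {s : Finset α} {t : Finset β} (k : α → β)
    (hk : Set.InjOn k s) (hm : ∀ a ∈ s, k a ∈ t) {f : α → ℝ} {g : β → ℝ} (hg : ∀ b ∈ t, 0 ≤ g b)
    (hfg : ∀ a ∈ s, f a ≤ g (k a)) : ∑ a ∈ s, f a ≤ ∑ b ∈ t, g b := by
  classical
  calc ∑ a ∈ s, f a ≤ ∑ a ∈ s, g (k a) := Finset.sum_le_sum hfg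
    _ = ∑ b ∈ s.image k, g b := (Finset.sum_image hk).symm
    _ ≤ ∑ b ∈ t, g b := Finset.sum_le_sum_of_subset_of_nonneg
        (Finset.image_subset_iff.mpr hm) fun b hb _ => hg b hb

theorem sum_union_le_add {α : Type*} [DecidableEq α] {s t : Finset α} {f : α → ℝ}
    (hf : ∀ a, 0 ≤ f a) : ∑ a ∈ s ∪ t, f a ≤ ∑ a ∈ s, f a + ∑ a ∈ t, f a := by
  rw [← Finset.sum_union_inter]
  linarith [Finset.sum_nonneg fun a (_ : a ∈ s ∩ t) => hf a]

theorem sum_range_rpow_le (N : ℕ) :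
    ∑ n ∈ Finset.range N, ((n : ℝ) + 1) ^ (-(2 / 3 : ℝ)) ≤ 3 * (N : ℝ) ^ (1 / 3 : ℝ) := by
  induction N with
  | zero => simp
  | succ n ih =>
    rw [Finset.sum_range_succ]
    have hn : (0 : ℝ) ≤ n := n.cast_nonneg
    set a := ((n : ℝ) + 1) ^ (1 / 3 : ℝ) with ha
    set b := (n : ℝ) ^ (1 / 3 : ℝ) with hb
    have ha3 : a ^ 3 = n + 1 := by
      rw [ha, ← Real.rpow_natCast, ← Real.rpow_mul (by positivity)]; norm_num
    have hb3 : b ^ 3 = n := by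
      rw [hb, ← Real.rpow_natCast, ← Real.rpow_mul hn]; norm_num
    have ha0 : 0 < a := by positivity
    have hb0 : 0 ≤ b := by positivity
    have hba : b ≤ a := Real.rpow_le_rpow hn (by linarith) (by norm_num)
    have e : ((n : ℝ) + 1) ^ (-(2 / 3 : ℝ)) = 1 / a ^ 2 := by
      rw [ha, ← Real.rpow_natCast, ← Real.rpow_mul (by positivity), one_div,
        ← Real.rpow_neg (by positivity)]
      norm_num
    -- Telescoping with cube roots: `1 = a³ - b³ = (a - b)(a² + a b + b²) ≤ 3 a² (a - b)`.
    have h : 1 / a ^ 2 ≤ 3 * (a - b) := by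
      rw [div_le_iff₀ (by positivity)]
      have : a ^ 3 - b ^ 3 = 1 := by rw [ha3, hb3]; ring
      nlinarith [mul_nonneg (sub_nonneg.mpr hba) (sub_nonneg.mpr hba), mul_nonneg ha0.le hb0,
        mul_nonneg (sub_nonneg.mpr hba) hb0, mul_nonneg (mul_nonneg (sub_nonneg.mpr hba) ha0.le) (sub_nonneg.mpr hba), mul_nonneg (mul_nonneg (sub_nonneg.mpr hba) hb0) (sub_nonneg.mpr hba)]
    rw [e]
    push_cast
    linarith

theorem sum_Icc_max_rpow_le (N : ℕ) (hN : 1 ≤ N) :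
    ∑ n ∈ Finset.Icc (-(N : ℤ)) N, (max 1 |(n : ℝ)|) ^ (-(2 / 3 : ℝ)) ≤ 7 * (N : ℝ) ^ (1 / 3 : ℝ) := by
  have hsub : Finset.Icc (-(N : ℤ)) N ⊆ {0} ∪ ((Finset.range N).image (fun n : ℕ => (n : ℤ) + 1)
      ∪ (Finset.range N).image (fun n : ℕ => -((n : ℤ) + 1))) := by
    intro z hz
    rw [Finset.mem_Icc] at hz
    simp only [Finset.mem_union, Finset.mem_singleton, Finset.mem_image, Finset.mem_range]
    rcases lt_trichotomy z 0 with h | h | h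
    · exact Or.inr (Or.inr ⟨(-z).toNat - 1, by omega, by omega⟩)
    · exact Or.inl h
    · exact Or.inr (Or.inl ⟨z.toNat - 1, by omega, by omega⟩)
  have hnn : ∀ z : ℤ, 0 ≤ (max 1 |(z : ℝ)|) ^ (-(2 / 3 : ℝ)) := fun z => by positivity
  have h1 : ∀ s : ℤ → ℤ, Function.Injective (fun n : ℕ => s n) →
      (∀ n : ℕ, |((s n : ℤ) : ℝ)| = n + 1) →
      ∑ z ∈ (Finset.range N).image (fun n : ℕ => s n), (max 1 |(z : ℝ)|) ^ (-(2 / 3 : ℝ))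
        ≤ 3 * (N : ℝ) ^ (1 / 3 : ℝ) := by
    intro s hs ha
    rw [Finset.sum_image hs.injOn]
    refine le_trans (le_of_eq (Finset.sum_congr rfl fun n _ => ?_)) (sum_range_rpow_le N)
    rw [ha, max_eq_right]
    linarith [n.cast_nonneg (α := ℝ)]
  have hp := h1 (fun z => z + 1) (fun a b h => by simpa using h) (fun n => by
    push_cast; exact abs_of_nonneg (by positivity))
  have hm := h1 (fun z => -(z + 1)) (fun a b h => by simpa using h) (fun n => by
    push_cast; rw [abs_neg]; exact abs_of_nonneg (by positivity))
  have hN1 : 1 ≤ (N : ℝ) ^ (1 / 3 : ℝ) :=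
    Real.one_le_rpow (by exact_mod_cast hN) (by norm_num)
  calc _ ≤ _ := Finset.sum_le_sum_of_subset_of_nonneg hsub fun z _ _ => hnn z
    _ ≤ 1 + (3 * (N : ℝ) ^ (1 / 3 : ℝ) + 3 * (N : ℝ) ^ (1 / 3 : ℝ)) := by
      refine (sum_union_le_add hnn).trans (add_le_add ?_ ?_)
      · simp
      · exact (sum_union_le_add hnn).trans (add_le_add hp hm)
    _ ≤ _ := by linarith

set_option maxHeartbeats 1000000 in
open scoped Classical in
/-- Pairs of prime tuples for which the orthogonal lattice has small covolume contribute little. -/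
theorem sum_pairs_small_covolume_le : ∃ C : ℝ, 0 < C ∧ ∀ (B D : ℝ), 2 ≤ B → 1 ≤ D →
    ∑ xy ∈ ((Fintype.piFinset fun _ : Fin 4 => primesUpTo B) ×ˢ
        (Fintype.piFinset fun _ : Fin 4 => primesUpTo B)).filter
          (fun xy => Indep xy.1 xy.2 ∧ Real.sqrt (wedgeSq xy.1 xy.2) ≤ D * minorGcd xy.1 xy.2),
      (minorGcd xy.1 xy.2 : ℝ) / Real.sqrt (wedgeSq xy.1 xy.2) ≤ C * B ^ 4 * D := by
  refine ⟨4 * (4 * 81 * 7 ^ 4), by norm_num, fun B D hB hD => ?_⟩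
  have hB0 : 0 < B := by linarith
  set X := Fintype.piFinset fun _ : Fin 4 => primesUpTo B with hX
  have hXm : ∀ x ∈ X, ∀ i, Nat.Prime (x i).toNat ∧ |(x i : ℝ)| ≤ B ∧ 0 < x i := by
    intro x hx i
    have h := (mem_primesUpTo hB0.le).mp (Fintype.mem_piFinset.mp hx i)
    have := h.1.pos
    exact ⟨h.1, h.2, by omega⟩
  set P := (X ×ˢ X).filter
    (fun xy => Indep xy.1 xy.2 ∧ Real.sqrt (wedgeSq xy.1 xy.2) ≤ D * minorGcd xy.1 xy.2) with hP
  set N := ⌊D⌋₊ with hN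
  have hN1 : 1 ≤ N := Nat.le_floor (by simpa using hD)
  -- A product majorant for the weight: if `d = √Δ / G ≥ 1` bounds the entries of `w` and `w i = 0`,
  -- then `φ w ≥ 1 / d`. Being a product, it can be summed over `w` coordinate by coordinate.
  set φ : (Fin 4 → ℤ) → ℝ := fun w => ∏ j, (max 1 |(w j : ℝ)|) ^ (-(1 / 3 : ℝ)) with hφ
  have hφ0 : ∀ w, 0 < φ w := fun w => Finset.prod_pos fun j _ => by positivity
  set Wt : (Fin 4 → ℤ) × (Fin 4 → ℤ) → ℝ := fun xy =>
    (minorGcd xy.1 xy.2 : ℝ) / Real.sqrt (wedgeSq xy.1 xy.2) with hWt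
  have hone : ∀ i : Fin 4, ∑ xy ∈ P.filter (fun xy => ∀ j, |xy.2 j - xy.1 j| ≤ |xy.2 i - xy.1 i|),
      Wt xy ≤ 4 * 81 * 7 ^ 4 * B ^ 4 * D := by
    intro i
    set Pi := P.filter (fun xy => ∀ j, |xy.2 j - xy.1 j| ≤ |xy.2 i - xy.1 i|) with hPi
    -- With `u = y - x` and `i` the index of its largest entry in absolute value, a pair is encoded
    -- by `x i`, `y i`, the quotients of the `u j` by `|u i|` (only `-1`, `0`, `1` occur), the
    -- reduced minors and `G`.
    set key : (Fin 4 → ℤ) × (Fin 4 → ℤ) → (ℤ × ℤ) × (Fin 4 → ℤ) × (Fin 4 → ℤ) × ℕ := fun xy =>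
      ((xy.1 i, xy.2 i), (fun j => (xy.2 j - xy.1 j) / |xy.2 i - xy.1 i|),
        (fun j => minor xy.1 xy.2 i j / minorGcd xy.1 xy.2), minorGcd xy.1 xy.2) with hkey
    have hmem : ∀ xy ∈ Pi, xy.1 ∈ X ∧ xy.2 ∈ X ∧ Indep xy.1 xy.2 ∧
        Real.sqrt (wedgeSq xy.1 xy.2) ≤ D * minorGcd xy.1 xy.2 ∧
        ∀ j, |xy.2 j - xy.1 j| ≤ |xy.2 i - xy.1 i| := by
      intro xy h
      rw [hPi, Finset.mem_filter, hP, Finset.mem_filter, Finset.mem_product] at h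
      exact ⟨h.1.1.1, h.1.1.2, h.1.2.1, h.1.2.2, h.2⟩
    have hU : ∀ xy ∈ Pi, xy.2 i - xy.1 i ≠ 0 := by
      intro xy h h0
      obtain ⟨-, -, ⟨k, l, hkl⟩, -, h5⟩ := hmem xy h
      have : ∀ j, xy.2 j = xy.1 j := by
        intro j
        have := h5 j
        rw [h0, abs_zero] at this
        have := abs_eq_zero.mp (le_antisymm this (abs_nonneg _))
        omega
      apply hkl
      rw [minor, this, this]; ring
    have hinj : Set.InjOn key (Pi : Set ((Fin 4 → ℤ) × (Fin 4 → ℤ))) := by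
      rintro ⟨x, y⟩ h ⟨x', y'⟩ h' hk
      simp only [hkey, Prod.mk.injEq] at hk
      obtain ⟨⟨k1, k2⟩, k3, k4, k5⟩ := hk
      have m1 := hmem _ h
      have m2 := hmem _ h'
      have hU1 : y i - x i ≠ 0 := hU _ h
      -- The only use of primality: `x i` and `y i` are different primes. As `minor x y i j = x i *
      -- u j - x j * u i`, the minor determines `u j` modulo `u i`; the quotient then fixes `u j`,
      -- and the minor fixes `x j`.
      have hcop : IsCoprime (y i - x i) (x i) := by
        have hnd : ¬ x i ∣ y i - x i := by
          intro hd
          have : x i ∣ y i := by simpa using dvd_add hd (dvd_refl (x i))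
          have := eq_of_prime_dvd (hXm x m1.1 i).1 (hXm y m1.2.1 i).1 this
          omega
        exact (((prime_of_toNat (hXm x m1.1 i).1).irreducible.coprime_iff_not_dvd).mpr hnd).symm
      have hall : ∀ j, x j = x' j ∧ y j = y' j := by
        intro j
        have e3 := congrFun k3 j
        have e4 := congrFun k4 j
        rw [← k1, ← k2] at e3
        have hm : minor x y i j = minor x' y' i j := by
          rw [← Int.ediv_mul_cancel (minorGcd_dvd x y i j),
            ← Int.ediv_mul_cancel (minorGcd_dvd x' y' i j), e4, k5]
        simp only [minor] at hm
        rw [← k1, ← k2] at hm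
        have hd : y i - x i ∣ x i * ((y j - x j) - (y' j - x' j)) :=
          ⟨x j - x' j, by linarith⟩
        have hd2 : |y i - x i| ∣ (y j - x j) - (y' j - x' j) := by
          rw [abs_dvd]; exact hcop.dvd_of_dvd_mul_left hd
        have hu : y j - x j = y' j - x' j := by
          have q1 := Int.emod_add_mul_ediv (y j - x j) |y i - x i|
          have q2 := Int.emod_add_mul_ediv (y' j - x' j) |y i - x i|
          have q4 : (y j - x j) % |y i - x i| = (y' j - x' j) % |y i - x i| :=
            Int.emod_eq_emod_iff_emod_sub_eq_zero.mpr (Int.emod_eq_zero_of_dvd hd2)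
          rw [e3] at q1
          linarith
        have hx : (y i - x i) * (x j - x' j) = 0 := by
          have e : y j = y' j - x' j + x j := by linarith
          rw [e] at hm
          linarith
        rcases mul_eq_zero.mp hx with h0 | h0
        · exact absurd h0 hU1
        · constructor <;> omega
      ext j
      · exact (hall j).1
      · exact (hall j).2
    -- The reduced minors are at most `d = √Δ / G`, the weight is `1 / d`, and `G = √Δ / d` is at
    -- most `4 B² φ`.
    have hd : ∀ xy ∈ Pi, Wt xy ≤ φ (key xy).2.2.1 ∧ (minorGcd xy.1 xy.2 : ℝ) ≤
        4 * B ^ 2 * φ (key xy).2.2.1 ∧ ∀ j, |(key xy).2.2.1 j| ≤ N := by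
      rintro ⟨x, y⟩ h
      obtain ⟨m1, m2, m3, m4, m5⟩ := hmem _ h
      simp only at m1 m2 m3 m4 m5
      have hG : (0 : ℝ) < minorGcd x y := by exact_mod_cast m3.minorGcd_pos
      have hΔ : 0 < Real.sqrt (wedgeSq x y) := Real.sqrt_pos.mpr (by exact_mod_cast m3.wedgeSq_pos)
      set d := Real.sqrt (wedgeSq x y) / minorGcd x y with hdd
      have hd0 : 0 < d := by positivity
      have hw : ∀ j, |((minor x y i j / minorGcd x y : ℤ) : ℝ)| ≤ d := by
        intro j
        rw [Int.cast_div (minorGcd_dvd x y i j) (by exact_mod_cast hG.ne'), Int.cast_natCast, abs_div,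
          abs_of_pos hG, hdd]
        gcongr
        exact abs_minor_le_sqrt x y i j
      have hd1 : 1 ≤ d := by
        obtain ⟨k, l, hkl⟩ := m3
        rw [hdd, le_div_iff₀ hG, one_mul]
        refine le_trans ?_ (abs_minor_le_sqrt x y k l)
        have := Int.le_of_dvd (abs_pos.mpr hkl) ((dvd_abs _ _).mpr (minorGcd_dvd x y k l))
        exact_mod_cast this
      have hW : Wt (x, y) = 1 / d := by rw [hdd, one_div_div]
      have hφd : 1 / d ≤ φ (key (x, y)).2.2.1 := by
        calc 1 / d = (d ^ (-(1 / 3 : ℝ))) ^ 3 := by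
              rw [← Real.rpow_natCast, ← Real.rpow_mul hd0.le]
              norm_num [Real.rpow_neg hd0.le]
          _ = ∏ j : Fin 4, (if j = i then 1 else d ^ (-(1 / 3 : ℝ))) := (prod_ite_eq_pow _ _).symm
          _ ≤ _ := by
            refine Finset.prod_le_prod (fun j _ => by split_ifs <;> positivity) fun j _ => ?_
            split_ifs with hj
            · simp [hkey, hj, minor]
            · exact Real.rpow_le_rpow_of_nonpos (by positivity) (max_le hd1 (hw j)) (by norm_num)
      refine ⟨by rw [hW]; exact hφd, ?_, ?_⟩
      · have h4 := wedgeSq_le (fun j => (hXm x m1 j).2.1) (fun j => (hXm y m2 j).2.1)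
        calc (minorGcd x y : ℝ) = Real.sqrt (wedgeSq x y) * (1 / d) := by rw [hdd]; field_simp
          _ ≤ 4 * B ^ 2 * φ (key (x, y)).2.2.1 := by gcongr
      · intro j
        have h1 : |((minor x y i j / minorGcd x y : ℤ) : ℝ)| ≤ D := by
          refine (hw j).trans ?_
          rw [hdd, div_le_iff₀ hG]; exact m4
        have h2 : ((|minor x y i j / minorGcd x y|.toNat : ℕ) : ℝ) ≤ D := by
          refine le_trans (le_of_eq ?_) h1
          rw [← Int.cast_abs]
          exact_mod_cast congrArg (Int.cast (R := ℝ)) (Int.toNat_of_nonneg (abs_nonneg _))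
        have h3 := Nat.le_floor h2
        have h4 := Int.toNat_of_nonneg (abs_nonneg (minor x y i j / (minorGcd x y : ℤ)))
        simp only [hkey]
        omega
    set M := ⌊B⌋₊ with hM
    set Wb := Fintype.piFinset fun j : Fin 4 => if j = i then {(0 : ℤ)} else Finset.Icc (-(N : ℤ)) N with hWb
    set Gr := fun w : Fin 4 → ℤ => Finset.Icc 1 ⌊4 * B ^ 2 * φ w⌋₊ with hGr
    set Ks := ((Finset.Icc (1 : ℤ) M ×ˢ Finset.Icc (1 : ℤ) M) ×ˢ
      (Fintype.piFinset fun _ : Fin 4 => Finset.Icc (-1 : ℤ) 1)) with hKs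
    have hMB : (M : ℝ) ≤ B := Nat.floor_le hB0.le
    have hIcc : ∀ x ∈ X, ∀ j, x j ∈ Finset.Icc (1 : ℤ) M := by
      intro x hx j
      have h := hXm x hx j
      rw [Finset.mem_Icc]
      refine ⟨by omega, ?_⟩
      have : (((x j).toNat : ℕ) : ℝ) ≤ B := by
        have e : (((x j).toNat : ℕ) : ℝ) = x j := by
          exact_mod_cast congrArg (Int.cast (R := ℝ)) (Int.toNat_of_nonneg h.2.2.le)
        rw [e]; exact (le_abs_self _).trans h.2.1
      have := Nat.le_floor this
      omega
    have hsubset : ∀ xy ∈ Pi, (((key xy).1, (key xy).2.1) ∈ Ks) ∧ (key xy).2.2.1 ∈ Wb ∧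
        (key xy).2.2.2 ∈ Gr (key xy).2.2.1 := by
      rintro ⟨x, y⟩ h
      obtain ⟨m1, m2, m3, m4, m5⟩ := hmem _ h
      obtain ⟨-, d2, d3⟩ := hd _ h
      have hU1 := hU _ h
      simp only at m1 m2 m3 m4 m5 hU1
      refine ⟨?_, ?_, ?_⟩
      · rw [hKs, Finset.mem_product, Finset.mem_product, Fintype.mem_piFinset]
        refine ⟨⟨hIcc x m1 i, hIcc y m2 i⟩, fun j => ?_⟩
        have hpos : 0 < |y i - x i| := abs_pos.mpr hU1
        have := abs_le.mp (m5 j)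
        simp only [hkey, Finset.mem_Icc]
        constructor
        · rw [Int.le_ediv_iff_mul_le hpos]; linarith
        · have := Int.ediv_le_ediv hpos this.2
          rwa [Int.ediv_self hpos.ne'] at this
      · rw [hWb, Fintype.mem_piFinset]
        intro j
        split_ifs with hj
        · simp [hkey, hj, minor]
        · rw [Finset.mem_Icc]
          exact abs_le.mp (d3 j)
      · rw [hGr, Finset.mem_Icc]
        exact ⟨m3.minorGcd_pos, Nat.le_floor d2⟩
    calc ∑ xy ∈ Pi, Wt xy ≤ ∑ xy ∈ Pi, φ (key xy).2.2.1 :=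
          Finset.sum_le_sum fun xy h => (hd xy h).1
      _ ≤ ∑ k ∈ (Ks.sigma fun _ => Wb.sigma Gr), φ k.2.1 := by
          refine sum_le_sum_of_injOn
            (fun xy => ⟨((key xy).1, (key xy).2.1), ⟨(key xy).2.2.1, (key xy).2.2.2⟩⟩) ?_ ?_ ?_ ?_
          · intro a ha b hb h
            simp only [Sigma.mk.injEq, Prod.mk.injEq, heq_eq_eq] at h
            refine hinj ha hb ?_
            exact Prod.ext h.1.1 (Prod.ext h.1.2 (Prod.ext h.2.1 h.2.2))
          · intro xy hxy
            simp only [Finset.mem_sigma]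
            exact hsubset xy hxy
          · exact fun _ _ => (hφ0 _).le
          · exact fun _ _ => le_rfl
      _ = ∑ a ∈ Ks, ∑ w ∈ Wb, ∑ _g ∈ Gr w, φ w := by
            rw [Finset.sum_sigma]
            refine Finset.sum_congr rfl fun a _ => ?_
            rw [Finset.sum_sigma]
      _ ≤ ∑ a ∈ Ks, 4 * B ^ 2 * (7 ^ 4 * D) := by
          -- For given reduced minors `w` there are at most `4 B² φ w` values of `G`, each of weight
          -- `φ w`. The sum of `φ²` is a product of three sums of `n ^ (-2/3)` up to `D`, hence of
          -- order `D`.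
          refine Finset.sum_le_sum fun a _ => ?_
          calc ∑ w ∈ Wb, ∑ _g ∈ Gr w, φ w ≤ ∑ w ∈ Wb, 4 * B ^ 2 * ∏ j, (max 1 |(w j : ℝ)|) ^ (-(2 / 3 : ℝ)) := by
                refine Finset.sum_le_sum fun w _ => ?_
                rw [Finset.sum_const, nsmul_eq_mul, hGr, Nat.card_Icc, Nat.add_sub_cancel]
                have h1 : (⌊4 * B ^ 2 * φ w⌋₊ : ℝ) ≤ 4 * B ^ 2 * φ w :=
                  Nat.floor_le (by have := hφ0 w; positivity)
                have h2 : φ w * φ w = ∏ j, (max 1 |(w j : ℝ)|) ^ (-(2 / 3 : ℝ)) := by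
                  rw [hφ, ← Finset.prod_mul_distrib]
                  refine Finset.prod_congr rfl fun j _ => ?_
                  rw [← Real.rpow_add (by positivity)]; norm_num
                rw [← h2]
                have := hφ0 w
                nlinarith
            _ = 4 * B ^ 2 * ∏ j : Fin 4, ∑ n ∈ (if j = i then {(0 : ℤ)} else Finset.Icc (-(N : ℤ)) N),
                  (max 1 |(n : ℝ)|) ^ (-(2 / 3 : ℝ)) := by
                rw [← Finset.mul_sum, Finset.prod_univ_sum]
            _ ≤ 4 * B ^ 2 * ∏ j : Fin 4, (if j = i then 1 else 7 * (N : ℝ) ^ (1 / 3 : ℝ)) := by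
                refine mul_le_mul_of_nonneg_left ?_ (by positivity)
                refine Finset.prod_le_prod (fun j _ => Finset.sum_nonneg fun n _ => by positivity) fun j _ => ?_
                split_ifs with hj
                · simp
                · exact sum_Icc_max_rpow_le N hN1
            _ = 4 * B ^ 2 * (7 ^ 3 * N) := by
                rw [prod_ite_eq_pow, mul_pow, ← Real.rpow_natCast ((N : ℝ) ^ (1 / 3 : ℝ)),
                  ← Real.rpow_mul (by positivity)]
                norm_num
            _ ≤ 4 * B ^ 2 * (7 ^ 4 * D) := by
                have : (N : ℝ) ≤ D := Nat.floor_le (by linarith)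
                gcongr
                · norm_num
                · norm_num
      _ = (Ks.card : ℝ) * (4 * B ^ 2 * (7 ^ 4 * D)) := by rw [Finset.sum_const, nsmul_eq_mul]
      _ = M * M * 81 * (4 * B ^ 2 * (7 ^ 4 * D)) := by
          rw [hKs, Finset.card_product, Finset.card_product, Fintype.card_piFinset]
          simp
      _ ≤ B * B * 81 * (4 * B ^ 2 * (7 ^ 4 * D)) := by gcongr
      _ = _ := by ring
  have hWt0 : ∀ xy, 0 ≤ Wt xy := fun xy => by positivity
  calc ∑ xy ∈ P, Wt xy ≤ ∑ xy ∈ P, ∑ i : Fin 4,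
        (if ∀ j, |xy.2 j - xy.1 j| ≤ |xy.2 i - xy.1 i| then Wt xy else 0) := by
        refine Finset.sum_le_sum fun xy _ => ?_
        obtain ⟨i, -, hi⟩ := Finset.exists_max_image Finset.univ (fun j => |xy.2 j - xy.1 j|)
          Finset.univ_nonempty
        refine le_trans ?_ (Finset.single_le_sum (f := fun i => if ∀ j, |xy.2 j - xy.1 j|
          ≤ |xy.2 i - xy.1 i| then Wt xy else 0) (fun k _ => ?_) (Finset.mem_univ i))
        · rw [if_pos fun j => hi j (Finset.mem_univ j)]
        · have := hWt0 xy
          split_ifs <;> simp [this]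
    _ = ∑ i : Fin 4, ∑ xy ∈ P.filter (fun xy => ∀ j, |xy.2 j - xy.1 j| ≤ |xy.2 i - xy.1 i|), Wt xy := by
        rw [Finset.sum_comm]
        exact Finset.sum_congr rfl fun i _ => (Finset.sum_filter _ _).symm
    _ ≤ ∑ i : Fin 4, 4 * 81 * 7 ^ 4 * B ^ 4 * D := Finset.sum_le_sum fun i _ => hone i
    _ = _ := by simp; ring


/-! ### Areas, and comparison of lattice sums with integrals -/

open MeasureTheory in
theorem lintegral_eq_abs_det_mul {n : ℕ} (M : Matrix (Fin n) (Fin n) ℝ) (hM : M.det ≠ 0)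
    {F : (Fin n → ℝ) → ENNReal} (hF : Measurable F) :
    ∫⁻ t, F t = ENNReal.ofReal |M.det| * ∫⁻ t, F (M.mulVec t) := by
  have h := Real.map_matrix_volume_pi_eq_smul_volume_pi hM
  have hm : Measurable (Matrix.toLin' M) := by
    apply Continuous.measurable
    apply LinearMap.continuous_on_pi
  have h2 : ∫⁻ t, F (M.mulVec t) = ∫⁻ t, F t ∂(Measure.map (Matrix.toLin' M) volume) := by
    rw [lintegral_map hF hm]
    simp [Matrix.toLin'_apply]
  rw [h2, h, lintegral_smul_measure, smul_eq_mul, ← mul_assoc, ← ENNReal.ofReal_mul (abs_nonneg _),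
    ← abs_mul, mul_inv_cancel₀ hM]
  simp

open MeasureTheory in
theorem measurePreserving_two_add_two :
    MeasurePreserving (fun z : (Fin 2 → ℝ) × (Fin 2 → ℝ) =>
      (![z.1 0, z.1 1, z.2 0, z.2 1] : Fin 4 → ℝ)) := by
  have hm : Measurable (fun z : (Fin 2 → ℝ) × (Fin 2 → ℝ) =>
      (![z.1 0, z.1 1, z.2 0, z.2 1] : Fin 4 → ℝ)) := by
    rw [measurable_pi_iff]
    intro i
    fin_cases i <;> simp <;> fun_prop
  refine ⟨hm, ?_⟩
  symm
  rw [volume_pi]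
  refine Measure.pi_eq fun s hs => ?_
  rw [Measure.map_apply hm (MeasurableSet.univ_pi hs)]
  have : (fun z : (Fin 2 → ℝ) × (Fin 2 → ℝ) =>
      (![z.1 0, z.1 1, z.2 0, z.2 1] : Fin 4 → ℝ)) ⁻¹' (Set.univ.pi s)
      = (Set.univ.pi ![s 0, s 1]) ×ˢ (Set.univ.pi ![s 2, s 3]) := by
    ext z
    simp [Set.mem_pi, Fin.forall_fin_succ, and_assoc]
  rw [this, Measure.volume_eq_prod, Measure.prod_prod, volume_pi_pi, volume_pi_pi]
  simp [Fin.prod_univ_succ]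
  ring

open MeasureTheory in
theorem measurePreserving_one_add_two :
    MeasurePreserving (fun z : ℝ × (Fin 2 → ℝ) => (![z.1, z.2 0, z.2 1] : Fin 3 → ℝ)) := by
  have hm : Measurable (fun z : ℝ × (Fin 2 → ℝ) => (![z.1, z.2 0, z.2 1] : Fin 3 → ℝ)) := by
    rw [measurable_pi_iff]
    intro i
    fin_cases i <;> simp <;> fun_prop
  refine ⟨hm, ?_⟩
  symm
  rw [volume_pi]
  refine Measure.pi_eq fun s hs => ?_
  rw [Measure.map_apply hm (MeasurableSet.univ_pi hs)]
  have : (fun z : ℝ × (Fin 2 → ℝ) => (![z.1, z.2 0, z.2 1] : Fin 3 → ℝ)) ⁻¹' (Set.univ.pi s)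
      = (s 0) ×ˢ (Set.univ.pi ![s 1, s 2]) := by
    ext z
    simp [Set.mem_pi, Fin.forall_fin_succ]
  rw [this, Measure.volume_eq_prod, Measure.prod_prod, volume_pi_pi]
  simp [Fin.prod_univ_succ]

open MeasureTheory in
theorem volume_disc_pi (r : ℝ) (hr : 0 ≤ r) :
    volume {t : Fin 2 → ℝ | t 0 ^ 2 + t 1 ^ 2 ≤ r} = ENNReal.ofReal (Real.pi * r) := by
  have h := (PiLp.volume_preserving_toLp (Fin 2)).measure_preimage
    (s := Metric.closedBall (0 : EuclideanSpace ℝ (Fin 2)) (√r))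
    (Metric.isClosed_closedBall.measurableSet.nullMeasurableSet)
  rw [EuclideanSpace.volume_closedBall_fin_two] at h
  have he : (WithLp.toLp 2 : (Fin 2 → ℝ) → EuclideanSpace ℝ (Fin 2)) ⁻¹'
      (Metric.closedBall (0 : EuclideanSpace ℝ (Fin 2)) (√r))
      = {t : Fin 2 → ℝ | t 0 ^ 2 + t 1 ^ 2 ≤ r} := by
    ext t
    simp [EuclideanSpace.norm_eq, Fin.sum_univ_two, Real.sqrt_le_sqrt_iff hr]
  rw [he] at h
  rw [h, ← ENNReal.ofReal_pow (Real.sqrt_nonneg _), Real.sq_sqrt hr,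
    ← ENNReal.ofReal_mul hr, mul_comm]

open MeasureTheory in
/-- The area of an ellipse. -/
theorem volume_ellipse {a b c : ℝ} (ha : 0 < a) (hD : 0 < a * c - b ^ 2) (r : ℝ) (hr : 0 ≤ r) :
    volume {t : Fin 2 → ℝ | a * t 0 ^ 2 + 2 * b * t 0 * t 1 + c * t 1 ^ 2 ≤ r}
      = ENNReal.ofReal (Real.pi * r / √(a * c - b ^ 2)) := by
  set D := a * c - b ^ 2
  have hsD : 0 < √D := Real.sqrt_pos.mpr hD
  have hsa : 0 < √a := Real.sqrt_pos.mpr ha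
  -- Completing the square: the triangular factor of the quadratic form carries the ellipse to a
  -- disc.
  let M : Matrix (Fin 2) (Fin 2) ℝ := !![√a, b / √a; 0, √D / √a]
  have hdet : M.det = √D := by
    simp [M, Matrix.det_fin_two]
    field_simp
  have h := Real.map_matrix_volume_pi_eq_smul_volume_pi (M := M) (by rw [hdet]; exact hsD.ne')
  have hm : Measurable (Matrix.toLin' M) := by
    apply Continuous.measurable
    apply LinearMap.continuous_on_pi
  have hS : MeasurableSet {t : Fin 2 → ℝ | t 0 ^ 2 + t 1 ^ 2 ≤ r} :=
    measurableSet_le (by fun_prop) (by fun_prop)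
  have h2 := congrArg (fun μ => μ {t : Fin 2 → ℝ | t 0 ^ 2 + t 1 ^ 2 ≤ r}) h
  simp only [Measure.smul_apply, smul_eq_mul] at h2
  rw [Measure.map_apply hm hS, volume_disc_pi r hr, hdet] at h2
  have he : (Matrix.toLin' M) ⁻¹' {t : Fin 2 → ℝ | t 0 ^ 2 + t 1 ^ 2 ≤ r}
      = {t : Fin 2 → ℝ | a * t 0 ^ 2 + 2 * b * t 0 * t 1 + c * t 1 ^ 2 ≤ r} := by
    ext t
    have : (√a * t 0 + b / √a * t 1) ^ 2 + (√D / √a * t 1) ^ 2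
        = a * t 0 ^ 2 + 2 * b * t 0 * t 1 + c * t 1 ^ 2 := by
      have h1 : √a ^ 2 = a := Real.sq_sqrt ha.le
      have h2 : √D ^ 2 = D := Real.sq_sqrt hD.le
      have h3 : (√D / √a) ^ 2 = D / a := by rw [div_pow, h1, h2]
      have h4 : (b / √a) ^ 2 = b ^ 2 / a := by rw [div_pow, h1]
      have h5 : √a * (b / √a) = b := by field_simp
      calc _ = √a ^ 2 * t 0 ^ 2 + 2 * (√a * (b / √a)) * t 0 * t 1
            + ((b / √a) ^ 2 + (√D / √a) ^ 2) * t 1 ^ 2 := by ring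
        _ = a * t 0 ^ 2 + 2 * b * t 0 * t 1 + (b ^ 2 / a + D / a) * t 1 ^ 2 := by
            rw [h1, h3, h4, h5]
        _ = _ := by
            have : b ^ 2 / a + D / a = c := by simp only [D]; field_simp; ring
            rw [this]
    simp [M, Matrix.toLin'_apply, Matrix.mulVec, dotProduct, Fin.sum_univ_two, this]
  rw [he] at h2
  rw [h2, abs_of_pos (inv_pos.mpr hsD), ← ENNReal.ofReal_mul (inv_pos.mpr hsD).le]
  congr 1
  field_simp

open MeasureTheory in
/-- The area of a parallelogram given by two linear inequalities in triangular form. -/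
theorem volume_parallelogram {X β δ P R : ℝ} (hX : 0 < X) (hδ : 0 < δ) (hP : 0 ≤ P) :
    volume {t : Fin 2 → ℝ | |t 0 * X| ≤ P ∧ |t 0 * β + t 1 * δ| ≤ R}
      = ENNReal.ofReal (4 * P * R / (X * δ)) := by
  let M : Matrix (Fin 2) (Fin 2) ℝ := !![X, 0; β, δ]
  have hdet : M.det = X * δ := by simp [M, Matrix.det_fin_two]
  have h := Real.map_matrix_volume_pi_eq_smul_volume_pi (M := M)
    (by rw [hdet]; exact (mul_pos hX hδ).ne')
  have hm : Measurable (Matrix.toLin' M) := by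
    apply Continuous.measurable
    apply LinearMap.continuous_on_pi
  have hS : MeasurableSet (Set.univ.pi ![Set.Icc (-P) P, Set.Icc (-R) R]) :=
    MeasurableSet.univ_pi fun i => by fin_cases i <;> simp
  have h2 := congrArg (fun μ => μ (Set.univ.pi ![Set.Icc (-P) P, Set.Icc (-R) R])) h
  simp only [Measure.smul_apply, smul_eq_mul] at h2
  rw [Measure.map_apply hm hS, volume_pi_pi, hdet] at h2
  have he : (Matrix.toLin' M) ⁻¹' (Set.univ.pi ![Set.Icc (-P) P, Set.Icc (-R) R])
      = {t : Fin 2 → ℝ | |t 0 * X| ≤ P ∧ |t 0 * β + t 1 * δ| ≤ R} := by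
    ext t
    simp [M, -abs_mul, Matrix.toLin'_apply, dotProduct, Fin.sum_univ_two, Set.mem_pi,
      Fin.forall_fin_two, abs_le, mul_comm]
  rw [he] at h2
  rw [h2, abs_of_pos (inv_pos.mpr (mul_pos hX hδ))]
  simp only [Fin.prod_univ_two, Matrix.cons_val_zero, Matrix.cons_val_one, Real.volume_Icc]
  rw [← ENNReal.ofReal_mul (by linarith), ← ENNReal.ofReal_mul (inv_pos.mpr (mul_pos hX hδ)).le]
  congr 1
  field_simp
  ring

open MeasureTheory in
-- The cubes of side `Q` with corners at the points of `S` are disjoint, because these points agree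
-- modulo `Q`; on each cube `F` is at least the weight of the corner.
theorem sum_mul_pow_le_lintegral {n : ℕ} {Q : ℕ} (S : Finset (Fin n → ℤ))
    (hS : ∀ s ∈ S, ∀ s' ∈ S, ∀ i, (Q : ℤ) ∣ s i - s' i)
    (f : (Fin n → ℤ) → ℝ) (F : (Fin n → ℝ) → ℝ) (hf : ∀ s ∈ S, 0 ≤ f s)
    (h : ∀ s ∈ S, ∀ t : Fin n → ℝ, (∀ i, (s i : ℝ) ≤ t i ∧ t i < s i + Q) → f s ≤ F t) :
    ENNReal.ofReal ((∑ s ∈ S, f s) * (Q : ℝ) ^ n) ≤ ∫⁻ t, ENNReal.ofReal (F t) := by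
  classical
  let cell : (Fin n → ℤ) → Set (Fin n → ℝ) :=
    fun s => Set.univ.pi fun i => Set.Ico (s i : ℝ) (s i + Q)
  have hcm : ∀ s, MeasurableSet (cell s) := fun s => MeasurableSet.univ_pi fun i => measurableSet_Ico
  have hvol : ∀ s, volume (cell s) = ENNReal.ofReal ((Q : ℝ) ^ n) := by
    intro s
    simp only [cell]
    rw [Real.volume_pi_Ico]
    simp [ENNReal.ofReal_pow]
  have hdisj : Set.PairwiseDisjoint (S : Set (Fin n → ℤ)) cell := by
    intro s hs s' hs' hne
    rw [Function.onFun, Set.disjoint_left]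
    intro t ht ht'
    apply hne
    ext i
    have h1 := (Set.mem_univ_pi.mp ht) i
    have h2 := (Set.mem_univ_pi.mp ht') i
    obtain ⟨k, hk⟩ := hS s hs s' hs' i
    have h3 : (s i : ℝ) < s' i + Q := lt_of_le_of_lt h1.1 h2.2
    have h4 : (s' i : ℝ) < s i + Q := lt_of_le_of_lt h2.1 h1.2
    have h3' : s i < s' i + Q := by exact_mod_cast h3
    have h4' : s' i < s i + Q := by exact_mod_cast h4
    have h5 : k < 1 := by
      by_contra hc
      push Not at hc
      nlinarith
    have h6 : -1 < k := by
      by_contra hc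
      push Not at hc
      nlinarith
    have : k = 0 := by omega
    subst this
    linarith
  calc ENNReal.ofReal ((∑ s ∈ S, f s) * (Q : ℝ) ^ n)
      = ∑ s ∈ S, ENNReal.ofReal (f s) * volume (cell s) := by
        rw [Finset.sum_mul, ENNReal.ofReal_sum_of_nonneg
          (fun s hs => mul_nonneg (hf s hs) (by positivity))]
        refine Finset.sum_congr rfl fun s hs => ?_
        rw [hvol, ENNReal.ofReal_mul (hf s hs)]
    _ ≤ ∑ s ∈ S, ∫⁻ t in cell s, ENNReal.ofReal (F t) := by
        refine Finset.sum_le_sum fun s hs => ?_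
        rw [← setLIntegral_const]
        refine setLIntegral_mono' (hcm s) fun t ht => ?_
        exact ENNReal.ofReal_le_ofReal (h s hs t fun i => (Set.mem_univ_pi.mp ht) i)
    _ = ∫⁻ t in ⋃ s ∈ S, cell s, ENNReal.ofReal (F t) :=
        (lintegral_biUnion_finset hdisj (fun s _ => hcm s) _).symm
    _ ≤ _ := setLIntegral_le_lintegral _ _

open MeasureTheory in
-- The converse comparison: the cubes attached to `S` cover the set where `F` is positive, with the
-- weight of some corner above `F`. Disjointness plays no role here.
theorem lintegral_le_sum_mul_pow {n : ℕ} {Q : ℕ} (S : Finset (Fin n → ℤ))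
    (f : (Fin n → ℤ) → ℝ) (F : (Fin n → ℝ) → ℝ) (hf : ∀ s ∈ S, 0 ≤ f s)
    (h : ∀ t : Fin n → ℝ, 0 < F t →
      ∃ s ∈ S, (∀ i, (s i : ℝ) ≤ t i ∧ t i < s i + Q) ∧ F t ≤ f s) :
    ∫⁻ t, ENNReal.ofReal (F t) ≤ ENNReal.ofReal ((∑ s ∈ S, f s) * (Q : ℝ) ^ n) := by
  classical
  let cell : (Fin n → ℤ) → Set (Fin n → ℝ) :=
    fun s => Set.univ.pi fun i => Set.Ico (s i : ℝ) (s i + Q)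
  have hcm : ∀ s, MeasurableSet (cell s) := fun s => MeasurableSet.univ_pi fun i => measurableSet_Ico
  have hvol : ∀ s, volume (cell s) = ENNReal.ofReal ((Q : ℝ) ^ n) := by
    intro s
    simp only [cell]
    rw [Real.volume_pi_Ico]
    simp [ENNReal.ofReal_pow]
  calc ∫⁻ t, ENNReal.ofReal (F t)
      ≤ ∫⁻ t, ∑ s ∈ S, (cell s).indicator (fun _ => ENNReal.ofReal (f s)) t := by
        refine lintegral_mono fun t => ?_
        by_cases ht : 0 < F t
        · obtain ⟨s, hs, hc, hle⟩ := h t ht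
          refine le_trans ?_ (Finset.single_le_sum (f := fun s =>
            (cell s).indicator (fun _ => ENNReal.ofReal (f s)) t) (fun _ _ => zero_le) hs)
          have : t ∈ cell s := Set.mem_univ_pi.mpr hc
          simp only [Set.indicator_of_mem this]
          exact ENNReal.ofReal_le_ofReal hle
        · rw [ENNReal.ofReal_of_nonpos (not_lt.mp ht)]
          exact zero_le
    _ = ∑ s ∈ S, ENNReal.ofReal (f s) * volume (cell s) := by
        rw [lintegral_finsetSum _ (fun s _ => measurable_const.indicator (hcm s))]
        refine Finset.sum_congr rfl fun s _ => ?_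
        rw [lintegral_indicator_const (hcm s)]
    _ = _ := by
        rw [Finset.sum_mul, ENNReal.ofReal_sum_of_nonneg
          (fun s hs => mul_nonneg (hf s hs) (by positivity))]
        refine Finset.sum_congr rfl fun s hs => ?_
        rw [hvol, ENNReal.ofReal_mul (hf s hs)]


open MeasureTheory in
theorem lintegral_two_add_two {F : (Fin 4 → ℝ) → ENNReal} (hF : Measurable F) :
    ∫⁻ u, F u = ∫⁻ τ : Fin 2 → ℝ, ∫⁻ s : Fin 2 → ℝ, F ![s 0, s 1, τ 0, τ 1] := by
  rw [← measurePreserving_two_add_two.lintegral_comp hF, Measure.volume_eq_prod,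
    lintegral_prod_symm]
  exact (hF.comp measurePreserving_two_add_two.measurable).aemeasurable

open MeasureTheory in
theorem lintegral_two_add_two' {F : (Fin 4 → ℝ) → ENNReal} (hF : Measurable F) :
    ∫⁻ u, F u = ∫⁻ s : Fin 2 → ℝ, ∫⁻ τ : Fin 2 → ℝ, F ![s 0, s 1, τ 0, τ 1] := by
  rw [← measurePreserving_two_add_two.lintegral_comp hF, Measure.volume_eq_prod,
    lintegral_prod]
  exact (hF.comp measurePreserving_two_add_two.measurable).aemeasurable

open MeasureTheory in
theorem lintegral_one_add_two {F : (Fin 3 → ℝ) → ENNReal} (hF : Measurable F) :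
    ∫⁻ u, F u = ∫⁻ τ : Fin 2 → ℝ, ∫⁻ s : ℝ, F ![s, τ 0, τ 1] := by
  rw [← measurePreserving_one_add_two.lintegral_comp hF, Measure.volume_eq_prod,
    lintegral_prod_symm]
  exact (hF.comp measurePreserving_one_add_two.measurable).aemeasurable

/-- A binary quadratic form. -/
noncomputable def quadForm (a b c u v : ℝ) : ℝ := a * u ^ 2 + 2 * b * u * v + c * v ^ 2

theorem quadForm_nonneg {a b c : ℝ} (ha : 0 < a) (hD : 0 < a * c - b ^ 2) (u v : ℝ) :
    0 ≤ quadForm a b c u v := by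
  have : quadForm a b c u v = ((a * u + b * v) ^ 2 + (a * c - b ^ 2) * v ^ 2) / a := by
    unfold quadForm; field_simp; ring
  rw [this]
  positivity

@[fun_prop]
theorem measurable_quadForm {α : Type*} [MeasurableSpace α] {a b c : ℝ} {f g : α → ℝ}
    (hf : Measurable f) (hg : Measurable g) : Measurable fun x => quadForm a b c (f x) (g x) := by
  unfold quadForm
  fun_prop

open scoped Classical in
/-- The value `k` if `p` holds, and `0` otherwise. -/
noncomputable def iteZero (p : Prop) (k : ℝ) : ℝ := if p then k else 0

theorem iteZero_pos {p : Prop} (h : p) (k : ℝ) : iteZero p k = k := if_pos h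

theorem iteZero_neg {p : Prop} (h : ¬p) (k : ℝ) : iteZero p k = 0 := if_neg h

theorem iteZero_nonneg {p : Prop} {k : ℝ} (h : p → 0 ≤ k) : 0 ≤ iteZero p k := by
  unfold iteZero; split_ifs <;> tauto

theorem measurable_iteZero {α : Type*} [MeasurableSpace α] {p : α → Prop} {k : α → ℝ}
    (hp : MeasurableSet {x | p x}) (hk : Measurable k) :
    Measurable fun x => iteZero (p x) (k x) := by
  classical
  have : (fun x => iteZero (p x) (k x)) = fun x => if p x then k x else 0 := by
    ext x; unfold iteZero; congr
  rw [this]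
  exact Measurable.ite hp hk measurable_const

theorem measurableSet_and {α : Type*} [MeasurableSpace α] {p q : α → Prop}
    (hp : MeasurableSet {x | p x}) (hq : MeasurableSet {x | q x}) :
    MeasurableSet {x | p x ∧ q x} := hp.inter hq

open MeasureTheory in
theorem lintegral_ofReal_iteZero_const {α : Type*} [MeasureSpace α] {p : α → Prop}
    (hp : MeasurableSet {x | p x}) (k : ℝ) :
    ∫⁻ x, ENNReal.ofReal (iteZero (p x) k) = ENNReal.ofReal k * volume {x | p x} := by
  rw [← lintegral_indicator_const hp]
  refine lintegral_congr fun x => ?_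
  by_cases h : p x
  · rw [Set.indicator_of_mem (by exact h), iteZero_pos h]
  · rw [Set.indicator_of_notMem (by exact h), iteZero_neg h, ENNReal.ofReal_zero]

open MeasureTheory in
-- For fixed last two coordinates the first two range over a parallelogram whose area is
-- proportional to the value of the quadratic form. This cancels the denominator, and the area of an
-- ellipse remains.
theorem lintegral_cone_le {a b c X β δ P R r k : ℝ} (ha : 0 < a) (hD : 0 < a * c - b ^ 2)
    (hX : 0 < X) (hδ : 0 < δ) (hP : 0 ≤ P) (hR : 0 ≤ R) (hr : 0 ≤ r) (hk : 0 ≤ k) :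
    ∫⁻ u : Fin 4 → ℝ, ENNReal.ofReal (iteZero (quadForm a b c (u 2) (u 3) ≤ r ∧
      |u 0 * X| ≤ P * √(quadForm a b c (u 2) (u 3)) ∧
      |u 0 * β + u 1 * δ| ≤ R * √(quadForm a b c (u 2) (u 3)))
      (k / quadForm a b c (u 2) (u 3)))
    ≤ ENNReal.ofReal (4 * P * R * k / (X * δ) * (Real.pi * r / √(a * c - b ^ 2))) := by
  rw [lintegral_two_add_two]
  · simp only [Matrix.cons_val]
    calc _ ≤ ∫⁻ τ : Fin 2 → ℝ, ENNReal.ofReal (iteZero (quadForm a b c (τ 0) (τ 1) ≤ r)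
          (4 * P * R * k / (X * δ))) := by
          refine lintegral_mono fun τ => ?_
          have hq := quadForm_nonneg ha hD (τ 0) (τ 1)
          set q := quadForm a b c (τ 0) (τ 1)
          by_cases hqr : q ≤ r
          · simp only [hqr, true_and, iteZero_pos]
            rw [lintegral_ofReal_iteZero_const (measurableSet_and
              (measurableSet_le (by fun_prop) (by fun_prop))
              (measurableSet_le (by fun_prop) (by fun_prop))),
              volume_parallelogram hX hδ (by positivity),
              ← ENNReal.ofReal_mul (by positivity)]
            apply ENNReal.ofReal_le_ofReal
            rcases hq.eq_or_lt with h0 | h0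
            · rw [← h0]; simp; positivity
            · apply le_of_eq
              have := Real.mul_self_sqrt hq
              have h3 : 4 * (P * √q) * (R * √q) = 4 * P * R * q := by
                linear_combination 4 * P * R * this
              rw [h3]
              field_simp
          · simp [hqr, iteZero_neg]
      _ = _ := by
          rw [lintegral_ofReal_iteZero_const (measurableSet_le (by fun_prop) (by fun_prop))]
          unfold quadForm
          rw [volume_ellipse ha hD r hr, ← ENNReal.ofReal_mul (by positivity)]
  · refine ENNReal.measurable_ofReal.comp (measurable_iteZero (measurableSet_and ?_
      (measurableSet_and ?_ ?_)) (by fun_prop)) <;>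
      exact measurableSet_le (by fun_prop) (by fun_prop)

open MeasureTheory in
-- Complements `lintegral_cone_le` where the transverse part `S` dominates the quadratic form. The
-- order of integration is reversed: the ellipse in the last two coordinates has area proportional
-- to `S`, which cancels the denominator and leaves a parallelogram.
theorem lintegral_cone_le' {a b c X β δ P R k : ℝ} (S : ℝ → ℝ → ℝ)
    (hS : Measurable fun z : ℝ × ℝ => S z.1 z.2) (hS0 : ∀ u v, 0 ≤ S u v)
    (ha : 0 < a) (hD : 0 < a * c - b ^ 2)
    (hX : 0 < X) (hδ : 0 < δ) (hP : 0 ≤ P) (hk : 0 ≤ k) :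
    ∫⁻ u : Fin 4 → ℝ, ENNReal.ofReal (iteZero (quadForm a b c (u 2) (u 3) ≤ S (u 0) (u 1) ∧
      |u 0 * X| ≤ P ∧ |u 0 * β + u 1 * δ| ≤ R) (k / S (u 0) (u 1)))
    ≤ ENNReal.ofReal (4 * P * R * k / (X * δ) * (Real.pi / √(a * c - b ^ 2))) := by
  have hS1 : Measurable fun u : Fin 4 → ℝ => S (u 0) (u 1) :=
    hS.comp (.prodMk (by fun_prop) (by fun_prop))
  rw [lintegral_two_add_two']
  · simp only [Matrix.cons_val]
    calc _ ≤ ∫⁻ s : Fin 2 → ℝ, ENNReal.ofReal (iteZero (|s 0 * X| ≤ P ∧ |s 0 * β + s 1 * δ| ≤ R)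
          (k * (Real.pi / √(a * c - b ^ 2)))) := by
          refine lintegral_mono fun s => ?_
          by_cases h : |s 0 * X| ≤ P ∧ |s 0 * β + s 1 * δ| ≤ R
          · simp only [h, and_true, iteZero_pos]
            rw [lintegral_ofReal_iteZero_const (measurableSet_le (by fun_prop) (by fun_prop))]
            unfold quadForm
            rw [volume_ellipse ha hD _ (hS0 _ _), ← ENNReal.ofReal_mul (div_nonneg hk (hS0 _ _))]
            apply ENNReal.ofReal_le_ofReal
            rcases (hS0 (s 0) (s 1)).eq_or_lt with h0 | h0
            · rw [← h0]; simp; positivity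
            · apply le_of_eq; field_simp
          · rw [iteZero_neg h]
            refine le_trans (le_of_eq ?_) (zero_le (a := ENNReal.ofReal 0))
            rw [← lintegral_zero (μ := (volume : Measure (Fin 2 → ℝ)))]
            refine lintegral_congr fun τ => ?_
            rw [iteZero_neg (fun h' => h h'.2), ENNReal.ofReal_zero]
      _ ≤ _ := by
          rw [lintegral_ofReal_iteZero_const (measurableSet_and
            (measurableSet_le (by fun_prop) (by fun_prop))
            (measurableSet_le (by fun_prop) (by fun_prop))),
            volume_parallelogram hX hδ hP, ← ENNReal.ofReal_mul (by positivity)]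
          apply ENNReal.ofReal_le_ofReal
          apply le_of_eq; ring
  · refine ENNReal.measurable_ofReal.comp (measurable_iteZero (measurableSet_and ?_
      (measurableSet_and ?_ ?_)) (by fun_prop)) <;>
      exact measurableSet_le (by fun_prop) (by fun_prop)

open MeasureTheory in
-- The first coordinate runs over an interval of length proportional to the root of the quadratic
-- form, cancelling the denominator; what remains is the difference of two ellipse areas. Staying
-- away from the origin leaves room for the later displacement by a cell.
theorem le_lintegral_annulus {a b c δ R r₀ r k : ℝ} (ha : 0 < a) (hD : 0 < a * c - b ^ 2)
    (hδ : 0 < δ) (hR : 0 ≤ R) (hr₀ : 0 < r₀) (hr : r₀ ≤ r) (hk : 0 ≤ k) :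
    ENNReal.ofReal (2 * R * k / δ * (Real.pi * (r - r₀) / √(a * c - b ^ 2))) ≤
    ∫⁻ u : Fin 3 → ℝ, ENNReal.ofReal (iteZero ((r₀ ≤ quadForm a b c (u 1) (u 2) ∧
      quadForm a b c (u 1) (u 2) ≤ r) ∧
      |u 0 * δ| ≤ R * √(quadForm a b c (u 1) (u 2)))
      (k / √(quadForm a b c (u 1) (u 2)))) := by
  rw [lintegral_one_add_two]
  · simp only [Matrix.cons_val]
    calc ENNReal.ofReal (2 * R * k / δ * (Real.pi * (r - r₀) / √(a * c - b ^ 2)))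
      ≤ ∫⁻ τ : Fin 2 → ℝ, ENNReal.ofReal (iteZero (r₀ ≤ quadForm a b c (τ 0) (τ 1) ∧
          quadForm a b c (τ 0) (τ 1) ≤ r) (2 * R * k / δ)) := by
          rw [lintegral_ofReal_iteZero_const (measurableSet_and
            (measurableSet_le (by fun_prop) (by fun_prop))
            (measurableSet_le (by fun_prop) (by fun_prop)))]
          have h1 := volume_ellipse ha hD r (hr₀.le.trans hr)
          have h2 := volume_ellipse ha hD r₀ hr₀.le
          rw [ENNReal.ofReal_mul (by positivity)]
          gcongr
          have h3 : {t : Fin 2 → ℝ | a * t 0 ^ 2 + 2 * b * t 0 * t 1 + c * t 1 ^ 2 ≤ r} \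
              {t : Fin 2 → ℝ | a * t 0 ^ 2 + 2 * b * t 0 * t 1 + c * t 1 ^ 2 ≤ r₀} ⊆
              {τ : Fin 2 → ℝ | r₀ ≤ quadForm a b c (τ 0) (τ 1) ∧ quadForm a b c (τ 0) (τ 1) ≤ r} := by
            intro t ht
            simp only [Set.mem_sdiff, Set.mem_ofPred_eq, not_le] at ht
            exact ⟨ht.2.le, ht.1⟩
          refine le_trans ?_ (measure_mono h3)
          refine le_trans ?_ le_measure_sdiff
          rw [h1, h2, ← ENNReal.ofReal_sub _ (by positivity)]
          apply ENNReal.ofReal_le_ofReal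
          apply le_of_eq; ring
      _ ≤ _ := by
          refine lintegral_mono fun τ => ?_
          by_cases h : r₀ ≤ quadForm a b c (τ 0) (τ 1) ∧ quadForm a b c (τ 0) (τ 1) ≤ r
          · simp only [h, and_true, iteZero_pos, true_and]
            have hq : 0 < quadForm a b c (τ 0) (τ 1) := hr₀.trans_le h.1
            set q := quadForm a b c (τ 0) (τ 1)
            have hsq : 0 < √q := Real.sqrt_pos.mpr hq
            rw [lintegral_ofReal_iteZero_const (measurableSet_le (by fun_prop) (by fun_prop))]
            have : {x : ℝ | |x * δ| ≤ R * √q} = Set.Icc (-(R * √q / δ)) (R * √q / δ) := by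
              ext x
              rw [Set.mem_ofPred_eq, Set.mem_Icc, ← abs_le, abs_mul, abs_of_pos hδ, le_div_iff₀ hδ]
            rw [this, Real.volume_Icc, ← ENNReal.ofReal_mul (by positivity)]
            apply ENNReal.ofReal_le_ofReal
            apply le_of_eq; field_simp; ring
          · rw [iteZero_neg h]; simp
  · refine ENNReal.measurable_ofReal.comp (measurable_iteZero (measurableSet_and
      (measurableSet_and ?_ ?_) ?_) (by fun_prop)) <;>
      exact measurableSet_le (by fun_prop) (by fun_prop)


/-! ### Residue classes on which a linear form vanishes -/

/-- The integer vectors with entries in `[0, n)`. -/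
noncomputable def residues (n k : ℕ) : Finset (Fin k → ℤ) := Fintype.piFinset fun _ => Finset.Ico 0 (n : ℤ)

theorem card_residues (n k : ℕ) : (residues n k).card = n ^ k := by
  simp [residues, Fintype.card_piFinset]

theorem mem_residues {n k : ℕ} {s : Fin k → ℤ} : s ∈ residues n k ↔ ∀ i, 0 ≤ s i ∧ s i < n := by
  simp [residues, Fintype.mem_piFinset]

/-- Reduction of an integer vector modulo `n`. -/
def modVec (n : ℕ) {k : ℕ} (s : Fin k → ℤ) : Fin k → ℤ := fun i => s i % n

theorem modVec_mem {n k : ℕ} (hn : 0 < n) (s : Fin k → ℤ) : modVec n s ∈ residues n k :=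
  mem_residues.mpr fun i => ⟨Int.emod_nonneg _ (by omega), Int.emod_lt_of_pos _ (by omega)⟩

theorem dvd_modVec_sub (n : ℕ) {k : ℕ} (s : Fin k → ℤ) (i : Fin k) :
    (n : ℤ) ∣ modVec n s i - s i := by
  have := Int.emod_add_mul_ediv (s i) n
  exact ⟨-(s i / n), by simp only [modVec]; linarith⟩

theorem dvd_sub_of_modVec_eq {n k : ℕ} {s t : Fin k → ℤ} (h : modVec n s = modVec n t)
    (i : Fin k) : (n : ℤ) ∣ s i - t i :=
  Int.ModEq.dvd (a := t i) (b := s i) (congrFun h i).symm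

theorem eq_of_mem_residues {n k : ℕ} {s t : Fin k → ℤ} (hs : s ∈ residues n k)
    (ht : t ∈ residues n k) (h : ∀ i, (n : ℤ) ∣ s i - t i) : s = t := by
  ext i
  have h1 := mem_residues.mp hs i
  have h2 := mem_residues.mp ht i
  have h3 : s i % n = t i % n :=
    (Int.modEq_iff_dvd (a := s i) (b := t i)).mpr (by rw [dvd_sub_comm]; exact h i)
  rwa [Int.emod_eq_of_lt h1.1 h1.2, Int.emod_eq_of_lt h2.1 h2.2] at h3

/-- No prime divisor of `n` divides all the entries of `s`. -/
def PrimitiveAt (n : ℕ) {k : ℕ} (s : Fin k → ℤ) : Prop :=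
  ∀ p : ℕ, p.Prime → p ∣ n → ∃ i, ¬ (p : ℤ) ∣ s i

theorem PrimitiveAt.congr {n k : ℕ} {s t : Fin k → ℤ} (h : PrimitiveAt n s)
    (hst : ∀ p : ℕ, p.Prime → p ∣ n → ∀ i, (p : ℤ) ∣ s i - t i) : PrimitiveAt n t := by
  intro p hp hpn
  obtain ⟨i, hi⟩ := h p hp hpn
  exact ⟨i, fun h => hi ((dvd_iff_dvd_of_dvd_sub (hst p hp hpn i)).mpr h)⟩

theorem PrimitiveAt.congr_of_dvd {n k : ℕ} {s t : Fin k → ℤ} (h : PrimitiveAt n s)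
    (hst : ∀ i, (n : ℤ) ∣ s i - t i) : PrimitiveAt n t :=
  h.congr fun _ _ hpn i => (Int.natCast_dvd_natCast.mpr hpn).trans (hst i)

theorem dvd_sum_mul_iff {n : ℤ} {k : ℕ} (h : Fin k → ℤ) {s t : Fin k → ℤ}
    (hst : ∀ i, n ∣ s i - t i) : n ∣ ∑ i, h i * s i ↔ n ∣ ∑ i, h i * t i := by
  refine dvd_iff_dvd_of_dvd_sub ?_
  rw [← Finset.sum_sub_distrib]
  exact Finset.dvd_sum fun i _ => by rw [← mul_sub]; exact (hst i).mul_left _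

open scoped Classical in
-- The translates of the solution set by `j t`, for `j < n / g`, are disjoint modulo `n`, since the
-- form takes the distinct values `j g` on them. They fit into `n ^ k` classes.
theorem card_filter_dvd_mul_le {n k g : ℕ} (hn : 0 < n) (h t : Fin k → ℤ) (hg : 0 < g)
    (ht : (n : ℤ) ∣ ∑ i, h i * t i - g) :
    ((residues n k).filter fun s => (n : ℤ) ∣ ∑ i, h i * s i).card * n ≤ n ^ k * g := by
  set S := (residues n k).filter fun s => (n : ℤ) ∣ ∑ i, h i * s i
  -- The quotient `n / g` rounded up: then `n ≤ J g`, while `j g < n` still holds for all `j < J`.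
  set J := (n + g - 1) / g
  have hJ : n ≤ J * g := by
    have h2 : (n + g - 1) < g * ((n + g - 1) / g + 1) := Nat.lt_mul_div_succ _ hg
    have : g * (J + 1) = J * g + g := by ring
    simp only [J] at *
    omega
  have hJ' : ∀ j < J, j * g < n := by
    intro j hj
    have h1 : (j + 1) * g ≤ J * g := Nat.mul_le_mul_right _ hj
    have h2 : J * g ≤ n + g - 1 := Nat.div_mul_le_self _ _
    have : (j + 1) * g = j * g + g := by ring
    omega
  have key : (S ×ˢ Finset.range J).card ≤ (residues n k).card := by
    refine Finset.card_le_card_of_injOn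
      (fun sj => modVec n fun i => sj.1 i + sj.2 * t i) ?_ ?_
    · intro sj _
      exact modVec_mem hn _
    · rintro ⟨s, j⟩ hs ⟨s', j'⟩ hs' heq
      simp only [Finset.coe_product, Set.mem_prod, Finset.mem_coe, S, Finset.mem_filter,
        Finset.mem_range] at hs hs'
      have hd := dvd_sub_of_modVec_eq heq
      simp only at hd
      have h1 : (n : ℤ) ∣ ∑ i, h i * (s i + j * t i) - ∑ i, h i * (s' i + j' * t i) := by
        rw [← Finset.sum_sub_distrib]
        exact Finset.dvd_sum fun i _ => by rw [← mul_sub]; exact (hd i).mul_left _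
      have h2 : ∀ (s : Fin k → ℤ) (j : ℕ), ∑ i, h i * (s i + j * t i)
          = ∑ i, h i * s i + j * ∑ i, h i * t i := by
        intro s j
        rw [Finset.mul_sum, ← Finset.sum_add_distrib]
        exact Finset.sum_congr rfl fun i _ => by ring
      rw [h2, h2] at h1
      have h3 : (n : ℤ) ∣ (j * g : ℕ) - (j' * g : ℕ) := by
        have h4 := (h1.sub hs.1.2).add hs'.1.2
        have h5 := h4.sub (ht.mul_left ((j : ℤ) - j'))
        refine h5.trans (dvd_of_eq ?_)
        push_cast; ring
      have h4 : j * g = j' * g := by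
        have e1 := hJ' j hs.2
        have e2 := hJ' j' hs'.2
        have := (Nat.modEq_iff_dvd (a := j' * g) (b := j * g)).mpr h3
        exact (Nat.ModEq.eq_of_lt_of_lt this e2 e1).symm
      have h5 : j = j' := Nat.eq_of_mul_eq_mul_right hg h4
      subst h5
      have : s = s' := eq_of_mem_residues hs.1.1 hs'.1.1 fun i => by simpa using hd i
      rw [this]
  rw [Finset.card_product, Finset.card_range, card_residues] at key
  calc S.card * n ≤ S.card * (J * g) := Nat.mul_le_mul_left _ hJ
    _ = (S.card * J) * g := by ring
    _ ≤ n ^ k * g := Nat.mul_le_mul_right _ key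

open scoped Classical in
/-- The residue classes modulo `n`, primitive at `n`, on which the linear form `h` vanishes. -/
noncomputable def kernelSet (n : ℕ) {k : ℕ} (h : Fin k → ℤ) : Finset (Fin k → ℤ) :=
  (residues n k).filter fun s => (n : ℤ) ∣ ∑ i, h i * s i ∧ PrimitiveAt n s

theorem mem_kernelSet {n k : ℕ} {h s : Fin k → ℤ} : s ∈ kernelSet n h ↔
    s ∈ residues n k ∧ (n : ℤ) ∣ ∑ i, h i * s i ∧ PrimitiveAt n s := by
  classical simp [kernelSet]

theorem modVec_mem_kernelSet {n k : ℕ} (hn : 0 < n) {h s : Fin k → ℤ}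
    (h1 : (n : ℤ) ∣ ∑ i, h i * s i) (h2 : PrimitiveAt n s) : modVec n s ∈ kernelSet n h := by
  refine mem_kernelSet.mpr ⟨modVec_mem hn s, ?_, h2.congr_of_dvd fun i => ?_⟩
  · exact (dvd_sum_mul_iff h (dvd_modVec_sub n s)).mpr h1
  · rw [dvd_sub_comm]; exact dvd_modVec_sub n s i

theorem card_kernelSet_mul_le {n k g : ℕ} (hn : 0 < n) (h t : Fin k → ℤ) (hg : 0 < g)
    (ht : ∑ i, h i * t i = g) : (kernelSet n h).card * n ≤ n ^ k * g := by
  classical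
  refine le_trans (Nat.mul_le_mul_right _ (Finset.card_le_card ?_))
    (card_filter_dvd_mul_le hn h t hg (by simp [ht]))
  intro s hs
  rw [mem_kernelSet] at hs
  exact Finset.mem_filter.mpr ⟨hs.1, hs.2.1⟩

/-- Write `n = g m`. Each zero `s` of `h'` gives `g` zeros `s + j m t` of `h = g h'`, told apart by
the value `j m` of `h'`. They stay primitive because every prime dividing `n` divides `m`, which is
the content of `hgp`. -/
theorem mul_card_kernelSet_le {n k g : ℕ} (hn : 0 < n) (h h' t : Fin k → ℤ) (hg : 0 < g)
    (hh : ∀ i, h i = g * h' i) (ht : ∑ i, h' i * t i = 1) (hgn : g ∣ n)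
    (hgp : ∀ p : ℕ, p.Prime → p ∣ n → g * p ∣ n) :
    g * (kernelSet n h').card ≤ (kernelSet n h).card := by
  obtain ⟨m, rfl⟩ := hgn
  have hm : 0 < m := Nat.pos_of_mul_pos_left hn
  have hpm : ∀ p : ℕ, p.Prime → p ∣ g * m → (p : ℤ) ∣ m := fun p hp hpn =>
    Int.natCast_dvd_natCast.mpr ((Nat.mul_dvd_mul_iff_left hg).mp (hgp p hp hpn))
  have key : (Finset.range g ×ˢ kernelSet (g * m) h').card ≤ (kernelSet (g * m) h).card := by
    refine Finset.card_le_card_of_injOn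
      (fun js => modVec (g * m) fun i => js.2 i + js.1 * m * t i) ?_ ?_
    · rintro ⟨j, s⟩ hs
      simp only [Finset.coe_product, Set.mem_prod, Finset.mem_coe, Finset.mem_range,
        mem_kernelSet] at hs
      refine modVec_mem_kernelSet hn ?_ ?_
      · have : ∑ i, h i * (s i + j * m * t i) = g * ∑ i, h' i * s i + (g * m) * j := by
          have e : ∑ i, h i * (s i + j * m * t i)
            = g * ∑ i, h' i * s i + (g * m) * j * ∑ i, h' i * t i := by
            rw [Finset.mul_sum, Finset.mul_sum, ← Finset.sum_add_distrib]
            exact Finset.sum_congr rfl fun i _ => by rw [hh]; ring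
          rw [e, ht, mul_one]
        simp only
        rw [this]
        push_cast at hs ⊢
        exact (hs.2.2.1.mul_left _).add (dvd_mul_right _ _)
      · refine hs.2.2.2.congr fun p hp hpn i => ?_
        have e : s i - (s i + j * m * t i) = m * (-(j * t i)) := by ring
        simp only [e]
        exact (hpm p hp hpn).mul_right _
    · rintro ⟨j, s⟩ hs ⟨j', s'⟩ hs' heq
      simp only [Finset.coe_product, Set.mem_prod, Finset.mem_coe, Finset.mem_range,
        mem_kernelSet] at hs hs'
      have hd := dvd_sub_of_modVec_eq heq
      simp only at hd
      have h1 : ((g * m : ℕ) : ℤ) ∣ ∑ i, h' i * (s i + j * m * t i)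
          - ∑ i, h' i * (s' i + j' * m * t i) := by
        rw [← Finset.sum_sub_distrib]
        exact Finset.dvd_sum fun i _ => by rw [← mul_sub]; exact (hd i).mul_left _
      have h2 : ∀ (s : Fin k → ℤ) (j : ℕ), ∑ i, h' i * (s i + j * m * t i)
          = ∑ i, h' i * s i + j * m := by
        intro s j
        have e : ∑ i, h' i * (s i + j * m * t i)
          = ∑ i, h' i * s i + j * m * ∑ i, h' i * t i := by
          rw [Finset.mul_sum, ← Finset.sum_add_distrib]
          exact Finset.sum_congr rfl fun i _ => by ring
        rw [e, ht, mul_one]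
      rw [h2, h2] at h1
      have h3 : ((g * m : ℕ) : ℤ) ∣ (j * m : ℕ) - (j' * m : ℕ) := by
        have h4 := (h1.sub hs.2.2.1).add hs'.2.2.1
        refine h4.trans (dvd_of_eq ?_)
        push_cast; ring
      have h4 : j * m = j' * m := by
        have e1 : j * m < g * m := Nat.mul_lt_mul_of_pos_right hs.1 hm
        have e2 : j' * m < g * m := Nat.mul_lt_mul_of_pos_right hs'.1 hm
        have := (Nat.modEq_iff_dvd (a := j' * m) (b := j * m)).mpr h3
        exact (Nat.ModEq.eq_of_lt_of_lt this e2 e1).symm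
      have h5 : j = j' := Nat.eq_of_mul_eq_mul_right hm h4
      subst h5
      have : s = s' := eq_of_mem_residues hs.2.1 hs'.2.1 fun i => by simpa using hd i
      rw [this]
  rwa [Finset.card_product, Finset.card_range] at key

open scoped Classical in
-- By the Chinese remainder theorem: the condition on the form concerns `m` only, and primitivity
-- can be imposed separately at `m` and at `n`.
theorem card_kernelSet_mul_card_le {m n k : ℕ} (hm : 0 < m) (hn : 0 < n) (hmn : m.Coprime n)
    (h : Fin k → ℤ) :
    (kernelSet m h).card * ((residues n k).filter (PrimitiveAt n)).card ≤
      ((residues (m * n) k).filter fun s => (m : ℤ) ∣ ∑ i, h i * s i ∧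
        PrimitiveAt (m * n) s).card := by
  obtain ⟨u, v, huv⟩ := Nat.isCoprime_iff_coprime.mpr hmn
  have hc : ∀ (s t : Fin k → ℤ) (i : Fin k),
      (m : ℤ) ∣ s i - modVec (m * n) (fun i => v * n * s i + u * m * t i) i ∧
      (n : ℤ) ∣ t i - modVec (m * n) (fun i => v * n * s i + u * m * t i) i := by
    intro s t i
    have h1 := dvd_modVec_sub (m * n) (fun i => v * n * s i + u * m * t i) i
    rw [dvd_sub_comm] at h1
    push_cast at h1
    constructor
    · have h2 : (m : ℤ) ∣ _ := (Dvd.intro _ rfl).trans h1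
      have h3 : (m : ℤ) ∣ u * (s i - t i) * m := dvd_mul_left _ _
      refine (h2.add h3).trans (dvd_of_eq ?_)
      linear_combination s i * huv
    · have h2 : (n : ℤ) ∣ _ := (Dvd.intro_left _ rfl).trans h1
      have h3 : (n : ℤ) ∣ v * (t i - s i) * n := dvd_mul_left _ _
      refine (h2.add h3).trans (dvd_of_eq ?_)
      linear_combination t i * huv
  rw [← Finset.card_product]
  refine Finset.card_le_card_of_injOn
    (fun st => modVec (m * n) (fun i => v * n * st.1 i + u * m * st.2 i)) ?_ ?_
  · rintro ⟨s, t⟩ hst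
    simp only [Finset.coe_product, Set.mem_prod, Finset.mem_coe, mem_kernelSet,
      Finset.mem_filter] at hst
    simp only [Finset.coe_filter, Set.mem_ofPred_eq]
    refine ⟨modVec_mem (by positivity) _,
      (dvd_sum_mul_iff h fun i => (hc s t i).1).mp hst.1.2.1, fun p hp hpd => ?_⟩
    rcases (hp.dvd_mul).mp hpd with h1 | h1
    · exact (hst.1.2.2.congr_of_dvd fun i => (hc s t i).1) p hp h1
    · exact (hst.2.2.congr_of_dvd fun i => (hc s t i).2) p hp h1
  · rintro ⟨s, t⟩ hst ⟨s', t'⟩ hst' heq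
    simp only [Finset.coe_product, Set.mem_prod, Finset.mem_coe, mem_kernelSet,
      Finset.mem_filter] at hst hst'
    simp only at heq
    have e1 : s = s' := eq_of_mem_residues hst.1.1 hst'.1.1 fun i => by
      have := (hc s t i).1
      rw [heq] at this
      exact (this.sub (hc s' t' i).1).trans (dvd_of_eq (by ring))
    have e2 : t = t' := eq_of_mem_residues hst.2.1 hst'.2.1 fun i => by
      have := (hc s t i).2
      rw [heq] at this
      exact (this.sub (hc s' t' i).2).trans (dvd_of_eq (by ring))
    rw [e1, e2]

open scoped Classical in
-- A union bound: the classes with all entries divisible by `p` form a proportion `p ^ (-k)`.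
theorem le_card_filter_primitiveAt {n k : ℕ} (hn : 0 < n) (S : Finset ℕ)
    (hS : ∀ p, p.Prime → p ∣ n → p ∈ S) (hS' : ∀ p ∈ S, 0 < p ∧ p ∣ n) :
    (n : ℝ) ^ k * (1 - ∑ p ∈ S, 1 / (p : ℝ) ^ k) ≤
      ((residues n k).filter (PrimitiveAt n)).card := by
  have h1 : residues n k ⊆ (residues n k).filter (PrimitiveAt n) ∪
      S.biUnion fun p => (residues n k).filter fun s => ∀ i, (p : ℤ) ∣ s i := by
    intro s hs
    by_cases hp : PrimitiveAt n s
    · exact Finset.mem_union_left _ (Finset.mem_filter.mpr ⟨hs, hp⟩)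
    · refine Finset.mem_union_right _ ?_
      unfold PrimitiveAt at hp
      push Not at hp
      obtain ⟨p, hp, hpn, hd⟩ := hp
      exact Finset.mem_biUnion.mpr ⟨p, hS p hp hpn, Finset.mem_filter.mpr ⟨hs, hd⟩⟩
  have h2 := (Finset.card_le_card h1).trans ((Finset.card_union_le _ _).trans
    (Nat.add_le_add_left Finset.card_biUnion_le _))
  rw [card_residues] at h2
  have h3 : ∀ p ∈ S, ((((residues n k).filter fun s => ∀ i, (p : ℤ) ∣ s i).card : ℕ) : ℝ)
      ≤ (n : ℝ) ^ k * (1 / (p : ℝ) ^ k) := by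
    intro p hp
    obtain ⟨hp0, m, rfl⟩ := hS' p hp
    have : ((residues (p * m) k).filter fun s => ∀ i, (p : ℤ) ∣ s i).card ≤ (residues m k).card := by
      refine Finset.card_le_card_of_injOn (fun s i => s i / p) ?_ ?_
      · intro s hs
        simp only [Finset.coe_filter, Set.mem_ofPred_eq, mem_residues] at hs
        refine Finset.mem_coe.mpr (mem_residues.mpr fun i => ⟨Int.ediv_nonneg (hs.1 i).1 (by omega), ?_⟩)
        have := (hs.1 i).2
        push_cast at this
        exact Int.ediv_lt_of_lt_mul (by omega) (by linarith [mul_comm (p : ℤ) m])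
      · intro s hs s' hs' heq
        simp only [Finset.coe_filter, Set.mem_ofPred_eq] at hs hs'
        ext i
        have h4 : s i / p = s' i / p := congrFun heq i
        rw [← Int.ediv_mul_cancel (hs.2 i), h4, Int.ediv_mul_cancel (hs'.2 i)]
    rw [card_residues] at this
    have hp' : (0 : ℝ) < p := by exact_mod_cast hp0
    calc _ ≤ ((m ^ k : ℕ) : ℝ) := by exact_mod_cast this
      _ = _ := by push_cast; rw [mul_pow]; field_simp
  have h4 : (n : ℝ) ^ k ≤ ((residues n k).filter (PrimitiveAt n)).card +
      ∑ p ∈ S, (n : ℝ) ^ k * (1 / (p : ℝ) ^ k) := by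
    refine le_trans ?_ (add_le_add_right (Finset.sum_le_sum h3) _)
    exact_mod_cast h2
  rw [← Finset.mul_sum] at h4
  linarith


/-! ### Coordinates on the lattice orthogonal to one vector -/

/-- Integers that complete `(x 1, -x 0, 0, 0)` to a basis `(x 1, -x 0, 0, 0)`, `(a, b, 1, 0)`,
`(c, d, 0, 1)` of the lattice orthogonal to `x`, if `x 0` and `x 1` are coprime. -/
structure Frame (x : Fin 4 → ℤ) where
  a : ℤ
  b : ℤ
  c : ℤ
  d : ℤ
  hab : x 0 * a + x 1 * b + x 2 = 0
  hcd : x 0 * c + x 1 * d + x 3 = 0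

namespace Frame

variable {x : Fin 4 → ℤ}

/-- The lattice vector with given coordinates. -/
def vec (F : Frame x) (s : Fin 3 → ℤ) : Fin 4 → ℤ :=
  ![s 0 * x 1 + s 1 * F.a + s 2 * F.c, -(s 0 * x 0) + s 1 * F.b + s 2 * F.d, s 1, s 2]

/-- The real vector with given coordinates. -/
def vecReal (F : Frame x) (s : Fin 3 → ℝ) : Fin 4 → ℝ :=
  ![s 0 * x 1 + s 1 * F.a + s 2 * F.c, -(s 0 * x 0) + s 1 * F.b + s 2 * F.d, s 1, s 2]

/-- The linear form `⟨y, ·⟩` in the coordinates of the frame. -/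
def form (F : Frame x) (y : Fin 4 → ℤ) : Fin 3 → ℤ :=
  ![-minor x y 0 1, y 0 * F.a + y 1 * F.b + y 2, y 0 * F.c + y 1 * F.d + y 3]

theorem vecReal_intCast (F : Frame x) (s : Fin 3 → ℤ) (i : Fin 4) :
    F.vecReal (fun j => (s j : ℝ)) i = F.vec s i := by
  fin_cases i <;> simp [vec, vecReal]

theorem sum_mul_vec (F : Frame x) (s : Fin 3 → ℤ) : ∑ i, x i * F.vec s i = 0 := by
  simp only [Fin.sum_univ_four, vec, Matrix.cons_val]
  linear_combination s 1 * F.hab + s 2 * F.hcd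

theorem sum_mul_vec_eq (F : Frame x) (y : Fin 4 → ℤ) (s : Fin 3 → ℤ) :
    ∑ i, y i * F.vec s i = ∑ i, F.form y i * s i := by
  simp only [Fin.sum_univ_four, Fin.sum_univ_three, vec, form, minor, Matrix.cons_val]
  ring

/-- After subtracting the second and third basis vectors, a vector orthogonal to `(x 0, x 1)`
remains; Bézout's identity shows that it is an integer multiple of `(x 1, -x 0)`. -/
theorem exists_vec_eq (F : Frame x) (hx : IsCoprime (x 0) (x 1)) {a : Fin 4 → ℤ}
    (ha : ∑ i, x i * a i = 0) : ∃ s, F.vec s = a := by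
  obtain ⟨u, v, huv⟩ := hx
  rw [Fin.sum_univ_four] at ha
  have h : x 0 * (a 0 - a 2 * F.a - a 3 * F.c) + x 1 * (a 1 - a 2 * F.b - a 3 * F.d) = 0 := by
    linear_combination ha - a 2 * F.hab - a 3 * F.hcd
  refine ⟨![v * (a 0 - a 2 * F.a - a 3 * F.c) - u * (a 1 - a 2 * F.b - a 3 * F.d), a 2, a 3], ?_⟩
  ext i
  fin_cases i
  · simp only [vec, Matrix.cons_val, Fin.zero_eta]
    linear_combination (a 0 - a 2 * F.a - a 3 * F.c) * huv - u * h
  · simp only [vec, Matrix.cons_val, Fin.mk_one]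
    linear_combination (a 1 - a 2 * F.b - a 3 * F.d) * huv - v * h
  · simp [vec]
  · simp [vec]

theorem vec_sub (F : Frame x) (s t : Fin 3 → ℤ) (i : Fin 4) :
    F.vec s i - F.vec t i = F.vec (fun j => s j - t j) i := by
  fin_cases i <;> simp [vec] <;> ring

theorem dvd_vec (F : Frame x) {n : ℤ} {s : Fin 3 → ℤ} (h : ∀ i, n ∣ s i) (i : Fin 4) :
    n ∣ F.vec s i := by
  have h0 := h 0
  have h1 := h 1
  have h2 := h 2
  fin_cases i
  · exact ((h0.mul_right _).add (h1.mul_right _)).add (h2.mul_right _)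
  · exact (((h0.mul_right _).neg_right).add (h1.mul_right _)).add (h2.mul_right _)
  · exact h1
  · exact h2

theorem dvd_of_dvd_vec (F : Frame x) (hx : IsCoprime (x 0) (x 1)) {n : ℤ} {s : Fin 3 → ℤ}
    (h : ∀ i, n ∣ F.vec s i) (i : Fin 3) : n ∣ s i := by
  obtain ⟨u, v, huv⟩ := hx
  have h1 : n ∣ s 1 := by simpa [vec] using h 2
  have h2 : n ∣ s 2 := by simpa [vec] using h 3
  have h0 : n ∣ s 0 := by
    have e0 : n ∣ s 0 * x 1 + s 1 * F.a + s 2 * F.c := by simpa [vec] using h 0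
    have e1 : n ∣ -(s 0 * x 0) + s 1 * F.b + s 2 * F.d := by simpa [vec] using h 1
    have e2 : n ∣ s 0 * x 1 := by
      have := (e0.sub (h1.mul_right F.a)).sub (h2.mul_right F.c)
      refine this.trans (dvd_of_eq (by ring))
    have e3 : n ∣ s 0 * x 0 := by
      have := ((h1.mul_right F.b).add (h2.mul_right F.d)).sub e1
      refine this.trans (dvd_of_eq (by ring))
    refine ((e3.mul_left u).add (e2.mul_left v)).trans (dvd_of_eq ?_)
    linear_combination s 0 * huv
  fin_cases i
  · exact h0
  · exact h1
  · exact h2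

/-- With `dvd_minor_of_dvd_form` this shows that the content of the form is the gcd of the minors.
An entry `f` of the form satisfies that `x 0 * f` and `x 1 * f` are integer combinations of minors,
and `u * x 0 + v * x 1 = 1` recovers `f`. -/
theorem minorGcd_dvd_form (F : Frame x) (hx : IsCoprime (x 0) (x 1)) (y : Fin 4 → ℤ)
    (i : Fin 3) : (minorGcd x y : ℤ) ∣ F.form y i := by
  obtain ⟨u, v, huv⟩ := hx
  have h := minorGcd_dvd x y
  have e1 := F.hab
  have e2 := F.hcd
  fin_cases i
  · exact (h 0 1).neg_right
  · have h1 := ((h 0 2).add ((h 0 1).mul_right F.b)).mul_left u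
    have h2 := ((h 1 2).sub ((h 0 1).mul_right F.a)).mul_left v
    refine (h1.add h2).trans (dvd_of_eq ?_)
    simp only [form, minor, Matrix.cons_val, Fin.mk_one]
    linear_combination (y 0 * F.a + y 1 * F.b + y 2) * huv - (u * y 0 + v * y 1) * e1
  · have h1 := ((h 0 3).add ((h 0 1).mul_right F.d)).mul_left u
    have h2 := ((h 1 3).sub ((h 0 1).mul_right F.c)).mul_left v
    refine (h1.add h2).trans (dvd_of_eq ?_)
    simp only [form, minor, Matrix.cons_val, Fin.reduceFinMk]
    linear_combination (y 0 * F.c + y 1 * F.d + y 3) * huv - (u * y 0 + v * y 1) * e2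

theorem dvd_minor_of_dvd_form (F : Frame x) {y : Fin 4 → ℤ} {n : ℤ}
    (h : ∀ i, n ∣ F.form y i) (i j : Fin 4) : n ∣ minor x y i j := by
  have h0 : n ∣ minor x y 0 1 := by simpa [form] using h 0
  have h1 : n ∣ y 0 * F.a + y 1 * F.b + y 2 := by simpa [form] using h 1
  have h2 : n ∣ y 0 * F.c + y 1 * F.d + y 3 := by simpa [form] using h 2
  have e1 := F.hab
  have e2 := F.hcd
  have m02 : n ∣ minor x y 0 2 := ((h1.mul_left (x 0)).sub (h0.mul_left F.b)).trans
    (dvd_of_eq (by unfold minor; linear_combination y 0 * e1))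
  have m12 : n ∣ minor x y 1 2 := ((h1.mul_left (x 1)).add (h0.mul_left F.a)).trans
    (dvd_of_eq (by unfold minor; linear_combination y 1 * e1))
  have m03 : n ∣ minor x y 0 3 := ((h2.mul_left (x 0)).sub (h0.mul_left F.d)).trans
    (dvd_of_eq (by unfold minor; linear_combination y 0 * e2))
  have m13 : n ∣ minor x y 1 3 := ((h2.mul_left (x 1)).add (h0.mul_left F.c)).trans
    (dvd_of_eq (by unfold minor; linear_combination y 1 * e2))
  have m23 : n ∣ minor x y 2 3 := by
    have := ((h2.mul_left (x 2)).sub (h1.mul_left (x 3))).add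
      (h0.mul_left (F.a * F.d - F.c * F.b))
    refine this.trans (dvd_of_eq ?_)
    unfold minor
    linear_combination (F.c * y 0 + F.d * y 1) * e1 - (F.a * y 0 + F.b * y 1) * e2
  have hneg : ∀ i j, n ∣ minor x y i j → n ∣ minor x y j i := fun i j h =>
    h.neg_right.trans (dvd_of_eq (by unfold minor; ring))
  have hz : ∀ i, n ∣ minor x y i i := fun i => by
    have : minor x y i i = 0 := by unfold minor; ring
    rw [this]; exact dvd_zero _
  fin_cases i <;> fin_cases j <;>
    simp only [Fin.zero_eta, Fin.mk_one, Fin.reduceFinMk] <;>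
    first | exact hz _ | assumption | (apply hneg; assumption)

/-- The gcd `g` of the entries of the form divides all minors, hence `G`; a Bézout relation for `g`,
multiplied by `G / g`, gives `t`. -/
theorem exists_bezout_form (F : Frame x) (hx : IsCoprime (x 0) (x 1)) {y : Fin 4 → ℤ}
    (hG : 0 < minorGcd x y) : ∃ h' t : Fin 3 → ℤ,
      (∀ i, F.form y i = minorGcd x y * h' i) ∧ ∑ i, h' i * t i = 1 := by
  choose h' hh' using F.minorGcd_dvd_form hx y
  set g := Int.gcd (F.form y 0) (Int.gcd (F.form y 1) (F.form y 2)) with hg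
  have hgd : ∀ i, (g : ℤ) ∣ F.form y i := by
    have h12 : (g : ℤ) ∣ (Int.gcd (F.form y 1) (F.form y 2) : ℤ) := Int.gcd_dvd_right _ _
    intro i
    fin_cases i
    · exact Int.gcd_dvd_left _ _
    · exact h12.trans (Int.gcd_dvd_left _ _)
    · exact h12.trans (Int.gcd_dvd_right _ _)
  have hgG : (g : ℤ) ∣ minorGcd x y :=
    Int.natCast_dvd_natCast.mpr (dvd_minorGcd (F.dvd_minor_of_dvd_form hgd))
  obtain ⟨k, hk⟩ := hgG
  obtain ⟨α, β, b1⟩ : ∃ α β, (g : ℤ) = F.form y 0 * α + Int.gcd (F.form y 1) (F.form y 2) * β :=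
    ⟨_, _, Int.gcd_eq_gcd_ab _ _⟩
  obtain ⟨u, v, b2⟩ : ∃ u v, (Int.gcd (F.form y 1) (F.form y 2) : ℤ)
    = F.form y 1 * u + F.form y 2 * v := ⟨_, _, Int.gcd_eq_gcd_ab _ _⟩
  refine ⟨h', ![α * k, β * u * k, β * v * k], hh', ?_⟩
  have hG' : (minorGcd x y : ℤ) ≠ 0 := by exact_mod_cast hG.ne'
  apply mul_left_cancel₀ hG'
  simp only [Fin.sum_univ_three, Matrix.cons_val]
  linear_combination (-(α * k)) * hh' 0 - (β * u * k) * hh' 1 - (β * v * k) * hh' 2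
    - β * k * b2 - k * b1 - hk

end Frame

/-- The coefficient of `x 0` may be reduced modulo `x 1`; the relation then bounds the coefficient
of `x 1` by `x 0 + x i`. Short basis vectors keep the later displacement errors of order `B`. -/
theorem exists_frame {x : Fin 4 → ℤ} {B : ℝ} (hx : IsCoprime (x 0) (x 1)) (h0 : ∀ i, 1 ≤ x i)
    (hB : ∀ i, |(x i : ℝ)| ≤ B) : ∃ F : Frame x, |(F.a : ℝ)| ≤ 2 * B ∧ |(F.b : ℝ)| ≤ 2 * B ∧
      |(F.c : ℝ)| ≤ 2 * B ∧ |(F.d : ℝ)| ≤ 2 * B := by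
  have key : ∀ i, ∃ a b : ℤ, x 0 * a + x 1 * b + x i = 0 ∧ |(a : ℝ)| ≤ 2 * B ∧ |(b : ℝ)| ≤ 2 * B := by
    intro i
    obtain ⟨u, v, huv⟩ := hx
    have hx1 : 0 < x 1 := h0 1
    have ha0 := Int.emod_nonneg (-(u * x i)) hx1.ne'
    have ha1 := Int.emod_lt_of_pos (-(u * x i)) hx1
    have hdiv := Int.emod_add_mul_ediv (-(u * x i)) (x 1)
    set a := (-(u * x i)) % x 1
    set k := (-(u * x i)) / x 1
    have heq : x 0 * a + x 1 * (x 0 * k - v * x i) + x i = 0 := by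
      linear_combination x 0 * hdiv - x i * huv
    refine ⟨a, x 0 * k - v * x i, heq, ?_, ?_⟩
    · have h1 : (a : ℝ) ≤ x 1 := by exact_mod_cast ha1.le
      have h2 : (0 : ℝ) ≤ a := by exact_mod_cast ha0
      rw [abs_of_nonneg h2]
      have := (le_abs_self _).trans (hB 1)
      linarith
    · set b := x 0 * k - v * x i
      have h1 : |x 1 * b| ≤ x 1 * x 0 + x 1 * x i := by
        have e : x 1 * b = -(x 0 * a + x i) := by linarith
        have := h0 0
        have := h0 i
        rw [e, abs_neg, abs_of_nonneg (by positivity)]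
        nlinarith
      rw [abs_mul, abs_of_pos hx1, ← mul_add] at h1
      have h2 : |b| ≤ x 0 + x i := le_of_mul_le_mul_left h1 hx1
      have h3 : |(b : ℝ)| ≤ x 0 + x i := by exact_mod_cast h2
      have := (le_abs_self _).trans (hB 0)
      have := (le_abs_self _).trans (hB i)
      linarith
  obtain ⟨a, b, h1, ha, hb⟩ := key 2
  obtain ⟨c, d, h2, hc, hd⟩ := key 3
  exact ⟨⟨a, b, c, d, h1, h2⟩, ha, hb, hc, hd⟩


/-! ### Points of the rank two lattice orthogonal to two vectors -/

/-- The Euclidean norm of a real vector given by its entries. -/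
noncomputable def l2 {n : ℕ} (t : Fin n → ℝ) : ℝ := ‖(WithLp.toLp 2 t : EuclideanSpace ℝ (Fin n))‖

theorem norm_euc {n : ℕ} (a : Fin n → ℤ) : ‖euc a‖ = l2 fun i => (a i : ℝ) := rfl

theorem l2_nonneg {n : ℕ} (t : Fin n → ℝ) : 0 ≤ l2 t := norm_nonneg _

theorem l2_sq {n : ℕ} (t : Fin n → ℝ) : l2 t ^ 2 = ∑ i, t i ^ 2 := by
  simp [l2, EuclideanSpace.norm_sq_eq]

theorem l2_add_le {n : ℕ} (s t : Fin n → ℝ) : l2 (fun i => s i + t i) ≤ l2 s + l2 t :=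
  norm_add_le (WithLp.toLp 2 s : EuclideanSpace ℝ (Fin n)) (WithLp.toLp 2 t)

theorem l2_mul {n : ℕ} (c : ℝ) (t : Fin n → ℝ) : l2 (fun i => c * t i) = |c| * l2 t :=
  norm_smul c (WithLp.toLp 2 t : EuclideanSpace ℝ (Fin n))

theorem abs_dot_le {n : ℕ} (s t : Fin n → ℝ) : |∑ i, s i * t i| ≤ l2 s * l2 t := by
  have h := abs_real_inner_le_norm (WithLp.toLp 2 t : EuclideanSpace ℝ (Fin n)) (WithLp.toLp 2 s)
  simp only [PiLp.inner_apply, RCLike.inner_apply, conj_trivial] at h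
  rw [mul_comm (l2 s)]
  exact h

theorem abs_le_l2 {n : ℕ} (t : Fin n → ℝ) (i : Fin n) : |t i| ≤ l2 t :=
  PiLp.norm_apply_le (WithLp.toLp 2 t : EuclideanSpace ℝ (Fin n)) i

theorem l2_le_of_abs_le {t : Fin 4 → ℝ} {M : ℝ} (hM : 0 ≤ M) (h : ∀ i, |t i| ≤ M) :
    l2 t ≤ 2 * M := by
  apply le_of_sq_le_sq _ (by positivity)
  rw [l2_sq]
  calc ∑ i, t i ^ 2 ≤ ∑ _i : Fin 4, M ^ 2 := Finset.sum_le_sum fun i _ => by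
        rw [← sq_abs]; exact pow_le_pow_left₀ (abs_nonneg _) (h i) 2
    _ = (2 * M) ^ 2 := by simp; ring

/-- The vector `c (m₁₂, -m₀₂, m₀₁, 0) + d (m₁₃, -m₀₃, 0, m₀₁)`, where `m` are the minors of `x`
and `y`; it is orthogonal to `x` and `y`. -/
noncomputable def planeVec (x y : Fin 4 → ℤ) (c d : ℝ) : Fin 4 → ℝ :=
  ![c * minor x y 1 2 + d * minor x y 1 3, -(c * minor x y 0 2) - d * minor x y 0 3,
    c * minor x y 0 1, d * minor x y 0 1]

/-- The squared norm of `planeVec x y c d`, as a quadratic form in `c` and `d`. -/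
noncomputable def planeForm (x y : Fin 4 → ℤ) (c d : ℝ) : ℝ :=
  quadForm ((minor x y 1 2 : ℝ) ^ 2 + (minor x y 0 2 : ℝ) ^ 2 + (minor x y 0 1 : ℝ) ^ 2)
    (minor x y 1 2 * minor x y 1 3 + minor x y 0 2 * minor x y 0 3)
    ((minor x y 1 3 : ℝ) ^ 2 + (minor x y 0 3 : ℝ) ^ 2 + (minor x y 0 1 : ℝ) ^ 2) c d

theorem l2_planeVec_sq (x y : Fin 4 → ℤ) (c d : ℝ) :
    l2 (planeVec x y c d) ^ 2 = planeForm x y c d := by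
  simp only [l2_sq, Fin.sum_univ_four, planeVec, planeForm, quadForm, Matrix.cons_val]
  ring

/-- Rests on the Plücker relation `m₀₁ m₂₃ - m₀₂ m₁₃ + m₀₃ m₁₂ = 0` together with Lagrange's
identity. -/
theorem planeForm_disc (x y : Fin 4 → ℤ) :
    ((minor x y 1 2 : ℝ) ^ 2 + (minor x y 0 2 : ℝ) ^ 2 + (minor x y 0 1 : ℝ) ^ 2) *
    ((minor x y 1 3 : ℝ) ^ 2 + (minor x y 0 3 : ℝ) ^ 2 + (minor x y 0 1 : ℝ) ^ 2) -
    (minor x y 1 2 * minor x y 1 3 + minor x y 0 2 * minor x y 0 3 : ℝ) ^ 2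
    = (minor x y 0 1 : ℝ) ^ 2 * wedgeSq x y := by
  rw [wedgeSq_eq]
  simp only [minor]
  push_cast
  ring

theorem planeForm_lead_pos {x y : Fin 4 → ℤ} (h : minor x y 0 1 ≠ 0) :
    0 < (minor x y 1 2 : ℝ) ^ 2 + (minor x y 0 2 : ℝ) ^ 2 + (minor x y 0 1 : ℝ) ^ 2 := by
  have : (minor x y 0 1 : ℝ) ≠ 0 := by exact_mod_cast h
  positivity

theorem wedgeSq_cast_pos {x y : Fin 4 → ℤ} (h : minor x y 0 1 ≠ 0) :
    (0 : ℝ) < wedgeSq x y := by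
  exact_mod_cast (Indep.wedgeSq_pos ⟨0, 1, h⟩)

theorem planeForm_disc_pos {x y : Fin 4 → ℤ} (h : minor x y 0 1 ≠ 0) :
    0 < ((minor x y 1 2 : ℝ) ^ 2 + (minor x y 0 2 : ℝ) ^ 2 + (minor x y 0 1 : ℝ) ^ 2) *
    ((minor x y 1 3 : ℝ) ^ 2 + (minor x y 0 3 : ℝ) ^ 2 + (minor x y 0 1 : ℝ) ^ 2) -
    (minor x y 1 2 * minor x y 1 3 + minor x y 0 2 * minor x y 0 3 : ℝ) ^ 2 := by
  rw [planeForm_disc]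
  have : (minor x y 0 1 : ℝ) ≠ 0 := by exact_mod_cast h
  have := wedgeSq_cast_pos h
  positivity

theorem sqrt_planeForm_disc (x y : Fin 4 → ℤ) :
    √((minor x y 0 1 : ℝ) ^ 2 * wedgeSq x y) = |(minor x y 0 1 : ℝ)| * √(wedgeSq x y) := by
  rw [Real.sqrt_mul (sq_nonneg _), Real.sqrt_sq_eq_abs]

/-- Cramer's rule for the first two entries of `a`. Thus the last two entries determine `a`, and the
plane can be parametrised by them. -/
theorem minor_mul_eq {x y a : Fin 4 → ℤ} (hx : ∑ i, x i * a i = 0) (hy : ∑ i, y i * a i = 0)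
    (i : Fin 4) : (minor x y 0 1 : ℝ) * a i = planeVec x y (a 2) (a 3) i := by
  rw [Fin.sum_univ_four] at hx hy
  have hx' : (x 0 * a 0 + x 1 * a 1 + x 2 * a 2 + x 3 * a 3 : ℝ) = 0 := by exact_mod_cast hx
  have hy' : (y 0 * a 0 + y 1 * a 1 + y 2 * a 2 + y 3 * a 3 : ℝ) = 0 := by exact_mod_cast hy
  fin_cases i <;> simp only [planeVec, minor, Fin.zero_eta, Fin.mk_one, Fin.reduceFinMk,
    Matrix.cons_val] <;> push_cast
  · linear_combination y 1 * hx' - x 1 * hy'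
  · linear_combination x 0 * hy' - y 0 * hx'
  · ring
  · ring

theorem planeVec_add (x y : Fin 4 → ℤ) (c d c' d' : ℝ) :
    planeVec x y (c + c') (d + d') = fun i => planeVec x y c d i + planeVec x y c' d' i := by
  ext i
  fin_cases i <;> simp [planeVec] <;> ring

theorem abs_minor_le {x y : Fin 4 → ℤ} {B : ℝ} (hx : ∀ i, |(x i : ℝ)| ≤ B)
    (hy : ∀ i, |(y i : ℝ)| ≤ B) (i j : Fin 4) : |(minor x y i j : ℝ)| ≤ 2 * B ^ 2 := by
  have hB : 0 ≤ B := (abs_nonneg _).trans (hx 0)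
  have : (minor x y i j : ℝ) = x i * y j - x j * y i := by simp [minor]
  rw [this]
  calc |(x i * y j - x j * y i : ℝ)| ≤ |(x i * y j : ℝ)| + |(x j * y i : ℝ)| := abs_sub _ _
    _ ≤ B * B + B * B := by
        rw [abs_mul, abs_mul]
        have := abs_nonneg (x i : ℝ)
        gcongr
        · exact hx i
        · exact hy j
        · exact hx j
        · exact hy i
    _ = _ := by ring

theorem l2_planeVec_le {x y : Fin 4 → ℤ} {B M : ℝ} (hx : ∀ i, |(x i : ℝ)| ≤ B)
    (hy : ∀ i, |(y i : ℝ)| ≤ B) {c d : ℝ} (hc : |c| ≤ M) (hd : |d| ≤ M) :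
    l2 (planeVec x y c d) ≤ 8 * B ^ 2 * M := by
  have hM : 0 ≤ M := (abs_nonneg _).trans hc
  have h := abs_minor_le hx hy
  have hp : ∀ (e : ℝ) (i j : Fin 4), |e| ≤ M → |e * minor x y i j| ≤ M * (2 * B ^ 2) := by
    intro e i j he
    rw [abs_mul]
    exact mul_le_mul he (h i j) (abs_nonneg _) hM
  refine (l2_le_of_abs_le (M := M * (2 * B ^ 2) + M * (2 * B ^ 2)) (by positivity) ?_).trans
    (by apply le_of_eq; ring)
  have h0 : 0 ≤ M * (2 * B ^ 2) := by positivity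
  intro i
  fin_cases i <;> simp only [planeVec, Fin.zero_eta, Fin.mk_one, Fin.reduceFinMk, Matrix.cons_val]
  · exact (abs_add_le _ _).trans (add_le_add (hp c 1 2 hc) (hp d 1 3 hd))
  · refine (abs_sub _ _).trans (add_le_add ?_ (hp d 0 3 hd))
    rw [abs_neg]; exact hp c 0 2 hc
  · linarith [hp c 0 1 hc]
  · linarith [hp d 0 1 hd]

/-- Points of a rank two lattice in a ball, in one residue class of the coordinates. -/
theorem card_mul_sq_le_area {x y : Fin 4 → ℤ} {A B : ℝ} {Q : ℕ} (hm : minor x y 0 1 ≠ 0)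
    (hx : ∀ i, |(x i : ℝ)| ≤ B) (hy : ∀ i, |(y i : ℝ)| ≤ B)
    (S : Finset (Fin 4 → ℤ)) (hSx : ∀ a ∈ S, ∑ i, x i * a i = 0)
    (hSy : ∀ a ∈ S, ∑ i, y i * a i = 0) (hSA : ∀ a ∈ S, ‖euc a‖ ≤ A)
    (hS2 : ∀ a ∈ S, ∀ a' ∈ S, (Q : ℤ) ∣ a 2 - a' 2)
    (hS3 : ∀ a ∈ S, ∀ a' ∈ S, (Q : ℤ) ∣ a 3 - a' 3) :
    (S.card : ℝ) * (Q : ℝ) ^ 2 ≤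
      Real.pi * (|(minor x y 0 1 : ℝ)| * A + 8 * B ^ 2 * Q) ^ 2 /
        (|(minor x y 0 1 : ℝ)| * √(wedgeSq x y)) := by
  classical
  have hmR : (minor x y 0 1 : ℝ) ≠ 0 := by exact_mod_cast hm
  set T := S.image fun a => (![a 2, a 3] : Fin 2 → ℤ) with hT
  have hcard : T.card = S.card := by
    refine Finset.card_image_of_injOn fun a ha a' ha' heq => ?_
    have e2 : a 2 = a' 2 := by simpa using congrFun heq 0
    have e3 : a 3 = a' 3 := by simpa using congrFun heq 1
    ext i
    have h1 := minor_mul_eq (hSx a ha) (hSy a ha) i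
    have h2 := minor_mul_eq (hSx a' ha') (hSy a' ha') i
    rw [e2, e3, ← h2] at h1
    exact_mod_cast mul_left_cancel₀ hmR h1
  -- In the coordinates `(a 2, a 3)` the ball is an ellipse scaled by the minor. Moving by a cell of
  -- side `Q` changes `planeVec` by at most `8 B² Q`, so the cells lie in this enlarged ellipse.
  set r := (|(minor x y 0 1 : ℝ)| * A + 8 * B ^ 2 * Q) ^ 2
  have h := sum_mul_pow_le_lintegral (Q := Q) T ?_ (fun _ => 1)
    (fun t => iteZero (planeForm x y (t 0) (t 1) ≤ r) 1) (fun _ _ => zero_le_one) ?_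
  · unfold planeForm at h
    rw [lintegral_ofReal_iteZero_const (measurableSet_le (by fun_prop) (by fun_prop))] at h
    have hv := volume_ellipse (planeForm_lead_pos hm) (planeForm_disc_pos hm) r (sq_nonneg _)
    unfold quadForm at h
    rw [hv, ENNReal.ofReal_one, one_mul, planeForm_disc, sqrt_planeForm_disc,
      ENNReal.ofReal_le_ofReal_iff (by positivity)] at h
    simpa [hcard] using h
  · intro s hs s' hs' i
    obtain ⟨a, ha, rfl⟩ := Finset.mem_image.mp hs
    obtain ⟨a', ha', rfl⟩ := Finset.mem_image.mp hs'
    fin_cases i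
    · simpa using hS2 a ha a' ha'
    · simpa using hS3 a ha a' ha'
  · intro s hs t ht
    obtain ⟨a, ha, rfl⟩ := Finset.mem_image.mp hs
    have h0 := ht 0
    have h1 := ht 1
    simp only [Matrix.cons_val] at h0 h1
    rw [iteZero_pos]
    rw [← l2_planeVec_sq]
    apply pow_le_pow_left₀ (l2_nonneg _)
    have e := planeVec_add x y (a 2) (a 3) (t 0 - a 2) (t 1 - a 3)
    rw [add_sub_cancel, add_sub_cancel] at e
    rw [e]
    refine (l2_add_le _ _).trans (add_le_add ?_ (l2_planeVec_le hx hy ?_ ?_))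
    · have e2 : planeVec x y (a 2) (a 3) = fun i => (minor x y 0 1 : ℝ) * a i :=
        funext fun i => (minor_mul_eq (hSx a ha) (hSy a ha) i).symm
      rw [e2, l2_mul]
      exact mul_le_mul_of_nonneg_left (hSA a ha) (abs_nonneg _)
    · rw [abs_le]; constructor <;> linarith [(Nat.cast_nonneg Q : (0 : ℝ) ≤ Q)]
    · rw [abs_le]; constructor <;> linarith [(Nat.cast_nonneg Q : (0 : ℝ) ≤ Q)]

open scoped Classical in
/-- The number of primitive points of a rank two lattice in a ball. -/
theorem card_orth_orth_le {x y : Fin 4 → ℤ} {A B : ℝ} {W : ℕ} (hW : 0 < W)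
    (hm : minor x y 0 1 ≠ 0) (hcop : IsCoprime (x 0) (x 1))
    (hx : ∀ i, |(x i : ℝ)| ≤ B) (hy : ∀ i, |(y i : ℝ)| ≤ B)
    (F : Frame x) (h' t : Fin 3 → ℤ) (hh' : ∀ i, F.form y i = minorGcd x y * h' i)
    (ht : ∑ i, h' i * t i = 1)
    (S : Finset (Fin 4 → ℤ)) (hSx : ∀ a ∈ S, ∑ i, x i * a i = 0)
    (hSy : ∀ a ∈ S, ∑ i, y i * a i = 0) (hSA : ∀ a ∈ S, ‖euc a‖ ≤ A)
    (hSW : ∀ a ∈ S, PrimitiveAt W a) :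
    (S.card : ℝ) ≤ Real.pi * (A + 8 * B ^ 2 * W) ^ 2 * minorGcd x y * (kernelSet W h').card /
      ((W : ℝ) ^ 2 * √(wedgeSq x y)) := by
  have hG : 0 < minorGcd x y := Indep.minorGcd_pos ⟨0, 1, hm⟩
  set G := minorGcd x y
  set m := (minor x y 0 1).natAbs with hmdef
  have hm0 : 0 < m := Int.natAbs_pos.mpr hm
  have hmabs : |(minor x y 0 1 : ℝ)| = m := by
    rw [hmdef, Nat.cast_natAbs, Int.cast_abs]
  have hΔ := Real.sqrt_pos.mpr (wedgeSq_cast_pos hm)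
  have hex : ∀ a : Fin 4 → ℤ, ∑ i, x i * a i = 0 → ∃ s, F.vec s = a :=
    fun a ha => F.exists_vec_eq hcop ha
  choose! s hs using hex
  have hsa : ∀ a ∈ S, F.vec (s a) = a := fun a ha => hs a (hSx a ha)
  have hs1 : ∀ a ∈ S, s a 1 = a 2 := fun a ha => by
    conv_rhs => rw [← hsa a ha]
    simp [Frame.vec]
  have hs2 : ∀ a ∈ S, s a 2 = a 3 := fun a ha => by
    conv_rhs => rw [← hsa a ha]
    simp [Frame.vec]
  have hform : ∀ a ∈ S, ∑ i, F.form y i * s a i = 0 := fun a ha => by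
    rw [← F.sum_mul_vec_eq, hsa a ha]; exact hSy a ha
  have hform' : ∀ a ∈ S, ∑ i, h' i * s a i = 0 := fun a ha => by
    have h1 := hform a ha
    have h2 : ∑ i, F.form y i * s a i = G * ∑ i, h' i * s a i := by
      rw [Finset.mul_sum]
      exact Finset.sum_congr rfl fun i _ => by rw [hh']; ring
    rw [h2] at h1
    exact (mul_eq_zero.mp h1).resolve_left (by exact_mod_cast hG.ne')
  -- Modulo `m = |m₀₁|` the first coordinate drops out of the form, so a zero of the form imposes
  -- one congruence on the other two. Since `t` represents `G`, it has at most `m G` solutions.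
  set K := (residues m 2).filter fun κ => (m : ℤ) ∣ ∑ i, ![F.form y 1, F.form y 2] i * κ i
  have hK : K.card ≤ m * G := by
    have := card_filter_dvd_mul_le hm0 ![F.form y 1, F.form y 2] ![t 1, t 2] hG ?_
    · have h2 : K.card * m ≤ (m * G) * m := this.trans (le_of_eq (by ring))
      exact Nat.le_of_mul_le_mul_right h2 hm0
    · have h0 := hh' 0
      have h1 := hh' 1
      have h2 := hh' 2
      rw [Fin.sum_univ_three] at ht
      simp only [Fin.sum_univ_two, Matrix.cons_val_zero, Matrix.cons_val_one]
      have e : F.form y 1 * t 1 + F.form y 2 * t 2 - G = minor x y 0 1 * t 0 := by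
        have h0' : -minor x y 0 1 = G * h' 0 := h0
        rw [h1, h2]
        linear_combination (G : ℤ) * ht + t 0 * h0'
      rw [e]
      exact (Int.natAbs_dvd.mpr dvd_rfl).mul_right _
  -- The area bound for cells of side `m W`, after cancelling `m`. Multiplied by the `m G` classes
  -- modulo `m` and the kernel classes modulo `W`, it gives the claim.
  set Z := Real.pi * (A + 8 * B ^ 2 * W) ^ 2 / ((W : ℝ) ^ 2 * √(wedgeSq x y) * m) with hZ
  have hZ0 : 0 ≤ Z := by positivity
  have hcell : ∀ S' ⊆ S, (∀ a ∈ S', ∀ a' ∈ S', ((m * W : ℕ) : ℤ) ∣ a 2 - a' 2) →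
      (∀ a ∈ S', ∀ a' ∈ S', ((m * W : ℕ) : ℤ) ∣ a 3 - a' 3) → (S'.card : ℝ) ≤ Z := by
    intro S' hS' h2 h3
    have := card_mul_sq_le_area hm hx hy S' (fun a ha => hSx a (hS' ha))
      (fun a ha => hSy a (hS' ha)) (fun a ha => hSA a (hS' ha)) h2 h3
    rw [hmabs] at this
    have hmR : (0 : ℝ) < m := by exact_mod_cast hm0
    have hWR : (0 : ℝ) < W := by exact_mod_cast hW
    rw [← le_div_iff₀ (by positivity)] at this
    refine this.trans (le_of_eq ?_)
    rw [hZ]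
    push_cast
    field_simp
  have hfib : ∀ r ∈ kernelSet W h', ((S.filter fun a => modVec W (s a) = r).card : ℝ)
      ≤ (m * G : ℕ) * Z := by
    intro r _
    set S₁ := S.filter fun a => modVec W (s a) = r
    rcases S₁.eq_empty_or_nonempty with h0 | ⟨a₀, ha₀⟩
    · rw [h0]; simp; positivity
    have hS₁ : ∀ a ∈ S₁, a ∈ S ∧ modVec W (s a) = r := fun a ha => Finset.mem_filter.mp ha
    have hdiff : ∀ a ∈ S₁, ∀ i, s a i - s a₀ i = W * (s a i / W - s a₀ i / W) := by
      intro a ha i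
      have e1 := congrFun (hS₁ a ha).2 i
      have e2 := congrFun (hS₁ a₀ ha₀).2 i
      simp only [modVec] at e1 e2
      have d1 := Int.emod_add_mul_ediv (s a i) W
      have d2 := Int.emod_add_mul_ediv (s a₀ i) W
      linear_combination e1 - e2 - d1 + d2
    -- Within a class modulo `W`, differences from a base point are divisible by `W`; the quotients
    -- modulo `m` decide the class of `(a 2, a 3)` modulo `m W`.
    let κ : (Fin 4 → ℤ) → Fin 2 → ℤ := fun a =>
      modVec m ![s a 1 / W - s a₀ 1 / W, s a 2 / W - s a₀ 2 / W]
    have hκ : ∀ a ∈ S₁, κ a ∈ K := by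
      intro a ha
      refine Finset.mem_filter.mpr ⟨modVec_mem hm0 _, ?_⟩
      refine (dvd_sum_mul_iff _ (dvd_modVec_sub m _)).mpr ?_
      simp only [Fin.sum_univ_two, Matrix.cons_val_zero, Matrix.cons_val_one]
      have e1 := hform a (hS₁ a ha).1
      have e2 := hform a₀ (hS₁ a₀ ha₀).1
      rw [Fin.sum_univ_three] at e1 e2
      have d0 := hdiff a ha 0
      have d1 := hdiff a ha 1
      have d2 := hdiff a ha 2
      have e3 : (W : ℤ) * (F.form y 1 * (s a 1 / W - s a₀ 1 / W)
          + F.form y 2 * (s a 2 / W - s a₀ 2 / W)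
          - minor x y 0 1 * (s a 0 / W - s a₀ 0 / W)) = 0 := by
        have h0 : F.form y 0 = -minor x y 0 1 := rfl
        rw [h0] at e1 e2
        linear_combination e1 - e2 - F.form y 1 * d1 - F.form y 2 * d2 + minor x y 0 1 * d0
      have e4 := (mul_eq_zero.mp e3).resolve_left (by exact_mod_cast hW.ne')
      rw [sub_eq_zero.mp e4]
      exact (Int.natAbs_dvd.mpr dvd_rfl).mul_right _
    rw [Finset.card_eq_sum_card_fiberwise hκ]
    push_cast
    calc ∑ k ∈ K, ((S₁.filter fun a => κ a = k).card : ℝ) ≤ ∑ k ∈ K, Z := by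
          refine Finset.sum_le_sum fun k _ => hcell _ ?_ ?_ ?_
          · exact (Finset.filter_subset _ _).trans (Finset.filter_subset _ _)
          all_goals
            intro a ha a' ha'
            obtain ⟨ha1, ha2⟩ := Finset.mem_filter.mp ha
            obtain ⟨ha1', ha2'⟩ := Finset.mem_filter.mp ha'
            have hd := dvd_sub_of_modVec_eq (ha2.trans ha2'.symm)
          · rw [← hs1 a (hS₁ a ha1).1, ← hs1 a' (hS₁ a' ha1').1]
            have e := hdiff a ha1 1
            have e' := hdiff a' ha1' 1
            have h0 := hd 0
            simp only [Matrix.cons_val_zero] at h0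
            have : s a 1 - s a' 1 = (s a 1 / W - s a₀ 1 / W - (s a' 1 / W - s a₀ 1 / W)) * W := by
              linear_combination e - e'
            rw [this]; push_cast
            exact mul_dvd_mul_right h0 _
          · rw [← hs2 a (hS₁ a ha1).1, ← hs2 a' (hS₁ a' ha1').1]
            have e := hdiff a ha1 2
            have e' := hdiff a' ha1' 2
            have h0 := hd 1
            simp only [Matrix.cons_val_one] at h0
            have : s a 2 - s a' 2 = (s a 2 / W - s a₀ 2 / W - (s a' 2 / W - s a₀ 2 / W)) * W := by
              linear_combination e - e'
            rw [this]; push_cast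
            exact mul_dvd_mul_right h0 _
      _ = K.card * Z := by rw [Finset.sum_const, nsmul_eq_mul]
      _ ≤ (m * G : ℕ) * Z := by gcongr
      _ = _ := by push_cast; ring
  have hkey : ∀ a ∈ S, modVec W (s a) ∈ kernelSet W h' := by
    intro a ha
    refine modVec_mem_kernelSet hW (by rw [hform' a ha]; exact dvd_zero _) fun p hp hpW => ?_
    by_contra hc
    push Not at hc
    obtain ⟨i, hi⟩ := hSW a ha p hp hpW
    apply hi
    rw [← hsa a ha]
    exact F.dvd_vec hc i
  rw [Finset.card_eq_sum_card_fiberwise hkey]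
  push_cast
  calc _ ≤ ∑ r ∈ kernelSet W h', (m * G : ℕ) * Z := Finset.sum_le_sum hfib
    _ = _ := by
        rw [Finset.sum_const, nsmul_eq_mul, hZ]
        have hmR : (0 : ℝ) < m := by exact_mod_cast hm0
        have hWR : (0 : ℝ) < W := by exact_mod_cast hW
        push_cast
        field_simp


/-! ### Volume of the vectors almost orthogonal to two vectors -/

/-- The component of `y` orthogonal to `x`, multiplied by `‖x‖²`. -/
noncomputable def orthPart (x y : Fin 4 → ℤ) (i : Fin 4) : ℝ :=
  (∑ j, (x j : ℝ) ^ 2) * y i - (∑ j, (x j : ℝ) * y j) * x i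

/-- The real vector with coordinates `u` with respect to `x`, `orthPart x y`, and the basis vectors
of `planeVec x y`. -/
noncomputable def orthVec (x y : Fin 4 → ℤ) (u : Fin 4 → ℝ) : Fin 4 → ℝ :=
  fun i => u 0 * x i + u 1 * orthPart x y i + planeVec x y (u 2) (u 3) i

theorem wedgeSq_cast (x y : Fin 4 → ℤ) : (wedgeSq x y : ℝ) =
    (∑ i, (x i : ℝ) ^ 2) * (∑ i, (y i : ℝ) ^ 2) - (∑ i, (x i : ℝ) * y i) ^ 2 := by
  simp [wedgeSq]

/-- The vectors `x`, `orthPart x y` and the plane are mutually orthogonal, and `orthPart x y` has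
squared norm `‖x‖² Δ`. -/
theorem l2_orthVec_sq (x y : Fin 4 → ℤ) (u : Fin 4 → ℝ) : l2 (orthVec x y u) ^ 2 =
    (u 0 ^ 2 * (∑ i, (x i : ℝ) ^ 2) + u 1 ^ 2 * ((∑ i, (x i : ℝ) ^ 2) * wedgeSq x y))
      + planeForm x y (u 2) (u 3) := by
  rw [l2_sq, wedgeSq_cast]
  simp only [orthVec, orthPart, planeVec, planeForm, quadForm, minor, Fin.sum_univ_four,
    Matrix.cons_val]
  push_cast
  ring

theorem dot_orthVec (x y : Fin 4 → ℤ) (u : Fin 4 → ℝ) :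
    ∑ i, (x i : ℝ) * orthVec x y u i = u 0 * ∑ i, (x i : ℝ) ^ 2 := by
  simp only [orthVec, orthPart, planeVec, minor, Fin.sum_univ_four, Matrix.cons_val]
  push_cast
  ring

theorem dot_orthVec' (x y : Fin 4 → ℤ) (u : Fin 4 → ℝ) :
    ∑ i, (y i : ℝ) * orthVec x y u i
      = u 0 * (∑ i, (x i : ℝ) * y i) + u 1 * wedgeSq x y := by
  rw [wedgeSq_cast]
  simp only [orthVec, orthPart, planeVec, minor, Fin.sum_univ_four, Matrix.cons_val]
  push_cast
  ring

/-- By the same orthogonality the determinant is, up to sign, the product of `‖x‖`, `‖x‖ √Δ` and the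
area `|m₀₁| √Δ` of the basis of the plane. -/
theorem abs_det_orthVec (x y : Fin 4 → ℤ) : ∃ M : Matrix (Fin 4) (Fin 4) ℝ,
    (∀ u, M.mulVec u = orthVec x y u) ∧
    |M.det| = (∑ i, (x i : ℝ) ^ 2) * |(minor x y 0 1 : ℝ)| * wedgeSq x y := by
  refine ⟨Matrix.of fun i j => ![(x i : ℝ), orthPart x y i, planeVec x y 1 0 i,
    planeVec x y 0 1 i] j, ?_, ?_⟩
  · intro u
    ext i
    simp only [Matrix.mulVec, dotProduct, Matrix.of_apply, Fin.sum_univ_four, Matrix.cons_val,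
      orthVec]
    have : planeVec x y (u 2) (u 3) i = planeVec x y 1 0 i * u 2 + planeVec x y 0 1 i * u 3 := by
      fin_cases i <;> simp [planeVec] <;> ring
    rw [this]
    ring
  · have hΔ : (0 : ℝ) ≤ wedgeSq x y := by exact_mod_cast wedgeSq_nonneg x y
    have hX : 0 ≤ ∑ i, (x i : ℝ) ^ 2 := Finset.sum_nonneg fun _ _ => sq_nonneg _
    rw [← abs_of_nonneg hX, ← abs_of_nonneg hΔ, ← abs_mul, ← abs_mul]
    congr 1
    rw [wedgeSq_cast]
    simp [Matrix.det_succ_row_zero, Fin.sum_univ_succ, Fin.succAbove, planeVec, orthPart, minor]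
    ring

/-- The function `k / ‖t‖²` on the vectors `t` of norm at most `A` that are almost orthogonal to
`x` and `y`. -/
noncomputable def coneFun (x y : Fin 4 → ℤ) (A κ k : ℝ) (t : Fin 4 → ℝ) : ℝ :=
  iteZero (l2 t ≤ A ∧ |∑ i, (x i : ℝ) * t i| ≤ κ * ‖euc x‖ * l2 t ∧
    |∑ i, (y i : ℝ) * t i| ≤ κ * ‖euc y‖ * l2 t) (k / l2 t ^ 2)

@[fun_prop]
theorem measurable_l2 {n : ℕ} : Measurable (l2 : (Fin n → ℝ) → ℝ) := by
  unfold l2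
  fun_prop

theorem measurable_coneFun (x y : Fin 4 → ℤ) (A κ k : ℝ) : Measurable (coneFun x y A κ k) := by
  refine measurable_iteZero (measurableSet_and ?_ (measurableSet_and ?_ ?_)) (by fun_prop) <;>
    exact measurableSet_le (by fun_prop) (by fun_prop)

theorem norm_euc_sq {n : ℕ} (x : Fin n → ℤ) : ‖euc x‖ ^ 2 = ∑ i, (x i : ℝ) ^ 2 := by
  rw [norm_euc, l2_sq]

theorem planeForm_nonneg {x y : Fin 4 → ℤ} (c d : ℝ) : 0 ≤ planeForm x y c d := by
  rw [← l2_planeVec_sq]; exact sq_nonneg _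

theorem planeForm_le (x y : Fin 4 → ℤ) (u : Fin 4 → ℝ) :
    planeForm x y (u 2) (u 3) ≤ l2 (orthVec x y u) ^ 2 := by
  rw [l2_orthVec_sq]
  have h1 : (0 : ℝ) ≤ wedgeSq x y := by exact_mod_cast wedgeSq_nonneg x y
  have h2 : 0 ≤ ∑ i, (x i : ℝ) ^ 2 := Finset.sum_nonneg fun _ _ => sq_nonneg _
  have : 0 ≤ u 0 ^ 2 * (∑ i, (x i : ℝ) ^ 2)
      + u 1 ^ 2 * ((∑ i, (x i : ℝ) ^ 2) * wedgeSq x y) := by positivity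
  linarith

theorem norm_euc_pos_of_minor {x y : Fin 4 → ℤ} (hm : minor x y 0 1 ≠ 0) :
    0 < ‖euc x‖ ∧ 0 < ‖euc y‖ := by
  have h := wedgeSq_cast_pos hm
  rw [wedgeSq_cast, ← norm_euc_sq, ← norm_euc_sq] at h
  have h2 : 0 < ‖euc x‖ ^ 2 * ‖euc y‖ ^ 2 := by nlinarith [sq_nonneg (∑ i, (x i : ℝ) * y i)]
  constructor
  · refine (norm_nonneg _).lt_of_ne fun h0 => ?_
    rw [← h0] at h2; simp at h2
  · refine (norm_nonneg _).lt_of_ne fun h0 => ?_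
    rw [← h0] at h2; simp at h2

/-- The norm is replaced by that of the component in the plane, so that the conditions take the
shape required by `lintegral_cone_le`; `lam` measures the cost. -/
theorem coneFun_orthVec_le {x y : Fin 4 → ℤ} {A κ k lam : ℝ}
    (hκ : 0 ≤ κ) (hk : 0 ≤ k) (hlam : 0 ≤ lam) {u : Fin 4 → ℝ}
    (h : |∑ i, (x i : ℝ) * orthVec x y u i| ≤ κ * ‖euc x‖ * l2 (orthVec x y u) →
      |∑ i, (y i : ℝ) * orthVec x y u i| ≤ κ * ‖euc y‖ * l2 (orthVec x y u) →
      l2 (orthVec x y u) ^ 2 ≤ lam * planeForm x y (u 2) (u 3)) :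
    coneFun x y A κ k (orthVec x y u) ≤
      iteZero (planeForm x y (u 2) (u 3) ≤ A ^ 2 ∧
        |u 0 * ∑ i, (x i : ℝ) ^ 2| ≤ (κ * ‖euc x‖ * √lam) * √(planeForm x y (u 2) (u 3)) ∧
        |u 0 * (∑ i, (x i : ℝ) * y i) + u 1 * wedgeSq x y| ≤
          (κ * ‖euc y‖ * √lam) * √(planeForm x y (u 2) (u 3)))
        (k / planeForm x y (u 2) (u 3)) := by
  unfold coneFun
  have hpf := planeForm_nonneg (x := x) (y := y) (u 2) (u 3)
  by_cases hc : l2 (orthVec x y u) ≤ A ∧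
    |∑ i, (x i : ℝ) * orthVec x y u i| ≤ κ * ‖euc x‖ * l2 (orthVec x y u) ∧
    |∑ i, (y i : ℝ) * orthVec x y u i| ≤ κ * ‖euc y‖ * l2 (orthVec x y u)
  · rw [iteZero_pos hc]
    obtain ⟨h1, h2, h3⟩ := hc
    have hle := h h2 h3
    have hle' := planeForm_le x y u
    have hl : l2 (orthVec x y u) ≤ √lam * √(planeForm x y (u 2) (u 3)) := by
      rw [← Real.sqrt_mul hlam]
      exact Real.le_sqrt_of_sq_le hle
    rw [dot_orthVec] at h2
    rw [dot_orthVec'] at h3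
    rw [iteZero_pos]
    · rcases hpf.eq_or_lt with h0 | h0
      · rw [← h0, mul_zero] at hle
        have : l2 (orthVec x y u) ^ 2 = 0 := le_antisymm hle (sq_nonneg _)
        rw [this, ← h0]
      · gcongr
    · refine ⟨hle'.trans (pow_le_pow_left₀ (l2_nonneg _) h1 2), h2.trans ?_, h3.trans ?_⟩
      · rw [mul_assoc (κ * ‖euc x‖)]
        gcongr
      · rw [mul_assoc (κ * ‖euc y‖)]
        gcongr
  · rw [iteZero_neg hc]
    exact iteZero_nonneg fun _ => by positivity

open MeasureTheory in
theorem lintegral_orthVec {x y : Fin 4 → ℤ} (hm : minor x y 0 1 ≠ 0) {F : (Fin 4 → ℝ) → ENNReal}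
    (hF : Measurable F) : ∫⁻ t, F t = ENNReal.ofReal ((∑ i, (x i : ℝ) ^ 2) *
      |(minor x y 0 1 : ℝ)| * wedgeSq x y) * ∫⁻ u, F (orthVec x y u) := by
  obtain ⟨M, hM, hdet⟩ := abs_det_orthVec x y
  have hmR : (minor x y 0 1 : ℝ) ≠ 0 := by exact_mod_cast hm
  have hΔ := wedgeSq_cast_pos hm
  have hX : 0 < ∑ i, (x i : ℝ) ^ 2 := by
    rw [← norm_euc_sq]; exact pow_pos (norm_euc_pos_of_minor hm).1 2
  have hd : M.det ≠ 0 := by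
    rw [← abs_pos, hdet]
    have := abs_pos.mpr hmR
    positivity
  rw [lintegral_eq_abs_det_mul M hd hF, hdet]
  simp only [hM]

open MeasureTheory in
theorem lintegral_cone_planeForm_le {x y : Fin 4 → ℤ} (hm : minor x y 0 1 ≠ 0) {A κ k lam : ℝ}
    (hκ : 0 ≤ κ) (hk : 0 ≤ k) (hlam : 0 ≤ lam) :
    ENNReal.ofReal ((∑ i, (x i : ℝ) ^ 2) * |(minor x y 0 1 : ℝ)| * wedgeSq x y) *
    ∫⁻ u : Fin 4 → ℝ, ENNReal.ofReal (iteZero (planeForm x y (u 2) (u 3) ≤ A ^ 2 ∧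
        |u 0 * ∑ i, (x i : ℝ) ^ 2| ≤ (κ * ‖euc x‖ * √lam) * √(planeForm x y (u 2) (u 3)) ∧
        |u 0 * (∑ i, (x i : ℝ) * y i) + u 1 * wedgeSq x y| ≤
          (κ * ‖euc y‖ * √lam) * √(planeForm x y (u 2) (u 3)))
        (k / planeForm x y (u 2) (u 3))) ≤ ENNReal.ofReal
      (4 * Real.pi * κ ^ 2 * lam * k * A ^ 2 * ‖euc x‖ * ‖euc y‖ / √(wedgeSq x y)) := by
  have hmR : 0 < |(minor x y 0 1 : ℝ)| := abs_pos.mpr (by exact_mod_cast hm)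
  have hΔ := wedgeSq_cast_pos hm
  have hsΔ := Real.sqrt_pos.mpr hΔ
  have hX : 0 < ∑ i, (x i : ℝ) ^ 2 := by
    rw [← norm_euc_sq]; exact pow_pos (norm_euc_pos_of_minor hm).1 2
  have h := lintegral_cone_le (β := ∑ i, (x i : ℝ) * y i) (planeForm_lead_pos hm)
    (planeForm_disc_pos hm) hX hΔ
    (P := κ * ‖euc x‖ * √lam) (R := κ * ‖euc y‖ * √lam) (by positivity) (by positivity)
    (sq_nonneg A) hk
  refine (mul_le_mul_right h _).trans ?_
  rw [planeForm_disc, sqrt_planeForm_disc, ← ENNReal.ofReal_mul (by positivity)]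
  apply ENNReal.ofReal_le_ofReal
  apply le_of_eq
  have hl : √lam * √lam = lam := Real.mul_self_sqrt hlam
  field_simp
  rw [pow_two (√lam), hl]
  ring

open MeasureTheory in
theorem lintegral_coneFun_le_of_le {x y : Fin 4 → ℤ} (hm : minor x y 0 1 ≠ 0) {A κ k lam : ℝ}
    (hκ : 0 ≤ κ) (hk : 0 ≤ k) (hlam : 0 ≤ lam)
    (h : ∀ u : Fin 4 → ℝ, |∑ i, (x i : ℝ) * orthVec x y u i| ≤ κ * ‖euc x‖ * l2 (orthVec x y u) →
      |∑ i, (y i : ℝ) * orthVec x y u i| ≤ κ * ‖euc y‖ * l2 (orthVec x y u) →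
      l2 (orthVec x y u) ^ 2 ≤ lam * planeForm x y (u 2) (u 3)) :
    ∫⁻ t, ENNReal.ofReal (coneFun x y A κ k t) ≤ ENNReal.ofReal
      (4 * Real.pi * κ ^ 2 * lam * k * A ^ 2 * ‖euc x‖ * ‖euc y‖ / √(wedgeSq x y)) := by
  rw [lintegral_orthVec hm (measurable_coneFun x y A κ k).ennreal_ofReal]
  refine le_trans (mul_le_mul_right (lintegral_mono fun u => ?_) _)
    (lintegral_cone_planeForm_le hm hκ hk hlam)
  exact ENNReal.ofReal_le_ofReal (coneFun_orthVec_le hκ hk hlam (h u))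

open MeasureTheory in
-- Valid for every angle. Where the component in the plane dominates, the squared norm is at most
-- twice its square, which costs a factor `2`; elsewhere `lintegral_cone_le'` applies with factor
-- `1`. Together they give `3`.
theorem lintegral_coneFun_le {x y : Fin 4 → ℤ} (hm : minor x y 0 1 ≠ 0) {A κ k : ℝ}
    (hA : 0 ≤ A) (hκ : 0 ≤ κ) (hk : 0 ≤ k) :
    ∫⁻ t, ENNReal.ofReal (coneFun x y A κ k t) ≤ ENNReal.ofReal
      (4 * Real.pi * κ ^ 2 * 3 * k * A ^ 2 * ‖euc x‖ * ‖euc y‖ / √(wedgeSq x y)) := by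
  have hmR : 0 < |(minor x y 0 1 : ℝ)| := abs_pos.mpr (by exact_mod_cast hm)
  have hΔ := wedgeSq_cast_pos hm
  have hsΔ := Real.sqrt_pos.mpr hΔ
  have hX : 0 < ∑ i, (x i : ℝ) ^ 2 := by
    rw [← norm_euc_sq]; exact pow_pos (norm_euc_pos_of_minor hm).1 2
  let S : ℝ → ℝ → ℝ := fun u v => u ^ 2 * (∑ i, (x i : ℝ) ^ 2)
    + v ^ 2 * ((∑ i, (x i : ℝ) ^ 2) * wedgeSq x y)
  have hS0 : ∀ u v, 0 ≤ S u v := fun u v => by positivity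
  have hS : Measurable fun z : ℝ × ℝ => S z.1 z.2 := by fun_prop
  have h2 := lintegral_cone_le' (β := ∑ i, (x i : ℝ) * y i) (P := κ * ‖euc x‖ * A)
    (R := κ * ‖euc y‖ * A) S hS hS0 (planeForm_lead_pos hm) (planeForm_disc_pos hm) hX hΔ
    (by positivity) hk
  have h1 := lintegral_cone_planeForm_le hm (A := A) hκ hk (lam := 2) zero_le_two
  rw [lintegral_orthVec hm (measurable_coneFun x y A κ k).ennreal_ofReal]
  have hpt : ∀ u, coneFun x y A κ k (orthVec x y u) ≤
      iteZero (planeForm x y (u 2) (u 3) ≤ A ^ 2 ∧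
        |u 0 * ∑ i, (x i : ℝ) ^ 2| ≤ (κ * ‖euc x‖ * √2) * √(planeForm x y (u 2) (u 3)) ∧
        |u 0 * (∑ i, (x i : ℝ) * y i) + u 1 * wedgeSq x y| ≤
          (κ * ‖euc y‖ * √2) * √(planeForm x y (u 2) (u 3)))
        (k / planeForm x y (u 2) (u 3)) +
      iteZero (planeForm x y (u 2) (u 3) ≤ S (u 0) (u 1) ∧
        |u 0 * ∑ i, (x i : ℝ) ^ 2| ≤ κ * ‖euc x‖ * A ∧
        |u 0 * (∑ i, (x i : ℝ) * y i) + u 1 * wedgeSq x y| ≤ κ * ‖euc y‖ * A)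
        (k / S (u 0) (u 1)) := by
    intro u
    have hpf := planeForm_nonneg (x := x) (y := y) (u 2) (u 3)
    have hsplit : l2 (orthVec x y u) ^ 2 = S (u 0) (u 1) + planeForm x y (u 2) (u 3) :=
      l2_orthVec_sq x y u
    have hSn := hS0 (u 0) (u 1)
    by_cases hc : S (u 0) (u 1) < planeForm x y (u 2) (u 3)
    · refine (coneFun_orthVec_le hκ hk zero_le_two fun _ _ => by linarith).trans ?_
      exact le_add_of_nonneg_right (iteZero_nonneg fun _ => by positivity)
    · push Not at hc
      refine le_trans ?_ (le_add_of_nonneg_left (iteZero_nonneg fun _ => by positivity))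
      unfold coneFun
      by_cases hc' : l2 (orthVec x y u) ≤ A ∧
        |∑ i, (x i : ℝ) * orthVec x y u i| ≤ κ * ‖euc x‖ * l2 (orthVec x y u) ∧
        |∑ i, (y i : ℝ) * orthVec x y u i| ≤ κ * ‖euc y‖ * l2 (orthVec x y u)
      · rw [iteZero_pos hc']
        obtain ⟨e1, e2, e3⟩ := hc'
        rw [dot_orthVec] at e2
        rw [dot_orthVec'] at e3
        rw [iteZero_pos]
        · rcases hSn.eq_or_lt with h0 | h0
          · have : l2 (orthVec x y u) ^ 2 = 0 := by linarith
            rw [this, ← h0]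
          · exact div_le_div_of_nonneg_left hk h0 (by linarith)
        · exact ⟨hc, e2.trans (by gcongr), e3.trans (by gcongr)⟩
      · rw [iteZero_neg hc']
        exact iteZero_nonneg fun _ => by positivity
  have hmeas : Measurable fun u : Fin 4 → ℝ => ENNReal.ofReal
      (iteZero (planeForm x y (u 2) (u 3) ≤ A ^ 2 ∧
        |u 0 * ∑ i, (x i : ℝ) ^ 2| ≤ (κ * ‖euc x‖ * √2) * √(planeForm x y (u 2) (u 3)) ∧
        |u 0 * (∑ i, (x i : ℝ) * y i) + u 1 * wedgeSq x y| ≤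
          (κ * ‖euc y‖ * √2) * √(planeForm x y (u 2) (u 3)))
        (k / planeForm x y (u 2) (u 3))) := by
    unfold planeForm
    refine ENNReal.measurable_ofReal.comp (measurable_iteZero (measurableSet_and ?_
      (measurableSet_and ?_ ?_)) (by fun_prop)) <;>
      exact measurableSet_le (by fun_prop) (by fun_prop)
  refine le_trans (mul_le_mul_right (lintegral_mono fun u =>
    (ENNReal.ofReal_le_ofReal (hpt u)).trans ENNReal.ofReal_add_le) _) ?_
  rw [lintegral_add_left hmeas, mul_add]
  refine le_trans (add_le_add h1 (mul_le_mul_right h2 _)) ?_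
  rw [planeForm_disc, sqrt_planeForm_disc, ← ENNReal.ofReal_mul (by positivity),
    ← ENNReal.ofReal_add (by positivity) (by positivity)]
  apply ENNReal.ofReal_le_ofReal
  apply le_of_eq
  field_simp
  ring


/-! ### Upper bound for the sum behind the local second moment -/

theorem card_le_of_abs_le {n : ℕ} {R : ℝ} (hR : 1 ≤ R) (S : Finset (Fin n → ℤ))
    (hS : ∀ a ∈ S, ∀ i, |(a i : ℝ)| ≤ R) : (S.card : ℝ) ≤ (3 * R) ^ n := by
  have h1 : S ⊆ Fintype.piFinset fun _ : Fin n => Finset.Icc (-⌊R⌋) ⌊R⌋ := by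
    intro a ha
    refine Fintype.mem_piFinset.mpr fun i => Finset.mem_Icc.mpr ?_
    have h := abs_le.mp (hS a ha i)
    refine ⟨?_, Int.le_floor.mpr h.2⟩
    have h2 : -a i ≤ ⌊R⌋ := Int.le_floor.mpr (by push_cast; linarith)
    linarith
  have h2 := Finset.card_le_card h1
  rw [Fintype.card_piFinset] at h2
  simp only [Int.card_Icc, Finset.prod_const, Finset.card_univ, Fintype.card_fin] at h2
  have h3 : (((⌊R⌋ + 1 - -⌊R⌋).toNat : ℕ) : ℝ) ≤ 3 * R := by
    have h0 : 0 ≤ ⌊R⌋ := Int.floor_nonneg.mpr (by linarith)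
    have e : (((⌊R⌋ + 1 - -⌊R⌋).toNat : ℤ)) = 2 * ⌊R⌋ + 1 := by
      rw [Int.toNat_of_nonneg (by linarith)]; ring
    have e2 : (((⌊R⌋ + 1 - -⌊R⌋).toNat : ℕ) : ℝ) = 2 * (⌊R⌋ : ℝ) + 1 := by exact_mod_cast e
    rw [e2]
    linarith [Int.floor_le R]
  calc (S.card : ℝ) ≤ ((((⌊R⌋ + 1 - -⌊R⌋).toNat) ^ n : ℕ) : ℝ) := by exact_mod_cast h2
    _ ≤ (3 * R) ^ n := by
      push_cast
      exact pow_le_pow_left₀ (Nat.cast_nonneg _) h3 n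

theorem PrimitiveAt.of_vec {x : Fin 4 → ℤ} (F : Frame x) {W : ℕ} {s : Fin 3 → ℤ}
    (h : PrimitiveAt W (F.vec s)) : PrimitiveAt W s := by
  intro p hp hpW
  by_contra hc
  push Not at hc
  obtain ⟨i, hi⟩ := h p hp hpW
  exact hi (F.dvd_vec hc i)

/-- Subtracting a multiple of `n` times a Bézout vector makes `a` exactly orthogonal to `x`. Hence
classes orthogonal to `x` modulo `n` are described by three coordinates. -/
theorem Frame.exists_vec_congr {x : Fin 4 → ℤ} (F : Frame x) (hcop : IsCoprime (x 0) (x 1))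
    {n : ℤ} {a : Fin 4 → ℤ} (ha : n ∣ ∑ i, x i * a i) :
    ∃ s, ∀ i, n ∣ F.vec s i - a i := by
  obtain ⟨u, v, huv⟩ := id hcop
  obtain ⟨k, hk⟩ := ha
  rw [Fin.sum_univ_four] at hk
  obtain ⟨s, hs⟩ := F.exists_vec_eq hcop
    (a := ![a 0 - n * k * u, a 1 - n * k * v, a 2, a 3]) (by
      simp only [Fin.sum_univ_four, Matrix.cons_val]
      linear_combination hk - n * k * huv)
  refine ⟨s, fun i => ?_⟩
  rw [hs]
  fin_cases i
  · exact ⟨-(k * u), by simp; ring⟩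
  · exact ⟨-(k * v), by simp; ring⟩
  · simp
  · simp

/-- A displacement inside a cube of side `W` has length at most `2 W`. As the cone has relative
width `1 / (2 α)`, the hypothesis on `R` carries the factor `1 + α`; the enlargements by `1 + η`
then absorb the displacement. -/
theorem le_coneFun {x y : Fin 4 → ℤ} {A α η R W : ℝ} (hα : 0 < α) (hη : 0 < η) (hη1 : η ≤ 1)
    (hW : 0 ≤ W) (hR : 4 * W * (1 + α) ≤ η * R) {a : Fin 4 → ℤ} (ha : R ≤ ‖euc a‖)
    (haR : 0 < R) (haA : ‖euc a‖ ≤ A)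
    (hxa : |∑ i, (x i : ℝ) * a i| ≤ ‖euc x‖ * ‖euc a‖ / (2 * α))
    (hya : |∑ i, (y i : ℝ) * a i| ≤ ‖euc y‖ * ‖euc a‖ / (2 * α))
    {t : Fin 4 → ℝ} (ht : ∀ i, (a i : ℝ) ≤ t i ∧ t i < a i + W) :
    1 / ‖euc a‖ ^ 2 ≤ coneFun x y ((1 + η) * A) ((1 + η) / (2 * α)) ((1 + η) ^ 2) t := by
  have ha0 : 0 < ‖euc a‖ := haR.trans_le ha
  have hd : l2 (fun i => t i - a i) ≤ 2 * W := l2_le_of_abs_le hW fun i => by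
    rw [abs_le]; constructor <;> linarith [ht i]
  have h1 : l2 t ≤ ‖euc a‖ + 2 * W := by
    have := l2_add_le (fun i => (a i : ℝ)) (fun i => t i - a i)
    simp only [add_sub_cancel] at this
    rw [norm_euc]
    linarith
  have h2 : ‖euc a‖ ≤ l2 t + 2 * W := by
    have := l2_add_le t (fun i => a i - t i)
    simp only [add_sub_cancel] at this
    have e : l2 (fun i => a i - t i) = l2 (fun i => t i - a i) := by
      have := l2_mul (-1) (fun i => t i - a i)
      simp only [neg_mul, one_mul, neg_sub, abs_neg, abs_one] at this
      exact this
    rw [norm_euc]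
    linarith
  have hWR : 4 * W ≤ η * R := by nlinarith
  have hηa : η * R ≤ η * ‖euc a‖ := mul_le_mul_of_nonneg_left ha hη.le
  have ht0 : 0 < l2 t := by nlinarith
  have key : ∀ z : Fin 4 → ℤ, |∑ i, (z i : ℝ) * a i| ≤ ‖euc z‖ * ‖euc a‖ / (2 * α) →
      |∑ i, (z i : ℝ) * t i| ≤ (1 + η) / (2 * α) * ‖euc z‖ * l2 t := by
    intro z hz
    have e : ∑ i, (z i : ℝ) * t i = ∑ i, (z i : ℝ) * a i + ∑ i, (z i : ℝ) * (t i - a i) := by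
      rw [← Finset.sum_add_distrib]
      exact Finset.sum_congr rfl fun i _ => by ring
    have h3 : |∑ i, (z i : ℝ) * (t i - a i)| ≤ ‖euc z‖ * (2 * W) :=
      (abs_dot_le (fun i => (z i : ℝ)) (fun i => t i - a i)).trans
        (mul_le_mul_of_nonneg_left hd (l2_nonneg _))
    have h4 : ‖euc a‖ / (2 * α) + 2 * W ≤ (1 + η) / (2 * α) * l2 t := by
      rw [div_add' _ _ _ (by positivity), div_mul_eq_mul_div]
      apply div_le_div_of_nonneg_right _ (by positivity)
      nlinarith
    rw [e]
    calc _ ≤ ‖euc z‖ * ‖euc a‖ / (2 * α) + ‖euc z‖ * (2 * W) :=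
          (abs_add_le _ _).trans (add_le_add hz h3)
      _ = ‖euc z‖ * (‖euc a‖ / (2 * α) + 2 * W) := by ring
      _ ≤ ‖euc z‖ * ((1 + η) / (2 * α) * l2 t) := by
          exact mul_le_mul_of_nonneg_left h4 (norm_nonneg _)
      _ = _ := by ring
  have h5 : l2 t ≤ (1 + η) * ‖euc a‖ := by nlinarith
  unfold coneFun
  rw [iteZero_pos]
  · rw [div_le_div_iff₀ (by positivity) (by positivity), one_mul, ← mul_pow]
    exact pow_le_pow_left₀ ht0.le h5 2
  · exact ⟨h5.trans (mul_le_mul_of_nonneg_left haA (by positivity)), key x hxa, key y hya⟩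

open scoped Classical in
-- The vectors of norm at least `R` fall into as many classes modulo `W` as the kernel has elements,
-- since primitivity and both congruences pass to frame coordinates; each class is bounded by the
-- integral. Shorter vectors are counted trivially.
theorem sum_inv_sq_le {x y : Fin 4 → ℤ} {A α η R V : ℝ} {W : ℕ} (hWpos : 0 < W)
    (hcop : IsCoprime (x 0) (x 1)) (F : Frame x) (hα : 0 < α) (hη : 0 < η) (hη1 : η ≤ 1)
    (hR1 : 1 ≤ R) (hR : 4 * W * (1 + α) ≤ η * R) (hV : 0 ≤ V)
    (hI : ∫⁻ t, ENNReal.ofReal (coneFun x y ((1 + η) * A) ((1 + η) / (2 * α)) ((1 + η) ^ 2) t)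
      ≤ ENNReal.ofReal V)
    (S : Finset (Fin 4 → ℤ)) (hS1 : ∀ a ∈ S, 1 ≤ ‖euc a‖) (hSA : ∀ a ∈ S, ‖euc a‖ ≤ A)
    (hSW : ∀ a ∈ S, PrimitiveAt W a) (hSx : ∀ a ∈ S, (W : ℤ) ∣ ∑ i, x i * a i)
    (hSy : ∀ a ∈ S, (W : ℤ) ∣ ∑ i, y i * a i)
    (hSx' : ∀ a ∈ S, |∑ i, (x i : ℝ) * a i| ≤ ‖euc x‖ * ‖euc a‖ / (2 * α))
    (hSy' : ∀ a ∈ S, |∑ i, (y i : ℝ) * a i| ≤ ‖euc y‖ * ‖euc a‖ / (2 * α)) :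
    ∑ a ∈ S, 1 / ‖euc a‖ ^ 2 ≤
      (kernelSet W (F.form y)).card * (V / (W : ℝ) ^ 4) + 81 * R ^ 4 := by
  have hWR : (0 : ℝ) < W := by exact_mod_cast hWpos
  rw [← Finset.sum_filter_add_sum_filter_not S fun a => R ≤ ‖euc a‖]
  refine add_le_add ?_ ?_
  · set T := S.filter fun a => R ≤ ‖euc a‖
    have hT : ∀ a ∈ T, a ∈ S ∧ R ≤ ‖euc a‖ := fun a ha => Finset.mem_filter.mp ha
    have hex : ∀ a : Fin 4 → ℤ, (W : ℤ) ∣ ∑ i, x i * a i → ∃ s, ∀ i, (W : ℤ) ∣ F.vec s i - a i :=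
      fun a ha => F.exists_vec_congr hcop ha
    choose! s hs using hex
    have hkey : ∀ a ∈ T, modVec W (s a) ∈ kernelSet W (F.form y) := by
      intro a ha
      have hc := hs a (hSx a (hT a ha).1)
      refine modVec_mem_kernelSet hWpos ?_ ?_
      · rw [← F.sum_mul_vec_eq]
        exact (dvd_sum_mul_iff y hc).mpr (hSy a (hT a ha).1)
      · refine PrimitiveAt.of_vec F ((hSW a (hT a ha).1).congr_of_dvd fun i => ?_)
        rw [dvd_sub_comm]; exact hc i
    rw [← Finset.sum_fiberwise_of_maps_to hkey, ← nsmul_eq_mul]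
    refine Finset.sum_le_card_nsmul _ _ _ fun r _ => ?_
    rw [le_div_iff₀ (by positivity)]
    have hsub : ∀ a ∈ T.filter (fun a => modVec W (s a) = r), a ∈ S ∧ R ≤ ‖euc a‖ ∧
        modVec W (s a) = r := fun a ha =>
      ⟨(hT a (Finset.mem_filter.mp ha).1).1, (hT a (Finset.mem_filter.mp ha).1).2,
        (Finset.mem_filter.mp ha).2⟩
    have h := sum_mul_pow_le_lintegral (Q := W) (T.filter fun a => modVec W (s a) = r) ?_
      (fun a => 1 / ‖euc a‖ ^ 2) _ (fun a _ => by positivity) (fun a ha t ht =>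
        le_coneFun hα hη hη1 hWR.le hR (hsub a ha).2.1 (by linarith) (hSA a (hsub a ha).1)
          (hSx' a (hsub a ha).1) (hSy' a (hsub a ha).1) ht)
    · exact (ENNReal.ofReal_le_ofReal_iff hV).mp (h.trans hI)
    · intro a ha a' ha' i
      have e := F.dvd_vec (dvd_sub_of_modVec_eq ((hsub a ha).2.2.trans (hsub a' ha').2.2.symm)) i
      rw [← F.vec_sub] at e
      have e1 := hs a (hSx a (hsub a ha).1) i
      have e2 := hs a' (hSx a' (hsub a' ha').1) i
      exact ((e.sub e1).add e2).trans (dvd_of_eq (by ring))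
  · set T := S.filter fun a => ¬ R ≤ ‖euc a‖
    have hcard : (T.card : ℝ) ≤ (3 * R) ^ 4 := by
      refine card_le_of_abs_le hR1 T fun a ha i => ?_
      have := (Finset.mem_filter.mp ha).2
      exact (abs_le_l2 (fun i => (a i : ℝ)) i).trans (not_le.mp this).le
    calc ∑ a ∈ T, 1 / ‖euc a‖ ^ 2 ≤ ∑ a ∈ T, (1 : ℝ) := by
          refine Finset.sum_le_sum fun a ha => ?_
          have := hS1 a (Finset.mem_filter.mp ha).1
          rw [div_le_one (by positivity)]
          nlinarith
      _ = T.card := by simp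
      _ ≤ (3 * R) ^ 4 := hcard
      _ = _ := by ring

/-- A vector almost orthogonal to `x` and `y` is close to the orthogonal plane, if `x` and `y` are
not almost parallel. -/
theorem l2_orthVec_sq_le {x y : Fin 4 → ℤ} (hm : minor x y 0 1 ≠ 0) {κ η : ℝ}
    (hκη : κ * (‖euc x‖ * ‖euc y‖) ≤ η * √(wedgeSq x y)) (hκ : 0 ≤ κ) (hη : 0 ≤ η)
    (hη1 : η ≤ 1 / 4) (u : Fin 4 → ℝ)
    (hxu : |∑ i, (x i : ℝ) * orthVec x y u i| ≤ κ * ‖euc x‖ * l2 (orthVec x y u))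
    (hyu : |∑ i, (y i : ℝ) * orthVec x y u i| ≤ κ * ‖euc y‖ * l2 (orthVec x y u)) :
    l2 (orthVec x y u) ^ 2 ≤ (1 + 2 * η) * planeForm x y (u 2) (u 3) := by
  have hsplit := l2_orthVec_sq x y u
  rw [dot_orthVec] at hxu
  rw [dot_orthVec'] at hyu
  have hΔ := wedgeSq_cast_pos hm
  have hβ : |∑ i, (x i : ℝ) * y i| ≤ ‖euc x‖ * ‖euc y‖ :=
    abs_dot_le (fun i => (x i : ℝ)) (fun i => (y i : ℝ))
  have hΔe := wedgeSq_cast x y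
  obtain ⟨hx0, hy0⟩ := norm_euc_pos_of_minor hm
  rw [← norm_euc_sq] at hxu hsplit hΔe
  rw [← norm_euc_sq] at hΔe
  set T := l2 (orthVec x y u)
  have hT : 0 ≤ T := l2_nonneg _
  set β := ∑ i, (x i : ℝ) * y i
  set X := ‖euc x‖
  set Y := ‖euc y‖
  set Δ : ℝ := (wedgeSq x y : ℝ)
  have h0 : |u 0| * X ≤ κ * T := by
    rw [abs_mul, abs_of_nonneg (sq_nonneg X)] at hxu
    refine le_of_mul_le_mul_right ?_ hx0
    linarith
  have h1 : |u 1| * Δ ≤ 2 * (κ * Y * T) := by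
    have e : u 1 * Δ = (u 0 * β + u 1 * Δ) - u 0 * β := by ring
    rw [← abs_of_pos hΔ, ← abs_mul, e]
    refine (abs_sub _ _).trans ?_
    have : |u 0 * β| ≤ κ * Y * T := by
      rw [abs_mul]
      calc |u 0| * |β| ≤ |u 0| * (X * Y) := mul_le_mul_of_nonneg_left hβ (abs_nonneg _)
        _ = |u 0| * X * Y := by ring
        _ ≤ κ * T * Y := mul_le_mul_of_nonneg_right h0 hy0.le
        _ = _ := by ring
    linarith
  have hκ2 : κ ^ 2 * (X ^ 2 * Y ^ 2) ≤ η ^ 2 * Δ := by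
    have := pow_le_pow_left₀ (by positivity) hκη 2
    rw [mul_pow, mul_pow, mul_pow, Real.sq_sqrt hΔ.le] at this
    exact this
  have hΔle : Δ ≤ X ^ 2 * Y ^ 2 := by rw [hΔe]; nlinarith [sq_nonneg β]
  -- The hypothesis on the angle contains this, because `√Δ ≤ ‖x‖ ‖y‖`. The components along `x` and
  -- `orthPart x y` then take up at most `η² T²` and `4 η² T²`.
  have hκη' : κ ^ 2 ≤ η ^ 2 := by
    have : κ ^ 2 * Δ ≤ η ^ 2 * Δ :=
      (mul_le_mul_of_nonneg_left hΔle (sq_nonneg _)).trans hκ2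
    exact le_of_mul_le_mul_right this hΔ
  have e0 : u 0 ^ 2 * X ^ 2 ≤ η ^ 2 * T ^ 2 := by
    have := pow_le_pow_left₀ (by positivity) h0 2
    rw [mul_pow, mul_pow, sq_abs] at this
    exact this.trans (mul_le_mul_of_nonneg_right hκη' (sq_nonneg _))
  have e1 : u 1 ^ 2 * (X ^ 2 * Δ) ≤ 4 * (η ^ 2 * T ^ 2) := by
    have h2 := pow_le_pow_left₀ (by positivity) h1 2
    rw [mul_pow, sq_abs] at h2
    refine le_of_mul_le_mul_right ?_ hΔ
    calc u 1 ^ 2 * (X ^ 2 * Δ) * Δ = X ^ 2 * (u 1 ^ 2 * Δ ^ 2) := by ring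
      _ ≤ X ^ 2 * (2 * (κ * Y * T)) ^ 2 := mul_le_mul_of_nonneg_left h2 (sq_nonneg _)
      _ = 4 * T ^ 2 * (κ ^ 2 * (X ^ 2 * Y ^ 2)) := by ring
      _ ≤ 4 * T ^ 2 * (η ^ 2 * Δ) := mul_le_mul_of_nonneg_left hκ2 (by positivity)
      _ = _ := by ring
  have e2 : (1 - 5 * η ^ 2) * T ^ 2 ≤ planeForm x y (u 2) (u 3) := by linarith
  have e3 : 1 ≤ (1 + 2 * η) * (1 - 5 * η ^ 2) := by nlinarith [mul_nonneg hη hη]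
  calc T ^ 2 ≤ (1 + 2 * η) * (1 - 5 * η ^ 2) * T ^ 2 := le_mul_of_one_le_left (sq_nonneg _) e3
    _ = (1 + 2 * η) * ((1 - 5 * η ^ 2) * T ^ 2) := by ring
    _ ≤ _ := mul_le_mul_of_nonneg_left e2 (by positivity)


/-! ### Lower bound for the sum behind the mixed second moment -/

namespace Frame

variable {x : Fin 4 → ℤ}

theorem sum_mul_vecReal_eq (F : Frame x) (y : Fin 4 → ℤ) (s : Fin 3 → ℝ) :
    ∑ i, (y i : ℝ) * F.vecReal s i = ∑ i, (F.form y i : ℝ) * s i := by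
  simp only [Fin.sum_univ_four, Fin.sum_univ_three, vecReal, form, minor, Matrix.cons_val]
  push_cast
  ring

theorem vecReal_add (F : Frame x) (s t : Fin 3 → ℝ) :
    F.vecReal (fun i => s i + t i) = fun i => F.vecReal s i + F.vecReal t i := by
  ext i
  fin_cases i <;> simp [vecReal] <;> ring

theorem vec_injective (F : Frame x) (hx : IsCoprime (x 0) (x 1)) : Function.Injective F.vec := by
  intro s t hst
  ext i
  have := F.dvd_of_dvd_vec hx (n := 0) (s := fun j => s j - t j) (fun i => by
    rw [← F.vec_sub, hst, sub_self]) i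
  simp only [zero_dvd_iff] at this
  linarith

theorem l2_vecReal_le (F : Frame x) {B M : ℝ} (hx : ∀ i, |(x i : ℝ)| ≤ B)
    (ha : |(F.a : ℝ)| ≤ 2 * B) (hb : |(F.b : ℝ)| ≤ 2 * B) (hc : |(F.c : ℝ)| ≤ 2 * B)
    (hd : |(F.d : ℝ)| ≤ 2 * B) (hB : 1 ≤ B) {t : Fin 3 → ℝ} (ht : ∀ i, |t i| ≤ M) :
    l2 (F.vecReal t) ≤ 10 * B * M := by
  have hM : 0 ≤ M := (abs_nonneg _).trans (ht 0)
  refine (l2_le_of_abs_le (M := 5 * B * M) (by positivity) fun i => ?_).trans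
    (by apply le_of_eq; ring)
  have hmul : ∀ (j : Fin 3) (z K : ℝ), |z| ≤ K → |t j * z| ≤ M * K := fun j z K hz => by
    rw [abs_mul]; exact mul_le_mul (ht j) hz (abs_nonneg _) hM
  have hB' : 1 * M ≤ 5 * B * M := by gcongr; linarith
  fin_cases i <;> simp only [vecReal, Fin.zero_eta, Fin.mk_one, Fin.reduceFinMk, Matrix.cons_val]
  · calc _ ≤ |t 0 * x 1| + |t 1 * F.a| + |t 2 * F.c| := abs_add_three _ _ _
      _ ≤ M * B + M * (2 * B) + M * (2 * B) :=
        add_le_add (add_le_add (hmul _ _ _ (hx 1)) (hmul _ _ _ ha)) (hmul _ _ _ hc)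
      _ = _ := by ring
  · calc _ ≤ |-(t 0 * x 0)| + |t 1 * F.b| + |t 2 * F.d| := abs_add_three _ _ _
      _ ≤ M * B + M * (2 * B) + M * (2 * B) := by
        rw [abs_neg]
        exact add_le_add (add_le_add (hmul _ _ _ (hx 0)) (hmul _ _ _ hb)) (hmul _ _ _ hd)
      _ = _ := by ring
  · linarith [ht 1]
  · linarith [ht 2]

/-- The coordinates of the vector with given coordinates with respect to `orthPart x y` and the
basis vectors of `planeVec x y`. -/
theorem exists_matrix (F : Frame x) {y : Fin 4 → ℤ} (hx0 : x 0 ≠ 0) :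
    ∃ M : Matrix (Fin 3) (Fin 3) ℝ,
      (∀ u, F.vecReal (M.mulVec u) = orthVec x y ![0, u 0, u 1, u 2]) ∧
      |M.det| = |(minor x y 0 1 : ℝ)| * wedgeSq x y := by
  have hx0' : (x 0 : ℝ) ≠ 0 := by exact_mod_cast hx0
  have hab : (x 0 * F.a + x 1 * F.b + x 2 : ℝ) = 0 := by exact_mod_cast F.hab
  have hcd : (x 0 * F.c + x 1 * F.d + x 3 : ℝ) = 0 := by exact_mod_cast F.hcd
  obtain ⟨k, hk⟩ : ∃ k : Fin 3 → ℝ, F.vecReal k = orthPart x y := by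
    have hdot : (x 0 * orthPart x y 0 + x 1 * orthPart x y 1 + x 2 * orthPart x y 2
        + x 3 * orthPart x y 3 : ℝ) = 0 := by
      simp only [orthPart, Fin.sum_univ_four]; ring
    refine ⟨![(orthPart x y 2 * F.b + orthPart x y 3 * F.d - orthPart x y 1) / x 0,
      orthPart x y 2, orthPart x y 3], ?_⟩
    ext i
    fin_cases i <;> simp only [vecReal, Fin.zero_eta, Fin.mk_one, Fin.reduceFinMk, Matrix.cons_val]
    · field_simp
      linear_combination orthPart x y 2 * hab + orthPart x y 3 * hcd - hdot
    · field_simp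
      ring
  have hform : (F.form y 0 : ℝ) * k 0 + F.form y 1 * k 1 + F.form y 2 * k 2 = wedgeSq x y := by
    have h := F.sum_mul_vecReal_eq y k
    rw [hk, Fin.sum_univ_three] at h
    rw [← h, wedgeSq_cast]
    simp only [orthPart, Fin.sum_univ_four]
    ring
  have h0 : (F.form y 0 : ℝ) = -minor x y 0 1 := by simp [form]
  rw [h0] at hform
  -- The columns are the frame coordinates of `orthPart x y` and of the two basis vectors of the
  -- plane.
  refine ⟨!![k 0, F.form y 1, F.form y 2; k 1, minor x y 0 1, 0; k 2, 0, minor x y 0 1], ?_, ?_⟩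
  · intro u
    have hk0 := congrFun hk 0
    have hk1 := congrFun hk 1
    have hk2 := congrFun hk 2
    have hk3 := congrFun hk 3
    simp only [vecReal, Matrix.cons_val] at hk0 hk1 hk2 hk3
    ext i
    fin_cases i <;> simp only [vecReal, orthVec, planeVec, Matrix.mulVec, dotProduct,
      Fin.sum_univ_three, Fin.zero_eta, Fin.mk_one, Fin.reduceFinMk, Matrix.cons_val,
      Matrix.of_apply, form, minor] <;> push_cast
    · linear_combination u 0 * hk0 + (u 1 * y 1) * hab + (u 2 * y 1) * hcd
    · linear_combination u 0 * hk1 - (u 1 * y 0) * hab - (u 2 * y 0) * hcd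
    · linear_combination u 0 * hk2
    · linear_combination u 0 * hk3
  · have hΔ : (0 : ℝ) ≤ wedgeSq x y := by exact_mod_cast wedgeSq_nonneg x y
    rw [← abs_of_nonneg hΔ, ← abs_mul, ← abs_neg]
    congr 1
    rw [Matrix.det_fin_three]
    simp only [Matrix.of_apply, Matrix.cons_val]
    rw [← hform]
    simp
    ring

end Frame

/-- The squared norm of the component of `t` orthogonal to `y`, for `t` orthogonal to `x`. -/
noncomputable def orthNormSq (x y : Fin 4 → ℤ) (t : Fin 4 → ℝ) : ℝ :=
  l2 t ^ 2 - (∑ i, (y i : ℝ) * t i) ^ 2 * ‖euc x‖ ^ 2 / wedgeSq x y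

/-- The function `k / ρ`, where `ρ` is the norm of the component of `t` orthogonal to `y`, on the
vectors `t` with `ρ` in a given interval that are almost orthogonal to `y`. -/
noncomputable def stripFun (x y : Fin 4 → ℤ) (r₀ r R k : ℝ) (t : Fin 4 → ℝ) : ℝ :=
  iteZero ((r₀ ≤ orthNormSq x y t ∧ orthNormSq x y t ≤ r) ∧
    |∑ i, (y i : ℝ) * t i| ≤ R * √(orthNormSq x y t)) (k / √(orthNormSq x y t))

open MeasureTheory in
-- In the coordinates of `Frame.exists_matrix`, the norm of the component orthogonal to `y` is the
-- root of `planeForm`, and the integral is that of `le_lintegral_annulus`; the determinant `|m₀₁|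
-- Δ` cancels.
theorem le_lintegral_stripFun {x y : Fin 4 → ℤ} (F : Frame x) (hx0 : x 0 ≠ 0)
    (hm : minor x y 0 1 ≠ 0) {r₀ r R k : ℝ} (hR : 0 ≤ R) (hr₀ : 0 < r₀) (hr : r₀ ≤ r)
    (hk : 0 ≤ k) : ENNReal.ofReal (2 * Real.pi * R * k * (r - r₀) / √(wedgeSq x y)) ≤
      ∫⁻ s, ENNReal.ofReal (stripFun x y r₀ r R k (F.vecReal s)) := by
  obtain ⟨M, hM, hdet⟩ := F.exists_matrix (y := y) hx0
  have hmR : 0 < |(minor x y 0 1 : ℝ)| := abs_pos.mpr (by exact_mod_cast hm)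
  have hΔ := wedgeSq_cast_pos hm
  have hsΔ := Real.sqrt_pos.mpr hΔ
  have hvm : Measurable F.vecReal := by
    rw [measurable_pi_iff]
    intro i
    fin_cases i <;> simp only [Frame.vecReal, Fin.zero_eta, Fin.mk_one, Fin.reduceFinMk,
      Matrix.cons_val] <;> fun_prop
  have hqm : Measurable (orthNormSq x y) := by
    unfold orthNormSq
    fun_prop
  have hmeas : Measurable fun s => ENNReal.ofReal (stripFun x y r₀ r R k (F.vecReal s)) := by
    have : Measurable (stripFun x y r₀ r R k) := by
      refine measurable_iteZero (measurableSet_and (measurableSet_and ?_ ?_) ?_)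
        (by fun_prop) <;> exact measurableSet_le (by fun_prop) (by fun_prop)
    exact (this.comp hvm).ennreal_ofReal
  rw [lintegral_eq_abs_det_mul M (by rw [← abs_pos, hdet]; positivity) hmeas, hdet]
  have h := le_lintegral_annulus (planeForm_lead_pos hm) (planeForm_disc_pos hm) hΔ hR hr₀ hr hk
  refine le_trans ?_ (mul_le_mul_right (h.trans (le_of_eq (lintegral_congr fun u => ?_))) _)
  · rw [planeForm_disc, sqrt_planeForm_disc, ← ENNReal.ofReal_mul (by positivity)]
    apply ENNReal.ofReal_le_ofReal
    apply le_of_eq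
    field_simp
  · have e1 : ∑ i, (y i : ℝ) * orthVec x y ![0, u 0, u 1, u 2] i = u 0 * wedgeSq x y := by
      rw [dot_orthVec']; simp
    have e2 : orthNormSq x y (orthVec x y ![0, u 0, u 1, u 2]) = planeForm x y (u 1) (u 2) := by
      unfold orthNormSq
      rw [e1, l2_orthVec_sq, norm_euc_sq]
      simp only [Matrix.cons_val]
      field_simp
      ring
    rw [hM]
    unfold stripFun
    rw [e1, e2]
    rfl

/-- The vectors counted with weight in the lower bound for the mixed sums. -/
structure IsMixed (x y : Fin 4 → ℤ) (A α : ℝ) (W n : ℕ) (a : Fin 4 → ℤ) : Prop where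
  orth : ∑ i, x i * a i = 0
  norm_le : ‖euc a‖ ≤ A
  dvd : (W : ℤ) ∣ ∑ i, y i * a i
  cone : |∑ i, (y i : ℝ) * a i| ≤ ‖euc y‖ * ‖euc a‖ / (2 * α)
  prim : PrimitiveAt n a

set_option maxHeartbeats 400000 in
-- On the support of `stripFun` the planar component `ρ` is at least `η A`, and the angle condition
-- gives `‖t‖ ≤ (1 + η) ρ`. Rounding `t` to the corner of its cell costs at most `η ρ / (2 α + 1)`,
-- so the reduced radius, cone width and weight leave exactly enough room for the corner to satisfy
-- the true conditions.
theorem stripFun_le {x y : Fin 4 → ℤ} {A B α η : ℝ} {Q : ℕ} (F : Frame x)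
    (hm : minor x y 0 1 ≠ 0) (hx : ∀ i, |(x i : ℝ)| ≤ B) (ha : |(F.a : ℝ)| ≤ 2 * B)
    (hb : |(F.b : ℝ)| ≤ 2 * B) (hc : |(F.c : ℝ)| ≤ 2 * B) (hd : |(F.d : ℝ)| ≤ 2 * B) (hB : 1 ≤ B)
    (hA : 0 < A) (hα : 0 < α) (hη : 0 < η) (hη1 : η ≤ 1 / 8)
    (hQ : 10 * B * Q * (2 * α + 1) ≤ η ^ 2 * A)
    (hθ : ‖euc x‖ * ‖euc y‖ ≤ η * (2 * α) * √(wedgeSq x y))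
    {t : Fin 3 → ℝ} (ht : 0 < stripFun x y ((η * A) ^ 2) (((1 - 2 * η) * A) ^ 2)
      ((1 - η) / (2 * α) * ‖euc y‖) (1 / (1 + 2 * η)) (F.vecReal t))
    {s : Fin 3 → ℤ} (hs : ∀ i, (s i : ℝ) ≤ t i ∧ t i < s i + Q) :
    (‖euc (F.vec s)‖ ≤ A ∧
      |∑ i, (y i : ℝ) * F.vec s i| ≤ ‖euc y‖ * ‖euc (F.vec s)‖ / (2 * α)) ∧
    stripFun x y ((η * A) ^ 2) (((1 - 2 * η) * A) ^ 2)
      ((1 - η) / (2 * α) * ‖euc y‖) (1 / (1 + 2 * η)) (F.vecReal t) ≤ 1 / ‖euc (F.vec s)‖ := by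
  obtain ⟨hx0, hy0⟩ := norm_euc_pos_of_minor hm
  have hΔ := wedgeSq_cast_pos hm
  -- A bound for the frame vectors with coordinates in `[0, Q)`, hence for the displacement within a
  -- cell.
  set δ := 10 * B * Q with hδ
  have hδ0 : 0 ≤ δ := by positivity
  unfold stripFun at ht ⊢
  by_cases hcond : ((η * A) ^ 2 ≤ orthNormSq x y (F.vecReal t) ∧
    orthNormSq x y (F.vecReal t) ≤ ((1 - 2 * η) * A) ^ 2) ∧
    |∑ i, (y i : ℝ) * F.vecReal t i| ≤
      (1 - η) / (2 * α) * ‖euc y‖ * √(orthNormSq x y (F.vecReal t))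
  swap
  · rw [iteZero_neg hcond] at ht; exact absurd ht (lt_irrefl 0)
  rw [iteZero_pos hcond]
  obtain ⟨⟨h1, h2⟩, h3⟩ := hcond
  have hq : 0 < orthNormSq x y (F.vecReal t) := lt_of_lt_of_le (by positivity) h1
  have hqdef : orthNormSq x y (F.vecReal t) = l2 (F.vecReal t) ^ 2 -
    (∑ i, (y i : ℝ) * F.vecReal t i) ^ 2 * ‖euc x‖ ^ 2 / wedgeSq x y := rfl
  set q := orthNormSq x y (F.vecReal t)
  set ρ := √q with hρ
  have hρ2 : ρ ^ 2 = q := Real.sq_sqrt hq.le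
  have hρ0 : 0 < ρ := Real.sqrt_pos.mpr hq
  have hρ1 : η * A ≤ ρ := Real.le_sqrt_of_sq_le h1
  have hρA : ρ ≤ (1 - 2 * η) * A := by
    apply Real.sqrt_le_iff.mpr ⟨mul_nonneg (by linarith) hA.le, h2⟩
  -- the norm of `t`
  have hdot2 : (∑ i, (y i : ℝ) * F.vecReal t i) ^ 2 * ‖euc x‖ ^ 2 / wedgeSq x y
      ≤ η ^ 2 * ρ ^ 2 := by
    rw [div_le_iff₀ hΔ]
    have e1 : |∑ i, (y i : ℝ) * F.vecReal t i| * ‖euc x‖ ≤ η * √(wedgeSq x y) * ρ := by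
      calc _ ≤ (1 - η) / (2 * α) * ‖euc y‖ * ρ * ‖euc x‖ := by gcongr
        _ ≤ 1 / (2 * α) * ‖euc y‖ * ρ * ‖euc x‖ := by gcongr; linarith
        _ = 1 / (2 * α) * ρ * (‖euc x‖ * ‖euc y‖) := by ring
        _ ≤ 1 / (2 * α) * ρ * (η * (2 * α) * √(wedgeSq x y)) := by gcongr
        _ = _ := by field_simp
    have e2 := pow_le_pow_left₀ (by positivity) e1 2
    rw [mul_pow, sq_abs, mul_pow, mul_pow, Real.sq_sqrt hΔ.le] at e2
    linarith
  have ht1 : l2 (F.vecReal t) ≤ (1 + η) * ρ := by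
    apply le_of_sq_le_sq _ (by positivity)
    have : l2 (F.vecReal t) ^ 2 ≤ (1 + η ^ 2) * ρ ^ 2 := by linarith
    rw [mul_pow]
    refine this.trans (mul_le_mul_of_nonneg_right ?_ (sq_nonneg _))
    nlinarith
  have ht2 : ρ ≤ l2 (F.vecReal t) := by
    apply le_of_sq_le_sq _ (l2_nonneg _)
    have : 0 ≤ (∑ i, (y i : ℝ) * F.vecReal t i) ^ 2 * ‖euc x‖ ^ 2 / wedgeSq x y := by positivity
    linarith
  -- the displacement
  set a : Fin 4 → ℝ := fun i => (F.vec s i : ℝ) with ha_def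
  have haR : a = F.vecReal fun j => (s j : ℝ) := funext fun i => (F.vecReal_intCast s i).symm
  have hsub : F.vecReal t = fun i => a i + F.vecReal (fun j => t j - s j) i := by
    rw [haR, ← F.vecReal_add]
    simp
  have hdisp : l2 (F.vecReal fun j => t j - s j) ≤ δ := F.l2_vecReal_le hx ha hb hc hd hB
    fun i => by rw [abs_le]; constructor <;> linarith [hs i]
  have hd1 : l2 (F.vecReal t) ≤ l2 a + δ := by
    have := l2_add_le a (F.vecReal fun j => t j - s j)
    rw [← hsub] at this
    linarith
  have hd2 : l2 a ≤ l2 (F.vecReal t) + δ := by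
    have e := l2_add_le (F.vecReal t) (fun i => -1 * F.vecReal (fun j => t j - s j) i)
    rw [l2_mul, abs_neg, abs_one, one_mul] at e
    have e2 : (fun i => F.vecReal t i + -1 * F.vecReal (fun j => t j - s j) i) = a := by
      ext i
      rw [congrFun hsub i]; ring
    rw [e2] at e
    linarith
  have hna : ‖euc (F.vec s)‖ = l2 a := rfl
  rw [hna]
  have hδη : δ * (2 * α + 1) ≤ η * ρ := by
    calc δ * (2 * α + 1) ≤ η ^ 2 * A := hQ
      _ = η * (η * A) := by ring
      _ ≤ η * ρ := by gcongr
  have hδη' : δ ≤ η * ρ := by nlinarith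
  have hapos : 0 < l2 a := by nlinarith
  refine ⟨⟨?_, ?_⟩, ?_⟩
  · calc l2 a ≤ (1 + η) * ρ + δ := by linarith
      _ ≤ (1 + 2 * η) * ρ := by linarith
      _ ≤ (1 + 2 * η) * ((1 - 2 * η) * A) := by gcongr
      _ = (1 - 4 * η ^ 2) * A := by ring
      _ ≤ 1 * A := mul_le_mul_of_nonneg_right (by linarith [sq_nonneg η]) hA.le
      _ = A := one_mul A
  · have e : ∑ i, (y i : ℝ) * a i = ∑ i, (y i : ℝ) * F.vecReal t i
        - ∑ i, (y i : ℝ) * F.vecReal (fun j => t j - s j) i := by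
      rw [← Finset.sum_sub_distrib]
      refine Finset.sum_congr rfl fun i _ => ?_
      rw [congrFun hsub i]; ring
    have h4 : |∑ i, (y i : ℝ) * F.vecReal (fun j => t j - s j) i| ≤ ‖euc y‖ * δ :=
      (abs_dot_le (fun i => (y i : ℝ)) _).trans
        (mul_le_mul_of_nonneg_left hdisp (l2_nonneg _))
    have h5 : (1 - η) / (2 * α) * ρ + δ ≤ l2 a / (2 * α) := by
      rw [div_mul_eq_mul_div, div_add' _ _ _ (by positivity)]
      apply div_le_div_of_nonneg_right _ (by positivity)
      linarith
    change |∑ i, (y i : ℝ) * a i| ≤ _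
    rw [e]
    calc _ ≤ (1 - η) / (2 * α) * ‖euc y‖ * ρ + ‖euc y‖ * δ :=
          (abs_sub _ _).trans (add_le_add h3 h4)
      _ = ‖euc y‖ * ((1 - η) / (2 * α) * ρ + δ) := by ring
      _ ≤ ‖euc y‖ * (l2 a / (2 * α)) := by gcongr
      _ = _ := by ring
  · rw [div_div, div_le_div_iff₀ (by positivity) hapos, one_mul, one_mul]
    linarith

set_option maxHeartbeats 400000 in
open scoped Classical in
/-- A lower bound for the weighted number of lattice points orthogonal to `x`, and almost
orthogonal to `y`, that are primitive at the primes dividing `W * P`. -/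
theorem le_sum_inv_norm {x y : Fin 4 → ℤ} {A B α η σ : ℝ} {W P : ℕ} (hW : 0 < W) (hP : 0 < P)
    (hWP : W.Coprime P) (hcop : IsCoprime (x 0) (x 1)) (hx0 : x 0 ≠ 0) (F : Frame x)
    (hm : minor x y 0 1 ≠ 0) (hx : ∀ i, |(x i : ℝ)| ≤ B) (ha : |(F.a : ℝ)| ≤ 2 * B)
    (hb : |(F.b : ℝ)| ≤ 2 * B) (hc : |(F.c : ℝ)| ≤ 2 * B) (hd : |(F.d : ℝ)| ≤ 2 * B) (hB : 1 ≤ B)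
    (hA : 0 < A) (hα : 0 < α) (hη : 0 < η) (hη1 : η ≤ 1 / 8)
    (hQ : 10 * B * (W * P : ℕ) * (2 * α + 1) ≤ η ^ 2 * A)
    (hθ : ‖euc x‖ * ‖euc y‖ ≤ η * (2 * α) * √(wedgeSq x y))
    (hσ : (P : ℝ) ^ 3 * (1 - σ) ≤ ((residues P 3).filter (PrimitiveAt P)).card)
    (hσ1 : σ ≤ 1)
    (S : Finset (Fin 4 → ℤ)) (hS : ∀ a, a ∈ S ↔ IsMixed x y A α W (W * P) a) :
    (1 - σ) * (1 - 7 * η) * (Real.pi * (kernelSet W (F.form y)).card * A ^ 2 * ‖euc y‖ /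
      (α * (W : ℝ) ^ 3 * √(wedgeSq x y))) ≤ ∑ a ∈ S, 1 / ‖euc a‖ := by
  obtain ⟨hxn, hyn⟩ := norm_euc_pos_of_minor hm
  have hsΔ := Real.sqrt_pos.mpr (wedgeSq_cast_pos hm)
  have hWR : (0 : ℝ) < W := by exact_mod_cast hW
  have hPR : (0 : ℝ) < P := by exact_mod_cast hP
  set Q := W * P with hQdef
  have hQ0 : 0 < Q := Nat.mul_pos hW hP
  set V := 2 * Real.pi * ((1 - η) / (2 * α) * ‖euc y‖) * (1 / (1 + 2 * η)) *
    (((1 - 2 * η) * A) ^ 2 - (η * A) ^ 2) / √(wedgeSq x y) with hV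
  have hVle := le_lintegral_stripFun F hx0 hm (R := (1 - η) / (2 * α) * ‖euc y‖)
    (r₀ := (η * A) ^ 2) (r := ((1 - 2 * η) * A) ^ 2) (k := 1 / (1 + 2 * η))
    (by have : 0 ≤ 1 - η := by linarith
        positivity) (by positivity)
    (pow_le_pow_left₀ (by positivity) (by nlinarith) 2) (by positivity)
  set T := (S.filter fun a => a ∈ Set.range F.vec).preimage F.vec (F.vec_injective hcop).injOn
    with hT
  have hTm : ∀ s, s ∈ T ↔ F.vec s ∈ S := by simp [hT]
  -- The classes modulo `Q = W P` allowed by the congruence modulo `W` and primitivity at `Q`. Each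
  -- carries mass at least `V / Q³`, and the Chinese remainder theorem bounds their number from
  -- below.
  set C := (residues Q 3).filter fun s => (W : ℤ) ∣ ∑ i, F.form y i * s i ∧ PrimitiveAt Q s
  have hcell : ∀ c ∈ C, V ≤ (∑ s ∈ T.filter (fun s => modVec Q s = c), 1 / ‖euc (F.vec s)‖)
      * (Q : ℝ) ^ 3 := by
    intro c hcC
    obtain ⟨hc1, hc2, hc3⟩ := Finset.mem_filter.mp hcC
    have hnn : 0 ≤ (∑ s ∈ T.filter (fun s => modVec Q s = c), 1 / ‖euc (F.vec s)‖)
        * (Q : ℝ) ^ 3 :=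
      mul_nonneg (Finset.sum_nonneg fun _ _ => by positivity) (by positivity)
    refine (ENNReal.ofReal_le_ofReal_iff hnn).mp (hVle.trans ?_)
    refine lintegral_le_sum_mul_pow (Q := Q) _ (fun s => 1 / ‖euc (F.vec s)‖)
      (fun s => stripFun x y ((η * A) ^ 2) (((1 - 2 * η) * A) ^ 2)
        ((1 - η) / (2 * α) * ‖euc y‖) (1 / (1 + 2 * η)) (F.vecReal s))
      (fun _ _ => by positivity) fun t ht => ?_
    have hQR : (0 : ℝ) < Q := by exact_mod_cast hQ0
    -- The corner, in the class of `c` modulo `Q`, of the cube of side `Q` that contains `t`.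
    set s : Fin 3 → ℤ := fun i => c i + Q * ⌊(t i - c i) / Q⌋ with hs
    have hst : ∀ i, (s i : ℝ) ≤ t i ∧ t i < s i + Q := by
      intro i
      have h1 := Int.floor_le ((t i - c i) / Q)
      have h2 := Int.lt_floor_add_one ((t i - c i) / Q)
      rw [le_div_iff₀ hQR] at h1
      rw [div_lt_iff₀ hQR] at h2
      simp only [hs]
      push_cast
      constructor <;> linarith
    have hmod : modVec Q s = c := by
      ext i
      have := mem_residues.mp hc1 i
      simp only [modVec, hs]
      rw [Int.add_mul_emod_self_left, Int.emod_eq_of_lt this.1 this.2]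
    have hsc : ∀ i, (Q : ℤ) ∣ s i - c i := fun i => ⟨⌊(t i - c i) / Q⌋, by simp only [hs]; ring⟩
    obtain ⟨⟨hn, hcone⟩, hle⟩ := stripFun_le F hm hx ha hb hc hd hB hA hα hη hη1 hQ hθ ht hst
    refine ⟨s, Finset.mem_filter.mpr ⟨(hTm s).mpr ((hS _).mpr ⟨F.sum_mul_vec s, hn, ?_, hcone, ?_⟩),
      hmod⟩, hst, hle⟩
    · rw [F.sum_mul_vec_eq]
      refine (dvd_sum_mul_iff _ fun i => ?_).mpr hc2
      exact (Int.natCast_dvd_natCast.mpr (Dvd.intro _ rfl)).trans (hsc i)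
    · intro p hp hpQ
      by_contra hcon
      push Not at hcon
      obtain ⟨i, hi⟩ := hc3 p hp hpQ
      apply hi
      have h1 := F.dvd_of_dvd_vec hcop hcon i
      have h2 := (Int.natCast_dvd_natCast.mpr hpQ).trans (hsc i)
      exact (dvd_sub_right h1).mp h2
  have hsum : ∑ s ∈ T, 1 / ‖euc (F.vec s)‖ ≤ ∑ a ∈ S, 1 / ‖euc a‖ := by
    rw [← Finset.sum_image (f := fun a => 1 / ‖euc a‖) (g := F.vec)
      (fun s _ t _ h => F.vec_injective hcop h)]
    refine Finset.sum_le_sum_of_subset_of_nonneg ?_ fun _ _ _ => by positivity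
    intro a ha
    obtain ⟨s, hs, rfl⟩ := Finset.mem_image.mp ha
    exact (hTm s).mp hs
  have hfib : ∑ c ∈ C, ∑ s ∈ T.filter (fun s => modVec Q s = c), 1 / ‖euc (F.vec s)‖
      ≤ ∑ s ∈ T, 1 / ‖euc (F.vec s)‖ :=
    Finset.sum_fiberwise_le_sum_of_sum_fiber_nonneg fun _ _ =>
      Finset.sum_nonneg fun _ _ => by positivity
  have hCV : (C.card : ℝ) * V ≤ (∑ a ∈ S, 1 / ‖euc a‖) * (Q : ℝ) ^ 3 := by
    calc (C.card : ℝ) * V = ∑ c ∈ C, V := by rw [Finset.sum_const, nsmul_eq_mul]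
      _ ≤ ∑ c ∈ C, (∑ s ∈ T.filter (fun s => modVec Q s = c), 1 / ‖euc (F.vec s)‖)
          * (Q : ℝ) ^ 3 := Finset.sum_le_sum hcell
      _ = (∑ c ∈ C, ∑ s ∈ T.filter (fun s => modVec Q s = c), 1 / ‖euc (F.vec s)‖)
          * (Q : ℝ) ^ 3 := by rw [Finset.sum_mul]
      _ ≤ _ := by gcongr; exact hfib.trans hsum
  have hC : ((kernelSet W (F.form y)).card : ℝ) * ((P : ℝ) ^ 3 * (1 - σ)) ≤ C.card := by
    refine (mul_le_mul_of_nonneg_left hσ (Nat.cast_nonneg _)).trans ?_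
    exact_mod_cast card_kernelSet_mul_card_le hW hP hWP (F.form y)
  -- The losses are `(1 - η) / (1 + 2 η)` from the width and weight, and `(1 - 2 η)² - η²` from the
  -- radii of the annulus.
  have hVge : (1 - 7 * η) * (Real.pi * A ^ 2 * ‖euc y‖ / (α * √(wedgeSq x y))) ≤ V := by
    have e : V = ((1 - η) / (1 + 2 * η) * (1 - 4 * η + 3 * η ^ 2)) *
        (Real.pi * A ^ 2 * ‖euc y‖ / (α * √(wedgeSq x y))) := by
      rw [hV]; field_simp; ring
    rw [e]
    refine mul_le_mul_of_nonneg_right ?_ (by positivity)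
    have h1 : 1 - 3 * η ≤ (1 - η) / (1 + 2 * η) := by
      rw [le_div_iff₀ (by positivity)]; nlinarith
    have h2 : (0 : ℝ) ≤ 1 - 4 * η + 3 * η ^ 2 := by nlinarith
    calc 1 - 7 * η ≤ (1 - 3 * η) * (1 - 4 * η + 3 * η ^ 2) := by nlinarith [mul_pos hη hη]
      _ ≤ _ := mul_le_mul_of_nonneg_right h1 h2
  have hQR : (Q : ℝ) ^ 3 = (W : ℝ) ^ 3 * (P : ℝ) ^ 3 := by rw [hQdef]; push_cast; ring
  have hfin := (mul_le_mul_of_nonneg_right hC (le_trans (by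
    have : 0 ≤ 1 - 7 * η := by linarith
    positivity) hVge)).trans hCV
  have hfin2 := (mul_le_mul_of_nonneg_left hVge (by
    have : 0 ≤ 1 - σ := by linarith
    positivity : (0:ℝ) ≤ (kernelSet W (F.form y)).card * ((P : ℝ) ^ 3 * (1 - σ)))).trans hfin
  rw [hQR, ← div_le_iff₀ (by positivity)] at hfin2
  refine le_trans (le_of_eq ?_) hfin2
  field_simp


/-! ### Orthogonal vectors with a zero entry or a large common divisor -/

theorem card_Icc_neg_floor_le {R : ℝ} (hR : 1 ≤ R) :
    ((Finset.Icc (-⌊R⌋) ⌊R⌋).card : ℝ) ≤ 3 * R := by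
  have h := card_le_of_abs_le (n := 1) hR
    ((Finset.Icc (-⌊R⌋) ⌊R⌋).image fun k => (fun _ : Fin 1 => k)) (by
      intro a ha i
      obtain ⟨k, hk, rfl⟩ := Finset.mem_image.mp ha
      rw [Finset.mem_Icc] at hk
      have h1 : (k : ℝ) ≤ ⌊R⌋ := by exact_mod_cast hk.2
      have h2 : (-⌊R⌋ : ℝ) ≤ k := by exact_mod_cast hk.1
      rw [abs_le]
      constructor <;> linarith [Int.floor_le R])
  rw [Finset.card_image_of_injective _ (fun a b hab => congrFun hab 0), pow_one] at h
  exact h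

theorem mem_Icc_neg_floor {R : ℝ} {k : ℤ} (h : |(k : ℝ)| ≤ R) : k ∈ Finset.Icc (-⌊R⌋) ⌊R⌋ := by
  rw [abs_le] at h
  rw [Finset.mem_Icc]
  refine ⟨?_, Int.le_floor.mpr h.2⟩
  have h2 : -k ≤ ⌊R⌋ := Int.le_floor.mpr (by push_cast; linarith)
  linarith

theorem prod_four_le {c : Fin 4 → ℝ} {i₀ j₀ : Fin 4} (hij : i₀ ≠ j₀) (hc : ∀ i, 0 ≤ c i) {K : ℝ}
    (hK : ∀ i, i ≠ i₀ → i ≠ j₀ → c i ≤ K) : ∏ i, c i ≤ c i₀ * (c j₀ * K ^ 2) := by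
  have hj : j₀ ∈ Finset.univ.erase i₀ := Finset.mem_erase.mpr ⟨hij.symm, Finset.mem_univ j₀⟩
  rw [← Finset.mul_prod_erase _ _ (Finset.mem_univ i₀), ← Finset.mul_prod_erase _ _ hj]
  have hc2 : ((Finset.univ.erase i₀).erase j₀).card = 2 := by
    rw [Finset.card_erase_of_mem hj, Finset.card_erase_of_mem (Finset.mem_univ _)]
    simp
  have hp : ∏ i ∈ (Finset.univ.erase i₀).erase j₀, c i ≤ K ^ 2 := by
    calc _ ≤ ∏ _i ∈ (Finset.univ.erase i₀).erase j₀, K :=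
          Finset.prod_le_prod (fun i _ => hc i) fun i hi => by
            rw [Finset.mem_erase, Finset.mem_erase] at hi
            exact hK i hi.2.1 hi.1
      _ = K ^ 2 := by rw [Finset.prod_const, hc2]
  exact mul_le_mul_of_nonneg_left (mul_le_mul_of_nonneg_left hp (hc _)) (hc _)

/-- The number of vectors orthogonal to `x` in a ball. -/
theorem card_orth_le {x : Fin 4 → ℤ} {i₀ j₀ : Fin 4} (hij : i₀ ≠ j₀) (hcop : IsCoprime (x i₀) (x j₀))
    (hx0 : 0 < x i₀) (hxn : ‖euc x‖ ≤ 2 * x i₀) (hxp : 0 < ‖euc x‖) {R : ℝ} (hR : 1 ≤ R)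
    (S : Finset (Fin 4 → ℤ)) (hS : ∀ a ∈ S, ∑ i, x i * a i = 0) (hSR : ∀ a ∈ S, ‖euc a‖ ≤ R) :
    (S.card : ℝ) ≤ 36 / ‖euc x‖ * R ^ 3 + 18 * R ^ 2 := by
  classical
  set M : ℝ := (x i₀ : ℝ)
  have hM : 0 < M := Int.cast_pos.mpr hx0
  have hle : ∀ a ∈ S, ∀ i, |(a i : ℝ)| ≤ R := fun a ha i =>
    (abs_le_l2 (fun i => (a i : ℝ)) i).trans (hSR a ha)
  -- Two entries are free. They determine `a j₀` modulo `x i₀`, so only its quotient is recorded,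
  -- with about `R / x i₀` values; the entry `a i₀` then follows from orthogonality.
  let box : Fin 4 → Finset ℤ := fun i => if i = i₀ then {0} else if i = j₀ then
    Finset.Icc ⌊-R / M⌋ ⌊R / M⌋ else Finset.Icc (-⌊R⌋) ⌊R⌋
  have hcard : S.card ≤ (Fintype.piFinset box).card := by
    refine Finset.card_le_card_of_injOn
      (fun a i => if i = i₀ then 0 else if i = j₀ then a j₀ / x i₀ else a i) ?_ ?_
    · intro a ha
      refine Finset.mem_coe.mpr (Fintype.mem_piFinset.mpr fun i => ?_)
      simp only [box]
      split_ifs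
      · simp
      · have h := abs_le.mp (hle a ha j₀)
        have h1 := Int.ediv_mul_le (a j₀) hx0.ne'
        have h2 := Int.lt_ediv_add_one_mul_self (a j₀) hx0
        have h1' : ((a j₀ / x i₀ : ℤ) : ℝ) * M ≤ a j₀ := by
          rw [← Int.cast_mul]; exact Int.cast_le.mpr h1
        have h2' : (a j₀ : ℝ) < (((a j₀ / x i₀ : ℤ) : ℝ) + 1) * M := by
          have := (Int.cast_lt (R := ℝ)).mpr h2
          push_cast at this
          exact this
        rw [Finset.mem_Icc]
        refine ⟨Int.lt_add_one_iff.mp (Int.cast_lt (R := ℝ).mp ?_), Int.le_floor.mpr ?_⟩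
        · refine (Int.floor_le _).trans_lt ?_
          rw [div_lt_iff₀ hM]
          push_cast
          linarith [h.1]
        · rw [le_div_iff₀ hM]
          linarith [h.2]
      · exact mem_Icc_neg_floor (hle a ha i)
    · intro a ha b hb hab
      have hab' : ∀ i, i ≠ i₀ → i ≠ j₀ → a i = b i := fun i h1 h2 => by
        have := congrFun hab i
        simpa [h1, h2] using this
      have hq : a j₀ / x i₀ = b j₀ / x i₀ := by
        have := congrFun hab j₀
        simpa [hij.symm] using this
      have hd : ∑ i, x i * (a i - b i) = 0 := by
        simp only [mul_sub, Finset.sum_sub_distrib]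
        rw [hS a ha, hS b hb, sub_zero]
      have hd2 : x i₀ * (a i₀ - b i₀) + x j₀ * (a j₀ - b j₀) = 0 := by
        rw [← hd, ← Finset.sum_subset (Finset.subset_univ {i₀, j₀}), Finset.sum_pair hij]
        intro i _ hi
        simp only [Finset.mem_insert, Finset.mem_singleton, not_or] at hi
        rw [hab' i hi.1 hi.2]; simp
      have hdvd : x i₀ ∣ a j₀ - b j₀ := by
        refine hcop.dvd_of_dvd_mul_left ⟨-(a i₀ - b i₀), by linarith⟩
      have hj : a j₀ = b j₀ := by
        have h1 := Int.emod_add_mul_ediv (a j₀) (x i₀)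
        have h2 := Int.emod_add_mul_ediv (b j₀) (x i₀)
        have h3 : a j₀ % x i₀ = b j₀ % x i₀ := (Int.ModEq.symm ((Int.modEq_iff_dvd).mpr hdvd))
        rw [← h1, ← h2, h3, hq]
      have hi : a i₀ = b i₀ := by
        rw [hj, sub_self, mul_zero, add_zero] at hd2
        have := (mul_eq_zero.mp hd2).resolve_left hx0.ne'
        linarith
      ext i
      by_cases e1 : i = i₀
      · rw [e1, hi]
      · by_cases e2 : i = j₀
        · rw [e2, hj]
        · exact hab' i e1 e2
  have hmid : ((Finset.Icc ⌊-R / M⌋ ⌊R / M⌋).card : ℝ) ≤ 2 * R / M + 2 := by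
    rw [Int.card_Icc]
    have h1 := Int.floor_le (R / M)
    have h2 := Int.lt_floor_add_one (-R / M)
    have h3 : (0 : ℝ) ≤ R / M := by positivity
    have h5 : -R / M = -(R / M) := by ring
    have h6 : 2 * R / M = 2 * (R / M) := by ring
    have h4 : 0 ≤ ⌊R / M⌋ + 1 - ⌊-R / M⌋ := by
      have : ⌊-R / M⌋ ≤ ⌊R / M⌋ := Int.floor_le_floor (by rw [h5]; linarith)
      linarith
    have e : (((⌊R / M⌋ + 1 - ⌊-R / M⌋).toNat : ℕ) : ℝ) = ⌊R / M⌋ + 1 - ⌊-R / M⌋ := by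
      have := Int.toNat_of_nonneg h4
      exact_mod_cast this
    rw [e, h6]
    rw [h5] at h2 ⊢
    linarith
  have hbox : ((Fintype.piFinset box).card : ℝ) ≤ (2 * R / M + 2) * (3 * R) ^ 2 := by
    rw [Fintype.card_piFinset]
    push_cast
    refine (prod_four_le hij (fun _ => Nat.cast_nonneg _) (K := 3 * R) fun i h1 h2 => ?_).trans ?_
    · have e3 : box i = Finset.Icc (-⌊R⌋) ⌊R⌋ := by simp only [box, h1, h2, if_false]
      rw [e3]
      exact card_Icc_neg_floor_le hR
    · have e1 : box i₀ = {0} := if_pos rfl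
      have e2 : box j₀ = Finset.Icc ⌊-R / M⌋ ⌊R / M⌋ := by
        simp only [box, hij.symm, if_false, if_true]
      rw [e1, e2, Finset.card_singleton, Nat.cast_one, one_mul]
      exact mul_le_mul_of_nonneg_right hmid (by positivity)
  have hMx : 1 / M ≤ 2 / ‖euc x‖ := by
    rw [div_le_div_iff₀ hM hxp]; linarith
  calc (S.card : ℝ) ≤ ((Fintype.piFinset box).card : ℝ) := by exact_mod_cast hcard
    _ ≤ (2 * R / M + 2) * (3 * R) ^ 2 := hbox
    _ = 18 * R ^ 3 * (1 / M) + 18 * R ^ 2 := by ring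
    _ ≤ 18 * R ^ 3 * (2 / ‖euc x‖) + 18 * R ^ 2 := by gcongr
    _ = _ := by ring

/-- The number of vectors orthogonal to `x` in a ball, with a vanishing entry. -/
theorem card_orth_zero_le {x : Fin 4 → ℤ} (hx : ∀ i, x i ≠ 0) (i₀ : Fin 4) {R : ℝ} (hR : 1 ≤ R)
    (S : Finset (Fin 4 → ℤ)) (hS : ∀ a ∈ S, ∑ i, x i * a i = 0) (hSR : ∀ a ∈ S, ‖euc a‖ ≤ R)
    (hS0 : ∀ a ∈ S, a i₀ = 0) : (S.card : ℝ) ≤ 9 * R ^ 2 := by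
  classical
  obtain ⟨j₀, hij⟩ : ∃ j₀, j₀ ≠ i₀ := exists_ne i₀
  have hle : ∀ a ∈ S, ∀ i, |(a i : ℝ)| ≤ R := fun a ha i =>
    (abs_le_l2 (fun i => (a i : ℝ)) i).trans (hSR a ha)
  -- The entry at `i₀` vanishes and the one at `j₀` follows from orthogonality, which leaves two
  -- free entries.
  let box : Fin 4 → Finset ℤ := fun i => if i = i₀ then {0} else if i = j₀ then
    {0} else Finset.Icc (-⌊R⌋) ⌊R⌋
  have hcard : S.card ≤ (Fintype.piFinset box).card := by
    refine Finset.card_le_card_of_injOn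
      (fun a i => if i = i₀ then 0 else if i = j₀ then 0 else a i) ?_ ?_
    · intro a ha
      refine Finset.mem_coe.mpr (Fintype.mem_piFinset.mpr fun i => ?_)
      simp only [box]
      split_ifs
      · simp
      · simp
      · exact mem_Icc_neg_floor (hle a ha i)
    · intro a ha b hb hab
      have hab' : ∀ i, i ≠ j₀ → a i = b i := fun i h2 => by
        by_cases h1 : i = i₀
        · rw [h1, hS0 a ha, hS0 b hb]
        · have := congrFun hab i
          simpa [h1, h2] using this
      have hd : ∑ i, x i * (a i - b i) = 0 := by
        simp only [mul_sub, Finset.sum_sub_distrib]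
        rw [hS a ha, hS b hb, sub_zero]
      have hd2 : x j₀ * (a j₀ - b j₀) = 0 := by
        rw [← hd]
        symm
        refine Finset.sum_eq_single j₀ (fun i _ hi => by rw [hab' i hi]; simp) (by simp)
      have := (mul_eq_zero.mp hd2).resolve_left (hx j₀)
      ext i
      by_cases e1 : i = j₀
      · rw [e1]; linarith
      · exact hab' i e1
  have hbox : ((Fintype.piFinset box).card : ℝ) ≤ (3 * R) ^ 2 := by
    rw [Fintype.card_piFinset]
    push_cast
    refine (prod_four_le hij (fun _ => Nat.cast_nonneg _) (K := 3 * R) fun i h1 h2 => ?_).trans ?_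
    · have e3 : box i = Finset.Icc (-⌊R⌋) ⌊R⌋ := by simp only [box, h1, h2, if_false]
      rw [e3]
      exact card_Icc_neg_floor_le hR
    · simp [box]
  calc (S.card : ℝ) ≤ ((Fintype.piFinset box).card : ℝ) := by exact_mod_cast hcard
    _ ≤ (3 * R) ^ 2 := hbox
    _ = _ := by ring

theorem sum_range_pow_le_two_mul {q : ℝ} (hq : 2 ≤ q) (n : ℕ) :
    ∑ i ∈ Finset.range (n + 1), q ^ i ≤ 2 * q ^ n := by
  induction n with
  | zero => simp
  | succ k ih =>
    rw [Finset.sum_range_succ, pow_succ q k]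
    have : 0 ≤ q ^ k := by positivity
    nlinarith

/-- Partial summation of a negative power over a set with a polynomial counting function. -/
theorem sum_one_div_pow_le {ι : Type*} (S : Finset ι) (ν : ι → ℝ) {A c₁ c₂ : ℝ} {j d₁ d₂ : ℕ}
    (hA : 0 ≤ A) (hd₁ : 0 < d₁) (hd₂ : 0 < d₂) (hc₁ : 0 ≤ c₁) (hc₂ : 0 ≤ c₂)
    (hν : ∀ a ∈ S, 1 ≤ ν a) (hνA : ∀ a ∈ S, ν a ≤ A)
    (h : ∀ R, 1 ≤ R → ((S.filter fun a => ν a ≤ R).card : ℝ) ≤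
      c₁ * R ^ (j + d₁) + c₂ * R ^ (j + d₂)) :
    ∑ a ∈ S, 1 / ν a ^ j ≤ 2 ^ (j + d₁ + 1) * c₁ * A ^ d₁ + 2 ^ (j + d₂ + 1) * c₂ * A ^ d₂ := by
  classical
  rcases S.eq_empty_or_nonempty with h0 | ⟨a₀, ha₀⟩
  · rw [h0, Finset.sum_empty]
    positivity
  have hA1 : 1 ≤ A := (hν a₀ ha₀).trans (hνA a₀ ha₀)
  set I := Nat.log 2 ⌊A⌋₊
  have hI : (2 : ℝ) ^ I ≤ A := by
    have h1 : 2 ^ I ≤ ⌊A⌋₊ := Nat.pow_log_le_self 2 (Nat.floor_pos.mpr hA1).ne'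
    calc (2 : ℝ) ^ I = ((2 ^ I : ℕ) : ℝ) := by push_cast; rfl
      _ ≤ (⌊A⌋₊ : ℝ) := by exact_mod_cast h1
      _ ≤ A := Nat.floor_le (by linarith)
  -- Dyadic decomposition: `ν a` lies between `2 ^ key a` and `2 ^ (key a + 1)`. The positive
  -- exponents `d₁` and `d₂` make the sum over dyadic ranges geometric.
  let key : ι → ℕ := fun a => Nat.log 2 ⌊ν a⌋₊
  have hkey : ∀ a ∈ S, key a ∈ Finset.range (I + 1) := fun a ha =>
    Finset.mem_range.mpr (Nat.lt_succ_of_le (Nat.log_mono_right (Nat.floor_le_floor (hνA a ha))))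
  have hlow : ∀ a ∈ S, (2 : ℝ) ^ key a ≤ ν a := fun a ha => by
    have h1 : 2 ^ key a ≤ ⌊ν a⌋₊ := Nat.pow_log_le_self 2 (Nat.floor_pos.mpr (hν a ha)).ne'
    calc (2 : ℝ) ^ key a = ((2 ^ key a : ℕ) : ℝ) := by push_cast; rfl
      _ ≤ (⌊ν a⌋₊ : ℝ) := by exact_mod_cast h1
      _ ≤ ν a := Nat.floor_le (by linarith [hν a ha])
  have hup : ∀ a ∈ S, ν a ≤ 2 ^ (key a + 1) := fun a ha => by
    have h1 : ⌊ν a⌋₊ < 2 ^ (key a + 1) := Nat.lt_pow_succ_log_self (by norm_num) _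
    have h2 : ν a < ((2 ^ (key a + 1) : ℕ) : ℝ) := (Nat.floor_lt (by linarith [hν a ha])).mp h1
    push_cast at h2
    exact h2.le
  have hgeom : ∀ d : ℕ, 0 < d → ∑ i ∈ Finset.range (I + 1), ((2 : ℝ) ^ d) ^ i ≤ 2 * A ^ d := by
    intro d hd
    have h2 : (2 : ℝ) ≤ 2 ^ d := by
      calc (2 : ℝ) = 2 ^ 1 := by norm_num
        _ ≤ 2 ^ d := pow_le_pow_right₀ (by norm_num) hd
    refine (sum_range_pow_le_two_mul h2 I).trans ?_
    rw [← pow_mul, mul_comm d, pow_mul]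
    gcongr
  rw [← Finset.sum_fiberwise_of_maps_to hkey]
  calc ∑ i ∈ Finset.range (I + 1), ∑ a ∈ S.filter (fun a => key a = i), 1 / ν a ^ j
      ≤ ∑ i ∈ Finset.range (I + 1), (c₁ * 2 ^ (j + d₁) * ((2 : ℝ) ^ d₁) ^ i
        + c₂ * 2 ^ (j + d₂) * ((2 : ℝ) ^ d₂) ^ i) := by
        refine Finset.sum_le_sum fun i _ => ?_
        have hc : ((S.filter fun a => key a = i).card : ℝ) ≤
            c₁ * (2 ^ (i + 1)) ^ (j + d₁) + c₂ * (2 ^ (i + 1)) ^ (j + d₂) := by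
          refine le_trans ?_ (h (2 ^ (i + 1)) (one_le_pow₀ (by norm_num)))
          have : (S.filter fun a => key a = i) ⊆ S.filter fun a => ν a ≤ 2 ^ (i + 1) := by
            intro a ha
            obtain ⟨h1, rfl⟩ := Finset.mem_filter.mp ha
            exact Finset.mem_filter.mpr ⟨h1, hup a h1⟩
          exact_mod_cast Finset.card_le_card this
        calc ∑ a ∈ S.filter (fun a => key a = i), 1 / ν a ^ j
            ≤ ∑ a ∈ S.filter (fun a => key a = i), 1 / ((2 : ℝ) ^ i) ^ j := by
              refine Finset.sum_le_sum fun a ha => ?_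
              obtain ⟨h1, rfl⟩ := Finset.mem_filter.mp ha
              have := hlow a h1
              gcongr
          _ = ((S.filter fun a => key a = i).card : ℝ) * (1 / ((2 : ℝ) ^ i) ^ j) := by
              rw [Finset.sum_const, nsmul_eq_mul]
          _ ≤ (c₁ * (2 ^ (i + 1)) ^ (j + d₁) + c₂ * (2 ^ (i + 1)) ^ (j + d₂))
              * (1 / ((2 : ℝ) ^ i) ^ j) := by gcongr
          _ = _ := by
              have e : ∀ d : ℕ, ((2 : ℝ) ^ (i + 1)) ^ (j + d)
                  = 2 ^ (j + d) * (2 ^ d) ^ i * (2 ^ i) ^ j := by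
                intro d
                simp only [← pow_mul, ← pow_add]
                congr 1; ring
              rw [e, e]
              field_simp
    _ = c₁ * 2 ^ (j + d₁) * ∑ i ∈ Finset.range (I + 1), ((2 : ℝ) ^ d₁) ^ i
        + c₂ * 2 ^ (j + d₂) * ∑ i ∈ Finset.range (I + 1), ((2 : ℝ) ^ d₂) ^ i := by
        rw [Finset.sum_add_distrib, Finset.mul_sum, Finset.mul_sum]
    _ ≤ c₁ * 2 ^ (j + d₁) * (2 * A ^ d₁) + c₂ * 2 ^ (j + d₂) * (2 * A ^ d₂) := by
        gcongr
        · exact hgeom d₁ hd₁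
        · exact hgeom d₂ hd₂
    _ = _ := by ring


theorem one_le_norm_euc {n : ℕ} {a : Fin n → ℤ} (ha : a ≠ 0) : 1 ≤ ‖euc a‖ := by
  obtain ⟨i, hi⟩ := Function.ne_iff.mp ha
  have h1 : (1 : ℝ) ≤ |(a i : ℝ)| := by
    have : 1 ≤ |a i| := Int.one_le_abs hi
    exact_mod_cast this
  exact h1.trans (abs_le_l2 (fun i => (a i : ℝ)) i)

theorem finite_norm_le {n : ℕ} (A : ℝ) : {a : Fin n → ℤ | ‖euc a‖ ≤ A}.Finite :=
  (finite_box A).subset fun a ha i => (abs_le_l2 (fun i => (a i : ℝ)) i).trans ha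

theorem sum_inv_norm_orth_le {x : Fin 4 → ℤ} {i₀ j₀ : Fin 4} (hij : i₀ ≠ j₀)
    (hcop : IsCoprime (x i₀) (x j₀))
    (hx0 : 0 < x i₀) (hxn : ‖euc x‖ ≤ 2 * x i₀) (hxp : 0 < ‖euc x‖) {A : ℝ} (hA : 0 ≤ A)
    (S : Finset (Fin 4 → ℤ)) (hS : ∀ a ∈ S, ∑ i, x i * a i = 0) (hSA : ∀ a ∈ S, ‖euc a‖ ≤ A)
    (hS0 : ∀ a ∈ S, a ≠ 0) :
    ∑ a ∈ S, 1 / ‖euc a‖ ≤ 576 / ‖euc x‖ * A ^ 2 + 144 * A := by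
  have h := sum_one_div_pow_le (j := 1) (d₁ := 2) (d₂ := 1) (c₁ := 36 / ‖euc x‖) (c₂ := 18)
    S (fun a => ‖euc a‖) hA two_pos one_pos (by positivity) (by norm_num)
    (fun a ha => one_le_norm_euc (hS0 a ha)) hSA (fun R hR =>
      card_orth_le hij hcop hx0 hxn hxp hR _ (fun a ha => hS a (Finset.mem_filter.mp ha).1)
        fun a ha => (Finset.mem_filter.mp ha).2)
  simp only [pow_one] at h
  refine h.trans (le_of_eq ?_)
  ring

theorem sum_inv_norm_orth_zero_le {x : Fin 4 → ℤ} (hx : ∀ i, x i ≠ 0) (i₀ : Fin 4) {A : ℝ}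
    (hA : 0 ≤ A) (S : Finset (Fin 4 → ℤ)) (hS : ∀ a ∈ S, ∑ i, x i * a i = 0)
    (hSA : ∀ a ∈ S, ‖euc a‖ ≤ A) (hS0 : ∀ a ∈ S, a ≠ 0) (hSi : ∀ a ∈ S, a i₀ = 0) :
    ∑ a ∈ S, 1 / ‖euc a‖ ≤ 72 * A := by
  have h := sum_one_div_pow_le (j := 1) (d₁ := 1) (d₂ := 1) (c₁ := 9) (c₂ := 0)
    S (fun a => ‖euc a‖) hA one_pos one_pos (by norm_num) le_rfl
    (fun a ha => one_le_norm_euc (hS0 a ha)) hSA (fun R hR => by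
      rw [zero_mul, add_zero]
      exact card_orth_zero_le hx i₀ hR _ (fun a ha => hS a (Finset.mem_filter.mp ha).1)
        (fun a ha => (Finset.mem_filter.mp ha).2) fun a ha => hSi a (Finset.mem_filter.mp ha).1)
  simp only [pow_one] at h
  refine h.trans (le_of_eq ?_)
  ring

/-- The contribution of the vectors divisible by an integer greater than `z`. -/
theorem sum_inv_norm_orth_dvd_le {x : Fin 4 → ℤ} {i₀ j₀ : Fin 4} (hij : i₀ ≠ j₀)
    (hcop : IsCoprime (x i₀) (x j₀))
    (hx0 : 0 < x i₀) (hxn : ‖euc x‖ ≤ 2 * x i₀) (hxp : 0 < ‖euc x‖) {A : ℝ} (hA : 0 ≤ A)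
    {z : ℕ} (hz : 0 < z)
    (S : Finset (Fin 4 → ℤ)) (hS : ∀ a ∈ S, ∑ i, x i * a i = 0) (hSA : ∀ a ∈ S, ‖euc a‖ ≤ A)
    (hS0 : ∀ a ∈ S, a ≠ 0) (hSp : ∀ a ∈ S, ∃ p : ℕ, z < p ∧ ∀ i, (p : ℤ) ∣ a i) :
    ∑ a ∈ S, 1 / ‖euc a‖ ≤ 576 / ‖euc x‖ * A ^ 2 / (z : ℝ) ^ 2 + 144 * A / z := by
  classical
  have hzR : (0 : ℝ) < z := by exact_mod_cast hz
  choose! p hzp hpd using hSp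
  have hpA : ∀ a ∈ S, (p a : ℝ) ≤ A := by
    intro a ha
    obtain ⟨i, hi⟩ := Function.ne_iff.mp (hS0 a ha)
    have h1 : (p a : ℤ) ≤ |a i| := Int.le_of_dvd (abs_pos.mpr hi) ((dvd_abs _ _).mpr (hpd a ha i))
    have h2 : (p a : ℝ) ≤ |(a i : ℝ)| := by exact_mod_cast h1
    exact h2.trans ((abs_le_l2 (fun i => (a i : ℝ)) i).trans (hSA a ha))
  have hkey : ∀ a ∈ S, p a ∈ Finset.Ioc z ⌊A⌋₊ := fun a ha =>
    Finset.mem_Ioc.mpr ⟨hzp a ha, Nat.le_floor (hpA a ha)⟩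
  rcases S.eq_empty_or_nonempty with h0 | ⟨a₀, ha₀⟩
  · rw [h0, Finset.sum_empty]; positivity
  have hzA : z ≤ ⌊A⌋₊ := by
    have := Finset.mem_Ioc.mp (hkey a₀ ha₀)
    omega
  rw [← Finset.sum_fiberwise_of_maps_to hkey]
  have hone : ∀ q ∈ Finset.Ioc z ⌊A⌋₊, ∑ a ∈ S.filter (fun a => p a = q), 1 / ‖euc a‖ ≤
      (576 / ‖euc x‖ * A ^ 2 / z + 144 * A) * ((q : ℝ) ^ 2)⁻¹ := by
    intro q hq
    have hq1 := Finset.mem_Ioc.mp hq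
    have hq0 : (0 : ℝ) < q := by exact_mod_cast (lt_trans hz hq1.1)
    have hqz : (z : ℝ) ≤ q := by exact_mod_cast hq1.1.le
    set T := S.filter fun a => p a = q
    have hT : ∀ a ∈ T, a ∈ S ∧ ∀ i, (q : ℤ) ∣ a i := by
      intro a ha
      obtain ⟨h1, rfl⟩ := Finset.mem_filter.mp ha
      exact ⟨h1, hpd a h1⟩
    -- Dividing by the common divisor `q` reduces to the ball of radius `A / q` and brings out `1 /
    -- q`; the sum of `q ^ (-2)` over `q > z` is at most `1 / z`.
    let g : (Fin 4 → ℤ) → Fin 4 → ℤ := fun a i => a i / q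
    have hg : ∀ a ∈ T, ∀ i, a i = q * g a i := fun a ha i =>
      (Int.mul_ediv_cancel' ((hT a ha).2 i)).symm
    have hnorm : ∀ a ∈ T, ‖euc a‖ = q * ‖euc (g a)‖ := by
      intro a ha
      have : (fun i => (a i : ℝ)) = fun i => (q : ℝ) * (g a i : ℝ) := by
        ext i
        rw [hg a ha i]; push_cast; rfl
      rw [norm_euc, this, l2_mul, abs_of_pos hq0, norm_euc]
    have hinj : Set.InjOn g T := by
      intro a ha b hb hab
      ext i
      rw [hg a ha i, hg b hb i, hab]
    have h := sum_inv_norm_orth_le hij hcop hx0 hxn hxp (A := A / q) (by positivity)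
      (T.image g) (by
        intro b hb
        obtain ⟨a, ha, rfl⟩ := Finset.mem_image.mp hb
        have h1 := hS a (hT a ha).1
        have h2 : ∑ i, x i * a i = q * ∑ i, x i * g a i := by
          rw [Finset.mul_sum]
          exact Finset.sum_congr rfl fun i _ => by rw [hg a ha i]; ring
        rw [h2] at h1
        exact (mul_eq_zero.mp h1).resolve_left (by have := hq1.1; omega)) (by
        intro b hb
        obtain ⟨a, ha, rfl⟩ := Finset.mem_image.mp hb
        rw [le_div_iff₀ hq0, mul_comm, ← hnorm a ha]
        exact hSA a (hT a ha).1) (by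
        intro b hb
        obtain ⟨a, ha, rfl⟩ := Finset.mem_image.mp hb
        intro h0
        refine hS0 a (hT a ha).1 (funext fun i => ?_)
        rw [hg a ha i, h0]; simp)
    rw [Finset.sum_image hinj] at h
    calc ∑ a ∈ T, 1 / ‖euc a‖ = (1 / q) * ∑ a ∈ T, 1 / ‖euc (g a)‖ := by
          rw [Finset.mul_sum]
          refine Finset.sum_congr rfl fun a ha => ?_
          rw [hnorm a ha, one_div_mul_one_div]
      _ ≤ (1 / q) * (576 / ‖euc x‖ * (A / q) ^ 2 + 144 * (A / q)) := by gcongr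
      _ = (576 / ‖euc x‖ * A ^ 2 / q + 144 * A) * ((q : ℝ) ^ 2)⁻¹ := by field_simp
      _ ≤ _ := by gcongr
  have hsq : ∑ q ∈ Finset.Ioc z ⌊A⌋₊, ((q : ℝ) ^ 2)⁻¹ ≤ (z : ℝ)⁻¹ := by
    refine (sum_Ioc_inv_sq_le_sub hz.ne' hzA).trans ?_
    have : (0 : ℝ) ≤ (⌊A⌋₊ : ℝ)⁻¹ := by positivity
    linarith
  calc _ ≤ ∑ q ∈ Finset.Ioc z ⌊A⌋₊,
        (576 / ‖euc x‖ * A ^ 2 / z + 144 * A) * ((q : ℝ) ^ 2)⁻¹ := Finset.sum_le_sum hone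
    _ = (576 / ‖euc x‖ * A ^ 2 / z + 144 * A) * ∑ q ∈ Finset.Ioc z ⌊A⌋₊, ((q : ℝ) ^ 2)⁻¹ := by
        rw [Finset.mul_sum]
    _ ≤ (576 / ‖euc x‖ * A ^ 2 / z + 144 * A) * (z : ℝ)⁻¹ := by gcongr
    _ = _ := by field_simp

theorem exists_prime_dvd_of_gcd_ne_one {a : Fin 4 → ℤ} (ha : Finset.univ.gcd a ≠ 1) :
    ∃ p : ℕ, p.Prime ∧ ∀ i, (p : ℤ) ∣ a i := by
  have h1 : (Finset.univ.gcd a).natAbs ≠ 1 := by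
    intro h
    apply ha
    rw [← Finset.normalize_gcd, ← Int.abs_eq_normalize, Int.abs_eq_natAbs, h]; rfl
  obtain ⟨p, hp, hpd⟩ := Nat.exists_prime_and_dvd h1
  exact ⟨p, hp, fun i => (Int.natCast_dvd.mpr hpd).trans (Finset.gcd_dvd (Finset.mem_univ i))⟩

theorem primitiveAt_of_mem {a : Fin 4 → ℤ} (ha : a ∈ primitiveTuples) (n : ℕ) :
    PrimitiveAt n a := by
  intro p hp _
  by_contra hc
  push Not at hc
  have h1 : (p : ℤ) ∣ Finset.univ.gcd a := Finset.dvd_gcd fun i _ => hc i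
  rw [ha.2] at h1
  have h2 : (p : ℤ) ≤ 1 := Int.le_of_dvd one_pos h1
  have := hp.two_le
  omega

theorem ne_zero_of_mem {a : Fin 4 → ℤ} (ha : a ∈ primitiveTuples) : a ≠ 0 := fun h =>
  ha.1 0 (by rw [h]; rfl)

open scoped Classical in
/-- The vectors counted in the lower bound for the mixed sum are, up to a small proportion, primitive
with non-zero entries. -/
theorem sum_isMixed_le {x y : Fin 4 → ℤ} {i₀ j₀ : Fin 4} (hij : i₀ ≠ j₀)
    (hcop : IsCoprime (x i₀) (x j₀)) (hx : ∀ i, x i ≠ 0)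
    (hx0 : 0 < x i₀) (hxn : ‖euc x‖ ≤ 2 * x i₀) (hxp : 0 < ‖euc x‖) {A α : ℝ} (hA : 0 ≤ A)
    {W n z : ℕ} (hz : 0 < z) (hn : ∀ p : ℕ, p.Prime → p ≤ z → p ∣ n)
    (S : Finset (Fin 4 → ℤ)) (hS : ∀ a, a ∈ S ↔ IsMixed x y A α W n a)
    (L : Finset (Fin 4 → ℤ)) (hL : ∀ a ∈ S, a ∈ primitiveTuples → a ∈ L) :
    ∑ a ∈ S, 1 / ‖euc a‖ ≤ ∑ a ∈ L, 1 / ‖euc a‖ +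
      (288 * A + (576 / ‖euc x‖ * A ^ 2 / (z : ℝ) ^ 2 + 144 * A / z)) := by
  have hpt : ∀ a ∈ S, 1 / ‖euc a‖ ≤ (if a ∈ L then 1 / ‖euc a‖ else 0) +
      (∑ i, (if a ≠ 0 ∧ a i = 0 then 1 / ‖euc a‖ else 0) +
        (if a ≠ 0 ∧ ∃ p : ℕ, z < p ∧ ∀ i, (p : ℤ) ∣ a i then 1 / ‖euc a‖ else 0)) := by
    intro a ha
    have h0 : 0 ≤ 1 / ‖euc a‖ := by positivity
    have hL0 : 0 ≤ (if a ∈ L then 1 / ‖euc a‖ else 0) := by split_ifs <;> simp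
    have hZ0 : ∀ i : Fin 4, 0 ≤ (if a ≠ 0 ∧ a i = 0 then 1 / ‖euc a‖ else 0) := fun i => by
      split_ifs <;> simp
    have hD0 : 0 ≤ (if a ≠ 0 ∧ ∃ p : ℕ, z < p ∧ ∀ i, (p : ℤ) ∣ a i then 1 / ‖euc a‖ else 0) := by
      split_ifs <;> simp
    have hZs := Finset.sum_nonneg fun i (_ : i ∈ Finset.univ) => hZ0 i
    -- The zero vector has weight `1 / 0`, which is `0` by convention, so it contributes nothing.
    by_cases ha0 : a = 0
    · have : 1 / ‖euc a‖ = 0 := by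
        rw [ha0]
        have : (euc (0 : Fin 4 → ℤ)) = 0 := by ext i; simp [euc]
        rw [this]; simp
      linarith
    by_cases hprim : a ∈ primitiveTuples
    · rw [if_pos (hL a ha hprim)]; linarith
    by_cases hz0 : ∃ i, a i = 0
    · obtain ⟨i, hi⟩ := hz0
      have := Finset.single_le_sum (f := fun i => if a ≠ 0 ∧ a i = 0 then 1 / ‖euc a‖ else 0)
        (fun i _ => hZ0 i) (Finset.mem_univ i)
      simp only [if_pos (⟨ha0, hi⟩ : a ≠ 0 ∧ a i = 0)] at this
      linarith
    · push Not at hz0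
      have hg : Finset.univ.gcd a ≠ 1 := fun hg => hprim ⟨hz0, hg⟩
      obtain ⟨p, hp, hpd⟩ := exists_prime_dvd_of_gcd_ne_one hg
      -- A common prime factor up to `z` would divide `n`, contrary to primitivity at `n`.
      have hzp : z < p := by
        by_contra hc
        push Not at hc
        obtain ⟨i, hi⟩ := ((hS a).mp ha).prim p hp (hn p hp hc)
        exact hi (hpd i)
      rw [if_pos (⟨ha0, p, hzp, hpd⟩ : a ≠ 0 ∧ ∃ p : ℕ, z < p ∧ ∀ i, (p : ℤ) ∣ a i)]
      linarith
  refine (Finset.sum_le_sum hpt).trans ?_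
  rw [Finset.sum_add_distrib, Finset.sum_add_distrib, Finset.sum_comm]
  have hZ : ∀ i, ∑ a ∈ S, (if a ≠ 0 ∧ a i = 0 then 1 / ‖euc a‖ else 0) ≤ 72 * A := by
    intro i
    rw [← Finset.sum_filter]
    refine sum_inv_norm_orth_zero_le hx i hA _ ?_ ?_ ?_ ?_ <;> intro a ha <;>
      obtain ⟨h1, h2, h3⟩ := Finset.mem_filter.mp ha
    · exact ((hS a).mp h1).orth
    · exact ((hS a).mp h1).norm_le
    · exact h2
    · exact h3
  refine add_le_add ?_ (add_le_add ?_ ?_)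
  · rw [← Finset.sum_filter]
    refine Finset.sum_le_sum_of_subset_of_nonneg (fun a ha => (Finset.mem_filter.mp ha).2)
      fun _ _ _ => by positivity
  · calc _ ≤ ∑ _i : Fin 4, 72 * A := Finset.sum_le_sum fun i _ => hZ i
      _ = _ := by simp; ring
  · rw [← Finset.sum_filter]
    refine sum_inv_norm_orth_dvd_le hij hcop hx0 hxn hxp hA hz _ ?_ ?_ ?_ ?_ <;> intro a ha <;>
      obtain ⟨h1, h2, h3⟩ := Finset.mem_filter.mp ha
    · exact ((hS a).mp h1).orth
    · exact ((hS a).mp h1).norm_le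
    · exact h2
    · exact h3


/-! ### Expansion of the square into pairs of prime tuples -/

open scoped Classical in
/-- The indicator function of the lattice orthogonal to `x`. -/
noncomputable def orthInd (a x : Fin 4 → ℤ) : ℝ := if a ∈ orthLattice x then 1 else 0

open scoped Classical in
/-- The local density attached to `x`, at `a`. -/
noncomputable def locDensity (α : ℝ) (W : ℕ) (a x : Fin 4 → ℤ) : ℝ :=
  if a ∈ orthLatticeMod W x ∧ euc a ∈ coneRegion α (euc x) then α * W / (‖euc a‖ * ‖euc x‖) else 0

theorem orthInd_nonneg (a x : Fin 4 → ℤ) : 0 ≤ orthInd a x := by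
  unfold orthInd; split_ifs <;> norm_num

theorem locDensity_nonneg {α : ℝ} (hα : 0 ≤ α) (W : ℕ) (a x : Fin 4 → ℤ) :
    0 ≤ locDensity α W a x := by
  unfold locDensity; split_ifs <;> positivity

/-- The number of primitive tuples in the ball orthogonal to both `x` and `y`. -/
noncomputable def pairCount (A : ℝ) (x y : Fin 4 → ℤ) : ℝ :=
  ∑ a ∈ (finite_primitiveTuplesUpTo A).toFinset, orthInd a x * orthInd a y

/-- The mixed second moment. -/
noncomputable def pairMixed (A α : ℝ) (W : ℕ) (x y : Fin 4 → ℤ) : ℝ :=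
  ∑ a ∈ (finite_primitiveTuplesUpTo A).toFinset, orthInd a x * locDensity α W a y

/-- The second moment of the local densities. -/
noncomputable def pairLocal (A α : ℝ) (W : ℕ) (x y : Fin 4 → ℤ) : ℝ :=
  ∑ a ∈ (finite_primitiveTuplesUpTo A).toFinset, locDensity α W a x * locDensity α W a y

/-- The mixed term of a single pair is not symmetric in `x` and `y`, but its sum over all ordered
pairs is, which accounts for the factor `2`. -/
theorem sum_abs_sub_sq_eq (A B : ℝ) :
    ∑ a ∈ (finite_primitiveTuplesUpTo A).toFinset, |weightedCount a B - localCount a B| ^ 2 =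
      Real.log B ^ 8 * ∑ x ∈ (finite_primeTuples B).toFinset,
        ∑ y ∈ (finite_primeTuples B).toFinset,
          (pairCount A x y - 2 * pairMixed A (alphaParam B) (WParam B) x y
            + pairLocal A (alphaParam B) (WParam B) x y) := by
  set X := (finite_primeTuples B).toFinset
  set LA := (finite_primitiveTuplesUpTo A).toFinset
  set α := alphaParam B
  set W := WParam B
  have h1 : ∀ a, weightedCount a B = Real.log B ^ 4 * ∑ x ∈ X, orthInd a x := by
    intro a
    unfold weightedCount orthInd
    rw [Finset.sum_filter]
  have h2 : ∀ a, localCount a B = Real.log B ^ 4 * ∑ x ∈ X, locDensity α W a x := by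
    intro a
    unfold localCount locDensity
    rw [Finset.sum_filter, mul_assoc]
    congr 1
    rw [Finset.mul_sum]
    refine Finset.sum_congr rfl fun x _ => ?_
    split_ifs
    · rw [div_mul_div_comm, mul_one]
    · rw [mul_zero]
  have h3 : ∀ a, |weightedCount a B - localCount a B| ^ 2 = Real.log B ^ 8 *
      (∑ x ∈ X, ∑ y ∈ X, orthInd a x * orthInd a y -
        2 * ∑ x ∈ X, ∑ y ∈ X, orthInd a x * locDensity α W a y +
        ∑ x ∈ X, ∑ y ∈ X, locDensity α W a x * locDensity α W a y) := by
    intro a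
    rw [sq_abs, h1, h2, ← Finset.sum_mul_sum, ← Finset.sum_mul_sum, ← Finset.sum_mul_sum]
    ring
  simp_rw [h3]
  rw [← Finset.mul_sum]
  congr 1
  simp only [pairCount, pairMixed, pairLocal]
  rw [Finset.sum_add_distrib, Finset.sum_sub_distrib, ← Finset.mul_sum]
  have hcomm : ∀ f : (Fin 4 → ℤ) → (Fin 4 → ℤ) → (Fin 4 → ℤ) → ℝ,
      ∑ a ∈ LA, ∑ x ∈ X, ∑ y ∈ X, f a x y = ∑ x ∈ X, ∑ y ∈ X, ∑ a ∈ LA, f a x y := by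
    intro f
    rw [Finset.sum_comm]
    exact Finset.sum_congr rfl fun x _ => Finset.sum_comm
  rw [hcomm, hcomm, hcomm]
  simp only [Finset.sum_add_distrib, Finset.sum_sub_distrib, Finset.mul_sum]
  rfl

theorem mem_tuplesUpTo {A : ℝ} {a : Fin 4 → ℤ} :
    a ∈ (finite_primitiveTuplesUpTo A).toFinset ↔ a ∈ primitiveTuples ∧ ‖euc a‖ ≤ A := by
  rw [Set.Finite.mem_toFinset]; rfl

open scoped Classical in
theorem pairCount_eq (A : ℝ) (x y : Fin 4 → ℤ) : pairCount A x y =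
    (((finite_primitiveTuplesUpTo A).toFinset.filter fun a =>
      a ∈ orthLattice x ∧ a ∈ orthLattice y).card : ℝ) := by
  unfold pairCount orthInd
  rw [Finset.card_filter]
  push_cast
  refine Finset.sum_congr rfl fun a _ => ?_
  by_cases h1 : a ∈ orthLattice x <;> by_cases h2 : a ∈ orthLattice y <;> simp [h1, h2]

theorem pairCount_comm (A : ℝ) (x y : Fin 4 → ℤ) : pairCount A x y = pairCount A y x :=
  Finset.sum_congr rfl fun _ _ => mul_comm _ _

theorem mem_orthLattice {x a : Fin 4 → ℤ} : a ∈ orthLattice x ↔ ∑ i, x i * a i = 0 := Iff.rfl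

theorem pairMixed_nonneg {A α : ℝ} (hα : 0 ≤ α) (W : ℕ) (x y : Fin 4 → ℤ) :
    0 ≤ pairMixed A α W x y :=
  Finset.sum_nonneg fun _ _ => mul_nonneg (orthInd_nonneg _ _) (locDensity_nonneg hα _ _ _)

theorem inner_euc (x a : Fin 4 → ℤ) : inner ℝ (euc x) (euc a) = ∑ i, (x i : ℝ) * a i := by
  simp only [euc, PiLp.inner_apply, RCLike.inner_apply, conj_trivial]
  exact Finset.sum_congr rfl fun i _ => mul_comm _ _

theorem mem_coneRegion {α : ℝ} {x a : Fin 4 → ℤ} : euc a ∈ coneRegion α (euc x) ↔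
    |∑ i, (x i : ℝ) * a i| ≤ ‖euc x‖ * ‖euc a‖ / (2 * α) := by
  rw [← inner_euc]; rfl

theorem mem_orthLatticeMod {W : ℕ} {x a : Fin 4 → ℤ} :
    a ∈ orthLatticeMod W x ↔ (W : ℤ) ∣ ∑ i, x i * a i := Int.modEq_zero_iff_dvd

theorem euc_comp_norm (σ : Equiv.Perm (Fin 4)) (a : Fin 4 → ℤ) : ‖euc (a ∘ σ)‖ = ‖euc a‖ := by
  have : ‖euc (a ∘ σ)‖ ^ 2 = ‖euc a‖ ^ 2 := by
    rw [norm_euc_sq, norm_euc_sq]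
    exact Equiv.sum_comp σ fun i => (a i : ℝ) ^ 2
  exact (pow_left_inj₀ (norm_nonneg _) (norm_nonneg _) two_ne_zero).mp this

theorem wedgeSq_comp (σ : Equiv.Perm (Fin 4)) (x y : Fin 4 → ℤ) :
    wedgeSq (x ∘ σ) (y ∘ σ) = wedgeSq x y := by
  unfold wedgeSq
  rw [← Equiv.sum_comp σ fun i => x i ^ 2, ← Equiv.sum_comp σ fun i => y i ^ 2,
    ← Equiv.sum_comp σ fun i => x i * y i]
  rfl

theorem minorGcd_comp (σ : Equiv.Perm (Fin 4)) (x y : Fin 4 → ℤ) :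
    minorGcd (x ∘ σ) (y ∘ σ) = minorGcd x y := by
  apply Nat.dvd_antisymm
  · refine dvd_minorGcd fun i j => ?_
    have h := minorGcd_dvd (x ∘ σ) (y ∘ σ) (σ.symm i) (σ.symm j)
    simpa [minor] using h
  · exact dvd_minorGcd fun i j => minorGcd_dvd x y (σ i) (σ j)

theorem minorGcd_comm (x y : Fin 4 → ℤ) : minorGcd x y = minorGcd y x := by
  apply Nat.dvd_antisymm <;>
  · refine dvd_minorGcd fun i j => ?_
    refine (minorGcd_dvd _ _ j i).trans (dvd_of_eq ?_)
    unfold minor; ring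

theorem wedgeSq_comm (x y : Fin 4 → ℤ) : wedgeSq x y = wedgeSq y x := by
  have : ∑ i, x i * y i = ∑ i, y i * x i := Finset.sum_congr rfl fun _ _ => mul_comm _ _
  unfold wedgeSq; rw [this]; ring

theorem isCoprime_of_prime_ne {p q : ℤ} (hp : p.toNat.Prime) (hq : q.toNat.Prime) (h : p ≠ q) :
    IsCoprime p q := by
  have h0 : ∀ r : ℤ, r.toNat.Prime → ((r.toNat : ℕ) : ℤ) = r := fun r hr =>
    Int.toNat_of_nonneg (by
      by_contra hc
      rw [Int.toNat_of_nonpos (by omega)] at hr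
      exact Nat.not_prime_zero hr)
  rw [← h0 p hp, ← h0 q hq]
  refine Nat.isCoprime_iff_coprime.mpr ((Nat.coprime_primes hp hq).mpr fun he => h ?_)
  rw [← h0 p hp, ← h0 q hq, he]

theorem card_kernelSet_one {k : ℕ} (h : Fin k → ℤ) : (kernelSet 1 h).card ≤ 1 := by
  classical
  refine (Finset.card_le_card (t := residues 1 k) fun s hs => (mem_kernelSet.mp hs).1).trans ?_
  rw [card_residues, one_pow]

theorem one_le_of_prime {p : ℤ} (h : p.toNat.Prime) : 1 ≤ p := by
  have := h.one_lt
  omega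

theorem exists_perm {i j : Fin 4} (hij : i ≠ j) : ∃ σ : Equiv.Perm (Fin 4), σ 0 = i ∧ σ 1 = j := by
  refine ⟨Equiv.swap (Equiv.swap 0 i 1) j * Equiv.swap 0 i, ?_, ?_⟩
  · rw [Equiv.Perm.mul_apply, Equiv.swap_apply_left, Equiv.swap_apply_of_ne_of_ne _ hij]
    intro h
    have : Equiv.swap 0 i 0 = Equiv.swap 0 i 1 := by rw [Equiv.swap_apply_left]; exact h
    exact absurd ((Equiv.swap 0 i).injective this) (by decide)
  · rw [Equiv.Perm.mul_apply, Equiv.swap_apply_left]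

/-- The number of points orthogonal to two independent prime vectors. -/
theorem pairCount_le {x y : Fin 4 → ℤ} {A B : ℝ} (hx : x ∈ primeTuples B) (hy : y ∈ primeTuples B)
    (hxy : Indep x y) : pairCount A x y ≤
      Real.pi * (A + 8 * B ^ 2) ^ 2 * minorGcd x y / √(wedgeSq x y) := by
  classical
  have key : ∀ x y : Fin 4 → ℤ, x ∈ primeTuples B → y ∈ primeTuples B →
      (∃ i j, minor x y i j ≠ 0 ∧ x i ≠ x j) → pairCount A x y ≤
      Real.pi * (A + 8 * B ^ 2) ^ 2 * minorGcd x y / √(wedgeSq x y) := by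
    intro x y hx hy ⟨i, j, hm, hne⟩
    obtain ⟨σ, rfl, rfl⟩ := exists_perm (fun h : i = j => hne (by rw [h]))
    set x' := x ∘ σ with hx'
    set y' := y ∘ σ with hy'
    have hcop : IsCoprime (x' 0) (x' 1) := isCoprime_of_prime_ne (hx _).1 (hx _).1 hne
    obtain ⟨F, -⟩ := exists_frame (B := B) hcop (fun i => one_le_of_prime (hx _).1)
      fun i => (hx (σ i)).2
    have hm' : minor x' y' 0 1 ≠ 0 := hm
    obtain ⟨h', t, hh', ht⟩ := F.exists_bezout_form (y := y') hcop
      (Indep.minorGcd_pos ⟨0, 1, hm'⟩)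
    set S := (finite_primitiveTuplesUpTo A).toFinset.filter fun a =>
      a ∈ orthLattice x ∧ a ∈ orthLattice y
    have hS : ∀ a ∈ S, (∑ i, x i * a i = 0 ∧ ∑ i, y i * a i = 0) ∧ ‖euc a‖ ≤ A := by
      intro a ha
      obtain ⟨h1, h2, h3⟩ := Finset.mem_filter.mp ha
      exact ⟨⟨h2, h3⟩, (mem_tuplesUpTo.mp h1).2⟩
    have hinj : Function.Injective fun a : Fin 4 → ℤ => a ∘ σ := fun a b hab => by
      have := congrArg (fun f : Fin 4 → ℤ => f ∘ σ.symm) hab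
      simpa [Function.comp_assoc] using this
    have h := card_orth_orth_le (A := A) (W := 1) one_pos hm' hcop (fun i => (hx (σ i)).2)
      (fun i => (hy (σ i)).2) F h' t hh' ht (S.image fun a => a ∘ σ) ?_ ?_ ?_ ?_
    · rw [Finset.card_image_of_injective _ hinj, minorGcd_comp, wedgeSq_comp] at h
      rw [pairCount_eq]
      refine h.trans ?_
      have hk : ((kernelSet 1 h').card : ℝ) ≤ 1 := by exact_mod_cast card_kernelSet_one h'
      simp only [Nat.cast_one, mul_one, one_pow, one_mul]
      apply div_le_div_of_nonneg_right _ (Real.sqrt_nonneg _)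
      exact mul_le_of_le_one_right (by positivity) hk
    all_goals
      intro b hb
      obtain ⟨a, ha, rfl⟩ := Finset.mem_image.mp hb
    · rw [← (hS a ha).1.1]; exact Equiv.sum_comp σ fun i => x i * a i
    · rw [← (hS a ha).1.2]; exact Equiv.sum_comp σ fun i => y i * a i
    · rw [euc_comp_norm]; exact (hS a ha).2
    · intro p hp hp1
      exact (hp.one_lt.ne' (Nat.dvd_one.mp hp1)).elim
  obtain ⟨i, j, hm⟩ := hxy
  -- The lattice bound needs two coprime entries at the indices of the nonzero minor. If `x i = x
  -- j`, then `y i ≠ y j`, and `x` and `y` are exchanged.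
  by_cases hne : x i = x j
  · rw [pairCount_comm, minorGcd_comm, wedgeSq_comm]
    refine key y x hy hx ⟨i, j, ?_, fun h => hm ?_⟩
    · intro h0
      apply hm
      have : minor x y i j = - minor y x i j := by unfold minor; ring
      rw [this, h0, neg_zero]
    · unfold minor; rw [hne, h]; ring
  · exact key x y hx hy ⟨i, j, hm, hne⟩

theorem sum_inv_sq_norm_le {A : ℝ} (hA : 0 ≤ A) :
    ∑ a ∈ (finite_primitiveTuplesUpTo A).toFinset, 1 / ‖euc a‖ ^ 2 ≤ 2592 * A ^ 2 := by
  have h := sum_one_div_pow_le (j := 2) (d₁ := 2) (d₂ := 1) (c₁ := 81) (c₂ := 0)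
    (finite_primitiveTuplesUpTo A).toFinset (fun a => ‖euc a‖) hA two_pos one_pos (by norm_num) le_rfl
    (fun a ha => one_le_norm_euc (ne_zero_of_mem (mem_tuplesUpTo.mp ha).1))
    (fun a ha => (mem_tuplesUpTo.mp ha).2) (fun R hR => by
      rw [zero_mul, add_zero]
      refine (card_le_of_abs_le hR _ fun a ha i => ?_).trans (le_of_eq (by ring))
      exact (abs_le_l2 (fun i => (a i : ℝ)) i).trans (Finset.mem_filter.mp ha).2)
  refine h.trans (le_of_eq ?_)
  ring

theorem locDensity_mul_le {α : ℝ} (hα : 0 ≤ α) (W : ℕ) (a x y : Fin 4 → ℤ) :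
    locDensity α W a x * locDensity α W a y ≤
      α ^ 2 * (W : ℝ) ^ 2 / (‖euc x‖ * ‖euc y‖) * (1 / ‖euc a‖ ^ 2) := by
  have h : ∀ x, locDensity α W a x ≤ α * W / (‖euc a‖ * ‖euc x‖) := fun x => by
    unfold locDensity; split_ifs
    · exact le_rfl
    · positivity
  calc _ ≤ (α * W / (‖euc a‖ * ‖euc x‖)) * (α * W / (‖euc a‖ * ‖euc y‖)) :=
        mul_le_mul (h x) (h y) (locDensity_nonneg hα _ _ _) (by positivity)
    _ = _ := by
        rw [div_mul_div_comm, div_mul_div_comm]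
        congr 1 <;> ring

/-- A bound for the second moment of the local densities, valid for all pairs. -/
theorem pairLocal_le {A α : ℝ} (hA : 0 ≤ A) (hα : 0 ≤ α) (W : ℕ) (x y : Fin 4 → ℤ) :
    pairLocal A α W x y ≤
      2592 * α ^ 2 * (W : ℝ) ^ 2 * A ^ 2 / (‖euc x‖ * ‖euc y‖) := by
  refine (Finset.sum_le_sum fun a _ => locDensity_mul_le hα W a x y).trans ?_
  rw [← Finset.mul_sum]
  refine (mul_le_mul_of_nonneg_left (sum_inv_sq_norm_le hA) (by positivity)).trans (le_of_eq ?_)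
  ring


/-! ### The variance of one pair -/

/-- The conditions on the parameters under which the moments of a pair are estimated. -/
structure PairParams (A B α η R : ℝ) (W P z : ℕ) : Prop where
  one_le_B : 1 ≤ B
  A_pos : 0 < A
  α_pos : 0 < α
  η_pos : 0 < η
  η_le : η ≤ 1 / 8
  W_pos : 0 < W
  P_pos : 0 < P
  coprime : W.Coprime P
  W_le : 8 * B ^ 2 * W ≤ η * A
  one_le_R : 1 ≤ R
  le_R : 4 * W * (1 + α) ≤ η * R
  P_le : 10 * B * (W * P : ℕ) * (2 * α + 1) ≤ η ^ 2 * A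
  z_pos : 0 < z
  dvd_of_le : ∀ p : ℕ, p.Prime → p ≤ z → p ∣ W * P

/-- The coordinates used to estimate the moments of a pair. -/
structure PairFrame (B : ℝ) (W : ℕ) (x y : Fin 4 → ℤ) where
  F : Frame x
  ha : |(F.a : ℝ)| ≤ 2 * B
  hb : |(F.b : ℝ)| ≤ 2 * B
  hc : |(F.c : ℝ)| ≤ 2 * B
  hd : |(F.d : ℝ)| ≤ 2 * B
  h : Fin 3 → ℤ
  t : Fin 3 → ℤ
  hh : ∀ i, F.form y i = minorGcd x y * h i
  ht : ∑ i, h i * t i = 1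
  x_mem : x ∈ primeTuples B
  y_mem : y ∈ primeTuples B
  distinct : Distinct x y

section

variable {A B α η R : ℝ} {W P z : ℕ} {x y : Fin 4 → ℤ}

theorem Distinct.minor_ne_zero (hx : x ∈ primeTuples B) (hy : y ∈ primeTuples B)
    (h : Distinct x y) : minor x y 0 1 ≠ 0 :=
  minor_ne_zero_of_primes (fun i => (hx i).1) (fun i => (hy i).1) (h.1 0) (h.2.2 0 1 (by decide))

theorem nonempty_pairFrame (W : ℕ) (hx : x ∈ primeTuples B) (hy : y ∈ primeTuples B)
    (h : Distinct x y) : Nonempty (PairFrame B W x y) := by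
  have hcop : IsCoprime (x 0) (x 1) :=
    isCoprime_of_prime_ne (hx 0).1 (hx 1).1 (h.2.1 0 1 (by decide))
  obtain ⟨F, ha, hb, hc, hd⟩ := exists_frame (B := B) hcop (fun i => one_le_of_prime (hx i).1)
    fun i => (hx i).2
  obtain ⟨h', t, hh, ht⟩ := F.exists_bezout_form (y := y) hcop
    (Indep.minorGcd_pos ⟨0, 1, h.minor_ne_zero hx hy⟩)
  exact ⟨⟨F, ha, hb, hc, hd, h', t, hh, ht, hx, hy, h⟩⟩

namespace PairFrame

theorem minor_ne_zero (f : PairFrame B W x y) : minor x y 0 1 ≠ 0 :=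
  f.distinct.minor_ne_zero f.x_mem f.y_mem

theorem isCoprime (f : PairFrame B W x y) : IsCoprime (x 0) (x 1) :=
  isCoprime_of_prime_ne (f.x_mem 0).1 (f.x_mem 1).1 (f.distinct.2.1 0 1 (by decide))

theorem minorGcd_pos (f : PairFrame B W x y) : 0 < minorGcd x y :=
  Indep.minorGcd_pos ⟨0, 1, f.minor_ne_zero⟩

/-- The number of primitive classes on which the reduced form vanishes. -/
noncomputable def n₁ (f : PairFrame B W x y) : ℕ := (kernelSet W f.h).card

/-- The number of primitive classes on which the form vanishes. -/
noncomputable def n₂ (f : PairFrame B W x y) : ℕ := (kernelSet W (f.F.form y)).card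

theorem n₁_le (f : PairFrame B W x y) (hW : 0 < W) : (f.n₁ : ℝ) ≤ (W : ℝ) ^ 2 := by
  have h := card_kernelSet_mul_le hW f.h f.t one_pos (by rw [f.ht]; rfl)
  have : f.n₁ ≤ W ^ 2 := Nat.le_of_mul_le_mul_right (h.trans (le_of_eq (by ring))) hW
  exact_mod_cast this

theorem n₂_le (f : PairFrame B W x y) (hW : 0 < W) :
    (f.n₂ : ℝ) ≤ minorGcd x y * (W : ℝ) ^ 2 := by
  have e : ∑ i, f.F.form y i * f.t i = minorGcd x y := by
    have : ∑ i, f.F.form y i * f.t i = minorGcd x y * ∑ i, f.h i * f.t i := by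
      rw [Finset.mul_sum]
      exact Finset.sum_congr rfl fun i _ => by rw [f.hh]; ring
    rw [this, f.ht, mul_one]
  have h := card_kernelSet_mul_le hW (f.F.form y) f.t f.minorGcd_pos e
  have : f.n₂ ≤ minorGcd x y * W ^ 2 :=
    Nat.le_of_mul_le_mul_right (h.trans (le_of_eq (by ring))) hW
  exact_mod_cast this

/-- This makes the density in the exact count at most that of the local model, so that the main
terms can cancel. -/
theorem mul_n₁_le (f : PairFrame B W x y) (hW : 0 < W) (h1 : minorGcd x y ∣ W)
    (h2 : ∀ p : ℕ, p.Prime → p ∣ W → minorGcd x y * p ∣ W) :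
    (minorGcd x y : ℝ) * f.n₁ ≤ f.n₂ := by
  have := mul_card_kernelSet_le hW (f.F.form y) f.h f.t f.minorGcd_pos f.hh f.ht h1 h2
  exact_mod_cast this

theorem pairCount_le (f : PairFrame B W x y) (p : PairParams A B α η R W P z) :
    pairCount A x y ≤ (1 + η) ^ 2 * (minorGcd x y * f.n₁ / (W : ℝ) ^ 2) *
      (Real.pi * A ^ 2 / √(wedgeSq x y)) := by
  classical
  rw [pairCount_eq]
  have h := card_orth_orth_le (A := A) p.W_pos f.minor_ne_zero f.isCoprime
    (fun i => (f.x_mem i).2) (fun i => (f.y_mem i).2) f.F f.h f.t f.hh f.ht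
    ((finite_primitiveTuplesUpTo A).toFinset.filter fun a =>
      a ∈ orthLattice x ∧ a ∈ orthLattice y)
    (fun a ha => (Finset.mem_filter.mp ha).2.1) (fun a ha => (Finset.mem_filter.mp ha).2.2)
    (fun a ha => (mem_tuplesUpTo.mp (Finset.mem_filter.mp ha).1).2)
    (fun a ha => primitiveAt_of_mem (mem_tuplesUpTo.mp (Finset.mem_filter.mp ha).1).1 W)
  refine h.trans ?_
  have hA := p.A_pos
  have hη := p.η_pos
  have hW : (0 : ℝ) < W := by exact_mod_cast p.W_pos
  have h1 : A + 8 * B ^ 2 * W ≤ (1 + η) * A := by linarith [p.W_le]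
  have hsΔ := Real.sqrt_pos.mpr (wedgeSq_cast_pos f.minor_ne_zero)
  calc _ ≤ Real.pi * ((1 + η) * A) ^ 2 * minorGcd x y * (kernelSet W f.h).card /
      ((W : ℝ) ^ 2 * √(wedgeSq x y)) := by gcongr
    _ = (1 + η) ^ 2 * (minorGcd x y * (kernelSet W f.h).card / (W : ℝ) ^ 2) *
      (Real.pi * A ^ 2 / √(wedgeSq x y)) := by field_simp

theorem norm_pos (f : PairFrame B W x y) : 0 < ‖euc x‖ ∧ 0 < ‖euc y‖ :=
  norm_euc_pos_of_minor f.minor_ne_zero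

/-- The factors `α` and `‖x‖ ‖y‖` of the local densities cancel against the volume of the cone, and
the powers of `W` combine to the density `n₂ / W²`. The additive error comes from vectors shorter
than `R`. -/
theorem pairLocal_le_of_lintegral (f : PairFrame B W x y) (p : PairParams A B α η R W P z)
    {lam : ℝ} (hlam : 0 ≤ lam)
    (hI : ∫⁻ t, ENNReal.ofReal (coneFun x y ((1 + η) * A) ((1 + η) / (2 * α)) ((1 + η) ^ 2) t)
      ≤ ENNReal.ofReal (4 * Real.pi * ((1 + η) / (2 * α)) ^ 2 * lam * (1 + η) ^ 2 *
        ((1 + η) * A) ^ 2 * ‖euc x‖ * ‖euc y‖ / √(wedgeSq x y))) :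
    pairLocal A α W x y ≤ (1 + η) ^ 6 * lam * (f.n₂ / (W : ℝ) ^ 2) *
      (Real.pi * A ^ 2 / √(wedgeSq x y)) +
      81 * α ^ 2 * (W : ℝ) ^ 2 * R ^ 4 / (‖euc x‖ * ‖euc y‖) := by
  classical
  have hA := p.A_pos
  have hη := p.η_pos
  have hα := p.α_pos
  have hW : (0 : ℝ) < W := by exact_mod_cast p.W_pos
  have hsΔ := Real.sqrt_pos.mpr (wedgeSq_cast_pos f.minor_ne_zero)
  obtain ⟨hx0, hy0⟩ := f.norm_pos
  set S := (finite_primitiveTuplesUpTo A).toFinset.filter fun a =>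
    (a ∈ orthLatticeMod W x ∧ euc a ∈ coneRegion α (euc x)) ∧
    (a ∈ orthLatticeMod W y ∧ euc a ∈ coneRegion α (euc y))
  have hS : ∀ a ∈ S, (a ∈ primitiveTuples ∧ ‖euc a‖ ≤ A) ∧
      (a ∈ orthLatticeMod W x ∧ euc a ∈ coneRegion α (euc x)) ∧
      (a ∈ orthLatticeMod W y ∧ euc a ∈ coneRegion α (euc y)) := fun a ha =>
    ⟨mem_tuplesUpTo.mp (Finset.mem_filter.mp ha).1, (Finset.mem_filter.mp ha).2⟩
  have h := sum_inv_sq_le p.W_pos f.isCoprime f.F hα hη (by linarith [p.η_le]) p.one_le_R p.le_R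
    (by positivity) hI S (fun a ha => one_le_norm_euc (ne_zero_of_mem (hS a ha).1.1))
    (fun a ha => (hS a ha).1.2) (fun a ha => primitiveAt_of_mem (hS a ha).1.1 W)
    (fun a ha => mem_orthLatticeMod.mp (hS a ha).2.1.1)
    (fun a ha => mem_orthLatticeMod.mp (hS a ha).2.2.1)
    (fun a ha => mem_coneRegion.mp (hS a ha).2.1.2)
    (fun a ha => mem_coneRegion.mp (hS a ha).2.2.2)
  have h2 : pairLocal A α W x y ≤
      α ^ 2 * (W : ℝ) ^ 2 / (‖euc x‖ * ‖euc y‖) * ∑ a ∈ S, 1 / ‖euc a‖ ^ 2 := by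
    rw [Finset.mul_sum, Finset.sum_filter]
    refine Finset.sum_le_sum fun a _ => ?_
    split_ifs with hc
    · exact locDensity_mul_le hα.le W a x y
    · apply le_of_eq
      rw [not_and_or] at hc
      unfold locDensity
      rcases hc with hc | hc
      · rw [if_neg hc, zero_mul]
      · rw [if_neg hc, mul_zero]
  refine h2.trans ((mul_le_mul_of_nonneg_left h (by positivity)).trans (le_of_eq ?_))
  unfold n₂
  field_simp
  ring

theorem pairLocal_le (f : PairFrame B W x y) (p : PairParams A B α η R W P z) :
    pairLocal A α W x y ≤ (1 + η) ^ 6 * 3 * (f.n₂ / (W : ℝ) ^ 2) *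
      (Real.pi * A ^ 2 / √(wedgeSq x y)) +
      81 * α ^ 2 * (W : ℝ) ^ 2 * R ^ 4 / (‖euc x‖ * ‖euc y‖) := by
  have hA := p.A_pos
  have hη := p.η_pos
  have hα := p.α_pos
  exact f.pairLocal_le_of_lintegral p (by norm_num)
    (lintegral_coneFun_le f.minor_ne_zero (by positivity) (by positivity) (by positivity))

theorem pairLocal_le_of_angle (f : PairFrame B W x y) (p : PairParams A B α η R W P z)
    (hθ : ‖euc x‖ * ‖euc y‖ ≤ η * α * √(wedgeSq x y)) :
    pairLocal A α W x y ≤ (1 + η) ^ 6 * (1 + 2 * η) * (f.n₂ / (W : ℝ) ^ 2) *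
      (Real.pi * A ^ 2 / √(wedgeSq x y)) +
      81 * α ^ 2 * (W : ℝ) ^ 2 * R ^ 4 / (‖euc x‖ * ‖euc y‖) := by
  have hA := p.A_pos
  have hη := p.η_pos
  have hα := p.α_pos
  have hη1 := p.η_le
  refine f.pairLocal_le_of_lintegral p (by positivity)
    (lintegral_coneFun_le_of_le f.minor_ne_zero (by positivity) (by positivity) (by positivity)
      (l2_orthVec_sq_le f.minor_ne_zero ?_ (by positivity) hη.le (by linarith)))
  calc (1 + η) / (2 * α) * (‖euc x‖ * ‖euc y‖) ≤
      (1 + η) / (2 * α) * (η * α * √(wedgeSq x y)) := by gcongr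
    _ = (1 + η) / 2 * (η * √(wedgeSq x y)) := by field_simp
    _ ≤ 1 * (η * √(wedgeSq x y)) := by gcongr; linarith
    _ = _ := one_mul _

open scoped Classical in
-- The lower bound `le_sum_inv_norm` counts vectors primitive only at `W P`; those that are not
-- primitive tuples are removed by `sum_isMixed_le`, which produces the error term.
theorem le_pairMixed (f : PairFrame B W x y) (p : PairParams A B α η R W P z)
    (hσ : (P : ℝ) ^ 3 * (1 - 2 * η) ≤ ((residues P 3).filter (PrimitiveAt P)).card)
    (hθ : ‖euc x‖ * ‖euc y‖ ≤ η * α * √(wedgeSq x y)) :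
    (1 - 2 * η) * (1 - 7 * η) * (f.n₂ / (W : ℝ) ^ 2) * (Real.pi * A ^ 2 / √(wedgeSq x y)) ≤
      pairMixed A α W x y + α * W / ‖euc y‖ *
        (288 * A + (576 / ‖euc x‖ * A ^ 2 / (z : ℝ) ^ 2 + 144 * A / z)) := by
  have hA := p.A_pos
  have hη := p.η_pos
  have hα := p.α_pos
  have hη1 := p.η_le
  have hW : (0 : ℝ) < W := by exact_mod_cast p.W_pos
  have hsΔ := Real.sqrt_pos.mpr (wedgeSq_cast_pos f.minor_ne_zero)
  obtain ⟨hx0, hy0⟩ := f.norm_pos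
  have hxpos : ∀ i, 0 < x i := fun i => by
    have := one_le_of_prime (f.x_mem i).1; omega
  have hfin : {a : Fin 4 → ℤ | IsMixed x y A α W (W * P) a}.Finite :=
    (finite_norm_le A).subset fun a ha => ha.norm_le
  set S := hfin.toFinset
  have hS : ∀ a, a ∈ S ↔ IsMixed x y A α W (W * P) a := fun a => hfin.mem_toFinset
  have hθ' : ‖euc x‖ * ‖euc y‖ ≤ η * (2 * α) * √(wedgeSq x y) := by
    refine hθ.trans ?_
    gcongr
    linarith
  have hlow := le_sum_inv_norm (σ := 2 * η) p.W_pos p.P_pos p.coprime f.isCoprime (hxpos 0).ne' f.F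
    f.minor_ne_zero (fun i => (f.x_mem i).2) f.ha f.hb f.hc f.hd p.one_le_B hA hα hη hη1 p.P_le hθ'
    hσ (by linarith) S hS
  -- Counting vectors orthogonal to `x` requires an entry comparable to `‖x‖`, hence the largest
  -- one.
  obtain ⟨i₀, -, hi₀⟩ := Finset.exists_max_image Finset.univ x Finset.univ_nonempty
  obtain ⟨j₀, hj₀⟩ : ∃ j₀, j₀ ≠ i₀ := exists_ne i₀
  set L := (finite_primitiveTuplesUpTo A).toFinset.filter fun a => a ∈ orthLattice x ∧
    (a ∈ orthLatticeMod W y ∧ euc a ∈ coneRegion α (euc y))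
  have hup := sum_isMixed_le (x := x) (y := y) (α := α) hj₀.symm
    (isCoprime_of_prime_ne (f.x_mem _).1 (f.x_mem _).1 (f.distinct.2.1 i₀ j₀ hj₀.symm))
    (fun i => (hxpos i).ne') (hxpos i₀) (l2_le_of_abs_le (Int.cast_nonneg (hxpos i₀).le) fun i => by
      rw [abs_of_pos (Int.cast_pos.mpr (hxpos i))]
      exact Int.cast_le.mpr (hi₀ i (Finset.mem_univ i))) hx0 hA.le p.z_pos p.dvd_of_le S hS L
      (fun a ha hprim => Finset.mem_filter.mpr ⟨mem_tuplesUpTo.mpr ⟨hprim, ((hS a).mp ha).norm_le⟩,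
        ((hS a).mp ha).orth, mem_orthLatticeMod.mpr ((hS a).mp ha).dvd,
        mem_coneRegion.mpr ((hS a).mp ha).cone⟩)
  have hmix : pairMixed A α W x y = α * W / ‖euc y‖ * ∑ a ∈ L, 1 / ‖euc a‖ := by
    unfold pairMixed orthInd locDensity
    rw [Finset.mul_sum, Finset.sum_filter]
    refine Finset.sum_congr rfl fun a _ => ?_
    by_cases h1 : a ∈ orthLattice x <;>
      by_cases h2 : a ∈ orthLatticeMod W y ∧ euc a ∈ coneRegion α (euc y) <;> simp only [h1, h2,
        if_true, if_false, true_and, false_and, and_true, mul_zero, zero_mul, one_mul]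
    rw [div_mul_div_comm, mul_one, mul_comm ‖euc y‖]
  rw [hmix, ← mul_add]
  refine le_trans (le_of_eq ?_) (mul_le_mul_of_nonneg_left (hlow.trans hup) (by positivity))
  unfold n₂
  field_simp

open scoped Classical in
/-- The variance of a pair in general position. -/
theorem variance_le (f : PairFrame B W x y) (p : PairParams A B α η R W P z)
    (hσ : (P : ℝ) ^ 3 * (1 - 2 * η) ≤ ((residues P 3).filter (PrimitiveAt P)).card)
    (hθ : ‖euc x‖ * ‖euc y‖ ≤ η * α * √(wedgeSq x y)) (h1 : minorGcd x y ∣ W)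
    (h2 : ∀ p : ℕ, p.Prime → p ∣ W → minorGcd x y * p ∣ W) :
    pairCount A x y - 2 * pairMixed A α W x y + pairLocal A α W x y ≤
      35 * Real.pi * η * A ^ 2 * (minorGcd x y / √(wedgeSq x y)) +
      (81 * α ^ 2 * (W : ℝ) ^ 2 * R ^ 4 / (‖euc x‖ * ‖euc y‖) + 2 * (α * W / ‖euc y‖ *
        (288 * A + (576 / ‖euc x‖ * A ^ 2 / (z : ℝ) ^ 2 + 144 * A / z)))) := by
  have hη := p.η_pos
  have hη1 := p.η_le
  have hW : (0 : ℝ) < W := by exact_mod_cast p.W_pos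
  have hsΔ := Real.sqrt_pos.mpr (wedgeSq_cast_pos f.minor_ne_zero)
  have e1 := f.pairCount_le p
  have e2 := f.le_pairMixed p hσ hθ
  have e3 := f.pairLocal_le_of_angle p hθ
  set V := Real.pi * A ^ 2 / √(wedgeSq x y)
  have hV : 0 ≤ V := by positivity
  set ν := (f.n₂ : ℝ) / (W : ℝ) ^ 2
  have hν0 : 0 ≤ ν := by positivity
  have hν : ν ≤ minorGcd x y := by
    rw [div_le_iff₀ (by positivity)]; exact f.n₂_le p.W_pos
  have hn1 : (minorGcd x y * f.n₁ / (W : ℝ) ^ 2) ≤ ν :=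
    div_le_div_of_nonneg_right (f.mul_n₁_le p.W_pos h1 h2) (by positivity)
  -- In units of `ν V` the three coefficients are `1 + 3 η`, `-2 (1 - 9 η)` and `1 + 14 η`. The
  -- constants cancel and `35 η` is left.
  have e1' : pairCount A x y ≤ (1 + 3 * η) * ν * V := by
    refine e1.trans ?_
    gcongr
    nlinarith
  have e2' : (1 - 9 * η) * ν * V ≤ (1 - 2 * η) * (1 - 7 * η) * ν * V := by
    gcongr
    nlinarith
  have e3' : (1 + η) ^ 6 * (1 + 2 * η) * ν * V ≤ (1 + 14 * η) * ν * V := by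
    gcongr
    have a2 : (1 + η) ^ 2 ≤ 1 + 17 / 8 * η := by nlinarith
    have a3 : (1 + η) ^ 6 ≤ 1 + 9 * η := by
      calc (1 + η) ^ 6 = ((1 + η) ^ 2) ^ 3 := by ring
        _ ≤ (1 + 17 / 8 * η) ^ 3 := by gcongr
        _ ≤ 1 + 9 * η := by nlinarith [mul_pos hη hη]
    calc _ ≤ (1 + 9 * η) * (1 + 2 * η) := by gcongr
      _ ≤ _ := by nlinarith
  have e4 : η * ν * V ≤ η * A ^ 2 * (Real.pi * (minorGcd x y / √(wedgeSq x y))) := by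
    calc η * ν * V ≤ η * minorGcd x y * V := by gcongr
      _ = _ := by simp only [V]; ring
  linarith

/-- A bound for the variance of a pair in general position. -/
theorem variance_le' (f : PairFrame B W x y) (p : PairParams A B α η R W P z) :
    pairCount A x y - 2 * pairMixed A α W x y + pairLocal A α W x y ≤
      9 * Real.pi * A ^ 2 * (minorGcd x y / √(wedgeSq x y)) +
      81 * α ^ 2 * (W : ℝ) ^ 2 * R ^ 4 / (‖euc x‖ * ‖euc y‖) := by
  have hη := p.η_pos
  have hη1 := p.η_le
  have hW : (0 : ℝ) < W := by exact_mod_cast p.W_pos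
  have hsΔ := Real.sqrt_pos.mpr (wedgeSq_cast_pos f.minor_ne_zero)
  have e1 := f.pairCount_le p
  have e2 := pairMixed_nonneg (A := A) p.α_pos.le W x y
  have e3 := f.pairLocal_le p
  set V := Real.pi * A ^ 2 / √(wedgeSq x y) with hVdef
  have hV : 0 ≤ V := by positivity
  set ν := (f.n₂ : ℝ) / (W : ℝ) ^ 2
  have hν0 : 0 ≤ ν := by positivity
  have hν : ν ≤ minorGcd x y := by
    rw [div_le_iff₀ (by positivity)]; exact f.n₂_le p.W_pos
  have hn1 : (minorGcd x y * f.n₁ / (W : ℝ) ^ 2) ≤ minorGcd x y := by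
    rw [div_le_iff₀ (by positivity)]
    exact mul_le_mul_of_nonneg_left (f.n₁_le p.W_pos) (Nat.cast_nonneg _)
  have a1 : (1 + η) ^ 2 ≤ 2 := by nlinarith
  have a2 : (1 + η) ^ 6 * 3 ≤ 7 := by
    calc (1 + η) ^ 6 * 3 ≤ (1 + 1 / 8) ^ 6 * 3 := by gcongr
      _ ≤ 7 := by norm_num
  -- The mixed term is dropped; the other two contribute `2 + 7 = 9`.
  have e1' : pairCount A x y ≤ 2 * minorGcd x y * V := e1.trans (by gcongr)
  have e3' : (1 + η) ^ 6 * 3 * ν * V ≤ 7 * minorGcd x y * V := by gcongr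
  have e4 : 9 * minorGcd x y * V = 9 * Real.pi * A ^ 2 * (minorGcd x y / √(wedgeSq x y)) := by
    rw [hVdef]; ring
  linarith

end PairFrame

end


/-! ### Sums over pairs of prime tuples, and degenerate pairs -/

/-- The prime tuples, as a box. -/
noncomputable abbrev tuples (B : ℝ) : Finset (Fin 4 → ℤ) :=
  Fintype.piFinset fun _ : Fin 4 => primesUpTo B

theorem mem_tuples {B : ℝ} (hB : 0 ≤ B) {x : Fin 4 → ℤ} : x ∈ tuples B ↔ x ∈ primeTuples B := by
  unfold tuples
  rw [← primeTuples_toFinset hB, Set.Finite.mem_toFinset]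

open scoped Classical in
-- The pairs are sorted by the value `e` of `G`. Relaxing `G = e` to `e ∣ G` leaves `e ^ (3/2) e ^
-- (-21/8) = e ^ (-9/8)`, which is summable.
theorem sum_generic_le : ∃ C : ℝ, 0 < C ∧ ∀ B : ℝ, 2 ≤ B →
    ∑ xy ∈ (tuples B ×ˢ tuples B).filter (fun xy => Distinct xy.1 xy.2 ∧
        (minorGcd xy.1 xy.2 : ℝ) ≤ B ^ (1 / 100 : ℝ)),
      (minorGcd xy.1 xy.2 : ℝ) ^ (3 / 2 : ℝ) * (wedgeSq xy.1 xy.2 : ℝ) ^ (-(9 / 16 : ℝ))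
      ≤ C * B ^ (23 / 4 : ℝ) / Real.log B ^ 8 := by
  obtain ⟨C, hC, h⟩ := sum_pairs_dvd_le
  have hsum : Summable fun e : ℕ => (e : ℝ) ^ (-(9 / 8 : ℝ)) :=
    Real.summable_nat_rpow.mpr (by norm_num)
  have hT : 0 ≤ ∑' e : ℕ, (e : ℝ) ^ (-(9 / 8 : ℝ)) := tsum_nonneg fun e => by positivity
  refine ⟨C * ((∑' e : ℕ, (e : ℝ) ^ (-(9 / 8 : ℝ))) + 1), by positivity, fun B hB => ?_⟩
  have hB0 : 0 < B := by linarith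
  have hL : 0 < Real.log B := Real.log_pos (by linarith)
  set X := tuples B ×ˢ tuples B with hX
  set N := ⌊B ^ (1 / 100 : ℝ)⌋₊ with hN
  have hw : ∀ x y : Fin 4 → ℤ, (0 : ℝ) ≤ (wedgeSq x y : ℝ) ^ (-(9 / 16 : ℝ)) := fun x y => by
    have : (0 : ℝ) ≤ wedgeSq x y := by exact_mod_cast wedgeSq_nonneg x y
    positivity
  have hpos : ∀ xy ∈ X, Distinct xy.1 xy.2 → 0 < minorGcd xy.1 xy.2 := fun xy hxy hd => by
    rw [hX, Finset.mem_product, mem_tuples hB0.le, mem_tuples hB0.le] at hxy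
    exact Indep.minorGcd_pos ⟨0, 1, hd.minor_ne_zero hxy.1 hxy.2⟩
  rw [← Finset.sum_fiberwise_of_maps_to (t := Finset.Icc 1 N) (g := fun xy => minorGcd xy.1 xy.2)]
  · calc _ ≤ ∑ e ∈ Finset.Icc 1 N, C * B ^ (23 / 4 : ℝ) / Real.log B ^ 8 *
            (e : ℝ) ^ (-(9 / 8 : ℝ)) := by
          refine Finset.sum_le_sum fun e he => ?_
          rw [Finset.mem_Icc] at he
          have he0 : (0 : ℝ) < e := by exact_mod_cast he.1
          have h1 := h B e hB he.1 ((Nat.le_floor_iff (by positivity)).mp he.2)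
          calc _ ≤ ∑ xy ∈ X.filter (fun xy => Distinct xy.1 xy.2 ∧ e ∣ minorGcd xy.1 xy.2),
                (e : ℝ) ^ (3 / 2 : ℝ) * (wedgeSq xy.1 xy.2 : ℝ) ^ (-(9 / 16 : ℝ)) := by
                refine (le_of_eq (Finset.sum_congr rfl fun xy hxy => ?_)).trans
                  (Finset.sum_le_sum_of_subset_of_nonneg ?_ fun xy _ _ =>
                    mul_nonneg (by positivity) (hw _ _))
                · rw [(Finset.mem_filter.mp hxy).2]
                · intro xy hxy
                  rw [Finset.mem_filter, Finset.mem_filter] at hxy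
                  exact Finset.mem_filter.mpr ⟨hxy.1.1, hxy.1.2.1, dvd_of_eq hxy.2.symm⟩
            _ ≤ (e : ℝ) ^ (3 / 2 : ℝ) * (C * B ^ (23 / 4 : ℝ) * (e : ℝ) ^ (-(21 / 8 : ℝ)) /
                Real.log B ^ 8) := by
                rw [← Finset.mul_sum]
                exact mul_le_mul_of_nonneg_left h1 (by positivity)
            _ = C * B ^ (23 / 4 : ℝ) / Real.log B ^ 8 *
                ((e : ℝ) ^ (3 / 2 : ℝ) * (e : ℝ) ^ (-(21 / 8 : ℝ))) := by ring
            _ = _ := by rw [← Real.rpow_add he0]; norm_num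
      _ ≤ C * B ^ (23 / 4 : ℝ) / Real.log B ^ 8 * ∑' e : ℕ, (e : ℝ) ^ (-(9 / 8 : ℝ)) := by
          rw [← Finset.mul_sum]
          exact mul_le_mul_of_nonneg_left
            (hsum.sum_le_tsum _ fun _ _ => by positivity) (by positivity)
      _ ≤ C * B ^ (23 / 4 : ℝ) / Real.log B ^ 8 * ((∑' e : ℕ, (e : ℝ) ^ (-(9 / 8 : ℝ))) + 1) := by
          gcongr; linarith
      _ = _ := by ring
  · intro xy hxy
    rw [Finset.mem_filter] at hxy
    exact Finset.mem_Icc.mpr ⟨hpos xy hxy.1 hxy.2.1, Nat.le_floor hxy.2.2⟩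

theorem sum_tuples_le (B : ℝ) {f : (Fin 4 → ℤ) → ℝ} (hf : ∀ x, 0 ≤ f x) :
    ∑ x ∈ tuples B, f x ≤
      ∑ i : Fin 4, ∑ x ∈ (tuples B).filter (fun x => ∀ j, x j ≤ x i), f x := by
  simp_rw [Finset.sum_filter]
  rw [Finset.sum_comm]
  refine Finset.sum_le_sum fun x _ => ?_
  obtain ⟨i, -, hi⟩ := Finset.exists_max_image Finset.univ x ⟨0, Finset.mem_univ _⟩
  have h : f x ≤ if ∀ j, x j ≤ x i then f x else 0 :=
    (if_pos fun j => hi j (Finset.mem_univ j)).ge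
  exact h.trans (Finset.single_le_sum (f := fun i => if ∀ j, x j ≤ x i then f x else 0)
    (fun i _ => by split_ifs; exacts [hf x, le_rfl]) (Finset.mem_univ i))

theorem sum_inv_norm_le : ∃ C : ℝ, 0 < C ∧ ∀ B : ℝ, 2 ≤ B →
    ∑ x ∈ tuples B, 1 / ‖euc x‖ ≤ C * B ^ 3 / Real.log B ^ 4 := by
  obtain ⟨C, hC, h⟩ := sum_max_rpow_le
  refine ⟨4 * C, by positivity, fun B hB => ?_⟩
  have hB0 : 0 < B := by linarith
  refine (sum_tuples_le B fun x => by positivity).trans ?_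
  calc _ ≤ ∑ _i : Fin 4, C * B ^ 3 / Real.log B ^ 4 := by
        refine Finset.sum_le_sum fun i _ => ?_
        have h1 := h B 1 hB (by norm_num) (by norm_num) i
        rw [show (4 : ℝ) - 1 = (3 : ℕ) by norm_num, Real.rpow_natCast] at h1
        refine (Finset.sum_le_sum fun x hx => ?_).trans h1
        have hx' := (mem_tuples hB0.le).mp (Finset.mem_filter.mp hx).1
        have h2 : (1 : ℝ) ≤ x i := by exact_mod_cast one_le_of_prime (hx' i).1
        rw [Real.rpow_neg_one, one_div]
        refine inv_anti₀ (by linarith) ?_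
        exact (le_abs_self _).trans (PiLp.norm_apply_le (euc x) i)
    _ = _ := by rw [Finset.sum_const, Finset.card_univ, Fintype.card_fin, nsmul_eq_mul]; push_cast; ring

theorem card_tuples_le : ∃ C : ℝ, 0 < C ∧ ∀ B : ℝ, 2 ≤ B →
    ((tuples B).card : ℝ) ≤ C * B ^ 4 / Real.log B ^ 4 := by
  obtain ⟨C, hC, h⟩ := sum_max_rpow_le
  refine ⟨4 * C, by positivity, fun B hB => ?_⟩
  have h0 := sum_tuples_le B (f := fun _ => 1) fun x => zero_le_one
  rw [Finset.sum_const, nsmul_eq_mul, mul_one] at h0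
  refine h0.trans ?_
  calc _ ≤ ∑ _i : Fin 4, C * B ^ 4 / Real.log B ^ 4 := by
        refine Finset.sum_le_sum fun i _ => ?_
        have h1 := h B 0 hB le_rfl (by norm_num) i
        rw [show (4 : ℝ) - 0 = (4 : ℕ) by norm_num, Real.rpow_natCast] at h1
        simpa using h1
    _ = _ := by rw [Finset.sum_const, Finset.card_univ, Fintype.card_fin, nsmul_eq_mul]; push_cast; ring

theorem card_primesUpTo_le {B : ℝ} (hB : 0 ≤ B) : ((primesUpTo B).card : ℝ) ≤ B := by
  refine le_trans ?_ (Nat.floor_le hB)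
  have : primesUpTo B ⊆ (Finset.Icc 1 (⌊B⌋₊ : ℤ)) := fun p hp => by
    rw [mem_primesUpTo hB] at hp
    have h1 := one_le_of_prime hp.1
    rw [Finset.mem_Icc]
    refine ⟨h1, ?_⟩
    rw [Int.natCast_floor_eq_floor hB]
    exact Int.le_floor.mpr ((le_abs_self _).trans hp.2)
  have h := Finset.card_le_card this
  rw [Int.card_Icc] at h
  have : (primesUpTo B).card ≤ ⌊B⌋₊ := by omega
  exact_mod_cast this

theorem card_filter_eq_le {ι α : Type*} [Fintype ι] [DecidableEq ι] [DecidableEq α] {u v : ι}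
    (huv : u ≠ v) (S : Finset α) :
    ((Fintype.piFinset fun _ : ι => S).filter fun f => f u = f v).card ≤
      S.card ^ (Fintype.card ι - 1) := by
  have : (Fintype.piFinset fun _ : {k : ι // k ≠ v} => S).card = S.card ^ (Fintype.card ι - 1) := by
    rw [Fintype.card_piFinset, Finset.prod_const, Finset.card_univ]
    congr 1
    rw [Fintype.card_subtype_compl, Fintype.card_subtype_eq]
  rw [← this]
  refine Finset.card_le_card_of_injOn (fun f k => f k) (fun f hf => ?_) fun f hf g hg hfg => ?_
  · rw [Finset.mem_coe, Finset.mem_filter, Fintype.mem_piFinset] at hf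
    exact Finset.mem_coe.mpr (Fintype.mem_piFinset.mpr fun k => hf.1 k)
  · rw [Finset.mem_coe, Finset.mem_filter] at hf hg
    have h : ∀ k, k ≠ v → f k = g k := fun k hk => congrFun hfg ⟨k, hk⟩
    funext k
    by_cases hk : k = v
    · rw [hk, ← hf.2, ← hg.2, h u huv]
    · exact h k hk

open scoped Classical in
theorem card_not_distinct_le {B : ℝ} (hB : 0 ≤ B) :
    (((tuples B ×ˢ tuples B).filter fun xy => ¬ Distinct xy.1 xy.2).card : ℝ) ≤ 64 * B ^ 7 := by
  set T := Fintype.piFinset fun _ : Fin 4 ⊕ Fin 4 => primesUpTo B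
  set I := (Finset.univ : Finset ((Fin 4 ⊕ Fin 4) × (Fin 4 ⊕ Fin 4))).filter fun k => k.1 ≠ k.2
  have h : ((tuples B ×ˢ tuples B).filter fun xy => ¬ Distinct xy.1 xy.2).card ≤
      (I.biUnion fun k => T.filter fun f => f k.1 = f k.2).card := by
    refine Finset.card_le_card_of_injOn (fun xy => Sum.elim xy.1 xy.2) (fun xy hxy => ?_)
      fun xy _ xy' _ he => ?_
    · rw [Finset.mem_coe, Finset.mem_filter, Finset.mem_product] at hxy
      have hT : Sum.elim xy.1 xy.2 ∈ T := Fintype.mem_piFinset.mpr fun k => by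
        rcases k with k | k
        exacts [Fintype.mem_piFinset.mp hxy.1.1 k, Fintype.mem_piFinset.mp hxy.1.2 k]
      have hm : ∀ k l, k ≠ l → Sum.elim xy.1 xy.2 k = Sum.elim xy.1 xy.2 l →
          Sum.elim xy.1 xy.2 ∈ (I.biUnion fun k => T.filter fun f => f k.1 = f k.2) :=
        fun k l hkl he => Finset.mem_biUnion.mpr ⟨(k, l), Finset.mem_filter.mpr
          ⟨Finset.mem_univ _, hkl⟩, Finset.mem_filter.mpr ⟨hT, he⟩⟩
      by_contra hc
      refine hxy.2 ⟨fun i hi => hc (hm (.inl i) (.inr i) (by simp) hi),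
        fun i j hij hi => hc (hm (.inl i) (.inl j) (by simpa using hij) hi),
        fun i j hij hi => hc (hm (.inr i) (.inr j) (by simpa using hij) hi)⟩
    · exact Prod.ext (funext fun k => congrFun he (.inl k)) (funext fun k => congrFun he (.inr k))
  have h2 : (I.biUnion fun k => T.filter fun f => f k.1 = f k.2).card ≤
      64 * (primesUpTo B).card ^ 7 := by
    refine Finset.card_biUnion_le.trans ?_
    calc _ ≤ ∑ k ∈ I, (primesUpTo B).card ^ 7 := Finset.sum_le_sum fun k hk =>
          card_filter_eq_le (Finset.mem_filter.mp hk).2 _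
      _ ≤ _ := by
          rw [Finset.sum_const, smul_eq_mul]
          exact Nat.mul_le_mul_right _ ((Finset.card_le_univ _).trans (by simp))
  calc _ ≤ ((64 * (primesUpTo B).card ^ 7 : ℕ) : ℝ) := by exact_mod_cast h.trans h2
    _ = 64 * ((primesUpTo B).card : ℝ) ^ 7 := by push_cast; ring
    _ ≤ _ := by gcongr; exact card_primesUpTo_le hB

/-- Dependent prime vectors are equal or constant. -/
theorem eq_or_const_of_not_indep {B : ℝ} {x y : Fin 4 → ℤ} (hx : x ∈ primeTuples B)
    (hy : y ∈ primeTuples B) (h : ¬ Indep x y) :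
    (x = y ∧ ∃ i, x i ≠ x 0) ∨ ((∀ i, x i = x 0) ∧ ∀ i, y i = y 0) := by
  have hm : ∀ i j, x i * y j = x j * y i := fun i j => by
    by_contra hc
    exact h ⟨i, j, sub_ne_zero.mpr hc⟩
  by_cases hc : ∃ i, x i ≠ x 0
  · obtain ⟨i, hi⟩ := hc
    refine Or.inl ⟨?_, i, hi⟩
    have hdvd : x i ∣ y i := (isCoprime_of_prime_ne (hx i).1 (hx 0).1 hi).dvd_of_dvd_mul_left
      ⟨y 0, (hm i 0).symm⟩
    have he := eq_of_prime_dvd (hx i).1 (hy i).1 hdvd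
    have h0 : x i ≠ 0 := by have := one_le_of_prime (hx i).1; omega
    funext k
    have := hm i k
    rw [← he, mul_comm (x k)] at this
    exact (mul_left_cancel₀ h0 this).symm
  · push Not at hc
    refine Or.inr ⟨hc, fun i => ?_⟩
    have h0 : x 0 ≠ 0 := by have := one_le_of_prime (hx 0).1; omega
    have := hm 0 i
    rw [hc i] at this
    exact mul_left_cancel₀ h0 this

theorem sqrt_wedgeSq_le (x y : Fin 4 → ℤ) : √(wedgeSq x y) ≤ ‖euc x‖ * ‖euc y‖ := by
  refine Real.sqrt_le_iff.mpr ⟨by positivity, ?_⟩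
  rw [mul_pow, norm_euc_sq, norm_euc_sq]
  unfold wedgeSq
  push_cast
  nlinarith [sq_nonneg (∑ i, (x i : ℝ) * y i)]

/-- Orthogonality to `x` determines the last entry from the other three. -/
theorem pairCount_le_cube {A B : ℝ} (hA : 1 ≤ A) {x y : Fin 4 → ℤ} (hx : x ∈ primeTuples B) :
    pairCount A x y ≤ 27 * A ^ 3 := by
  classical
  rw [pairCount_eq]
  set S := (finite_primitiveTuplesUpTo A).toFinset.filter fun a =>
      a ∈ orthLattice x ∧ a ∈ orthLattice y
  have hinj : Set.InjOn (fun (a : Fin 4 → ℤ) (i : Fin 3) => a i.castSucc) S := by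
    intro a ha b hb hab
    rw [Finset.mem_coe, Finset.mem_filter, mem_orthLattice, mem_orthLattice, Fin.sum_univ_castSucc]
      at ha hb
    have h : ∀ i : Fin 3, a i.castSucc = b i.castSucc := fun i => congrFun hab i
    have h1 := ha.2.1.trans hb.2.1.symm
    simp only [h, add_right_inj] at h1
    have h0 : x (Fin.last 3) ≠ 0 := by have := one_le_of_prime (hx (Fin.last 3)).1; omega
    have h2 := mul_left_cancel₀ h0 h1
    funext i
    exact Fin.lastCases h2 h i
  rw [← Finset.card_image_of_injOn hinj]
  refine (card_le_of_abs_le hA _ fun a ha i => ?_).trans (le_of_eq (by ring))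
  obtain ⟨b, hb, rfl⟩ := Finset.mem_image.mp ha
  exact (PiLp.norm_apply_le (euc b) i.castSucc).trans
    (mem_tuplesUpTo.mp (Finset.mem_filter.mp hb).1).2

theorem one_le_norm_euc_of_mem {B : ℝ} {x : Fin 4 → ℤ} (hx : x ∈ primeTuples B) :
    1 ≤ ‖euc x‖ := by
  have : (1 : ℝ) ≤ x 0 := by exact_mod_cast one_le_of_prime (hx 0).1
  exact this.trans ((le_abs_self _).trans (PiLp.norm_apply_le (euc x) 0))

/-- A non-constant prime tuple has an entry different from its largest one; the two are coprime, so
the count of vectors orthogonal to `x` applies. -/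
theorem pairCount_self_le {A B : ℝ} (hA : 1 ≤ A) {x : Fin 4 → ℤ} (hx : x ∈ primeTuples B)
    (hc : ∃ i, x i ≠ x 0) : pairCount A x x ≤ 36 / ‖euc x‖ * A ^ 3 + 18 * A ^ 2 := by
  classical
  rw [pairCount_eq]
  have hxpos : ∀ i, 0 < x i := fun i => one_le_of_prime (hx i).1
  obtain ⟨i, -, hi⟩ := Finset.exists_max_image Finset.univ x ⟨0, Finset.mem_univ _⟩
  obtain ⟨j, hj⟩ : ∃ j, x i ≠ x j := by
    by_contra hn
    push Not at hn
    obtain ⟨k, hk⟩ := hc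
    exact hk ((hn k).symm.trans (hn 0))
  refine card_orth_le (fun h => hj (by rw [h])) (isCoprime_of_prime_ne (hx i).1 (hx j).1 hj)
    (hxpos i) (l2_le_of_abs_le (Int.cast_nonneg (hxpos i).le) fun k => ?_)
    (by linarith [one_le_norm_euc_of_mem hx]) hA _
    (fun a ha => (Finset.mem_filter.mp ha).2.1)
    (fun a ha => (mem_tuplesUpTo.mp (Finset.mem_filter.mp ha).1).2)
  rw [abs_of_pos (Int.cast_pos.mpr (hxpos k))]
  exact Int.cast_le.mpr (hi k (Finset.mem_univ k))


/-! ### Summing the variance over all pairs -/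

/-- The second moment of the difference of the two densities at a pair. -/
noncomputable def pairVariance (A α : ℝ) (W : ℕ) (x y : Fin 4 → ℤ) : ℝ :=
  pairCount A x y - 2 * pairMixed A α W x y + pairLocal A α W x y

/-- The conditions on the parameters under which the variance is estimated. -/
structure VarParams (A B δ η : ℝ) (W P z : ℕ) : Prop where
  pair : PairParams A B (Real.log B) η (Real.log B ^ 3) W P z
  two_le_B : 2 ≤ B
  A_lower : B ^ 2 * Real.log B ≤ A
  A_upper : A * Real.log B ^ 4 ≤ B ^ 3 * δ
  card_residues : (P : ℝ) ^ 3 * (1 - 2 * η) ≤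
    (@Finset.filter _ (PrimitiveAt P) (Classical.decPred _) (residues P 3)).card
  dvd : ∀ e : ℕ, 0 < e → e * η ≤ 1 → e ∣ W ∧ ∀ p : ℕ, p.Prime → p ∣ W → e * p ∣ W
  δ_pos : 0 < δ
  δ_le_one : δ ≤ 1
  η_le_δ : η ≤ δ ^ 2
  one_le_angle : 1 ≤ δ ^ 8 * (η * Real.log B)
  W_sq_le : (W : ℝ) ^ 2 ≤ Real.log B
  log_pow_le : Real.log B ^ 40 ≤ B * δ
  one_le_δ_log : 1 ≤ δ ^ 2 * Real.log B
  log_le_z : Real.log B ≤ 200 * z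
  log_pow_le_rpow : Real.log B ^ 20 ≤ B ^ (1 / 100 : ℝ)

section

variable {A B α δ η R : ℝ} {W P z : ℕ} {x y : Fin 4 → ℤ}

/-- The weight of a pair in the sum over the pairs in general position. -/
noncomputable def genericWeight (x y : Fin 4 → ℤ) : ℝ :=
  (minorGcd x y : ℝ) ^ (3 / 2 : ℝ) * (wedgeSq x y : ℝ) ^ (-(9 / 16 : ℝ))

theorem genericWeight_nonneg (x y : Fin 4 → ℤ) : 0 ≤ genericWeight x y := by
  have : (0 : ℝ) ≤ wedgeSq x y := by exact_mod_cast wedgeSq_nonneg x y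
  unfold genericWeight; positivity

/-- The second factor on the right is the reserve: it is at most `2 B ^ (1/4)` for all pairs, and
smaller by `δ` if `G` is large or `Δ` is small. -/
theorem minorGcd_div_eq (h : Indep x y) : (minorGcd x y : ℝ) / √(wedgeSq x y) =
    genericWeight x y * ((minorGcd x y : ℝ) ^ (-(1 / 2 : ℝ)) * √(wedgeSq x y) ^ (1 / 8 : ℝ)) := by
  have hg : (0 : ℝ) < minorGcd x y := by exact_mod_cast h.minorGcd_pos
  have hΔ : (0 : ℝ) < wedgeSq x y := by exact_mod_cast h.wedgeSq_pos
  rw [Real.sqrt_eq_rpow, ← Real.rpow_mul hΔ.le, genericWeight]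
  calc _ = (minorGcd x y : ℝ) ^ (3 / 2 + -(1 / 2) : ℝ) *
        (wedgeSq x y : ℝ) ^ (-(9 / 16) + 1 / 2 * (1 / 8) : ℝ) := by
        rw [show (3 / 2 + -(1 / 2) : ℝ) = 1 by norm_num,
          show (-(9 / 16) + 1 / 2 * (1 / 8) : ℝ) = -(1 / 2) by norm_num, Real.rpow_one,
          Real.rpow_neg hΔ.le, div_eq_mul_inv]
    _ = _ := by rw [Real.rpow_add hg, Real.rpow_add hΔ]; ring

theorem rpow_eighth_le {s B c : ℝ} (hs : 0 ≤ s) (hB : 0 ≤ B) (hc : 0 ≤ c)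
    (h : s ≤ 4 * B ^ 2 * c ^ 8) : s ^ (1 / 8 : ℝ) ≤ 2 * B ^ (1 / 4 : ℝ) * c := by
  have h1 : (2 * B ^ (1 / 4 : ℝ) * c) ^ 8 = 256 * B ^ 2 * c ^ 8 := by
    rw [mul_pow, mul_pow, ← Real.rpow_natCast (B ^ (1 / 4 : ℝ)), ← Real.rpow_mul hB,
      show (1 / 4 * (8 : ℕ) : ℝ) = (2 : ℕ) by norm_num, Real.rpow_natCast]
    norm_num
  calc s ^ (1 / 8 : ℝ) ≤ ((2 * B ^ (1 / 4 : ℝ) * c) ^ 8) ^ (1 / 8 : ℝ) := by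
        refine Real.rpow_le_rpow hs (h.trans ?_) (by norm_num)
        rw [h1]
        gcongr
        norm_num
    _ = _ := by
        rw [← Real.rpow_natCast, ← Real.rpow_mul (by positivity)]; norm_num

theorem norm_euc_le_of_mem (hB : 0 ≤ B) (hx : x ∈ primeTuples B) : ‖euc x‖ ≤ 2 * B :=
  l2_le_of_abs_le hB fun i => (hx i).2

theorem minorGcd_rpow_le_one (h : Indep x y) : (minorGcd x y : ℝ) ^ (-(1 / 2 : ℝ)) ≤ 1 :=
  Real.rpow_le_one_of_one_le_of_nonpos (by exact_mod_cast h.minorGcd_pos) (by norm_num)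

/-- The weight of a pair that is not well placed is small. -/
theorem VarParams.minorGcd_div_le (p : VarParams A B δ η W P z) (hx : x ∈ primeTuples B)
    (hy : y ∈ primeTuples B) (h : Indep x y)
    (hbad : 1 < minorGcd x y * η ∨ η * Real.log B * √(wedgeSq x y) ≤ ‖euc x‖ * ‖euc y‖) :
    (minorGcd x y : ℝ) / √(wedgeSq x y) ≤ 2 * B ^ (1 / 4 : ℝ) * δ * genericWeight x y := by
  have hB0 : 0 ≤ B := by linarith [p.two_le_B]
  have hδ := p.δ_pos
  have hη := p.pair.η_pos
  have hL := p.pair.α_pos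
  have hM := genericWeight_nonneg x y
  have hg : (0 : ℝ) < minorGcd x y := by exact_mod_cast h.minorGcd_pos
  rw [minorGcd_div_eq h, mul_comm]
  refine mul_le_mul_of_nonneg_right ?_ hM
  rcases hbad with hbad | hbad
  -- Here `G > 1 / η ≥ δ ^ (-2)`, and the gain comes from `G ^ (-1/2)`.
  · have h1 : (minorGcd x y : ℝ) ^ (-(1 / 2 : ℝ)) ≤ δ := by
      have e : (δ ^ 2)⁻¹ ≤ minorGcd x y := by
        refine (inv_anti₀ hη p.η_le_δ).trans ?_
        rw [inv_le_iff_one_le_mul₀ hη]; exact hbad.le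
      have e2 := Real.rpow_le_rpow_of_nonpos (by positivity) e
        (show (-(1 / 2) : ℝ) ≤ 0 by norm_num)
      refine e2.trans (le_of_eq ?_)
      rw [← Real.rpow_neg_one, ← Real.rpow_natCast, ← Real.rpow_mul hδ.le, ← Real.rpow_mul hδ.le]
      norm_num
    have h2 := rpow_eighth_le (Real.sqrt_nonneg (wedgeSq x y)) hB0 zero_le_one
      (by simpa using wedgeSq_le (fun i => (hx i).2) fun i => (hy i).2)
    calc _ ≤ δ * (2 * B ^ (1 / 4 : ℝ) * 1) := by gcongr
      _ = _ := by ring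
  -- Here the angle is small, and the gain comes from the power `1/8` of `√Δ ≤ 4 B² δ ^ 8`.
  · have h3 : √(wedgeSq x y) ≤ 4 * B ^ 2 * δ ^ 8 := by
      calc √(wedgeSq x y) ≤ δ ^ 8 * (η * Real.log B) * √(wedgeSq x y) :=
            le_mul_of_one_le_left (Real.sqrt_nonneg _) p.one_le_angle
        _ = δ ^ 8 * (η * Real.log B * √(wedgeSq x y)) := by ring
        _ ≤ δ ^ 8 * (2 * B * (2 * B)) := by
            refine mul_le_mul_of_nonneg_left (hbad.trans ?_) (by positivity)
            gcongr
            exacts [norm_euc_le_of_mem hB0 hx, norm_euc_le_of_mem hB0 hy]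
        _ = _ := by ring
    have h2 := rpow_eighth_le (Real.sqrt_nonneg (wedgeSq x y)) hB0 hδ.le h3
    calc _ ≤ 1 * (2 * B ^ (1 / 4 : ℝ) * δ) := by
          gcongr; exact minorGcd_rpow_le_one h
      _ = _ := one_mul _

/-- The variance of a pair in general position. -/
theorem VarParams.pairVariance_le (p : VarParams A B δ η W P z) (hx : x ∈ primeTuples B)
    (hy : y ∈ primeTuples B) (h : Distinct x y) :
    pairVariance A (Real.log B) W x y ≤ 220 * A ^ 2 * B ^ (1 / 4 : ℝ) * δ * genericWeight x y +
      ((81 * Real.log B ^ 2 * (W : ℝ) ^ 2 * (Real.log B ^ 3) ^ 4 +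
          1152 * Real.log B * W * A ^ 2 / (z : ℝ) ^ 2) * (1 / ‖euc x‖ * (1 / ‖euc y‖)) +
        864 * Real.log B * W * A * (1 / ‖euc y‖)) := by
  classical
  obtain ⟨f⟩ := nonempty_pairFrame W hx hy h
  have hind : Indep x y := ⟨0, 1, f.minor_ne_zero⟩
  have hδ := p.δ_pos
  have hη := p.pair.η_pos
  have hL := p.pair.α_pos
  have hA := p.pair.A_pos
  have hB0 : 0 ≤ B := by linarith [p.two_le_B]
  have hM := genericWeight_nonneg x y
  have hx1 := one_le_norm_euc_of_mem hx
  have hy1 := one_le_norm_euc_of_mem hy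
  have hz : (1 : ℝ) ≤ z := by exact_mod_cast p.pair.z_pos
  have hpi := Real.pi_lt_d4
  have hK : 0 ≤ A ^ 2 * (B ^ (1 / 4 : ℝ) * δ * genericWeight x y) := by positivity
  -- For a badly placed pair the weight supplies the factor `δ`; for the others cancellation of main
  -- terms supplies `η ≤ δ`.
  by_cases hbad : 1 < minorGcd x y * η ∨ η * Real.log B * √(wedgeSq x y) ≤ ‖euc x‖ * ‖euc y‖
  · have h1 := p.minorGcd_div_le hx hy hind hbad
    refine (f.variance_le' p.pair).trans (add_le_add ?_ ?_)
    · calc _ ≤ 9 * Real.pi * A ^ 2 * (2 * B ^ (1 / 4 : ℝ) * δ * genericWeight x y) := by gcongr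
        _ = 18 * Real.pi * (A ^ 2 * (B ^ (1 / 4 : ℝ) * δ * genericWeight x y)) := by ring
        _ ≤ 220 * (A ^ 2 * (B ^ (1 / 4 : ℝ) * δ * genericWeight x y)) := by gcongr; linarith
        _ = _ := by ring
    · calc _ = 81 * Real.log B ^ 2 * (W : ℝ) ^ 2 * (Real.log B ^ 3) ^ 4 *
            (1 / ‖euc x‖ * (1 / ‖euc y‖)) := by rw [one_div_mul_one_div, mul_one_div]
        _ ≤ (81 * Real.log B ^ 2 * (W : ℝ) ^ 2 * (Real.log B ^ 3) ^ 4 +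
            1152 * Real.log B * W * A ^ 2 / (z : ℝ) ^ 2) * (1 / ‖euc x‖ * (1 / ‖euc y‖)) := by
            gcongr
            exact le_add_of_nonneg_right (by positivity)
        _ ≤ _ := le_add_of_nonneg_right (by positivity)
  · push Not at hbad
    obtain ⟨hd1, hd2⟩ := p.dvd _ f.minorGcd_pos hbad.1
    have h1 : (minorGcd x y : ℝ) / √(wedgeSq x y) ≤ 2 * B ^ (1 / 4 : ℝ) * genericWeight x y := by
      rw [minorGcd_div_eq hind, mul_comm]
      refine mul_le_mul_of_nonneg_right ?_ hM
      have h2 := rpow_eighth_le (Real.sqrt_nonneg (wedgeSq x y)) hB0 zero_le_one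
        (by simpa using wedgeSq_le (fun i => (hx i).2) fun i => (hy i).2)
      calc _ ≤ 1 * (2 * B ^ (1 / 4 : ℝ) * 1) := by gcongr; exact minorGcd_rpow_le_one hind
        _ = _ := by ring
    have hηδ : η ≤ δ := p.η_le_δ.trans (by nlinarith [p.δ_le_one])
    refine (f.variance_le p.pair (by convert p.card_residues) hbad.2.le hd1 hd2).trans
      (add_le_add ?_ ?_)
    · calc _ ≤ 35 * Real.pi * δ * A ^ 2 * (2 * B ^ (1 / 4 : ℝ) * genericWeight x y) := by gcongr
        _ = 70 * Real.pi * (A ^ 2 * (B ^ (1 / 4 : ℝ) * δ * genericWeight x y)) := by ring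
        _ ≤ 220 * (A ^ 2 * (B ^ (1 / 4 : ℝ) * δ * genericWeight x y)) := by gcongr; linarith
        _ = _ := by ring
    · calc _ ≤ 81 * Real.log B ^ 2 * (W : ℝ) ^ 2 * (Real.log B ^ 3) ^ 4 / (‖euc x‖ * ‖euc y‖) +
            2 * (Real.log B * W / ‖euc y‖ *
              (288 * A + (576 / ‖euc x‖ * A ^ 2 / (z : ℝ) ^ 2 + 144 * A))) := by
            gcongr
            exact div_le_self (by positivity) hz
        _ = _ := by field_simp; ring

theorem eight_mul_sq_le (p : PairParams A B α η R W P z) : 8 * B ^ 2 ≤ A := by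
  have h1 : (1 : ℝ) ≤ W := by exact_mod_cast p.W_pos
  have := p.A_pos
  calc 8 * B ^ 2 = 8 * B ^ 2 * 1 := (mul_one _).symm
    _ ≤ 8 * B ^ 2 * W := by gcongr
    _ ≤ η * A := p.W_le
    _ ≤ 1 * A := by gcongr; linarith [p.η_le]
    _ = A := one_mul A

/-- The variance of an independent pair. -/
theorem VarParams.pairVariance_le_of_indep (p : VarParams A B δ η W P z) (hx : x ∈ primeTuples B)
    (hy : y ∈ primeTuples B) (h : Indep x y) :
    pairVariance A (Real.log B) W x y ≤ 2700 * Real.log B ^ 3 * A ^ 2 *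
      ((minorGcd x y : ℝ) / √(wedgeSq x y)) := by
  have hL := p.pair.α_pos
  have hA := p.pair.A_pos
  have hg : (1 : ℝ) ≤ minorGcd x y := by exact_mod_cast h.minorGcd_pos
  have hs : 0 < √(wedgeSq x y : ℝ) := Real.sqrt_pos.mpr (by exact_mod_cast h.wedgeSq_pos)
  have h8 := eight_mul_sq_le p.pair
  have h1 := pairCount_le (A := A) hx hy h
  have h2 := pairLocal_le hA.le hL.le W x y
  have h3 := pairMixed_nonneg (A := A) hL.le W x y
  have hW1 : (1 : ℝ) ≤ W := by exact_mod_cast p.pair.W_pos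
  have hL1 : 1 ≤ Real.log B := by nlinarith [p.W_sq_le]
  have hL3 : 1 ≤ Real.log B ^ 3 := one_le_pow₀ hL1
  set u := (minorGcd x y : ℝ) / √(wedgeSq x y) with hu
  have hu0 : 0 ≤ u := by positivity
  have e1 : pairCount A x y ≤ 16 * A ^ 2 * u := by
    calc _ ≤ Real.pi * (A + 8 * B ^ 2) ^ 2 * u := by rw [hu, ← mul_div_assoc]; exact h1
      _ ≤ 4 * (A + A) ^ 2 * u := by gcongr; exact Real.pi_le_four
      _ = _ := by ring
  have e2 : pairLocal A (Real.log B) W x y ≤ 2592 * Real.log B ^ 3 * A ^ 2 * u := by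
    have e3 : 1 / (‖euc x‖ * ‖euc y‖) ≤ u :=
      div_le_div₀ (by linarith) hg hs (sqrt_wedgeSq_le x y)
    calc _ ≤ 2592 * Real.log B ^ 2 * (W : ℝ) ^ 2 * A ^ 2 * (1 / (‖euc x‖ * ‖euc y‖)) := by
          rw [mul_one_div]; exact h2
      _ ≤ 2592 * Real.log B ^ 2 * Real.log B * A ^ 2 * u := by
          gcongr; exact p.W_sq_le
      _ = _ := by ring
  have e4 : 16 * A ^ 2 * u ≤ 16 * A ^ 2 * u * Real.log B ^ 3 :=
    le_mul_of_one_le_right (by positivity) hL3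
  have e5 : 0 ≤ Real.log B ^ 3 * A ^ 2 * u := by positivity
  unfold pairVariance
  linarith

end


section

variable {A B δ η : ℝ} {W P z : ℕ} {x y : Fin 4 → ℤ}

theorem VarParams.one_le_log (p : VarParams A B δ η W P z) : 1 ≤ Real.log B := by
  have hW1 : (1 : ℝ) ≤ W := by exact_mod_cast p.pair.W_pos
  nlinarith [p.W_sq_le]

theorem VarParams.pairLocal_le (p : VarParams A B δ η W P z) (hx : x ∈ primeTuples B)
    (hy : y ∈ primeTuples B) : pairLocal A (Real.log B) W x y ≤ 2592 * Real.log B ^ 3 * A ^ 2 := by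
  have hL := p.pair.α_pos
  have hA := p.pair.A_pos
  have h1 := one_le_norm_euc_of_mem hx
  have h2 := one_le_norm_euc_of_mem hy
  have := p.W_sq_le
  calc _ ≤ 2592 * Real.log B ^ 2 * (W : ℝ) ^ 2 * A ^ 2 :=
        (PrimeLinearForms.pairLocal_le hA.le hL.le W x y).trans
          (div_le_self (by positivity) (by nlinarith))
    _ ≤ 2592 * Real.log B ^ 2 * Real.log B * A ^ 2 := by gcongr
    _ = _ := by ring

open scoped Classical in
/-- The variance of a dependent pair. -/
theorem VarParams.pairVariance_le_of_not_indep (p : VarParams A B δ η W P z)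
    (hx : x ∈ primeTuples B) (hy : y ∈ primeTuples B) (h : ¬ Indep x y) :
    pairVariance A (Real.log B) W x y ≤
      (if x = y then 36 * A ^ 3 * (1 / ‖euc x‖) + 2610 * Real.log B ^ 3 * A ^ 2 else 0) +
      (if (∀ i, x i = x 0) ∧ ∀ i, y i = y 0 then 27 * A ^ 3 + 2592 * Real.log B ^ 3 * A ^ 2
        else 0) := by
  have hL := p.pair.α_pos
  have hA := p.pair.A_pos
  have hB := p.pair.one_le_B
  have hA1 : 1 ≤ A := by nlinarith [eight_mul_sq_le p.pair]
  have h1 := p.pairLocal_le hx hy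
  have h3 := pairMixed_nonneg (A := A) hL.le W x y
  have hL3 : 1 ≤ Real.log B ^ 3 := one_le_pow₀ p.one_le_log
  unfold pairVariance
  rcases eq_or_const_of_not_indep hx hy h with ⟨rfl, hc⟩ | hc
  · have h2 := pairCount_self_le hA1 hx hc
    have h4 : 18 * A ^ 2 * 1 ≤ 18 * A ^ 2 * Real.log B ^ 3 := by gcongr
    have h5 : 36 / ‖euc x‖ * A ^ 3 = 36 * A ^ 3 * (1 / ‖euc x‖) := by ring
    rw [if_pos rfl, if_neg fun h => by obtain ⟨i, hi⟩ := hc; exact hi (h.1 i)]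
    linarith
  · have h2 := pairCount_le_cube (y := y) hA1 hx
    rw [if_pos hc]
    have : 0 ≤ if x = y then 36 * A ^ 3 * (1 / ‖euc x‖) + 2610 * Real.log B ^ 3 * A ^ 2 else 0 := by
      split_ifs <;> positivity
    linarith

/-- The threshold that separates the pairs of small covolume. -/
noncomputable def covolThreshold (B : ℝ) : ℝ := 4 * B ^ 2 / Real.log B ^ 20

/-- The main term of the error of a pair. -/
noncomputable def errorProd (A B : ℝ) (W z : ℕ) : ℝ :=
  81 * Real.log B ^ 2 * (W : ℝ) ^ 2 * (Real.log B ^ 3) ^ 4 +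
    1152 * Real.log B * W * A ^ 2 / (z : ℝ) ^ 2

theorem VarParams.errorProd_nonneg (p : VarParams A B δ η W P z) : 0 ≤ errorProd A B W z := by
  have hL := p.pair.α_pos
  unfold errorProd; positivity

open scoped Classical in
-- Every pair falls under one of five cases: distinct with large covolume (first two terms), small
-- covolume, coinciding coordinates with large covolume, equal, or both constant. All terms are
-- nonnegative, so the unused ones do no harm.
theorem VarParams.pairVariance_le_sum (p : VarParams A B δ η W P z)
    (hx : x ∈ primeTuples B) (hy : y ∈ primeTuples B) :
    pairVariance A (Real.log B) W x y ≤
      (if Distinct x y ∧ (minorGcd x y : ℝ) ≤ B ^ (1 / 100 : ℝ) then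
        220 * A ^ 2 * B ^ (1 / 4 : ℝ) * δ * genericWeight x y else 0) +
      (errorProd A B W z * (1 / ‖euc x‖ * (1 / ‖euc y‖)) +
        864 * Real.log B * W * A * (1 / ‖euc y‖)) +
      (if Indep x y ∧ √(wedgeSq x y) ≤ covolThreshold B * minorGcd x y then
        2700 * Real.log B ^ 3 * A ^ 2 * ((minorGcd x y : ℝ) / √(wedgeSq x y)) else 0) +
      (if ¬ Distinct x y then 2700 * Real.log B ^ 3 * A ^ 2 * (1 / covolThreshold B) else 0) +
      (if x = y then 36 * A ^ 3 * (1 / ‖euc x‖) + 2610 * Real.log B ^ 3 * A ^ 2 else 0) +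
      (if (∀ i, x i = x 0) ∧ ∀ i, y i = y 0 then 27 * A ^ 3 + 2592 * Real.log B ^ 3 * A ^ 2
        else 0) := by
  have hL := p.pair.α_pos
  have hA := p.pair.A_pos
  have hB0 : 0 < B := by linarith [p.two_le_B]
  have hδ := p.δ_pos
  have hD : 0 < covolThreshold B := by unfold covolThreshold; positivity
  have hM := genericWeight_nonneg x y
  have hep := p.errorProd_nonneg
  set T₁ := if Distinct x y ∧ (minorGcd x y : ℝ) ≤ B ^ (1 / 100 : ℝ) then
        220 * A ^ 2 * B ^ (1 / 4 : ℝ) * δ * genericWeight x y else 0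
  set T₂ := errorProd A B W z * (1 / ‖euc x‖ * (1 / ‖euc y‖)) +
        864 * Real.log B * W * A * (1 / ‖euc y‖)
  set T₃ := if Indep x y ∧ √(wedgeSq x y) ≤ covolThreshold B * minorGcd x y then
        2700 * Real.log B ^ 3 * A ^ 2 * ((minorGcd x y : ℝ) / √(wedgeSq x y)) else 0
  set T₄ := if ¬ Distinct x y then 2700 * Real.log B ^ 3 * A ^ 2 * (1 / covolThreshold B) else 0
  set T₅ := if x = y then 36 * A ^ 3 * (1 / ‖euc x‖) + 2610 * Real.log B ^ 3 * A ^ 2 else 0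
  set T₆ := if (∀ i, x i = x 0) ∧ ∀ i, y i = y 0 then
    27 * A ^ 3 + 2592 * Real.log B ^ 3 * A ^ 2 else 0
  have h₁ : 0 ≤ T₁ := by simp only [T₁]; split_ifs <;> positivity
  have h₂ : 0 ≤ T₂ := by positivity
  have h₃ : 0 ≤ T₃ := by simp only [T₃]; split_ifs <;> positivity
  have h₄ : 0 ≤ T₄ := by simp only [T₄]; split_ifs <;> positivity
  have h₅ : 0 ≤ T₅ := by simp only [T₅]; split_ifs <;> positivity
  have h₆ : 0 ≤ T₆ := by simp only [T₆]; split_ifs <;> positivity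
  by_cases hi : Indep x y
  · have hs : 0 < √(wedgeSq x y : ℝ) := Real.sqrt_pos.mpr (by exact_mod_cast hi.wedgeSq_pos)
    by_cases hc : √(wedgeSq x y) ≤ covolThreshold B * minorGcd x y
    · have : T₃ = _ := if_pos ⟨hi, hc⟩
      have := p.pairVariance_le_of_indep hx hy hi
      linarith
    · push Not at hc
      by_cases hd : Distinct x y
      -- Large covolume bounds the gcd: `G < √Δ / D ≤ 4 B² / D = (log B) ^ 20`.
      · have hG : (minorGcd x y : ℝ) ≤ B ^ (1 / 100 : ℝ) := by
          refine le_trans ?_ p.log_pow_le_rpow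
          have h1 := hc.le.trans (wedgeSq_le (fun i => (hx i).2) fun i => (hy i).2)
          unfold covolThreshold at h1
          rw [div_mul_eq_mul_div, div_le_iff₀ (by positivity)] at h1
          exact le_of_mul_le_mul_left h1 (by positivity)
        have : T₁ = _ := if_pos ⟨hd, hG⟩
        have : pairVariance A (Real.log B) W x y ≤ _ + T₂ := p.pairVariance_le hx hy hd
        linarith
      · have e : T₄ = _ := if_pos hd
        have h1 := p.pairVariance_le_of_indep hx hy hi
        have h2 : (minorGcd x y : ℝ) / √(wedgeSq x y) ≤ 1 / covolThreshold B := by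
          rw [div_le_div_iff₀ hs hD, one_mul, mul_comm]; exact hc.le
        have h3 : 2700 * Real.log B ^ 3 * A ^ 2 * ((minorGcd x y : ℝ) / √(wedgeSq x y)) ≤ T₄ := by
          rw [e]; gcongr
        linarith
  · have : pairVariance A (Real.log B) W x y ≤ T₅ + T₆ := p.pairVariance_le_of_not_indep hx hy hi
    linarith

open scoped Classical in
theorem card_const_le (hB : 0 ≤ B) : (((tuples B ×ˢ tuples B).filter fun xy =>
    (∀ i, xy.1 i = xy.1 0) ∧ ∀ i, xy.2 i = xy.2 0).card : ℝ) ≤ B ^ 2 := by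
  have h : ((tuples B ×ˢ tuples B).filter fun xy =>
      (∀ i, xy.1 i = xy.1 0) ∧ ∀ i, xy.2 i = xy.2 0).card ≤
      (primesUpTo B ×ˢ primesUpTo B).card := by
    refine Finset.card_le_card_of_injOn (fun xy => (xy.1 0, xy.2 0)) (fun xy hxy => ?_)
      fun xy hxy xy' hxy' he => ?_
    · rw [Finset.mem_coe, Finset.mem_filter, Finset.mem_product] at hxy
      exact Finset.mem_coe.mpr (Finset.mem_product.mpr
        ⟨Fintype.mem_piFinset.mp hxy.1.1 0, Fintype.mem_piFinset.mp hxy.1.2 0⟩)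
    · rw [Finset.mem_coe, Finset.mem_filter] at hxy hxy'
      rw [Prod.mk.injEq] at he
      refine Prod.ext (funext fun k => ?_) (funext fun k => ?_)
      · rw [hxy.2.1, hxy'.2.1, he.1]
      · rw [hxy.2.2, hxy'.2.2, he.2]
  rw [Finset.card_product] at h
  calc _ ≤ ((primesUpTo B).card : ℝ) * (primesUpTo B).card := by exact_mod_cast h
    _ ≤ B * B := by gcongr <;> exact card_primesUpTo_le hB
    _ = _ := by ring

/-- The sum of the variances, in terms of sums over the prime tuples. -/
theorem exists_sum_pairVariance_le : ∃ C : ℝ, 0 < C ∧ ∀ {A B δ η : ℝ} {W P z : ℕ},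
    VarParams A B δ η W P z →
    ∑ xy ∈ tuples B ×ˢ tuples B, pairVariance A (Real.log B) W xy.1 xy.2 ≤
      C * (A ^ 2 * B ^ 6 * δ / Real.log B ^ 8 +
        (errorProd A B W z * B ^ 6 / Real.log B ^ 8 +
          Real.log B * W * A * B ^ 7 / Real.log B ^ 8) +
        Real.log B ^ 3 * A ^ 2 * B ^ 4 * covolThreshold B +
        Real.log B ^ 3 * A ^ 2 * B ^ 7 / covolThreshold B +
        (A ^ 3 * B ^ 3 / Real.log B ^ 4 + Real.log B ^ 3 * A ^ 2 * B ^ 4 / Real.log B ^ 4) +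
        (A ^ 3 + Real.log B ^ 3 * A ^ 2) * B ^ 2) := by
  classical
  obtain ⟨C₁, hC₁, h₁⟩ := sum_generic_le
  obtain ⟨C₂, hC₂, h₂⟩ := sum_inv_norm_le
  obtain ⟨C₃, hC₃, h₃⟩ := card_tuples_le
  obtain ⟨C₄, hC₄, h₄⟩ := sum_pairs_small_covolume_le
  refine ⟨220 * C₁ + (C₂ ^ 2 + 864 * (C₂ * C₃)) + 2700 * C₄ + 2700 * 64 + (36 * C₂ + 2610 * C₃) +
    2592, by positivity, fun {A B δ η W P z} p => ?_⟩
  have hL := p.pair.α_pos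
  have hA := p.pair.A_pos
  have hB := p.two_le_B
  have hB0 : 0 < B := by linarith
  have hδ := p.δ_pos
  have hep := p.errorProd_nonneg
  have hL1 := p.one_le_log
  have hD : 1 ≤ covolThreshold B := by
    unfold covolThreshold
    rw [one_le_div (by positivity)]
    have h1 : Real.log B ^ 20 ≤ Real.log B ^ 40 := pow_le_pow_right₀ hL1 (by norm_num)
    have h2 : B * δ ≤ B * 1 := by gcongr; exact p.δ_le_one
    nlinarith [p.log_pow_le]
  have hD0 : 0 < covolThreshold B := by linarith
  set L := Real.log B
  set D := covolThreshold B
  set E := errorProd A B W z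
  have hS := h₂ B hB
  set S := ∑ x ∈ tuples B, 1 / ‖euc x‖ with hSdef
  have hS0 : 0 ≤ S := Finset.sum_nonneg fun x _ => by positivity
  have hX := h₃ B hB
  refine (Finset.sum_le_sum fun xy hxy => p.pairVariance_le_sum
    ((mem_tuples hB0.le).mp (Finset.mem_product.mp hxy).1)
    ((mem_tuples hB0.le).mp (Finset.mem_product.mp hxy).2)).trans ?_
  simp only [Finset.sum_add_distrib]
  have t₁ : ∑ xy ∈ tuples B ×ˢ tuples B, (if Distinct xy.1 xy.2 ∧
      (minorGcd xy.1 xy.2 : ℝ) ≤ B ^ (1 / 100 : ℝ) then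
        220 * A ^ 2 * B ^ (1 / 4 : ℝ) * δ * genericWeight xy.1 xy.2 else 0) ≤
      220 * C₁ * (A ^ 2 * B ^ 6 * δ / L ^ 8) := by
    rw [← Finset.sum_filter, ← Finset.mul_sum]
    refine (mul_le_mul_of_nonneg_left (h₁ B hB) (by positivity)).trans (le_of_eq ?_)
    calc _ = 220 * C₁ * (A ^ 2 * (B ^ (1 / 4 : ℝ) * B ^ (23 / 4 : ℝ)) * δ / L ^ 8) := by ring
      _ = _ := by
        rw [← Real.rpow_add hB0, show (1 / 4 + 23 / 4 : ℝ) = (6 : ℕ) by norm_num,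
          Real.rpow_natCast]
  have t₂ : ∑ xy ∈ tuples B ×ˢ tuples B, E * (1 / ‖euc xy.1‖ * (1 / ‖euc xy.2‖)) ≤
      C₂ ^ 2 * (E * B ^ 6 / L ^ 8) := by
    rw [← Finset.mul_sum, Finset.sum_product]
    simp only
    rw [← Finset.sum_mul_sum, ← hSdef]
    calc _ ≤ E * (C₂ * B ^ 3 / L ^ 4 * (C₂ * B ^ 3 / L ^ 4)) := by gcongr
      _ = _ := by ring
  have t₂' : ∑ xy ∈ tuples B ×ˢ tuples B, 864 * L * W * A * (1 / ‖euc xy.2‖) ≤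
      864 * (C₂ * C₃) * (L * W * A * B ^ 7 / L ^ 8) := by
    rw [← Finset.mul_sum, Finset.sum_product]
    simp only
    rw [Finset.sum_const, nsmul_eq_mul, ← hSdef]
    calc _ ≤ 864 * L * W * A * (C₃ * B ^ 4 / L ^ 4 * (C₂ * B ^ 3 / L ^ 4)) := by gcongr
      _ = _ := by field_simp
  have t₃ : ∑ xy ∈ tuples B ×ˢ tuples B, (if Indep xy.1 xy.2 ∧
      √(wedgeSq xy.1 xy.2) ≤ D * minorGcd xy.1 xy.2 then
        2700 * L ^ 3 * A ^ 2 * ((minorGcd xy.1 xy.2 : ℝ) / √(wedgeSq xy.1 xy.2)) else 0) ≤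
      2700 * C₄ * (L ^ 3 * A ^ 2 * B ^ 4 * D) := by
    rw [← Finset.sum_filter, ← Finset.mul_sum]
    exact (mul_le_mul_of_nonneg_left (h₄ B D hB hD) (by positivity)).trans (le_of_eq (by ring))
  have t₄ : ∑ xy ∈ tuples B ×ˢ tuples B, (if ¬ Distinct xy.1 xy.2 then
      2700 * L ^ 3 * A ^ 2 * (1 / D) else 0) ≤ 2700 * 64 * (L ^ 3 * A ^ 2 * B ^ 7 / D) := by
    rw [← Finset.sum_filter, Finset.sum_const, nsmul_eq_mul]
    exact (mul_le_mul_of_nonneg_right (card_not_distinct_le hB0.le) (by positivity)).trans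
      (le_of_eq (by ring))
  have t₅ : ∑ xy ∈ tuples B ×ˢ tuples B, (if xy.1 = xy.2 then
      36 * A ^ 3 * (1 / ‖euc xy.1‖) + 2610 * L ^ 3 * A ^ 2 else 0) ≤
      36 * C₂ * (A ^ 3 * B ^ 3 / L ^ 4) + 2610 * C₃ * (L ^ 3 * A ^ 2 * B ^ 4 / L ^ 4) := by
    rw [Finset.sum_product]
    simp only [Finset.sum_ite_eq]
    rw [Finset.sum_congr rfl fun x hx => if_pos hx, Finset.sum_add_distrib, ← Finset.mul_sum,
      ← hSdef, Finset.sum_const, nsmul_eq_mul]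
    calc _ ≤ 36 * A ^ 3 * (C₂ * B ^ 3 / L ^ 4) + C₃ * B ^ 4 / L ^ 4 * (2610 * L ^ 3 * A ^ 2) := by
          gcongr
      _ = _ := by ring
  have t₆ : ∑ xy ∈ tuples B ×ˢ tuples B, (if (∀ i, xy.1 i = xy.1 0) ∧ ∀ i, xy.2 i = xy.2 0 then
      27 * A ^ 3 + 2592 * L ^ 3 * A ^ 2 else 0) ≤ 2592 * ((A ^ 3 + L ^ 3 * A ^ 2) * B ^ 2) := by
    rw [← Finset.sum_filter, Finset.sum_const, nsmul_eq_mul]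
    calc _ ≤ B ^ 2 * (2592 * A ^ 3 + 2592 * L ^ 3 * A ^ 2) := by
          gcongr
          · exact card_const_le hB0.le
          · norm_num
      _ = _ := by ring
  set u₁ := A ^ 2 * B ^ 6 * δ / L ^ 8
  set u₂ := E * B ^ 6 / L ^ 8
  set u₂' := L * W * A * B ^ 7 / L ^ 8
  set u₃ := L ^ 3 * A ^ 2 * B ^ 4 * D
  set u₄ := L ^ 3 * A ^ 2 * B ^ 7 / D
  set u₅ := A ^ 3 * B ^ 3 / L ^ 4
  set u₅' := L ^ 3 * A ^ 2 * B ^ 4 / L ^ 4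
  set u₆ := (A ^ 3 + L ^ 3 * A ^ 2) * B ^ 2
  have v₁ : 0 ≤ u₁ := by positivity
  have v₂ : 0 ≤ u₂ := by positivity
  have v₂' : 0 ≤ u₂' := by positivity
  have v₃ : 0 ≤ u₃ := by positivity
  have v₄ : 0 ≤ u₄ := by positivity
  have v₅ : 0 ≤ u₅ := by positivity
  have v₅' : 0 ≤ u₅' := by positivity
  have v₆ : 0 ≤ u₆ := by positivity
  set K := 220 * C₁ + (C₂ ^ 2 + 864 * (C₂ * C₃)) + 2700 * C₄ + 2700 * 64 + (36 * C₂ + 2610 * C₃) +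
    2592 with hK
  have q : 0 < C₂ * C₃ := by positivity
  have q2 : 0 < C₂ ^ 2 := by positivity
  have w₁ : 220 * C₁ * u₁ ≤ K * u₁ := by gcongr; linarith
  have w₂ : C₂ ^ 2 * u₂ ≤ K * u₂ := by gcongr; linarith
  have w₂' : 864 * (C₂ * C₃) * u₂' ≤ K * u₂' := by gcongr; linarith
  have w₃ : 2700 * C₄ * u₃ ≤ K * u₃ := by gcongr; linarith
  have w₄ : 2700 * 64 * u₄ ≤ K * u₄ := by gcongr; linarith
  have w₅ : 36 * C₂ * u₅ ≤ K * u₅ := by gcongr; linarith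
  have w₅' : 2610 * C₃ * u₅' ≤ K * u₅' := by gcongr; linarith
  have w₆ : 2592 * u₆ ≤ K * u₆ := by gcongr; linarith
  linarith

/-- Each term of `exists_sum_pairVariance_le` is absorbed by `A² B⁶ δ`; powers of `log B` cost
little against powers of `B`. -/
theorem exists_log_pow_mul_sum_pairVariance_le : ∃ C : ℝ, 0 < C ∧ ∀ {A B δ η : ℝ} {W P z : ℕ},
    VarParams A B δ η W P z →
    Real.log B ^ 8 * ∑ xy ∈ tuples B ×ˢ tuples B, pairVariance A (Real.log B) W xy.1 xy.2 ≤
      C * (A ^ 2 * B ^ 6 * δ) := by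
  obtain ⟨C, hC, h⟩ := exists_sum_pairVariance_le
  refine ⟨C * (1 + (81 + 1152 * 40000 + 1) + 4 + 1 + (1 + 1) + (1 + 1)), by positivity,
    fun {A B δ η W P z} p => ?_⟩
  have hL := p.pair.α_pos
  have hA := p.pair.A_pos
  have hB0 : 0 < B := by linarith [p.two_le_B]
  have hB1 : 1 ≤ B := p.pair.one_le_B
  have hδ := p.δ_pos
  have hδ1 := p.δ_le_one
  have hL1 := p.one_le_log
  have hAB := p.A_lower
  have hAu := p.A_upper
  have hz := p.log_le_z
  have hW2 := p.W_sq_le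
  have hδL := p.one_le_δ_log
  have h40 := p.log_pow_le
  refine (mul_le_mul_of_nonneg_left (h p) (by positivity)).trans ?_
  unfold errorProd covolThreshold
  set L := Real.log B
  have hpow : ∀ n ≤ 40, L ^ n ≤ B * δ := fun n hn => (pow_le_pow_right₀ hL1 hn).trans h40
  have hpow' : ∀ n ≤ 40, L ^ n ≤ B := fun n hn =>
    (hpow n hn).trans (mul_le_of_le_one_right hB0.le hδ1)
  have hLB : L ≤ B := (pow_one L).symm.le.trans (hpow' 1 (by norm_num))
  have hBA : B ≤ A := by nlinarith
  have hA1 : 1 ≤ A := hB1.trans hBA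
  have hWδ : (W : ℝ) ≤ δ * L := by
    apply le_of_sq_le_sq _ (by positivity)
    calc (W : ℝ) ^ 2 ≤ 1 * L := by rw [one_mul]; exact hW2
      _ ≤ δ ^ 2 * L * L := by gcongr
      _ = _ := by ring
  have hz0 : (0 : ℝ) < z := by exact_mod_cast p.pair.z_pos
  have hBδ : ∀ n, 1 ≤ n → B * δ ≤ B ^ n * δ := fun n hn => by
    gcongr; exact le_self_pow₀ hB1 (by omega)
  have b₁ : L ^ 2 * (W : ℝ) ^ 2 * (L ^ 3) ^ 4 ≤ A ^ 2 * δ := by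
    calc _ ≤ L ^ 2 * L * (L ^ 3) ^ 4 := by gcongr
      _ = L ^ 15 := by ring
      _ ≤ B * δ := hpow 15 (by norm_num)
      _ ≤ B ^ 2 * δ := hBδ 2 (by norm_num)
      _ ≤ _ := by gcongr
  have b₂ : L * W * A ^ 2 / (z : ℝ) ^ 2 ≤ 40000 * (A ^ 2 * δ) := by
    rw [div_le_iff₀ (by positivity)]
    calc L * W * A ^ 2 ≤ L * (δ * L) * A ^ 2 := by gcongr
      _ = L ^ 2 * (A ^ 2 * δ) := by ring
      _ ≤ (200 * z) ^ 2 * (A ^ 2 * δ) := by gcongr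
      _ = _ := by ring
  -- The lower bound `B² log B ≤ A` is used here.
  have c : L * W * A * B ^ 7 ≤ A ^ 2 * B ^ 6 * δ := by
    calc _ ≤ L * (δ * L) * A * B ^ 7 := by gcongr
      _ = L * L * B * (A * B ^ 6 * δ) := by ring
      _ ≤ B * L * B * (A * B ^ 6 * δ) := by gcongr
      _ = B ^ 2 * L * (A * B ^ 6 * δ) := by ring
      _ ≤ A * (A * B ^ 6 * δ) := by gcongr
      _ = _ := by ring
  -- The exponent `20` in the threshold exceeds `8 + 3`, so a negative power of `log B` remains; in
  -- the next term the resulting `(log B) ^ 31` is harmless because a factor `B` is to spare.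
  have d : L ^ 8 * (L ^ 3 * A ^ 2 * B ^ 4 * (4 * B ^ 2 / L ^ 20)) ≤ 4 * (A ^ 2 * B ^ 6 * δ) := by
    have e : 1 / L ^ 9 ≤ δ := by
      rw [div_le_iff₀ (by positivity)]
      calc (1 : ℝ) ≤ δ ^ 2 * L := hδL
        _ ≤ δ * L ^ 9 := by
          gcongr
          · nlinarith
          · exact le_self_pow₀ hL1 (by norm_num)
    calc _ = 4 * (A ^ 2 * B ^ 6 * (1 / L ^ 9)) := by field_simp
      _ ≤ _ := by gcongr
  have e : L ^ 8 * (L ^ 3 * A ^ 2 * B ^ 7 / (4 * B ^ 2 / L ^ 20)) ≤ A ^ 2 * B ^ 6 * δ := by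
    calc _ = A ^ 2 * B ^ 5 * L ^ 31 / 4 := by field_simp
      _ ≤ A ^ 2 * B ^ 5 * L ^ 31 := div_le_self (by positivity) (by norm_num)
      _ ≤ A ^ 2 * B ^ 5 * (B * δ) := by gcongr; exact hpow 31 (by norm_num)
      _ = _ := by ring
  -- The diagonal pairs: exactly here the upper bound for `A`, with its `(log B) ^ (-4)`, is
  -- critical.
  have f₁ : L ^ 8 * (A ^ 3 * B ^ 3 / L ^ 4) ≤ A ^ 2 * B ^ 6 * δ := by
    calc _ = A ^ 2 * B ^ 3 * (A * L ^ 4) := by field_simp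
      _ ≤ A ^ 2 * B ^ 3 * (B ^ 3 * δ) := by gcongr
      _ = _ := by ring
  have f₂ : L ^ 8 * (L ^ 3 * A ^ 2 * B ^ 4 / L ^ 4) ≤ A ^ 2 * B ^ 6 * δ := by
    calc _ = A ^ 2 * B ^ 4 * L ^ 7 := by field_simp
      _ ≤ A ^ 2 * B ^ 4 * (B ^ 2 * δ) := by
        gcongr; exact (hpow 7 (by norm_num)).trans (hBδ 2 (by norm_num))
      _ = _ := by ring
  have g₁ : L ^ 8 * (A ^ 3 * B ^ 2) ≤ A ^ 2 * B ^ 6 * δ := by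
    calc _ = A ^ 2 * B ^ 2 * (A * L ^ 4) * L ^ 4 := by ring
      _ ≤ A ^ 2 * B ^ 2 * (B ^ 3 * δ) * B := by gcongr; exact hpow' 4 (by norm_num)
      _ = _ := by ring
  have g₂ : L ^ 8 * (L ^ 3 * A ^ 2 * B ^ 2) ≤ A ^ 2 * B ^ 6 * δ := by
    calc _ = A ^ 2 * B ^ 2 * L ^ 11 := by ring
      _ ≤ A ^ 2 * B ^ 2 * (B ^ 4 * δ) := by
        gcongr; exact (hpow 11 (by norm_num)).trans (hBδ 4 (by norm_num))
      _ = _ := by ring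
  have a : L ^ 8 * (A ^ 2 * B ^ 6 * δ / L ^ 8) = A ^ 2 * B ^ 6 * δ := by field_simp
  have b : L ^ 8 * ((81 * L ^ 2 * (W : ℝ) ^ 2 * (L ^ 3) ^ 4 + 1152 * L * W * A ^ 2 / (z : ℝ) ^ 2) *
      B ^ 6 / L ^ 8) ≤ (81 + 1152 * 40000) * (A ^ 2 * B ^ 6 * δ) := by
    calc _ = (81 * (L ^ 2 * (W : ℝ) ^ 2 * (L ^ 3) ^ 4) + 1152 * (L * W * A ^ 2 / (z : ℝ) ^ 2)) *
          B ^ 6 := by field_simp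
      _ ≤ (81 * (A ^ 2 * δ) + 1152 * (40000 * (A ^ 2 * δ))) * B ^ 6 := by gcongr
      _ = _ := by ring
  have c' : L ^ 8 * (L * W * A * B ^ 7 / L ^ 8) ≤ A ^ 2 * B ^ 6 * δ := by
    rw [mul_div_cancel₀ _ (by positivity)]; exact c
  rw [mul_left_comm, mul_assoc C]
  refine mul_le_mul_of_nonneg_left ?_ hC.le
  linarith

end


/-! ### The modulus `W` and the sieving primes -/

/-- The primes up to `w`. -/
noncomputable abbrev smallPrimes (B : ℝ) : Finset ℕ :=
  (Finset.range (⌊wParam B⌋₊ + 1)).filter Nat.Prime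

theorem mem_smallPrimes {B : ℝ} {p : ℕ} : p ∈ smallPrimes B ↔ p ≤ ⌊wParam B⌋₊ ∧ p.Prime := by
  rw [Finset.mem_filter, Finset.mem_range, Nat.lt_succ_iff]

theorem WParam_pos (B : ℝ) : 0 < WParam B :=
  Finset.prod_pos fun _ hp => pow_pos (mem_smallPrimes.mp hp).2.pos _

theorem WParam_eq_one {B : ℝ} (h : wParam B < 2) : WParam B = 1 := by
  refine Finset.prod_eq_one fun p hp => ?_
  have h1 := mem_smallPrimes.mp hp
  have h2 := h1.2.two_le
  have : ⌊wParam B⌋₊ < 2 := (Nat.floor_lt' two_ne_zero).mpr (by exact_mod_cast h)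
  omega

theorem pow_dvd_WParam {B : ℝ} {p k : ℕ} (hp : p.Prime) (hpw : p ≤ ⌊wParam B⌋₊)
    (hk : k ≤ ⌈Real.log (wParam B) / Real.log p⌉₊ + 1) : p ^ k ∣ WParam B :=
  (pow_dvd_pow p hk).trans (Finset.dvd_prod_of_mem
    (fun p : ℕ => p ^ (⌈Real.log (wParam B) / Real.log (p : ℝ)⌉₊ + 1))
    (mem_smallPrimes.mpr ⟨hpw, hp⟩))

theorem prime_dvd_WParam_iff {B : ℝ} {p : ℕ} (hp : p.Prime) :
    p ∣ WParam B ↔ p ≤ ⌊wParam B⌋₊ := by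
  constructor
  · intro h
    obtain ⟨q, hq, hpq⟩ := (hp.prime.dvd_finsetProd_iff _).mp h
    have hq' := mem_smallPrimes.mp hq
    rw [(Nat.prime_dvd_prime_iff_eq hp hq'.2).mp (hp.dvd_of_dvd_pow hpq)]
    exact hq'.1
  · intro h
    simpa using pow_dvd_WParam (k := 1) hp h (by omega)

theorem le_ceil_of_pow_dvd {w : ℝ} {p k e : ℕ} (hp : p.Prime) (he : 0 < e) (hew : e ≤ w)
    (h : p ^ k ∣ e) : k ≤ ⌈Real.log w / Real.log p⌉₊ := by
  have hlp : 0 < Real.log p := Real.log_pos (by exact_mod_cast hp.one_lt)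
  have h1 : ((p ^ k : ℕ) : ℝ) ≤ w := le_trans (by exact_mod_cast Nat.le_of_dvd he h) hew
  have h2 := Real.log_le_log (by exact_mod_cast pow_pos hp.pos k) h1
  rw [Nat.cast_pow, Real.log_pow] at h2
  have h3 : (k : ℝ) ≤ Real.log w / Real.log p := (le_div_iff₀ hlp).mpr h2
  exact_mod_cast h3.trans (Nat.le_ceil _)

/-- The exponent of `p` in `W` is one more than a bound for the exponent of `p` in any integer up to
`w`. This leaves room for one extra prime factor. -/
theorem dvd_WParam {B : ℝ} {e : ℕ} (he : 0 < e) (hew : (e : ℝ) ≤ wParam B) :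
    e ∣ WParam B ∧ ∀ p : ℕ, p.Prime → p ∣ WParam B → e * p ∣ WParam B := by
  have hle : ∀ q k : ℕ, q.Prime → 0 < k → q ^ k ∣ e → q ≤ ⌊wParam B⌋₊ := fun q k _ hk h =>
    (Nat.le_of_dvd he ((dvd_pow_self q hk.ne').trans h)).trans (Nat.le_floor hew)
  constructor
  · rw [Nat.dvd_iff_prime_pow_dvd_dvd]
    intro q k hq h
    rcases Nat.eq_zero_or_pos k with rfl | hk
    · simp
    · exact pow_dvd_WParam hq (hle q k hq hk h) ((le_ceil_of_pow_dvd hq he hew h).trans (by omega))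
  · intro p hp hpW
    rw [Nat.dvd_iff_prime_pow_dvd_dvd]
    intro q k hq h
    rcases Nat.eq_zero_or_pos k with rfl | hk
    · simp
    by_cases hqp : q = p
    · subst hqp
      -- One of the factors `q` is the extra prime, and the summand `1` in the exponent accounts for
      -- it.
      obtain ⟨k, rfl⟩ : ∃ j, k = j + 1 := ⟨k - 1, by omega⟩
      rw [pow_succ] at h
      have h' : q ^ k ∣ e := Nat.dvd_of_mul_dvd_mul_right hq.pos h
      exact pow_dvd_WParam hq ((prime_dvd_WParam_iff hq).mp hpW)
        (by have := le_ceil_of_pow_dvd hq he hew h'; omega)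
    · have h' : q ^ k ∣ e := Nat.Coprime.dvd_of_dvd_mul_right
        (Nat.Coprime.pow_left k ((Nat.coprime_primes hq hp).mpr hqp)) h
      exact pow_dvd_WParam hq (hle q k hq hk h')
        ((le_ceil_of_pow_dvd hq he hew h').trans (by omega))

/-- Each prime contributes at most `log w + 2 log p ≤ 3 log w`. -/
theorem log_WParam_le {B : ℝ} (h : 1 ≤ wParam B) :
    Real.log (WParam B) ≤ 3 * (smallPrimes B).card * Real.log (wParam B) := by
  have hlw : 0 ≤ Real.log (wParam B) := Real.log_nonneg h
  unfold WParam
  rw [Nat.cast_prod, Real.log_prod fun p hp => by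
    have := (mem_smallPrimes.mp hp).2.pos; positivity]
  calc _ ≤ ∑ _p ∈ smallPrimes B, 3 * Real.log (wParam B) := by
        refine Finset.sum_le_sum fun p hp => ?_
        have hp' := mem_smallPrimes.mp hp
        have hlp : 0 < Real.log p := Real.log_pos (by exact_mod_cast hp'.2.one_lt)
        have h1 : Real.log p ≤ Real.log (wParam B) := by
          refine Real.log_le_log (by exact_mod_cast hp'.2.pos) ?_
          exact (Nat.le_floor_iff (by linarith)).mp hp'.1
        have h2 := (Nat.ceil_lt_add_one (show 0 ≤ Real.log (wParam B) / Real.log p by positivity)).le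
        rw [Nat.cast_pow, Real.log_pow]
        push_cast
        calc _ ≤ (Real.log (wParam B) / Real.log p + 1 + 1) * Real.log p := by gcongr
          _ = Real.log (wParam B) + 2 * Real.log p := by field_simp; ring
          _ ≤ _ := by linarith
    _ = _ := by rw [Finset.sum_const, nsmul_eq_mul]; ring

theorem exists_log_WParam_le : ∃ C : ℝ, 0 < C ∧ ∀ B : ℝ, 2 ≤ wParam B →
    Real.log (WParam B) ≤ C * wParam B := by
  obtain ⟨C, hC, h⟩ := primeCounting_le_sqrt
  refine ⟨3 * C, by positivity, fun B hB => (log_WParam_le (by linarith)).trans ?_⟩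
  have h1 := h (wParam B) (wParam B) hB le_rfl
  rw [Real.sqrt_mul_self (by linarith)] at h1
  have hl : 0 < Real.log (wParam B) := Real.log_pos (by linarith)
  have hc : (smallPrimes B).card = Nat.primeCounting ⌊wParam B⌋₊ := by
    rw [Nat.primeCounting, Nat.primeCounting', Nat.count_eq_card_filter_range]
  rw [hc]
  calc _ ≤ 3 * (C * wParam B / Real.log (wParam B)) * Real.log (wParam B) := by gcongr
    _ = _ := by field_simp

/-- The primes in `(w, z]`. -/
noncomputable abbrev middlePrimes (B : ℝ) (z : ℕ) : Finset ℕ :=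
  (Finset.Ioc ⌊wParam B⌋₊ z).filter Nat.Prime

theorem prod_middlePrimes_le (B : ℝ) (z : ℕ) : ∏ p ∈ middlePrimes B z, p ≤ 4 ^ z := by
  refine le_trans ?_ (primorial_le_four_pow z)
  refine Finset.prod_le_prod_of_subset_of_one_le' (fun p hp => ?_) fun p hp _ => ?_
  · rw [Finset.mem_filter, Finset.mem_Ioc] at hp
    exact Finset.mem_filter.mpr ⟨Finset.mem_range.mpr (by omega), hp.2⟩
  · exact (Finset.mem_filter.mp hp).2.pos

theorem coprime_middlePrimes (B : ℝ) (z : ℕ) : (WParam B).Coprime (∏ p ∈ middlePrimes B z, p) := by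
  refine Nat.Coprime.prod_right fun p hp => ?_
  rw [Finset.mem_filter, Finset.mem_Ioc] at hp
  refine ((Nat.Prime.coprime_iff_not_dvd hp.2).mpr fun h => ?_).symm
  have := (prime_dvd_WParam_iff hp.2).mp h
  omega

theorem dvd_mul_middlePrimes {B : ℝ} {p z : ℕ} (hp : p.Prime) (hz : p ≤ z) :
    p ∣ WParam B * ∏ p ∈ middlePrimes B z, p := by
  by_cases h : p ≤ ⌊wParam B⌋₊
  · exact ((prime_dvd_WParam_iff hp).mpr h).mul_right _
  · exact (Finset.dvd_prod_of_mem _ (Finset.mem_filter.mpr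
      ⟨Finset.mem_Ioc.mpr ⟨by omega, hz⟩, hp⟩)).mul_left _

open scoped Classical in
-- The excluded proportion is at most the sum of `p ^ (-3)` over `p > w`, which is at most `2 / w`;
-- with `η = 1 / w` this is the loss `2 η` allowed in the mixed term.
theorem card_primitiveAt_middlePrimes {B : ℝ} {z : ℕ} (hw : 2 ≤ wParam B)
    (hz : ⌊wParam B⌋₊ ≤ z) :
    ((∏ p ∈ middlePrimes B z, p : ℕ) : ℝ) ^ 3 * (1 - 2 * (1 / wParam B)) ≤
      ((residues (∏ p ∈ middlePrimes B z, p) 3).filter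
        (PrimitiveAt (∏ p ∈ middlePrimes B z, p))).card := by
  set P := ∏ p ∈ middlePrimes B z, p with hP
  have hprime : ∀ p ∈ middlePrimes B z, p.Prime := fun p hp => (Finset.mem_filter.mp hp).2
  have hPpos : 0 < P := Finset.prod_pos fun p hp => (hprime p hp).pos
  have h := le_card_filter_primitiveAt (n := P) (k := 3) hPpos (middlePrimes B z)
    (fun p hp hd => by
      obtain ⟨q, hq, hpq⟩ := (hp.prime.dvd_finsetProd_iff _).mp hd
      rwa [(Nat.prime_dvd_prime_iff_eq hp (hprime q hq)).mp hpq])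
    (fun p hp => ⟨(hprime p hp).pos, Finset.dvd_prod_of_mem _ hp⟩)
  refine le_trans (mul_le_mul_of_nonneg_left ?_ (by positivity)) (h.trans (le_of_eq (by congr!)))
  have hf : 2 ≤ ⌊wParam B⌋₊ := Nat.le_floor (by exact_mod_cast hw)
  have hf' : (2 : ℝ) ≤ ⌊wParam B⌋₊ := by exact_mod_cast hf
  have h1 : ∑ p ∈ middlePrimes B z, 1 / (p : ℝ) ^ 3 ≤ 2 * (1 / wParam B) := by
    calc _ ≤ ∑ p ∈ middlePrimes B z, ((p : ℝ) ^ 2)⁻¹ := by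
          refine Finset.sum_le_sum fun p hp => ?_
          have : (1 : ℝ) ≤ p := by exact_mod_cast (hprime p hp).pos
          rw [one_div]
          exact inv_anti₀ (by positivity) (pow_le_pow_right₀ this (by norm_num))
      _ ≤ ∑ p ∈ Finset.Ioc ⌊wParam B⌋₊ z, ((p : ℝ) ^ 2)⁻¹ :=
          Finset.sum_le_sum_of_subset_of_nonneg (Finset.filter_subset _ _)
            fun _ _ _ => by positivity
      _ ≤ (⌊wParam B⌋₊ : ℝ)⁻¹ - (z : ℝ)⁻¹ := sum_Ioc_inv_sq_le_sub (by omega) hz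
      _ ≤ (⌊wParam B⌋₊ : ℝ)⁻¹ := sub_le_self _ (by positivity)
      _ ≤ 2 * (1 / wParam B) := by
          rw [mul_one_div, ← one_div, div_le_div_iff₀ (by linarith) (by linarith)]
          linarith [Nat.lt_floor_add_one (wParam B)]
  linarith


/-! ### Choice of parameters for large `B`, and bounded `B` -/

theorem eventually_log_conditions (M : ℝ) : ∀ᶠ B in Filter.atTop,
    M ≤ Real.log (Real.log (Real.log B)) ∧
    Real.log (Real.log (Real.log B)) ^ 2 ≤ Real.log (Real.log B) ∧
    Real.log (Real.log B) ^ 3 ≤ Real.log B ∧ Real.log B ^ 2000 ≤ B := by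
  have h : ∀ n : ℕ, ∀ᶠ x in Filter.atTop, Real.log x ^ n ≤ x := fun n => by
    filter_upwards [(Real.isLittleO_pow_log_id_atTop (n := n)).bound one_pos,
      Filter.eventually_ge_atTop 0] with x hx hx0
    rw [one_mul, id, Real.norm_of_nonneg hx0] at hx
    exact (le_abs_self _).trans hx
  have t := Real.tendsto_log_atTop
  filter_upwards [(t.comp (t.comp t)).eventually_ge_atTop M, (t.comp t).eventually (h 2),
    t.eventually (h 3), h 2000] with B h1 h2 h3 h4
  exact ⟨h1, h2, h3, h4⟩

theorem four_pow_le {B : ℝ} {z : ℕ} (hB : 0 < B) (hz : (z : ℝ) ≤ Real.log B / 100) :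
    (4 : ℝ) ^ z ≤ B ^ (1 / 50 : ℝ) := by
  have h4 : Real.log 4 ≤ 2 := by
    rw [show (4 : ℝ) = 2 ^ 2 by norm_num, Real.log_pow]
    push_cast; linarith [Real.log_two_lt_d9]
  have hz0 : (0 : ℝ) ≤ z := z.cast_nonneg
  rw [← Real.rpow_natCast, Real.rpow_def_of_pos (by norm_num), Real.rpow_def_of_pos hB]
  refine Real.exp_le_exp.mpr ?_
  nlinarith

theorem pow_le_rpow_of_pow_le {L B t : ℝ} {m n : ℕ} (hL : 0 ≤ L) (hB : 1 ≤ B) (hm : 0 < m)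
    (h : L ^ m ≤ B) (hn : (n : ℝ) ≤ m * t) : L ^ n ≤ B ^ t := by
  have hm' : (0 : ℝ) < m := by exact_mod_cast hm
  calc L ^ n = (L ^ m) ^ ((n : ℝ) / m) := by
        rw [← Real.rpow_natCast, ← Real.rpow_natCast, ← Real.rpow_mul hL]; field_simp
    _ ≤ B ^ ((n : ℝ) / m) := Real.rpow_le_rpow (by positivity) h (by positivity)
    _ ≤ B ^ t := Real.rpow_le_rpow_of_exponent_le hB (by rw [div_le_iff₀ hm']; linarith)

/-- The cells used in the mixed term are small against `η² A`: here `w = 1 / η`, and `P ≤ B ^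
(1/50)` leaves almost a full factor `B` to spare. -/
theorem modulus_mul_le {A B L W P w : ℝ} (hB : 1 ≤ B) (hL : 30 ≤ L) (hWL : W ≤ L)
    (hwL : w ≤ L) (hw : 0 ≤ w) (hP0 : 0 ≤ P) (hP : P ≤ B ^ (1 / 50 : ℝ))
    (h : L ^ 4 ≤ B ^ (1 / 2 : ℝ)) (hA : B ^ 2 * L ≤ A) :
    10 * B * (W * P) * (2 * L + 1) * w ^ 2 ≤ A := by
  have hB0 : 0 < B := by linarith
  have hL0 : 0 < L := by linarith
  have h50 : B * B ^ (1 / 50 : ℝ) * B ^ (1 / 2 : ℝ) ≤ B ^ 2 := by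
    rw [← Real.rpow_natCast]
    nth_rewrite 1 [← Real.rpow_one B]
    rw [← Real.rpow_add hB0, ← Real.rpow_add hB0]
    exact Real.rpow_le_rpow_of_exponent_le hB (by norm_num)
  calc 10 * B * (W * P) * (2 * L + 1) * w ^ 2
      ≤ 10 * B * (L * B ^ (1 / 50 : ℝ)) * (2 * L + L) * L ^ 2 := by gcongr; linarith
    _ = B * B ^ (1 / 50 : ℝ) * (30 * L ^ 3) * L := by ring
    _ ≤ B * B ^ (1 / 50 : ℝ) * (L * L ^ 3) * L := by gcongr
    _ = B * B ^ (1 / 50 : ℝ) * L ^ 4 * L := by ring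
    _ ≤ B * B ^ (1 / 50 : ℝ) * B ^ (1 / 2 : ℝ) * L := by gcongr
    _ ≤ B ^ 2 * L := by gcongr
    _ ≤ A := hA

set_option maxHeartbeats 1000000 in
/-- For large `B` the parameters satisfy all the conditions. -/
theorem eventually_exists_varParams : ∃ B₀ : ℝ, ∀ A B : ℝ, B₀ ≤ B →
    B ^ 2 * Real.log B < A →
    A ≤ B ^ 3 * (Real.log B) ^ (-4 : ℤ) * (Real.log (Real.log B))⁻¹ →
    ∃ P z : ℕ, VarParams A B (Real.log (Real.log B) ^ (-(1 / 4) : ℝ)) (1 / wParam B)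
      (WParam B) P z := by
  obtain ⟨C, hC, hCW⟩ := exists_log_WParam_le
  obtain ⟨B₀, hB₀⟩ := Filter.eventually_atTop.mp
    ((eventually_log_conditions (200 + 2 * C)).and (Filter.eventually_ge_atTop 3))
  refine ⟨B₀, fun A B hB hA1 hA2 => ?_⟩
  obtain ⟨⟨hv, hvl, hlL, hLB⟩, hB3⟩ := hB₀ B hB
  set L := Real.log B with hL
  set l := Real.log L with hl
  set v := Real.log l with hvdef
  set w := wParam B with hw
  have hw_eq : w = l / v := rfl
  have hv200 : 200 ≤ v := by linarith
  have hl4 : 40000 ≤ l := by nlinarith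
  have hl64 : 64 * l ^ 2 ≤ L := by nlinarith
  have hl_le : l ≤ L := by nlinarith
  have hLbig : 40000 ≤ L := by linarith
  have hB0 : 0 < B := by linarith
  have hL0 : 0 < L := by linarith
  have hl0 : 0 < l := by linarith
  have hv0 : 0 < v := by linarith
  have hwv : v ≤ w := by rw [hw_eq, le_div_iff₀ hv0]; nlinarith
  have hwl : w ≤ l := by rw [hw_eq]; exact div_le_self hl0.le (by linarith)
  have hw0 : 0 < w := by linarith
  have hL1 : 1 ≤ L := by linarith
  have hWpos := WParam_pos B
  have hW1 : (1 : ℝ) ≤ WParam B := by exact_mod_cast hWpos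
  -- Since `log W ≤ C w` and `w = l / v` with `v ≥ 2 C`, twice `log W` is at most `l = log L`.
  have hWsq : (WParam B : ℝ) ^ 2 ≤ L := by
    have h1 := hCW B (by linarith)
    have h2 : 2 * (C * w) ≤ l := by
      rw [hw_eq]
      calc 2 * (C * (l / v)) = (2 * C) * (l / v) := by ring
        _ ≤ v * (l / v) := by gcongr; linarith
        _ = l := by field_simp
    rw [← Real.log_le_log_iff (by positivity) hL0, Real.log_pow]
    push_cast
    linarith
  have hWL : (WParam B : ℝ) ≤ L := by nlinarith
  have hWw : 8 * WParam B * w ≤ L := by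
    apply le_of_sq_le_sq _ hL0.le
    calc (8 * WParam B * w) ^ 2 = (WParam B : ℝ) ^ 2 * (64 * w ^ 2) := by ring
      _ ≤ L * (64 * l ^ 2) := by gcongr
      _ ≤ L * L := by gcongr
      _ = L ^ 2 := by ring
  have hA0 : 0 < A := lt_trans (by positivity) hA1
  -- Small enough that `P ≤ 4 ^ z ≤ B ^ (1/50)`, and of the order of `log B`, so that removing
  -- common factors above `z` costs little.
  set z := ⌊L / 100⌋₊ with hzdef
  have hz1 : (z : ℝ) ≤ L / 100 := Nat.floor_le (by positivity)
  have hz2 : L / 100 < z + 1 := Nat.lt_floor_add_one _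
  have hwz : ⌊w⌋₊ ≤ z := Nat.floor_le_floor (by nlinarith)
  set P := ∏ p ∈ middlePrimes B z, p with hPdef
  have hP4 : (P : ℝ) ≤ B ^ (1 / 50 : ℝ) := by
    refine le_trans ?_ (four_pow_le hB0 hz1)
    exact_mod_cast prod_middlePrimes_le B z
  have hLt : ∀ (n : ℕ) (t : ℝ), (n : ℝ) ≤ (2000 : ℕ) * t → L ^ n ≤ B ^ t := fun n t hn =>
    pow_le_rpow_of_pow_le hL0.le (by linarith) (by norm_num) hLB hn
  have hrpow : ∀ s t : ℝ, s ≤ t → l ^ s ≤ l ^ t := fun s t h =>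
    Real.rpow_le_rpow_of_exponent_le (by linarith) h
  have hδ2 : (l ^ (-(1 / 4) : ℝ)) ^ 2 = l ^ (-(1 / 2) : ℝ) := by
    rw [← Real.rpow_natCast, ← Real.rpow_mul hl0.le]; norm_num
  have hδ8 : (l ^ (-(1 / 4) : ℝ)) ^ 8 = (l ^ 2)⁻¹ := by
    rw [← Real.rpow_natCast, ← Real.rpow_mul hl0.le,
      show (-(1 / 4) * (8 : ℕ) : ℝ) = -(2 : ℕ) by norm_num, Real.rpow_neg hl0.le,
      Real.rpow_natCast]
  have hinv : l⁻¹ ≤ l ^ (-(1 / 4) : ℝ) := by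
    rw [← Real.rpow_neg_one]; exact hrpow _ _ (by norm_num)
  refine ⟨P, z, ⟨⟨by linarith, hA0, hL0, by positivity, ?_, hWpos, ?_, coprime_middlePrimes B z,
    ?_, one_le_pow₀ hL1, ?_, ?_, Nat.floor_pos.mpr (by linarith),
    fun p hp hpz => dvd_mul_middlePrimes hp hpz⟩, by linarith, hA1.le, ?_,
    card_primitiveAt_middlePrimes (by linarith) hwz, fun e he hew => dvd_WParam he ?_,
    by positivity, ?_, ?_, ?_, hWsq, ?_, ?_, by linarith, ?_⟩⟩
  · exact one_div_le_one_div_of_le (by norm_num) (by linarith)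
  · exact Finset.prod_pos fun p hp => (Finset.mem_filter.mp hp).2.pos
  · rw [one_div_mul_eq_div, le_div_iff₀ hw0]
    calc 8 * B ^ 2 * WParam B * w = B ^ 2 * (8 * WParam B * w) := by ring
      _ ≤ B ^ 2 * L := by gcongr
      _ ≤ A := hA1.le
  · change 4 * (WParam B : ℝ) * (1 + L) ≤ 1 / w * L ^ 3
    rw [one_div_mul_eq_div, le_div_iff₀ hw0]
    calc 4 * (WParam B : ℝ) * (1 + L) * w ≤ 4 * (WParam B : ℝ) * (L + L) * w := by gcongr
      _ = 8 * WParam B * w * L := by ring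
      _ ≤ L * L := by gcongr
      _ ≤ L * L * L := le_mul_of_one_le_right (by positivity) hL1
      _ = L ^ 3 := by ring
  · change 10 * B * (WParam B * P : ℕ) * (2 * L + 1) ≤ (1 / w) ^ 2 * A
    rw [one_div, inv_pow, inv_mul_eq_div, le_div_iff₀ (by positivity)]
    push_cast
    exact modulus_mul_le (by linarith) (by linarith) hWL (hwl.trans hl_le) hw0.le
      P.cast_nonneg hP4 (hLt 4 _ (by norm_num)) hA1.le
  · calc A * L ^ 4 ≤ B ^ 3 * L ^ (-4 : ℤ) * l⁻¹ * L ^ 4 := by gcongr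
      _ = B ^ 3 * l⁻¹ := by
        rw [zpow_neg, show (4 : ℤ) = (4 : ℕ) by rfl, zpow_natCast]; field_simp
      _ ≤ _ := by gcongr
  · rw [mul_one_div, div_le_one hw0] at hew
    exact hew
  · exact Real.rpow_le_one_of_one_le_of_nonpos (by linarith) (by norm_num)
  · rw [hδ2, Real.rpow_neg hl0.le, ← one_div, ← Real.sqrt_eq_rpow]
    refine one_div_le_one_div_of_le (Real.sqrt_pos.mpr hl0) ?_
    rw [hw_eq, le_div_iff₀ hv0]
    calc √l * v ≤ √l * √l := by gcongr; exact Real.le_sqrt_of_sq_le hvl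
      _ = l := Real.mul_self_sqrt hl0.le
  · rw [hδ8, one_div_mul_eq_div, inv_mul_eq_div, div_div, le_div_iff₀ (by positivity), one_mul]
    calc w * l ^ 2 ≤ l * l ^ 2 := by gcongr
      _ = l ^ 3 := by ring
      _ ≤ L := hlL
  · calc L ^ 40 = L ^ 40 * L * L⁻¹ := by field_simp
      _ = L ^ 41 * L⁻¹ := by ring
      _ ≤ B * l⁻¹ := by
        gcongr
        · exact (hLt 41 1 (by norm_num)).trans (Real.rpow_one B).le
      _ ≤ _ := by gcongr
  · rw [hδ2]
    have h1 : l⁻¹ ≤ l ^ (-(1 / 2) : ℝ) := by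
      rw [← Real.rpow_neg_one]; exact hrpow _ _ (by norm_num)
    calc (1 : ℝ) ≤ l⁻¹ * L := by rw [inv_mul_eq_div, one_le_div hl0]; exact hl_le
      _ ≤ _ := by gcongr
  · exact hLt 20 _ (by norm_num)

theorem sum_abs_sub_sq_eq_sum_pairVariance {A B : ℝ} (hB : 0 ≤ B) :
    ∑ a ∈ (finite_primitiveTuplesUpTo A).toFinset, |weightedCount a B - localCount a B| ^ 2 =
      Real.log B ^ 8 * ∑ xy ∈ tuples B ×ˢ tuples B,
        pairVariance A (Real.log B) (WParam B) xy.1 xy.2 := by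
  rw [sum_abs_sub_sq_eq, Finset.sum_product, primeTuples_toFinset hB]
  rfl

/-- A trivial bound, for bounded `B`. -/
theorem sum_pairVariance_le_of_bounded {A B α : ℝ} (hA : 1 ≤ A) (hB : 0 ≤ B) (hα : 0 ≤ α) (W : ℕ) :
    ∑ xy ∈ tuples B ×ˢ tuples B, pairVariance A α W xy.1 xy.2 ≤
      B ^ 8 * (27 * A ^ 3 + 2592 * α ^ 2 * (W : ℝ) ^ 2 * A ^ 2) := by
  have hX : ((tuples B).card : ℝ) ≤ B ^ 4 := by
    unfold tuples
    rw [Fintype.card_piFinset, Finset.prod_const, Finset.card_univ, Fintype.card_fin, Nat.cast_pow]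
    gcongr
    exact card_primesUpTo_le hB
  have hK : 0 ≤ 27 * A ^ 3 + 2592 * α ^ 2 * (W : ℝ) ^ 2 * A ^ 2 := by positivity
  calc _ ≤ ∑ _xy ∈ tuples B ×ˢ tuples B, (27 * A ^ 3 + 2592 * α ^ 2 * (W : ℝ) ^ 2 * A ^ 2) := by
        refine Finset.sum_le_sum fun xy hxy => ?_
        rw [Finset.mem_product, mem_tuples hB, mem_tuples hB] at hxy
        have h1 := pairCount_le_cube (y := xy.2) hA hxy.1
        have h2 := pairLocal_le (by linarith : 0 ≤ A) hα W xy.1 xy.2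
        have h3 := pairMixed_nonneg (A := A) hα W xy.1 xy.2
        have h4 := one_le_norm_euc_of_mem hxy.1
        have h5 := one_le_norm_euc_of_mem hxy.2
        have h6 : 2592 * α ^ 2 * (W : ℝ) ^ 2 * A ^ 2 / (‖euc xy.1‖ * ‖euc xy.2‖) ≤
            2592 * α ^ 2 * (W : ℝ) ^ 2 * A ^ 2 := div_le_self (by positivity) (by nlinarith)
        unfold pairVariance
        linarith
    _ = ((tuples B).card : ℝ) * (tuples B).card *
        (27 * A ^ 3 + 2592 * α ^ 2 * (W : ℝ) ^ 2 * A ^ 2) := by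
        rw [Finset.sum_const, Finset.card_product, nsmul_eq_mul]; push_cast; ring
    _ ≤ B ^ 4 * B ^ 4 * (27 * A ^ 3 + 2592 * α ^ 2 * (W : ℝ) ^ 2 * A ^ 2) := by gcongr
    _ = _ := by ring

/-- For `l = log log B` this says `log B ≤ 5 log log B`, that is `B ≤ (log B) ^ 5`, which
contradicts the range of `A`. -/
theorem exp_le_five_mul {l : ℝ} (h1 : 1 ≤ l) (h2 : l ≤ 2) : Real.exp l ≤ 5 * l := by
  have he := Real.exp_one_lt_d9
  have he0 := Real.exp_pos 1
  have e2 : Real.exp 2 = Real.exp 1 ^ 2 := by rw [← Real.exp_nat_mul]; norm_num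
  have e3 : Real.exp (3 / 2) ^ 2 = Real.exp 1 ^ 3 := by
    rw [← Real.exp_nat_mul, ← Real.exp_nat_mul]; norm_num
  rcases le_total l (3 / 2) with h | h
  · have h4 : Real.exp (3 / 2) ≤ 5 := by
      apply le_of_sq_le_sq _ (by norm_num)
      rw [e3]
      calc Real.exp 1 ^ 3 ≤ (2.8 : ℝ) ^ 3 := by gcongr; linarith
        _ ≤ _ := by norm_num
    linarith [Real.exp_le_exp.mpr h]
  · have h4 : Real.exp 2 ≤ 7.5 := by rw [e2]; nlinarith
    linarith [Real.exp_le_exp.mpr h2]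

/-- The range of `A` is empty if `log log B` lies between `1` and `2`. -/
theorem not_range_of_mem_Icc {A B : ℝ} (hB : 3 ≤ B) (h1 : 1 ≤ Real.log (Real.log B))
    (h2 : Real.log (Real.log B) ≤ 2) (hA1 : B ^ 2 * Real.log B < A)
    (hA2 : A ≤ B ^ 3 * (Real.log B) ^ (-4 : ℤ) * (Real.log (Real.log B))⁻¹) : False := by
  have hB0 : 0 < B := by linarith
  have hL0 : 0 < Real.log B := Real.log_pos (by linarith)
  set L := Real.log B with hL
  set l := Real.log L with hl
  have h3 : Real.exp l = L := Real.exp_log hL0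
  have h4 := exp_le_five_mul h1 h2
  have h5 : B ≤ L ^ 5 := by
    rw [← Real.log_le_log_iff hB0 (by positivity), Real.log_pow]
    push_cast
    linarith
  have h6 := hA1.trans_le hA2
  have h7 : B ^ 3 * L ^ (-4 : ℤ) * l⁻¹ ≤ B ^ 2 * L := by
    calc _ ≤ B ^ 3 * L ^ (-4 : ℤ) * 1 := by
          gcongr; exact inv_le_one_of_one_le₀ h1
      _ = B ^ 2 * B / L ^ 4 := by
          rw [zpow_neg, show (4 : ℤ) = (4 : ℕ) by rfl, zpow_natCast]; field_simp
      _ ≤ B ^ 2 * L ^ 5 / L ^ 4 := by gcongr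
      _ = _ := by field_simp
  linarith

/-- The modulus is bounded in terms of `B`, outside the range where `log log B` is between `1` and
`2`. -/
theorem WParam_le_of_le {B T : ℝ} (hB : 3 ≤ B) (hBT : B ≤ T)
    (h : Real.log (Real.log B) < 1 ∨ 2 ≤ Real.log (Real.log B)) :
    (WParam B : ℝ) ≤ Real.exp (6 * (2 * T) * (2 * T)) := by
  have hT : 0 ≤ T := by linarith
  have hL0 : 0 < Real.log B := Real.log_pos (by linarith)
  have he1 : (1 : ℝ) ≤ Real.exp (6 * (2 * T) * (2 * T)) := Real.one_le_exp (by positivity)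
  by_cases hw : wParam B < 2
  · rw [WParam_eq_one hw]; exact_mod_cast he1
  push Not at hw
  have hwT : wParam B ≤ 2 * T := by
    have h1 : Real.log (Real.log B) ≤ T := by
      have a := Real.log_le_sub_one_of_pos hL0
      have b := Real.log_le_sub_one_of_pos (show 0 < B by linarith)
      linarith
    -- If `log log B < 1`, the triple logarithm is not positive, so `w ≤ 0`. If `log log B ≥ 2`, the
    -- denominator of `w` is at least `1/2`. In between, `w` has a pole.
    rcases h with h | h
    · exfalso
      have hlog3 : 0 < Real.log (Real.log B) := by
        refine Real.log_pos ?_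
        rw [Real.lt_log_iff_exp_lt (by linarith)]
        linarith [Real.exp_one_lt_d9]
      have : wParam B ≤ 0 :=
        div_nonpos_of_nonneg_of_nonpos hlog3.le (Real.log_nonpos hlog3.le h.le)
      linarith
    · have h2 : 1 / 2 ≤ Real.log (Real.log (Real.log B)) := by
        have := Real.log_le_log (by norm_num) h
        linarith [Real.log_two_gt_d9]
      unfold wParam
      rw [div_le_iff₀ (by linarith)]
      nlinarith
  have hW := log_WParam_le (B := B) (by linarith)
  have hc : ((smallPrimes B).card : ℝ) ≤ 2 * wParam B := by
    have h1 : (smallPrimes B).card ≤ ⌊wParam B⌋₊ + 1 :=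
      (Finset.card_filter_le _ _).trans (Finset.card_range _).le
    have h2 : ((⌊wParam B⌋₊ : ℕ) : ℝ) ≤ wParam B := Nat.floor_le (by linarith)
    have h3 : ((smallPrimes B).card : ℝ) ≤ ⌊wParam B⌋₊ + 1 := by exact_mod_cast h1
    linarith
  have hlw : Real.log (wParam B) ≤ wParam B := by
    linarith [Real.log_le_sub_one_of_pos (show 0 < wParam B by linarith)]
  have hlw0 : 0 ≤ Real.log (wParam B) := Real.log_nonneg (by linarith)
  have hWp : (0 : ℝ) < WParam B := by exact_mod_cast WParam_pos B
  rw [← Real.log_le_iff_le_exp hWp]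
  calc _ ≤ 3 * (2 * wParam B) * wParam B := by
        refine hW.trans ?_
        gcongr
    _ ≤ 3 * (2 * (2 * T)) * (2 * T) := by gcongr
    _ = _ := by ring


end PrimeLinearForms

/-! ### Conclusion -/

theorem proposition2p1 :
    ∃ C : ℝ, 0 < C ∧ ∃ K : ℝ, 0 < K ∧ ∀ A B : ℝ, 3 ≤ B →
      B ^ 2 * Real.log B < A →
      A ≤ B ^ 3 * (Real.log B) ^ (-4 : ℤ) * (Real.log (Real.log B))⁻¹ →
      ∑ a ∈ (PrimeLinearForms.finite_primitiveTuplesUpTo A).toFinset,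
          |PrimeLinearForms.weightedCount a B - PrimeLinearForms.localCount a B| ^ 2
        ≤ K * (A ^ 2 * B ^ 6 / (Real.log (Real.log B)) ^ C) := by
  obtain ⟨B₀, hB₀⟩ := PrimeLinearForms.eventually_exists_varParams
  obtain ⟨K, hK, hsum⟩ := PrimeLinearForms.exists_log_pow_mul_sum_pairVariance_le
  set T := max B₀ 3
  have hT3 : 3 ≤ T := le_max_right _ _
  set M := Real.exp (6 * (2 * T) * (2 * T))
  set K' := T ^ 8 * (T ^ 8 * (27 * (T ^ 3 * 20) + 2592 * T ^ 2 * M ^ 2)) * T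
  -- The exponent is that of `δ = (log log B) ^ (-1/4)`; `K` serves large `B`, and `K'` serves `B <
  -- B₀`, its last factor `T` bounding `(log log B) ^ (1/4)`.
  refine ⟨1 / 4, by norm_num, K + K', by positivity, fun A B hB hA1 hA2 => ?_⟩
  have hB0 : 0 < B := by linarith
  -- Since `B ≥ 3`, `log log B` is bounded away from `0`; this keeps `A` bounded when `B` is.
  have hL1 : 1.09 ≤ Real.log B := by
    rw [Real.le_log_iff_exp_le hB0]
    have h1 : Real.exp 1.09 ≤ 3 := by
      rw [show (1.09 : ℝ) = 1 + 0.09 by norm_num, Real.exp_add]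
      have h2 := Real.exp_one_lt_d9
      have h3 : Real.exp 0.09 ≤ 1.1 := by
        have h4 := Real.one_sub_le_exp_neg (0.09 : ℝ)
        rw [Real.exp_neg] at h4
        have h5 : (1.1 : ℝ)⁻¹ ≤ (Real.exp 0.09)⁻¹ := le_trans (by norm_num) h4
        exact (inv_le_inv₀ (by norm_num) (Real.exp_pos _)).mp h5
      nlinarith [Real.exp_pos 1]
    linarith
  have hL0 : 0 < Real.log B := by linarith
  have hl : 1 / 20 ≤ Real.log (Real.log B) := by
    have h1 := Real.one_sub_inv_le_log_of_pos hL0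
    have h2 : (Real.log B)⁻¹ ≤ (1.09 : ℝ)⁻¹ := inv_anti₀ (by norm_num) hL1
    have h3 : (1.09 : ℝ)⁻¹ ≤ 0.92 := by norm_num
    linarith
  have hl0 : 0 < Real.log (Real.log B) := by linarith
  have hA0 : 1 ≤ A := by nlinarith
  rw [PrimeLinearForms.sum_abs_sub_sq_eq_sum_pairVariance hB0.le]
  by_cases hBT : B₀ ≤ B
  · obtain ⟨P, z, p⟩ := hB₀ A B hBT hA1 hA2
    refine (hsum p).trans ?_
    rw [Real.rpow_neg hl0.le, ← div_eq_mul_inv]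
    gcongr
    exact le_add_of_nonneg_right (by positivity)
  · have hBT' : B ≤ T := (not_le.mp hBT).le.trans (le_max_left _ _)
    have hLT : Real.log B ≤ T := by linarith [Real.log_le_sub_one_of_pos hB0]
    have hlT : Real.log (Real.log B) ≤ T := by linarith [Real.log_le_sub_one_of_pos hL0]
    -- The modulus is bounded away from the pole of `w`; near the pole no `A` is admissible.
    have hW : (PrimeLinearForms.WParam B : ℝ) ≤ M := by
      refine PrimeLinearForms.WParam_le_of_le hB hBT' ?_
      by_contra! hc
      exact PrimeLinearForms.not_range_of_mem_Icc hB hc.1 hc.2.le hA1 hA2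
    have hA3 : A ≤ T ^ 3 * 20 := by
      refine hA2.trans ?_
      have h1 : (Real.log B) ^ (-4 : ℤ) ≤ 1 := by
        rw [zpow_neg, show (4 : ℤ) = (4 : ℕ) by rfl, zpow_natCast]
        exact inv_le_one_of_one_le₀ (one_le_pow₀ (by linarith))
      have h2 : (Real.log (Real.log B))⁻¹ ≤ 20 := by
        rw [show (20 : ℝ) = (1 / 20)⁻¹ by norm_num]
        exact inv_anti₀ (by norm_num) hl
      calc _ ≤ T ^ 3 * 1 * 20 := by gcongr
        _ = _ := by ring
    have hlq : Real.log (Real.log B) ^ (1 / 4 : ℝ) ≤ T := by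
      calc _ ≤ T ^ (1 / 4 : ℝ) := Real.rpow_le_rpow hl0.le hlT (by norm_num)
        _ ≤ T ^ (1 : ℝ) := Real.rpow_le_rpow_of_exponent_le (by linarith) (by norm_num)
        _ = T := Real.rpow_one T
    have hlast : A ^ 2 / T ≤ A ^ 2 * B ^ 6 / Real.log (Real.log B) ^ (1 / 4 : ℝ) := by
      gcongr
      exact le_mul_of_one_le_right (by positivity) (one_le_pow₀ (by linarith))
    calc _ ≤ Real.log B ^ 8 * (B ^ 8 * (27 * A ^ 3 + 2592 * Real.log B ^ 2 *
          (PrimeLinearForms.WParam B : ℝ) ^ 2 * A ^ 2)) := by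
          gcongr
          exact PrimeLinearForms.sum_pairVariance_le_of_bounded hA0 hB0.le hL0.le _
      _ = Real.log B ^ 8 * (B ^ 8 * (27 * A + 2592 * Real.log B ^ 2 *
          (PrimeLinearForms.WParam B : ℝ) ^ 2)) * A ^ 2 := by ring
      _ ≤ T ^ 8 * (T ^ 8 * (27 * (T ^ 3 * 20) + 2592 * T ^ 2 * M ^ 2)) * A ^ 2 := by gcongr
      _ = K' * (A ^ 2 / T) := by simp only [K']; field_simp
      _ ≤ (K + K') * (A ^ 2 * B ^ 6 / Real.log (Real.log B) ^ (1 / 4 : ℝ)) := by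
          gcongr
          exact le_add_of_nonneg_left hK.le
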